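/- Let $K$ be a knot that is represented by a positive diagram, that is, by a knot diagram all of whose crossings are positive. Then $$a_2(K)\le 4\,v_3(K).$$ Here $a_2(K)$ is the coefficient of $z^2$ in the Conway polynomial $\nabla_K(z)$ of $K$, and $$v_3(K)=-\frac{1}{144}V_K'''(1)-\frac{1}{48}V_K''(1),$$ where $V_K(t)$ is the Jones polynomial of $K$, normalized so that the unknot has $V=1$ and the positive (right-handed) trefoil has $V=t+t^3-t^4$. -/

import Mathlib

/-!
Oriented knot diagrams on the sphere are represented by their signed Gauss codes: one walks once
around the knot and records, at every passage through a crossing, the name of the crossing, whether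
one passes over or under, and the sign of the crossing. A signed Gauss code determines the rotation
system of a 4-valent graph on a closed oriented surface; it is the code of a diagram on the sphere
precisely when that surface has genus zero, and then it determines the diagram up to isotopy of
the sphere. Knots are diagrams modulo Reidemeister moves.
-/

/-- A passage of the knot through a crossing: name of the crossing, whether this is the
over-passage, and the sign of the crossing. -/
@[ext]
structure Passage where
  label : ℕ
  isOver : Bool
  sign : ℤˣ
deriving DecidableEq

/-- A sequence of passages, read along the knot from a base point. A word of length `m` has the
edges `0, 1, …, m`: edge `i` leads into the passage at position `i` and edge `i + 1` leads out of
it. Edge `m` and edge `0` are the two halves of the edge that contains the base point. -/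
abbrev GaussWord := List Passage

namespace GaussWord

/-- Every crossing that occurs is passed exactly once over and once under, with the same sign. -/
def WellFormed (w : GaussWord) : Prop :=
  (w.map fun p => (p.label, p.isOver)).Nodup ∧
    ∀ p ∈ w, (⟨p.label, !p.isOver, p.sign⟩ : Passage) ∈ w

/-- The set of crossings. -/
def crossings (w : GaussWord) : Finset ℕ := (w.map Passage.label).toFinset

/-- The sides `(e, true)` (left) and `(e, false)` (right) of the edges which meet in a corner of a
crossing. Draw the crossing with both strands going up; `a` is the position of the strand from
south-west to north-east and `b` that of the strand from south-east to north-west, so that the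
strand at `a` is the over-strand exactly if the crossing is positive. -/
inductive Corner (w : GaussWord) :
    Fin (w.length + 1) × Bool → Fin (w.length + 1) × Bool → Prop
  | base (side : Bool) : Corner w (0, side) (Fin.last _, side)
  | north (a b : Fin w.length) (hl : (w.get a).label = (w.get b).label)
      (ha : (w.get a).isOver = true ↔ (w.get a).sign = 1)
      (hb : (w.get b).isOver = true ↔ ¬ (w.get b).sign = 1) :
      Corner w (a.succ, true) (b.succ, false)
  | west (a b : Fin w.length) (hl : (w.get a).label = (w.get b).label)
      (ha : (w.get a).isOver = true ↔ (w.get a).sign = 1)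
      (hb : (w.get b).isOver = true ↔ ¬ (w.get b).sign = 1) :
      Corner w (b.succ, true) (a.castSucc, true)
  | south (a b : Fin w.length) (hl : (w.get a).label = (w.get b).label)
      (ha : (w.get a).isOver = true ↔ (w.get a).sign = 1)
      (hb : (w.get b).isOver = true ↔ ¬ (w.get b).sign = 1) :
      Corner w (a.castSucc, false) (b.castSucc, true)
  | east (a b : Fin w.length) (hl : (w.get a).label = (w.get b).label)
      (ha : (w.get a).isOver = true ↔ (w.get a).sign = 1)
      (hb : (w.get b).isOver = true ↔ ¬ (w.get b).sign = 1) :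
      Corner w (b.castSucc, false) (a.succ, false)

/-- The number of faces: sides of edges modulo the equivalence relation generated by `Corner`. -/
noncomputable def faceCount (w : GaussWord) : ℕ := Nat.card (Quot w.Corner)

/-- Genus zero, by Euler's formula: with `n` crossings there are `2 n = w.length` edges, and
`n - 2 n + (number of faces) = 2` (also for `n = 0`, the circle without crossings). -/
def Planar (w : GaussWord) : Prop := 2 * w.faceCount = w.length + 4

/-- The writhe: the sum of the signs of the crossings. -/
def writhe (w : GaussWord) : ℤ :=
  ((w.filter Passage.isOver).map fun p => (p.sign : ℤ)).sum

/-- The way in which edges are connected after smoothing all crossings, those in `S` by the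
`A`-smoothing and the others by the `B`-smoothing. The `A`-smoothing is the one that merges the two
regions swept out when the over-strand is turned counterclockwise; it is the smoothing that
respects the orientation exactly if the crossing is positive. -/
inductive Joined (w : GaussWord) (S : Finset ℕ) :
    Fin (w.length + 1) → Fin (w.length + 1) → Prop
  | base : Joined w S 0 (Fin.last _)
  | oriented (i j : Fin w.length) (hl : (w.get i).label = (w.get j).label)
      (ho : (w.get i).isOver ≠ (w.get j).isOver)
      (hS : (w.get i).label ∈ S ↔ (w.get i).sign = 1) :
      Joined w S i.castSucc j.succ
  | unoriented_in (i j : Fin w.length) (hl : (w.get i).label = (w.get j).label)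
      (ho : (w.get i).isOver ≠ (w.get j).isOver)
      (hS : ¬ ((w.get i).label ∈ S ↔ (w.get i).sign = 1)) :
      Joined w S i.castSucc j.castSucc
  | unoriented_out (i j : Fin w.length) (hl : (w.get i).label = (w.get j).label)
      (ho : (w.get i).isOver ≠ (w.get j).isOver)
      (hS : ¬ ((w.get i).label ∈ S ↔ (w.get i).sign = 1)) :
      Joined w S i.succ j.succ

/-- The number of circles in the smoothed diagram. -/
noncomputable def loopCount (w : GaussWord) (S : Finset ℕ) : ℕ := Nat.card (Quot (w.Joined S))

/-- The Kauffman bracket at the value `A ≠ 0` of its variable, equal to `1` on the circle without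
crossings. -/
noncomputable def bracket (w : GaussWord) (A : ℝ) : ℝ :=
  ∑ S ∈ w.crossings.powerset,
    A ^ S.card * (A⁻¹) ^ (w.crossings \ S).card * (-A ^ 2 - (A⁻¹) ^ 2) ^ (w.loopCount S - 1)

/-- The Jones polynomial as a function of `t > 0`: `(-A ^ 3) ^ (-writhe) * ⟨D⟩` at
`A = t ^ (-1 / 4)`. -/
noncomputable def jones (w : GaussWord) (t : ℝ) : ℝ :=
  (-(t ^ (-(1 / 4) : ℝ)) ^ 3) ^ (-w.writhe) * w.bracket (t ^ (-(1 / 4) : ℝ))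

/-- The basis row vector of the edge `e`; the column of edge `0` is deleted. -/
def edgeRow (w : GaussWord) (e : Fin (w.length + 1)) (j : Fin w.length) : ℝ :=
  if e = j.succ then 1 else 0

/-- The Alexander matrix (abelianised Fox Jacobian of the Wirtinger presentation, with one
generator per edge and one relation per passage, and with the column of the generator of edge `0`
deleted). An over-passage gives the relation `out = in`. A crossing gives the relation
`left = t * right + (1 - t) * over` between the over-strand and the under-edges to its left and to
its right; a positive crossing is passed under from right to left, a negative one from left to
right. -/
noncomputable def alexanderMatrix (w : GaussWord) (t : ℝ) :
    Matrix (Fin w.length) (Fin w.length) ℝ := fun i j =>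
  if (w.get i).isOver then w.edgeRow i.succ j - w.edgeRow i.castSucc j
  else w.edgeRow i.succ j - t ^ ((w.get i).sign : ℤ) * w.edgeRow i.castSucc j
    - (1 - t ^ ((w.get i).sign : ℤ)) *
      ∑ k : Fin w.length,
        if (w.get k).isOver ∧ (w.get k).label = (w.get i).label then w.edgeRow k.castSucc j else 0

/-- The Alexander polynomial as a function of `t > 0`, up to a power of `t`. Its value at `t = 1`
is `1`, so that there is no ambiguity of sign. -/
noncomputable def alexander (w : GaussWord) (t : ℝ) : ℝ := (w.alexanderMatrix t).det

/-- `p` is the Conway polynomial: `p (t^{1/2} - t^{-1/2})` is the Alexander polynomial, multiplied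
by the power of `t^{1/2}` that makes it a polynomial in `t^{1/2} - t^{-1/2}`. At most one `p` has
this property. -/
def IsConway (w : GaussWord) (p : Polynomial ℤ) : Prop :=
  ∃ k : ℤ, ∀ t : ℝ, 0 < t →
    Polynomial.aeval (√t - (√t)⁻¹) p = √t ^ k * w.alexander t

open Classical in
/-- The Conway polynomial `∇(z)`. -/
noncomputable def conway (w : GaussWord) : Polynomial ℤ :=
  if h : ∃ p, w.IsConway p then h.choose else 0

/-- Two consecutive passages, in the order `p, q` if `e = 1` and in the order `q, p` otherwise. -/
def ordered (e : ℤˣ) (p q : Passage) : GaussWord := if e = 1 then [p, q] else [q, p]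

/-- Change of the base point, renaming of crossings, and the Reidemeister moves. -/
inductive Move : GaussWord → GaussWord → Prop
  | rotate (u v : GaussWord) : Move (u ++ v) (v ++ u)
  | relabel (f : Equiv.Perm ℕ) (u : GaussWord) :
      Move u (u.map fun p => ⟨f p.label, p.isOver, p.sign⟩)
  /-- A kink is removed. -/
  | r1 (u v : GaussWord) (c : ℕ) (o : Bool) (s : ℤˣ) :
      Move (u ++ [⟨c, o, s⟩, ⟨c, !o, s⟩] ++ v) (u ++ v)
  /-- A bigon between two strands with parallel orientations is removed. -/
  | r2_parallel (u v x : GaussWord) (c d : ℕ) (o : Bool) (s : ℤˣ) :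
      Move (u ++ [⟨c, o, s⟩, ⟨d, o, -s⟩] ++ v ++ [⟨c, !o, s⟩, ⟨d, !o, -s⟩] ++ x) (u ++ v ++ x)
  /-- A bigon between two strands with opposite orientations is removed. -/
  | r2_opposite (u v x : GaussWord) (c d : ℕ) (o : Bool) (s : ℤˣ) :
      Move (u ++ [⟨c, o, s⟩, ⟨d, o, -s⟩] ++ v ++ [⟨d, !o, -s⟩, ⟨c, !o, s⟩] ++ x) (u ++ v ++ x)
  /-- The triangle move. The crossings are `c` (top strand over middle strand), `d` (top over
  bottom) and `e` (middle over bottom). The units `p`, `q`, `r` say in which order the top, the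
  middle and the bottom strand pass through their two crossings, and `s` is the orientation of the
  triangle `c, d, e`; they determine the signs of the crossings. Here the strands are met in the
  cyclic order top, middle, bottom. -/
  | r3 (u v x y : GaussWord) (c d e : ℕ) (p q r s : ℤˣ) :
      Move
        (u ++ ordered p ⟨c, true, p * q * s⟩ ⟨d, true, p * r * s⟩ ++
          v ++ ordered q ⟨c, false, p * q * s⟩ ⟨e, true, q * r * s⟩ ++
          x ++ ordered r ⟨d, false, p * r * s⟩ ⟨e, false, q * r * s⟩ ++ y)
        (u ++ ordered (-p) ⟨c, true, p * q * s⟩ ⟨d, true, p * r * s⟩ ++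
          v ++ ordered (-q) ⟨c, false, p * q * s⟩ ⟨e, true, q * r * s⟩ ++
          x ++ ordered (-r) ⟨d, false, p * r * s⟩ ⟨e, false, q * r * s⟩ ++ y)
  /-- The same, with the strands met in the cyclic order top, bottom, middle. -/
  | r3' (u v x y : GaussWord) (c d e : ℕ) (p q r s : ℤˣ) :
      Move
        (u ++ ordered p ⟨c, true, p * q * s⟩ ⟨d, true, p * r * s⟩ ++
          v ++ ordered r ⟨d, false, p * r * s⟩ ⟨e, false, q * r * s⟩ ++
          x ++ ordered q ⟨c, false, p * q * s⟩ ⟨e, true, q * r * s⟩ ++ y)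
        (u ++ ordered (-p) ⟨c, true, p * q * s⟩ ⟨d, true, p * r * s⟩ ++
          v ++ ordered (-r) ⟨d, false, p * r * s⟩ ⟨e, false, q * r * s⟩ ++
          x ++ ordered (-q) ⟨c, false, p * q * s⟩ ⟨e, true, q * r * s⟩ ++ y)

end GaussWord

/-- An oriented knot diagram on the sphere, with a base point and named crossings. -/
structure KnotDiagram where
  word : GaussWord
  wellFormed : word.WellFormed
  planar : word.Planar

/-- All crossings are positive. -/
def KnotDiagram.IsPositive (D : KnotDiagram) : Prop := ∀ p ∈ D.word, p.sign = 1

/-- Knots: knot diagrams modulo the equivalence relation generated by the Reidemeister moves (and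
by change of the base point and of the names of the crossings). -/
def Knot : Type := Quot fun D D' : KnotDiagram => GaussWord.Move D.word D'.word

/-- The knot represented by a diagram. -/
def KnotDiagram.knot (D : KnotDiagram) : Knot := Quot.mk _ D

namespace Knot

/-- Some diagram of the knot. -/
noncomputable def diagram (K : Knot) : KnotDiagram := Quot.out K

/-- The Conway polynomial of a knot, computed from a diagram; it does not depend on the diagram. -/
noncomputable def conway (K : Knot) : Polynomial ℤ := K.diagram.word.conway

/-- The Jones polynomial of a knot as a function of `t > 0`, computed from a diagram; it does not
depend on the diagram. -/
noncomputable def jones (K : Knot) : ℝ → ℝ := K.diagram.word.jones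

/-- `a_n`, the coefficient of `z ^ n` in the Conway polynomial. -/
noncomputable def a (n : ℕ) (K : Knot) : ℤ := K.conway.coeff n

/-- The finite type invariant of degree three `-V'''(1) / 144 - V''(1) / 48`. -/
noncomputable def v₃ (K : Knot) : ℝ :=
  -(1 / 144) * iteratedDeriv 3 K.jones 1 - (1 / 48) * iteratedDeriv 2 K.jones 1

end Knot

/-!
Both sides are computed from the diagram, as sums over pairs and triples of crossings.

The values of the Jones polynomial. Up to a power of `t`, the Jones polynomial is a sum over the
smoothings of the diagram, and the number of circles of a smoothing is encoded by a polynomial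
(`loopPoly`). At a positive integer `k` this polynomial is a trace of products of `k × k` matrix
units (`eval_loopPoly`), so that relations between loop polynomials follow from matrix identities.
At `-2`, the value which belongs to `t = 1`, they give the correlations of the smoothings of one,
two and three crossings (`eval_oneState`, `eval_twoState`, `eval_threeState`); these depend only on
which crossings are linked. The second and third derivatives at `1` also involve the derivative of
the loop polynomial, the average number of circles. On the sphere it is determined by the number of
linked pairs, counted with the marks of the passages that come first (`Isotropic.eval_derivative`).
What is used about the sphere is that closed curves have intersection number zero: `Isotropic` says
this for the curves which run along the knot, and `Planar.isotropic` derives it from Euler's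
formula, because by a count of dimensions every flow on the edges has a potential on the faces.
Hence `V''(1)` and `V'''(1)` are explicit (`Planar.iteratedDeriv_two`, `Planar.third_order`).

The inequality for positive diagrams. With `-V''(1) / 6` in place of `a₂`, the difference of the two
sides is a sum over triples of crossings. After vanishing intersection numbers have been added with
suitable multiplicities, the contribution of every triple is nonnegative, whatever the order of its
six passages is (`Isotropic.chord_inequality`, `Planar.inequality`).

The equality `a₂ = -V''(1) / 6` for an arbitrary diagram (`IsConway.coeff_two`). Multiplying the
Alexander matrix by the inverse of its value at `1` gives a matrix `1 + D Y`, where `Y` records the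
order of the passages and `D` vanishes at `t = 1`. As the Conway polynomial is even, its square is
`Δ(t) Δ(1 / t)`, whose second-order term is a trace (`IsConway.two_mul_coeff_two`). This is a sum
over pairs of crossings, and the vanishing of intersection numbers turns it into the sum for
`V''(1)`. In this way the invariance of `a₂` is not needed.

The invariance of the Jones polynomial is needed, since the values attached to a knot are computed
from an arbitrary diagram of it. It is proved with the same matrix state sums, for the values `A` of
the variable with `-A ^ 2 - A ^ (-2) = k`: the Reidemeister moves become identities between tensors
(`triangle_move`, `Move.flatTrace_eq`), and these infinitely many values determine the Laurent
polynomial (`KnotDiagram.jones_eq`).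
-/


set_option linter.unusedSectionVars false

/-! ### State sums with matrices -/


section TensorAverage

open Matrix

/-- The entries of the two matrix units that are inserted at the two passages through a crossing:
row and column index at the passage marked `true`, then at the passage marked `false`. -/
abbrev Legs (k : ℕ) := (Fin k × Fin k) × (Fin k × Fin k)

variable {ι : Type*} [Fintype ι] [DecidableEq ι] {R : Type*} [CommRing R] {k : ℕ}

/-- The sum of `F` over all colourings, weighted with one tensor `wt c` for each crossing `c`. -/
def tensorAvg (wt : ι → Legs k → R) (F : (ι → Legs k) → R) : R :=
  ∑ χ, (∏ c, wt c (χ c)) * F χ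

/-- The matrix unit which the colouring puts at a passage. -/
def letterMatrix (R : Type*) [CommRing R] (χ : ι → Legs k) (l : ι × Bool) :
    Matrix (Fin k) (Fin k) R :=
  if l.2 then single (χ l.1).1.1 (χ l.1).1.2 1 else single (χ l.1).2.1 (χ l.1).2.2 1

/-- The product of the matrix units along a word. -/
def wordMatrix (R : Type*) [CommRing R] (χ : ι → Legs k) (w : List (ι × Bool)) :
    Matrix (Fin k) (Fin k) R :=
  (w.map (letterMatrix R χ)).prod

/-- The state sum of the closed word `w`. -/
def stateTrace (wt : ι → Legs k → R) (w : List (ι × Bool)) : R :=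
  tensorAvg wt fun χ => (wordMatrix R χ w).trace

/-- The tensor of the smoothing that respects the orientation. -/
def orientedTensor (R : Type*) [CommRing R] (x : Legs k) : R :=
  if x.2.1 = x.1.2 ∧ x.2.2 = x.1.1 then 1 else 0

/-- The tensor of the smoothing that does not respect the orientation. -/
def unorientedTensor (R : Type*) [CommRing R] (x : Legs k) : R :=
  if x.2.1 = x.1.1 ∧ x.2.2 = x.1.2 then 1 else 0

/-- The weight of a label that does not occur. -/
def idleTensor (R : Type*) [CommRing R] [NeZero k] (x : Legs k) : R :=
  if x = ((0, 0), (0, 0)) then 1 else 0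

lemma sum_idleTensor [NeZero k] : ∑ x : Legs k, idleTensor R x = 1 := by
  simp [idleTensor]

/-- Summation over the colours of one crossing. -/
lemma tensorAvg_update (wt : ι → Legs k → R) (F : (ι → Legs k) → R) (c : ι) (v : Legs k → R)
    (hv : ∑ x, v x = 1) :
    tensorAvg wt F =
      tensorAvg (Function.update wt c v) fun χ => ∑ x, wt c x * F (Function.update χ c x) := by
  classical
  unfold tensorAvg
  have split : ∀ G : Legs k × ({j // j ≠ c} → Legs k) → R,
      ∑ p, G p = ∑ x, ∑ g, G (x, g) := fun G => Fintype.sum_prod_type _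
  -- A colouring is a colour of `c` together with a colouring of the other crossings.
  rw [← (Equiv.funSplitAt c (Legs k)).symm.sum_comp, ← (Equiv.funSplitAt c (Legs k)).symm.sum_comp,
    split, split]
  have key : ∀ (u : ι → Legs k → R) (x : Legs k) (g : {j // j ≠ c} → Legs k),
      ∏ i, u i ((Equiv.funSplitAt c (Legs k)).symm (x, g) i) =
        u c x * ∏ i : {j // j ≠ c}, u i (g i) := by
    intro u x g
    rw [Fintype.prod_eq_mul_prod_subtype_ne _ c]
    congr 1
    · simp
    · apply Finset.prod_congr rfl
      rintro ⟨j, hj⟩ -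
      simp [hj]
  have upd : ∀ (x y : Legs k) (g : {j // j ≠ c} → Legs k),
      Function.update ((Equiv.funSplitAt c (Legs k)).symm (x, g)) c y =
        (Equiv.funSplitAt c (Legs k)).symm (y, g) := by
    intro x y g
    ext1 j
    by_cases hj : j = c
    · subst hj; simp
    · simp [hj]
  simp only [key, upd]
  have h2 : ∀ (g : {j // j ≠ c} → Legs k),
      ∏ i : {j // j ≠ c}, Function.update wt c v i (g i) = ∏ i : {j // j ≠ c}, wt i (g i) := by
    intro g
    apply Finset.prod_congr rfl
    rintro ⟨j, hj⟩ -
    simp [hj]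
  simp only [h2, Function.update_self]
  have h3 : ∀ x : Legs k, ∑ g : {j // j ≠ c} → Legs k, v x * (∏ i, wt i.1 (g i)) *
        ∑ y, wt c y * F ((Equiv.funSplitAt c (Legs k)).symm (y, g)) =
      v x * ∑ g : {j // j ≠ c} → Legs k, (∏ i, wt i.1 (g i)) *
        ∑ y, wt c y * F ((Equiv.funSplitAt c (Legs k)).symm (y, g)) := by
    intro x
    rw [Finset.mul_sum]
    exact Finset.sum_congr rfl fun g _ => by ring
  trans (∑ x, v x) * ∑ g : {j // j ≠ c} → Legs k, (∏ i, wt i.1 (g i)) *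
        ∑ y, wt c y * F ((Equiv.funSplitAt c (Legs k)).symm (y, g))
  · rw [hv, one_mul, Finset.sum_comm]
    apply Finset.sum_congr rfl
    intro g _
    rw [Finset.mul_sum]
    exact Finset.sum_congr rfl fun y _ => by ring
  · rw [Finset.sum_mul]
    exact Finset.sum_congr rfl fun x _ => (h3 x).symm

lemma tensorAvg_congr (wt : ι → Legs k → R) {F G : (ι → Legs k) → R} (h : ∀ χ, F χ = G χ) :
    tensorAvg wt F = tensorAvg wt G := by
  rw [show F = G from funext h]

lemma tensorAvg_smul (wt : ι → Legs k → R) (a : R) (F : (ι → Legs k) → R) :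
    tensorAvg wt (fun χ => a * F χ) = a * tensorAvg wt F := by
  unfold tensorAvg
  rw [Finset.mul_sum]
  exact Finset.sum_congr rfl fun χ _ => by ring

lemma tensorAvg_add (wt : ι → Legs k → R) (F G : (ι → Legs k) → R) :
    tensorAvg wt (fun χ => F χ + G χ) = tensorAvg wt F + tensorAvg wt G := by
  unfold tensorAvg
  rw [← Finset.sum_add_distrib]
  exact Finset.sum_congr rfl fun χ _ => by ring

lemma letterMatrix_update_of_ne (χ : ι → Legs k) {c : ι} (x : Legs k) {l : ι × Bool}
    (h : l.1 ≠ c) : letterMatrix R (Function.update χ c x) l = letterMatrix R χ l := by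
  unfold letterMatrix
  rw [Function.update_of_ne h]

lemma wordMatrix_update (χ : ι → Legs k) {c : ι} (x : Legs k) {w : List (ι × Bool)}
    (h : ∀ l ∈ w, l.1 ≠ c) :
    wordMatrix R (Function.update χ c x) w = wordMatrix R χ w := by
  unfold wordMatrix
  congr 1
  exact List.map_congr_left fun l hl => letterMatrix_update_of_ne χ x (h l hl)

lemma wordMatrix_append (χ : ι → Legs k) (u v : List (ι × Bool)) :
    wordMatrix R χ (u ++ v) = wordMatrix R χ u * wordMatrix R χ v := by
  simp [wordMatrix]

lemma wordMatrix_cons (χ : ι → Legs k) (l : ι × Bool) (v : List (ι × Bool)) :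
    wordMatrix R χ (l :: v) = letterMatrix R χ l * wordMatrix R χ v := by
  simp [wordMatrix]

@[simp] lemma wordMatrix_nil (χ : ι → Legs k) : wordMatrix R χ [] = 1 := rfl

lemma orientedTensor_sum (B : Matrix (Fin k) (Fin k) R) :
    ∑ x : Legs k, orientedTensor R x •
      (single x.1.1 x.1.2 1 * B * single x.2.1 x.2.2 (1 : R)) = B.trace • 1 := by
  ext i j
  simp only [single_mul_mul_single, orientedTensor, Matrix.sum_apply, Matrix.smul_apply]
  simp only [Fintype.sum_prod_type, single_apply, ite_and]
  simp only [one_mul, mul_one, smul_eq_mul, ite_mul, zero_mul, mul_ite, mul_zero]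
  rw [Matrix.trace, Matrix.one_apply]
  simp [eq_comm]

lemma unorientedTensor_sum (B : Matrix (Fin k) (Fin k) R) :
    ∑ x : Legs k, unorientedTensor R x •
      (single x.1.1 x.1.2 1 * B * single x.2.1 x.2.2 (1 : R)) = Bᵀ := by
  ext i j
  simp only [single_mul_mul_single, unorientedTensor, Matrix.sum_apply, Matrix.smul_apply]
  simp only [Fintype.sum_prod_type, single_apply, ite_and]
  simp

end TensorAverage

/-! ### Loops of a smoothed word -/

section Loops

open Matrix

variable {ι : Type*} [Fintype ι] [DecidableEq ι] {R : Type*} [CommRing R] {k : ℕ}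

/-- The relation between the edges `0, …, m` of a word of length `m` after smoothing: the crossings
in `T` are smoothed with the orientation, the others against it. -/
inductive Glue {m : ℕ} (a : Fin m → ι × Bool) (T : Finset ι) : Fin (m + 1) → Fin (m + 1) → Prop
  | base : Glue a T 0 (Fin.last m)
  | oriented (i j : Fin m) (hl : (a i).1 = (a j).1) (hb : (a i).2 ≠ (a j).2) (hT : (a i).1 ∈ T) :
      Glue a T i.castSucc j.succ
  | unoriented_in (i j : Fin m) (hl : (a i).1 = (a j).1) (hb : (a i).2 ≠ (a j).2)
      (hT : (a i).1 ∉ T) : Glue a T i.castSucc j.castSucc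
  | unoriented_out (i j : Fin m) (hl : (a i).1 = (a j).1) (hb : (a i).2 ≠ (a j).2)
      (hT : (a i).1 ∉ T) : Glue a T i.succ j.succ

/-- The number of circles after smoothing. -/
noncomputable def loopNumber {m : ℕ} (a : Fin m → ι × Bool) (T : Finset ι) : ℕ :=
  Nat.card (Quot (Glue a T))

lemma loopNumber_pos {m : ℕ} (a : Fin m → ι × Bool) (T : Finset ι) : 0 < loopNumber a T := by
  have : Finite (Quot (Glue a T)) := Finite.of_surjective _ Quot.mk_surjective
  have : Nonempty (Quot (Glue a T)) := ⟨Quot.mk _ 0⟩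
  exact Nat.card_pos

/-- A product of matrices as a sum over paths. -/
lemma prod_ofFn_apply {m : ℕ} (M : Fin m → Matrix (Fin k) (Fin k) R) (x y : Fin k) :
    (List.ofFn M).prod x y = ∑ φ : Fin (m + 1) → Fin k,
      if φ 0 = x ∧ φ (Fin.last m) = y then ∏ i, M i (φ i.castSucc) (φ i.succ) else 0 := by
  induction m generalizing x with
  | zero =>
    rw [← (Equiv.funUnique (Fin 1) (Fin k)).symm.sum_comp]
    simp [Matrix.one_apply, ite_and]
  | succ m ih =>
    rw [← (Fin.consEquiv fun _ => Fin k).sum_comp, Fintype.sum_prod_type]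
    simp only [List.ofFn_succ, List.prod_cons, Matrix.mul_apply, ih]
    simp only [Fin.consEquiv_apply, Fin.prod_univ_succ, Fin.cons_zero, ← Fin.succ_last,
      Fin.cons_succ, Fin.castSucc_zero, ← Fin.succ_castSucc]
    have h : ∀ z : Fin k, (∑ φ : Fin (m + 1) → Fin k, if z = x ∧ φ (Fin.last m) = y then
        M 0 z (φ 0) * ∏ i : Fin m, M i.succ (φ i.castSucc) (φ i.succ) else 0) =
        if z = x then ∑ φ : Fin (m + 1) → Fin k, if φ (Fin.last m) = y then
          M 0 z (φ 0) * ∏ i : Fin m, M i.succ (φ i.castSucc) (φ i.succ) else 0 else 0 := by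
      intro z
      split_ifs with hz <;> simp [hz]
    simp only [h, Finset.sum_ite_eq', Finset.mem_univ, if_true, Finset.mul_sum]
    rw [Finset.sum_comm]
    apply Finset.sum_congr rfl
    intro φ _
    rw [Finset.sum_eq_single (φ 0)]
    · simp
    · intro b _ hb
      rw [if_neg (fun h => hb h.1.symm), mul_zero]
    · simp

lemma trace_prod_ofFn {m : ℕ} (M : Fin m → Matrix (Fin k) (Fin k) R) :
    (List.ofFn M).prod.trace = ∑ φ : Fin (m + 1) → Fin k,
      if φ 0 = φ (Fin.last m) then ∏ i, M i (φ i.castSucc) (φ i.succ) else 0 := by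
  rw [Matrix.trace]
  simp only [Matrix.diag_apply, prod_ofFn_apply]
  rw [Finset.sum_comm]
  apply Finset.sum_congr rfl
  intro φ _
  rw [Finset.sum_eq_single (φ 0)]
  · simp [eq_comm]
  · intro b _ hb
    rw [if_neg (fun h => hb h.1.symm)]
  · simp

lemma letterMatrix_apply (χ : ι → Legs k) (l : ι × Bool) (x y : Fin k) :
    letterMatrix R χ l x y =
      if (if l.2 then (χ l.1).1 else (χ l.1).2) = (x, y) then 1 else 0 := by
  unfold letterMatrix
  split_ifs with h h1 h2 <;> simp_all [Prod.ext_iff]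

/-- The weights of a smoothing: labels outside `L` are idle, those in `T` are smoothed with the
orientation. -/
def stateWeight (R : Type*) [CommRing R] [NeZero k] (L T : Finset ι) (c : ι) : Legs k → R :=
  if c ∈ L then if c ∈ T then orientedTensor R else unorientedTensor R else idleTensor R

/-- Every label that occurs does so once with `true` and once with `false`. -/
def PairedWord (w : List (ι × Bool)) : Prop := w.Nodup ∧ ∀ l ∈ w, (l.1, !l.2) ∈ w

/-- The labels that occur. -/
def labels (w : List (ι × Bool)) : Finset ι := (w.map Prod.fst).toFinset

lemma PairedWord.mem_labels {w : List (ι × Bool)} (hw : PairedWord w) {c : ι} (b : Bool) :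
    c ∈ labels w ↔ (c, b) ∈ w := by
  constructor
  · intro h
    simp only [labels, List.mem_toFinset, List.mem_map, Prod.exists, exists_and_right,
      exists_eq_right] at h
    obtain ⟨b', hb'⟩ := h
    by_cases hbb : b' = b
    · rwa [← hbb]
    · have := hw.2 _ hb'
      have hb2 : b = !b' := by cases b <;> cases b' <;> simp_all
      simpa [hb2] using this
  · intro h
    simp only [labels, List.mem_toFinset, List.mem_map]
    exact ⟨_, h, rfl⟩

/-- The state sum of a smoothing counts the colourings of its circles. -/
theorem stateTrace_stateWeight [NeZero k] {w : List (ι × Bool)} (hw : PairedWord w)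
    (T : Finset ι) :
    stateTrace (k := k) (stateWeight R (labels w) T) w = (k : R) ^ loopNumber w.get T := by
  classical
  have hget : ∀ c ∈ labels w, ∀ b, ∃ i : Fin w.length, w.get i = (c, b) := by
    intro c hc b
    obtain ⟨i, hi⟩ := List.get_of_mem ((hw.mem_labels b).1 hc)
    exact ⟨i, hi⟩
  have hinj : ∀ i j : Fin w.length, w.get i = w.get j → i = j := fun i j h =>
    hw.1.injective_get h
  have hmem : ∀ i : Fin w.length, (w.get i).1 ∈ labels w := fun i =>
    (hw.mem_labels (w.get i).2).2 (List.get_mem w i)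
  rcases eq_or_ne w [] with rfl | hne
  · have h1 : loopNumber ([] : List (ι × Bool)).get T = 1 := by
      have : Subsingleton (Quot (Glue ([] : List (ι × Bool)).get T)) := by
        constructor
        rintro ⟨x⟩ ⟨y⟩
        rw [Subsingleton.elim (α := Fin 1) x y]
      have : Nonempty (Quot (Glue ([] : List (ι × Bool)).get T)) := ⟨Quot.mk _ 0⟩
      exact Nat.card_unique
    rw [h1]
    simp only [stateTrace, tensorAvg, wordMatrix_nil, stateWeight, labels, List.map_nil,
      List.toFinset_nil, Finset.notMem_empty, if_false, ← Finset.sum_mul]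
    have h2 : ∑ χ : ι → Legs k, ∏ c, idleTensor R (χ c) = 1 := by
      have := Finset.prod_univ_sum (fun _ : ι => (Finset.univ : Finset (Legs k)))
        fun _ x => idleTensor R x
      rw [Fintype.piFinset_univ] at this
      rw [← this]
      simp [sum_idleTensor]
    rw [h2]
    simp
  have : Nonempty (Fin w.length) := ⟨⟨0, List.length_pos_iff.2 hne⟩⟩
  choose! p hp using hget
  -- the colouring of the legs which is determined by a colouring of the edges
  let e : (Fin (w.length + 1) → Fin k) → Fin w.length → Fin k × Fin k :=
    fun φ i => (φ i.castSucc, φ i.succ)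
  let X : (Fin (w.length + 1) → Fin k) → ι → Legs k := fun φ c =>
    if c ∈ labels w then (e φ (p c true), e φ (p c false)) else ((0, 0), (0, 0))
  have hw' : w = List.ofFn w.get := (List.ofFn_get w).symm
  have step1 : ∀ χ : ι → Legs k, (wordMatrix R χ w).trace =
      ∑ φ : Fin (w.length + 1) → Fin k, if φ 0 = φ (Fin.last _) then
        ∏ i, letterMatrix R χ (w.get i) (φ i.castSucc) (φ i.succ) else 0 := by
    intro χ
    have : wordMatrix R χ w = (List.ofFn fun i => letterMatrix R χ (w.get i)).prod := by
      unfold wordMatrix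
      conv_lhs => rw [hw', List.map_ofFn]
      rfl
    rw [this, trace_prod_ofFn]
  -- Only the colouring of the crossings that fits the colouring of the edges contributes.
  have step2 : stateTrace (k := k) (stateWeight R (labels w) T) w =
      ∑ φ : Fin (w.length + 1) → Fin k, if φ 0 = φ (Fin.last _) then
        ∏ c, stateWeight R (labels w) T c (X φ c) else 0 := by
    unfold stateTrace tensorAvg
    simp only [step1, Finset.mul_sum]
    rw [Finset.sum_comm]
    apply Finset.sum_congr rfl
    intro φ _
    split_ifs with h0
    · rw [Finset.sum_eq_single (X φ)]
      · rw [Finset.prod_eq_one (s := Finset.univ (α := Fin w.length)), mul_one]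
        intro i _
        rw [letterMatrix_apply, if_pos]
        have h1 : p (w.get i).1 (w.get i).2 = i := hinj _ _ (hp _ (hmem i) _)
        simp only [X, if_pos (hmem i)]
        rcases hb : (w.get i).2 with _ | _
        · rw [hb] at h1
          simp only [e, h1, Bool.false_eq_true, if_false]
        · rw [hb] at h1
          simp only [e, h1, if_true]
      · intro χ _ hχ
        obtain ⟨c, hc⟩ := Function.ne_iff.1 hχ
        by_cases hcL : c ∈ labels w
        · have : ∏ i, letterMatrix R χ (w.get i) (φ i.castSucc) (φ i.succ) = 0 := by
            by_contra hne
            apply hc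
            have hall : ∀ b, letterMatrix R χ (w.get (p c b)) (φ (p c b).castSucc)
                (φ (p c b).succ) ≠ 0 := fun b hz =>
              hne (Finset.prod_eq_zero (Finset.mem_univ (p c b)) hz)
            simp only [hp c hcL, letterMatrix_apply] at hall
            have ht := hall true
            have hf := hall false
            simp only [if_true, Bool.false_eq_true, if_false, ne_eq, ite_eq_right_iff,
              Classical.not_imp] at ht hf
            simp only [X, if_pos hcL, e]
            exact Prod.ext ht.1 hf.1
          rw [this, mul_zero]
        · rw [Finset.prod_eq_zero (Finset.mem_univ c), zero_mul]
          simp only [X, if_neg hcL] at hc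
          simp [stateWeight, hcL, idleTensor, hc]
      · simp
    · simp
  have step3 : ∀ φ : Fin (w.length + 1) → Fin k,
      (if φ 0 = φ (Fin.last _) then ∏ c, stateWeight R (labels w) T c (X φ c) else 0) =
      if ∀ x y, Glue w.get T x y → φ x = φ y then 1 else 0 := by
    intro φ
    by_cases hφ : ∀ x y, Glue w.get T x y → φ x = φ y
    · rw [if_pos hφ, if_pos (hφ _ _ Glue.base)]
      apply Finset.prod_eq_one
      intro c _
      by_cases hcL : c ∈ labels w
      · have e1 : (w.get (p c false)).1 = (w.get (p c true)).1 := by rw [hp c hcL, hp c hcL]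
        have e2 : (w.get (p c false)).2 ≠ (w.get (p c true)).2 := by rw [hp c hcL, hp c hcL]; simp
        simp only [stateWeight, if_pos hcL, X, e]
        by_cases hcT : c ∈ T
        · rw [if_pos hcT, orientedTensor, if_pos]
          exact ⟨hφ _ _ (Glue.oriented _ _ e1 e2 (by rw [hp c hcL]; exact hcT)),
            (hφ _ _ (Glue.oriented _ _ e1.symm e2.symm (by rw [hp c hcL]; exact hcT))).symm⟩
        · rw [if_neg hcT, unorientedTensor, if_pos]
          exact ⟨hφ _ _ (Glue.unoriented_in _ _ e1 e2 (by rw [hp c hcL]; exact hcT)),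
            hφ _ _ (Glue.unoriented_out _ _ e1 e2 (by rw [hp c hcL]; exact hcT))⟩
      · simp [stateWeight, hcL, X, idleTensor]
    · rw [if_neg hφ]
      by_cases h0 : φ 0 = φ (Fin.last _)
      · rw [if_pos h0]
        by_contra hne
        have hall : ∀ c, stateWeight R (labels w) T c (X φ c) ≠ 0 := fun c hz =>
          hne (Finset.prod_eq_zero (Finset.mem_univ c) hz)
        apply hφ
        have hpos : ∀ i j : Fin w.length, (w.get i).1 = (w.get j).1 →
            (w.get i).2 ≠ (w.get j).2 → (i = p (w.get i).1 true ∧ j = p (w.get i).1 false) ∨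
              (i = p (w.get i).1 false ∧ j = p (w.get i).1 true) := by
          intro i j hl hb
          have h1 : p (w.get i).1 (w.get i).2 = i := hinj _ _ (hp _ (hmem i) _)
          have h2 : p (w.get j).1 (w.get j).2 = j := hinj _ _ (hp _ (hmem j) _)
          rw [← hl] at h2
          rcases hbi : (w.get i).2 with _ | _ <;> rcases hbj : (w.get j).2 with _ | _ <;>
            rw [hbi] at h1 hb <;> rw [hbj] at h2 hb
          · exact absurd rfl hb
          · exact Or.inr ⟨h1.symm, h2.symm⟩
          · exact Or.inl ⟨h1.symm, h2.symm⟩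
          · exact absurd rfl hb
        intro x y hxy
        cases hxy with
        | base => exact h0
        | oriented i j hl hb hT =>
          have := hall (w.get i).1
          simp only [stateWeight, if_pos (hmem i), if_pos hT, X, e, orientedTensor, ne_eq,
            ite_eq_right_iff, Classical.not_imp] at this
          rcases hpos i j hl hb with ⟨h1, h2⟩ | ⟨h1, h2⟩
          · rw [← h1, ← h2] at this; exact this.1.2.symm
          · rw [← h1, ← h2] at this; exact this.1.1
        | unoriented_in i j hl hb hT =>
          have := hall (w.get i).1
          simp only [stateWeight, if_pos (hmem i), if_neg hT, X, e, unorientedTensor, ne_eq,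
            ite_eq_right_iff, Classical.not_imp] at this
          rcases hpos i j hl hb with ⟨h1, h2⟩ | ⟨h1, h2⟩
          · rw [← h1, ← h2] at this; exact this.1.1.symm
          · rw [← h1, ← h2] at this; exact this.1.1
        | unoriented_out i j hl hb hT =>
          have := hall (w.get i).1
          simp only [stateWeight, if_pos (hmem i), if_neg hT, X, e, unorientedTensor, ne_eq,
            ite_eq_right_iff, Classical.not_imp] at this
          rcases hpos i j hl hb with ⟨h1, h2⟩ | ⟨h1, h2⟩
          · rw [← h1, ← h2] at this; exact this.1.2.symm
          · rw [← h1, ← h2] at this; exact this.1.2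
      · rw [if_neg h0]
  rw [step2, Finset.sum_congr rfl fun φ _ => step3 φ, Finset.sum_boole]
  have hfin : Finite (Quot (Glue w.get T)) := Finite.of_surjective _ Quot.mk_surjective
  have : Fintype (Quot (Glue w.get T)) := Fintype.ofFinite _
  have hcard : (Finset.univ.filter fun φ : Fin (w.length + 1) → Fin k =>
      ∀ x y, Glue w.get T x y → φ x = φ y).card = k ^ loopNumber w.get T := by
    rw [loopNumber, Nat.card_eq_fintype_card]
    have h1 : Fintype.card (Quot (Glue w.get T) → Fin k) =
        k ^ Fintype.card (Quot (Glue w.get T)) := by simp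
    rw [← h1, ← Finset.card_univ]
    symm
    apply Finset.card_bij (fun g _ => fun x => g (Quot.mk _ x))
    · intro g _
      simp only [Finset.mem_filter, Finset.mem_univ, true_and]
      intro x y hxy
      rw [Quot.sound hxy]
    · intro g _ g' _ h
      funext q
      obtain ⟨x, rfl⟩ := Quot.exists_rep q
      exact congrFun h x
    · intro φ hφ
      simp only [Finset.mem_filter, Finset.mem_univ, true_and] at hφ
      exact ⟨Quot.lift φ hφ, Finset.mem_univ _, rfl⟩
  rw [hcard]
  simp

end Loops

/-! ### The loop polynomial -/

section LoopPolynomial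

open Matrix Polynomial

variable {ι : Type*} [Fintype ι] [DecidableEq ι] {R : Type*} [CommRing R] {k : ℕ}

lemma PairedWord.of_perm {v w : List (ι × Bool)} (h : v.Perm w) (hv : PairedWord v) :
    PairedWord w :=
  ⟨h.nodup_iff.1 hv.1, fun l hl => h.mem_iff.1 (hv.2 l (h.mem_iff.2 hl))⟩

lemma labels_perm {v w : List (ι × Bool)} (h : v.Perm w) : labels v = labels w :=
  List.toFinset_eq_of_perm _ _ (h.map _)

lemma mem_labels_of_mem {w : List (ι × Bool)} {l : ι × Bool} (h : l ∈ w) : l.1 ∈ labels w := by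
  simp only [labels, List.mem_toFinset, List.mem_map]
  exact ⟨l, h, rfl⟩

lemma mem_labels_iff {w : List (ι × Bool)} {c : ι} : c ∈ labels w ↔ ∃ l ∈ w, l.1 = c := by
  simp [labels]

/-- Removing both passages through a crossing. -/
lemma PairedWord.remove {c : ι} {b : Bool} {y z : List (ι × Bool)}
    (h : PairedWord ((c, b) :: y ++ (c, !b) :: z)) :
    PairedWord (y ++ z) ∧ ∀ l ∈ y ++ z, l.1 ≠ c := by
  have hp : ((c, b) :: y ++ (c, !b) :: z).Perm ((c, b) :: (c, !b) :: (y ++ z)) := by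
    simp
  have h2 := h.of_perm hp
  have hne : ∀ l ∈ y ++ z, l.1 ≠ c := by
    intro l hl hlc
    have h1 := h2.1
    rw [List.nodup_cons, List.nodup_cons] at h1
    rcases l with ⟨d, b'⟩
    simp only at hlc
    subst hlc
    rcases Bool.eq_or_eq_not b' b with hb | hb <;> subst hb
    · exact h1.1 (List.mem_cons_of_mem _ hl)
    · exact h1.2.1 hl
  refine ⟨⟨(h2.1.of_cons).of_cons, fun l hl => ?_⟩, hne⟩
  have := h2.2 l (by simp only [List.mem_cons]; exact Or.inr (Or.inr hl))
  simp only [List.mem_cons, Prod.ext_iff] at this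
  rcases this with ⟨h3, -⟩ | ⟨h3, -⟩ | h3
  · exact absurd h3 (hne l hl)
  · exact absurd h3 (hne l hl)
  · exact h3

lemma labels_remove {c : ι} {b : Bool} {y z : List (ι × Bool)} :
    labels ((c, b) :: y ++ (c, !b) :: z) = insert c (labels (y ++ z)) := by
  ext d
  simp [labels]

/-- The tensor `a` times the oriented plus `b` times the unoriented smoothing at each label in `L`,
idle at the other labels. -/
def chordWeight [NeZero k] (α β : ι → R) (L : Finset ι) (c : ι) (x : Legs k) : R :=
  if c ∈ L then α c * orientedTensor R x + β c * unorientedTensor R x else idleTensor R x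

/-- The sum of `X` to the number of circles over all smoothings of a word, where the oriented
smoothing of the crossing `c` has the weight `α c` and the unoriented one the weight `β c`. -/
noncomputable def loopPoly (α β : ι → R) (w : List (ι × Bool)) : R[X] :=
  ∑ T ∈ (labels w).powerset,
    C ((∏ c ∈ T, α c) * ∏ c ∈ labels w \ T, β c) * X ^ loopNumber w.get T

/-- At a positive integer `k`, the loop polynomial is a trace of products of `k × k` matrices: every
circle can be coloured in `k` ways. -/
theorem eval_loopPoly [NeZero k] (α β : ι → R) {w : List (ι × Bool)} (hw : PairedWord w) :
    (loopPoly α β w).eval (k : R) = stateTrace (k := k) (chordWeight α β (labels w)) w := by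
  classical
  have h1 : ∀ χ : ι → Legs k, ∏ c, chordWeight α β (labels w) c (χ c) =
      ∑ T ∈ (labels w).powerset, ((∏ c ∈ T, α c) * ∏ c ∈ labels w \ T, β c) *
        ∏ c, stateWeight R (labels w) T c (χ c) := by
    intro χ
    rw [← Finset.prod_mul_prod_compl (labels w)]
    have e1 : ∏ c ∈ labels w, chordWeight α β (labels w) c (χ c) =
        ∏ c ∈ labels w, (α c * orientedTensor R (χ c) + β c * unorientedTensor R (χ c)) :=
      Finset.prod_congr rfl fun c hc => by simp [chordWeight, hc]
    rw [e1, Finset.prod_add, Finset.sum_mul]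
    apply Finset.sum_congr rfl
    intro T hT
    rw [Finset.mem_powerset] at hT
    have e2 : ∏ c, stateWeight R (labels w) T c (χ c) =
        (∏ c ∈ T, orientedTensor R (χ c)) * (∏ c ∈ labels w \ T, unorientedTensor R (χ c)) *
          ∏ c ∈ (labels w)ᶜ, idleTensor R (χ c) := by
      rw [← Finset.prod_mul_prod_compl (labels w), ← Finset.prod_sdiff hT,
        mul_comm (∏ c ∈ labels w \ T, _)]
      congr 1
      · congr 1
        · exact Finset.prod_congr rfl fun c hc => by simp [stateWeight, hT hc, hc]
        · refine Finset.prod_congr rfl fun c hc => ?_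
          rw [Finset.mem_sdiff] at hc
          simp [stateWeight, hc.1, hc.2]
      · refine Finset.prod_congr rfl fun c hc => ?_
        rw [Finset.mem_compl] at hc
        simp [stateWeight, hc]
    have e3 : ∏ c ∈ (labels w)ᶜ, chordWeight α β (labels w) c (χ c) =
        ∏ c ∈ (labels w)ᶜ, idleTensor R (χ c) := by
      refine Finset.prod_congr rfl fun c hc => ?_
      rw [Finset.mem_compl] at hc
      simp [chordWeight, hc]
    rw [e2, e3, Finset.prod_mul_distrib, Finset.prod_mul_distrib]
    ring
  have h2 : stateTrace (k := k) (chordWeight α β (labels w)) w =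
      ∑ T ∈ (labels w).powerset, ((∏ c ∈ T, α c) * ∏ c ∈ labels w \ T, β c) *
        stateTrace (k := k) (stateWeight R (labels w) T) w := by
    unfold stateTrace tensorAvg
    simp only [h1, Finset.sum_mul, Finset.mul_sum]
    rw [Finset.sum_comm]
    exact Finset.sum_congr rfl fun T _ => Finset.sum_congr rfl fun χ _ => by ring
  rw [h2, loopPoly, eval_finsetSum]
  refine Finset.sum_congr rfl fun T _ => ?_
  rw [stateTrace_stateWeight hw, eval_mul, eval_C, eval_pow, eval_X]

lemma polynomial_eq_of_eval_nat {p q : ℤ[X]}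
    (h : ∀ k : ℕ, k ≠ 0 → p.eval (k : ℤ) = q.eval (k : ℤ)) : p = q := by
  apply Polynomial.eq_of_infinite_eval_eq
  apply Set.Infinite.mono (s := Set.range fun n : ℕ => ((n + 1 : ℕ) : ℤ))
  · rintro _ ⟨n, rfl⟩
    exact h (n + 1) (Nat.succ_ne_zero n)
  · apply Set.infinite_range_of_injective
    intro a b hab
    simpa using hab

/-! ### Resolving a crossing -/

lemma letterMatrix_update_self (χ : ι → Legs k) (c : ι) (x : Legs k) (b : Bool) :
    letterMatrix R (Function.update χ c x) (c, b) =
      if b then single x.1.1 x.1.2 1 else single x.2.1 x.2.2 1 := by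
  simp [letterMatrix]

lemma orientedTensor_swap (x : Legs k) : orientedTensor R x.swap = orientedTensor R x := by
  simp only [orientedTensor, Prod.fst_swap, Prod.snd_swap, @eq_comm _ x.1.1, @eq_comm _ x.1.2,
    @and_comm (x.2.2 = x.1.1)]

lemma unorientedTensor_swap (x : Legs k) : unorientedTensor R x.swap = unorientedTensor R x := by
  simp only [unorientedTensor, Prod.fst_swap, Prod.snd_swap, @eq_comm _ x.1.1, @eq_comm _ x.1.2]

/-- Summation over the colours of a crossing whose passages enclose the matrix `B`. -/
lemma sum_chord (a b : R) (s : Bool) (χ : ι → Legs k) (c : ι) (B : Matrix (Fin k) (Fin k) R) :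
    ∑ x : Legs k, (a * orientedTensor R x + b * unorientedTensor R x) •
      (letterMatrix R (Function.update χ c x) (c, s) * B *
        letterMatrix R (Function.update χ c x) (c, !s)) = (a * B.trace) • 1 + b • Bᵀ := by
  have h : ∑ x : Legs k, (a * orientedTensor R x + b * unorientedTensor R x) •
      (single x.1.1 x.1.2 1 * B * single x.2.1 x.2.2 1) = (a * B.trace) • 1 + b • Bᵀ := by
    simp only [add_smul, mul_smul, Finset.sum_add_distrib, ← Finset.smul_sum]
    rw [orientedTensor_sum, unorientedTensor_sum]
  cases s
  · rw [← h, ← (Equiv.prodComm _ _).sum_comp]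
    refine Finset.sum_congr rfl fun x _ => ?_
    simp only [letterMatrix_update_self, Equiv.prodComm_apply]
    rw [orientedTensor_swap, unorientedTensor_swap]
    simp
  · rw [← h]
    refine Finset.sum_congr rfl fun x _ => ?_
    simp [letterMatrix_update_self]

lemma chordWeight_update [NeZero k] (α β : ι → R) (L : Finset ι) {c : ι} (hc : c ∉ L) :
    Function.update (chordWeight (k := k) α β (insert c L)) c (idleTensor R) =
      chordWeight α β L := by
  funext d x
  by_cases hd : d = c
  · subst hd; simp [chordWeight, hc]
  · simp [chordWeight, hd]

lemma chordWeight_insert_self [NeZero k] (α β : ι → R) (L : Finset ι) (c : ι) (x : Legs k) :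
    chordWeight α β (insert c L) c x = α c * orientedTensor R x + β c * unorientedTensor R x := by
  simp [chordWeight]

lemma notMem_labels {w : List (ι × Bool)} {c : ι} (h : ∀ l ∈ w, l.1 ≠ c) : c ∉ labels w := by
  rw [mem_labels_iff]
  rintro ⟨l, hl, rfl⟩
  exact h l hl rfl

/-- Resolving a crossing of a closed word. -/
lemma stateTrace_resolve [NeZero k] (α β : ι → R) {c : ι} {b : Bool} {y z : List (ι × Bool)}
    (h : PairedWord ((c, b) :: y ++ (c, !b) :: z)) :
    stateTrace (k := k) (chordWeight α β (labels ((c, b) :: y ++ (c, !b) :: z)))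
        ((c, b) :: y ++ (c, !b) :: z) =
      tensorAvg (k := k) (chordWeight α β (labels (y ++ z))) fun χ =>
        α c * ((wordMatrix R χ y).trace * (wordMatrix R χ z).trace) +
          β c * ((wordMatrix R χ y)ᵀ * wordMatrix R χ z).trace := by
  have hne := h.remove.2
  have hy : ∀ l ∈ y, l.1 ≠ c := fun l hl => hne l (List.mem_append_left _ hl)
  have hz : ∀ l ∈ z, l.1 ≠ c := fun l hl => hne l (List.mem_append_right _ hl)
  rw [labels_remove, stateTrace, tensorAvg_update _ _ c (idleTensor R) sum_idleTensor,
    chordWeight_update _ _ _ (notMem_labels hne)]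
  refine tensorAvg_congr _ fun χ => ?_
  simp only [chordWeight_insert_self, List.cons_append, wordMatrix_cons, wordMatrix_append,
    wordMatrix_update χ _ hy, wordMatrix_update χ _ hz]
  have := congrArg (fun M => (M * wordMatrix R χ z).trace) (sum_chord (α c) (β c) b χ c
    (wordMatrix R χ y))
  simp only [Finset.sum_mul, Matrix.trace_sum, smul_mul_assoc, Matrix.trace_smul, add_mul, one_mul,
    Matrix.trace_add, smul_eq_mul] at this
  rw [← mul_assoc, ← this]
  refine Finset.sum_congr rfl fun x _ => ?_
  simp only [mul_assoc, add_mul]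

lemma trace_transpose_single_sum (A B : Matrix (Fin k) (Fin k) R) :
    (∑ x : Legs k, orientedTensor R x *
      ((single x.1.1 x.1.2 1 * A).trace * (single x.2.1 x.2.2 1 * B).trace) = (A * B).trace) ∧
    ∑ x : Legs k, unorientedTensor R x *
      ((single x.1.1 x.1.2 1 * A).trace * (single x.2.1 x.2.2 1 * B).trace) =
        (Aᵀ * B).trace := by
  have h : ∀ (i j : Fin k) (M : Matrix (Fin k) (Fin k) R), (single i j 1 * M).trace = M j i := by
    intro i j M
    rw [Matrix.trace_single_mul]
    simp
  simp only [h]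
  simp only [orientedTensor, unorientedTensor, Fintype.sum_prod_type, ite_and, ite_mul, zero_mul,
    one_mul, Matrix.trace, Matrix.diag_apply, Matrix.mul_apply, Matrix.transpose_apply]
  constructor
  · rw [Finset.sum_comm]
    simp
  · rw [Finset.sum_comm]
    simp only [Finset.sum_ite_eq', Finset.sum_ite_irrel, Finset.sum_const_zero,
      Finset.mem_univ, if_true]
    exact Finset.sum_comm

/-- Resolving a crossing between two closed words. -/
lemma tensorAvg_merge [NeZero k] (α β : ι → R) {c : ι} {b : Bool} {y z : List (ι × Bool)}
    (h : PairedWord ((c, b) :: y ++ (c, !b) :: z)) :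
    tensorAvg (k := k) (chordWeight α β (labels ((c, b) :: y ++ (c, !b) :: z))) (fun χ =>
        (wordMatrix R χ ((c, b) :: y)).trace * (wordMatrix R χ ((c, !b) :: z)).trace) =
      tensorAvg (k := k) (chordWeight α β (labels (y ++ z))) fun χ =>
        α c * (wordMatrix R χ (y ++ z)).trace +
          β c * ((wordMatrix R χ y)ᵀ * wordMatrix R χ z).trace := by
  have hne := h.remove.2
  have hy : ∀ l ∈ y, l.1 ≠ c := fun l hl => hne l (List.mem_append_left _ hl)
  have hz : ∀ l ∈ z, l.1 ≠ c := fun l hl => hne l (List.mem_append_right _ hl)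
  rw [labels_remove, tensorAvg_update _ _ c (idleTensor R) sum_idleTensor,
    chordWeight_update _ _ _ (notMem_labels hne)]
  refine tensorAvg_congr _ fun χ => ?_
  simp only [chordWeight_insert_self, wordMatrix_cons, wordMatrix_append,
    wordMatrix_update χ _ hy, wordMatrix_update χ _ hz, letterMatrix_update_self]
  obtain ⟨h1, h2⟩ := trace_transpose_single_sum (wordMatrix R χ y) (wordMatrix R χ z)
  rw [← h1, ← h2, Finset.mul_sum, Finset.mul_sum, ← Finset.sum_add_distrib]
  cases b
  · rw [← (Equiv.prodComm _ _).sum_comp]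
    refine Finset.sum_congr rfl fun x _ => ?_
    simp only [Equiv.prodComm_apply]
    rw [orientedTensor_swap, unorientedTensor_swap]
    simp
    ring
  · refine Finset.sum_congr rfl fun x _ => ?_
    simp
    ring

end LoopPolynomial

/-! ### Reversing a part of a word -/

section Twist

open Matrix Polynomial

variable {ι : Type*} [Fintype ι] [DecidableEq ι] {R : Type*} [CommRing R] {k : ℕ}

/-- Exactly one of the two passages through `c` lies in `y`. -/
def OddIn (y : List (ι × Bool)) (c : ι) : Prop := ¬((c, true) ∈ y ↔ (c, false) ∈ y)

instance (y : List (ι × Bool)) (c : ι) : Decidable (OddIn y c) := by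
  unfold OddIn; infer_instance

lemma oddIn_iff {y : List (ι × Bool)} {c : ι} (b : Bool) :
    OddIn y c ↔ ¬((c, b) ∈ y ↔ (c, !b) ∈ y) := by
  unfold OddIn
  cases b
  · exact not_congr iff_comm
  · rfl

/-- The effect on the marks of reversing the direction of `y`: the direction in which a crossing
is traversed by the other strand changes if exactly one of its passages lies in `y`. -/
def flipMark (y : List (ι × Bool)) (l : ι × Bool) : ι × Bool :=
  if OddIn y l.1 then (l.1, !l.2) else l

/-- The word obtained from `y ++ z` by running through `y` in the reverse direction. -/
def twistWord (y z : List (ι × Bool)) : List (ι × Bool) := (y.reverse ++ z).map (flipMark y)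

@[simp] lemma flipMark_fst (y : List (ι × Bool)) (l : ι × Bool) : (flipMark y l).1 = l.1 := by
  unfold flipMark
  split_ifs <;> rfl

lemma flipMark_flipMark (y : List (ι × Bool)) (l : ι × Bool) :
    flipMark y (flipMark y l) = l := by
  unfold flipMark
  split_ifs <;> simp_all

lemma flipMark_not (y : List (ι × Bool)) (l : ι × Bool) :
    flipMark y (l.1, !l.2) = ((flipMark y l).1, !(flipMark y l).2) := by
  unfold flipMark
  split_ifs <;> simp_all

lemma flipMark_injective (y : List (ι × Bool)) : Function.Injective (flipMark y) :=
  Function.LeftInverse.injective (flipMark_flipMark y)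

lemma PairedWord.twist {y z : List (ι × Bool)} (h : PairedWord (y ++ z)) :
    PairedWord (twistWord y z) := by
  have hp : (y ++ z).Perm (y.reverse ++ z) := (List.reverse_perm y).symm.append_right z
  have h2 := h.of_perm hp
  refine ⟨h2.1.map (flipMark_injective y), fun l hl => ?_⟩
  obtain ⟨l', hl', rfl⟩ := List.mem_map.1 hl
  rw [← flipMark_not]
  exact List.mem_map_of_mem (h2.2 _ hl')

lemma labels_twistWord (y z : List (ι × Bool)) : labels (twistWord y z) = labels (y ++ z) := by
  have hp : (y ++ z).Perm (y.reverse ++ z) := (List.reverse_perm y).symm.append_right z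
  rw [labels_perm hp, twistWord, labels, List.map_map, labels]
  congr 2
  funext l
  simp

/-- The coefficients after reversing `y`: smoothings that respect the orientation and those that
do not change their roles. -/
def twistCoeff {A : Type*} (y : List (ι × Bool)) (α β : ι → A) (c : ι) : A :=
  if OddIn y c then β c else α c

/-- The change of colours that transposes the matrices along `y` and exchanges marks. -/
def twistLegs (k : ℕ) (y : List (ι × Bool)) (c : ι) : Legs k ≃ Legs k :=
  (Equiv.prodCongr (if (c, true) ∈ y then Equiv.prodComm _ _ else Equiv.refl _)
    (if (c, false) ∈ y then Equiv.prodComm _ _ else Equiv.refl _)).trans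
    (if OddIn y c then Equiv.prodComm _ _ else Equiv.refl _)

lemma chordWeight_twistLegs [NeZero k] (y : List (ι × Bool)) (α β : ι → R) (L : Finset ι) (c : ι)
    (x : Legs k) :
    chordWeight (twistCoeff y α β) (twistCoeff y β α) L c (twistLegs k y c x) =
      chordWeight α β L c x := by
  rcases x with ⟨⟨x1, x2⟩, ⟨x3, x4⟩⟩
  by_cases hL : c ∈ L <;> by_cases ht : (c, true) ∈ y <;> by_cases hf : (c, false) ∈ y <;>
    simp [chordWeight, twistLegs, twistCoeff, OddIn, hL, ht, hf, orientedTensor, unorientedTensor,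
      idleTensor, eq_comm, and_comm, add_comm, Prod.ext_iff]

lemma letterMatrix_twistLegs (y : List (ι × Bool)) (χ : ι → Legs k) (l : ι × Bool) :
    letterMatrix R (fun c => twistLegs k y c (χ c)) (flipMark y l) =
      if l ∈ y then (letterMatrix R χ l)ᵀ else letterMatrix R χ l := by
  rcases l with ⟨c, b⟩
  by_cases ht : (c, true) ∈ y <;> by_cases hf : (c, false) ∈ y <;> cases b <;>
    simp [letterMatrix, flipMark, twistLegs, OddIn, ht, hf]

/-- The state sum of a word with a part traversed backwards. -/
lemma tensorAvg_transpose [NeZero k] (α β : ι → R) (L : Finset ι) {y z : List (ι × Bool)}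
    (hyz : ∀ l ∈ z, l ∉ y) :
    tensorAvg (k := k) (chordWeight α β L) (fun χ =>
        ((wordMatrix R χ y)ᵀ * wordMatrix R χ z).trace) =
      stateTrace (k := k) (chordWeight (twistCoeff y α β) (twistCoeff y β α) L)
        (twistWord y z) := by
  unfold stateTrace tensorAvg
  symm
  rw [← (Equiv.piCongrRight fun c => twistLegs k y c).sum_comp]
  refine Finset.sum_congr rfl fun χ _ => ?_
  have h1 : ((Equiv.piCongrRight fun c => twistLegs k y c) χ) =
      fun c => twistLegs k y c (χ c) := rfl
  rw [h1]
  simp only [chordWeight_twistLegs]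
  congr 2
  symm
  have h2 : wordMatrix R (fun c => twistLegs k y c (χ c)) (twistWord y z) =
      (y.reverse.map ((letterMatrix R fun c => twistLegs k y c (χ c)) ∘ flipMark y)).prod *
        (z.map ((letterMatrix R fun c => twistLegs k y c (χ c)) ∘ flipMark y)).prod := by
    simp [wordMatrix, twistWord]
  rw [h2]
  congr 1
  · rw [wordMatrix, Matrix.transpose_list_prod, List.map_map, List.map_reverse]
    congr 2
    refine List.map_congr_left fun l hl => ?_
    simp [letterMatrix_twistLegs, hl]
  · rw [wordMatrix]
    congr 1
    refine List.map_congr_left fun l hl => ?_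
    simp [letterMatrix_twistLegs, hyz l hl]

lemma PairedWord.disjoint {y z : List (ι × Bool)} (h : PairedWord (y ++ z)) :
    ∀ l ∈ z, l ∉ y := fun _ hl hly => (List.nodup_append.1 h.1).2.2 _ hly _ hl rfl

/-! ### Relations between loop polynomials -/

lemma stateTrace_rotate (wt : ι → Legs k → R) (u v : List (ι × Bool)) :
    stateTrace wt (u ++ v) = stateTrace wt (v ++ u) := by
  refine tensorAvg_congr _ fun χ => ?_
  rw [wordMatrix_append, wordMatrix_append, Matrix.trace_mul_comm]

lemma loopPoly_rotate (α β : ι → ℤ) {u v : List (ι × Bool)} (h : PairedWord (u ++ v)) :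
    loopPoly α β (u ++ v) = loopPoly α β (v ++ u) := by
  refine polynomial_eq_of_eval_nat fun k hk => ?_
  have : NeZero k := ⟨hk⟩
  have hp : (u ++ v).Perm (v ++ u) := List.perm_append_comm
  rw [eval_loopPoly _ _ h, eval_loopPoly _ _ (h.of_perm hp), stateTrace_rotate, labels_perm hp]

lemma loopPoly_congr {A : Type*} [CommRing A] {α β α' β' : ι → A} {w : List (ι × Bool)}
    (h : ∀ c ∈ labels w, α c = α' c ∧ β c = β' c) : loopPoly α β w = loopPoly α' β' w := by
  unfold loopPoly
  refine Finset.sum_congr rfl fun T hT => ?_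
  rw [Finset.mem_powerset] at hT
  congr 3
  · exact Finset.prod_congr rfl fun c hc => (h c (hT hc)).1
  · exact Finset.prod_congr rfl fun c hc => (h c (Finset.mem_sdiff.1 hc).1).2

lemma chordWeight_congr [NeZero k] {α β α' β' : ι → R} {L : Finset ι}
    (h : ∀ c ∈ L, α c = α' c ∧ β c = β' c) :
    chordWeight (k := k) α β L = chordWeight α' β' L := by
  funext c x
  unfold chordWeight
  split_ifs with hc
  · rw [(h c hc).1, (h c hc).2]
  · rfl

/-- The loop polynomial in terms of the smoothings of one crossing. -/
lemma loopPoly_resolve (α β : ι → ℤ) {c : ι} {b : Bool} {y z : List (ι × Bool)}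
    (h : PairedWord ((c, b) :: y ++ (c, !b) :: z)) :
    loopPoly α β ((c, b) :: y ++ (c, !b) :: z) =
      C (α c) * loopPoly (Function.update α c 1) (Function.update β c 0)
          ((c, b) :: y ++ (c, !b) :: z) +
        C (β c) * loopPoly (twistCoeff y α β) (twistCoeff y β α) (twistWord y z) := by
  refine polynomial_eq_of_eval_nat fun k hk => ?_
  have : NeZero k := ⟨hk⟩
  have hr := h.remove
  rw [eval_add, eval_mul, eval_mul, eval_C, eval_C, eval_loopPoly _ _ h, eval_loopPoly _ _ h,
    eval_loopPoly _ _ hr.1.twist, stateTrace_resolve _ _ h, stateTrace_resolve _ _ h,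
    labels_twistWord, ← tensorAvg_transpose _ _ _ hr.1.disjoint, ← tensorAvg_smul,
    ← tensorAvg_smul]
  have hc : chordWeight (k := k) (Function.update α c 1) (Function.update β c 0) (labels (y ++ z)) =
      chordWeight α β (labels (y ++ z)) := by
    refine chordWeight_congr fun d hd => ?_
    have : d ≠ c := by
      rintro rfl
      exact notMem_labels hr.2 hd
    simp [this]
  rw [hc, ← tensorAvg_add]
  refine tensorAvg_congr _ fun χ => ?_
  simp

/-- A kink. -/
lemma loopPoly_kink (α β : ι → ℤ) {c : ι} {b : Bool} {z : List (ι × Bool)}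
    (h : PairedWord ((c, b) :: (c, !b) :: z)) :
    loopPoly α β ((c, b) :: (c, !b) :: z) = (C (α c) * X + C (β c)) * loopPoly α β z := by
  refine polynomial_eq_of_eval_nat fun k hk => ?_
  have : NeZero k := ⟨hk⟩
  have h' : PairedWord ((c, b) :: [] ++ (c, !b) :: z) := h
  have hr := h'.remove
  rw [eval_mul, eval_loopPoly _ _ (w := z) hr.1, eval_loopPoly _ _ h]
  have := stateTrace_resolve (k := k) α β h'
  simp only [List.cons_append, List.nil_append] at this
  rw [this, eval_add, eval_mul, eval_C, eval_X, eval_C, stateTrace,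
    ← tensorAvg_smul]
  refine tensorAvg_congr _ fun χ => ?_
  simp
  ring

/-- Two linked crossings, the first of which is smoothed with the orientation. -/
lemma loopPoly_linked (α β : ι → ℤ) {c p : ι} {b b' : Bool} {y z u v : List (ι × Bool)}
    (h : PairedWord ((c, b) :: (y ++ (p, b') :: z) ++ (c, !b) :: (u ++ (p, !b') :: v)))
    (hα : α c = 1) (hβ : β c = 0) :
    loopPoly α β ((c, b) :: (y ++ (p, b') :: z) ++ (c, !b) :: (u ++ (p, !b') :: v)) =
      C (α p) * loopPoly α β ((z ++ y) ++ (v ++ u)) +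
        C (β p) * loopPoly (twistCoeff (z ++ y) α β) (twistCoeff (z ++ y) β α)
          (twistWord (z ++ y) (v ++ u)) := by
  refine polynomial_eq_of_eval_nat fun k hk => ?_
  have : NeZero k := ⟨hk⟩
  have hr := h.remove
  have hp1 : ((y ++ (p, b') :: z) ++ (u ++ (p, !b') :: v)).Perm
      ((p, b') :: (z ++ y) ++ (p, !b') :: (v ++ u)) := by
    refine List.Perm.append ?_ ?_
    · exact List.perm_append_comm
    · exact List.perm_append_comm
  have hr1 := hr.1.of_perm hp1
  have hr2 := hr1.remove
  rw [eval_add, eval_mul, eval_mul, eval_C, eval_C, eval_loopPoly _ _ h, stateTrace_resolve _ _ h,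
    eval_loopPoly _ _ hr2.1, eval_loopPoly _ _ hr2.1.twist, labels_twistWord,
    ← tensorAvg_transpose _ _ _ hr2.1.disjoint, stateTrace, ← tensorAvg_smul, ← tensorAvg_smul,
    ← tensorAvg_add, ← tensorAvg_merge _ _ hr1, labels_perm hp1]
  refine tensorAvg_congr _ fun χ => ?_
  simp only [hα, hβ, one_mul, zero_mul, add_zero, wordMatrix_append, wordMatrix_cons]
  rw [Matrix.trace_mul_comm (wordMatrix ℤ χ y), Matrix.trace_mul_comm (wordMatrix ℤ χ u)]
  simp only [mul_assoc]

end Twist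

/-! ### Positions, linked crossings -/

section Positions

open Polynomial

variable {ι : Type*} [Fintype ι] [DecidableEq ι]

lemma idxOf_reverse_of_mem {α : Type*} [BEq α] [LawfulBEq α] {y : List α} (hy : y.Nodup) {l : α}
    (h : l ∈ y) : y.reverse.idxOf l + y.idxOf l + 1 = y.length := by
  induction y with
  | nil => simp at h
  | cons a y ih =>
    rw [List.nodup_cons] at hy
    rw [List.reverse_cons]
    by_cases hl : l = a
    · subst hl
      rw [List.idxOf_append_of_notMem (by simpa using hy.1)]
      simp
    · have h2 : l ∈ y := by simpa [hl] using h
      rw [List.idxOf_append_of_mem (by simpa using h2), List.idxOf_cons_ne _ (Ne.symm hl)]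
      have := ih hy.2 h2
      simp only [List.length_cons]
      omega

lemma idxOf_map_of_injective {α : Type*} [BEq α] [LawfulBEq α] {f : α → α}
    (hf : Function.Injective f) (w : List α) (l : α) : (w.map f).idxOf (f l) = w.idxOf l := by
  induction w with
  | nil => simp
  | cons a w ih =>
    by_cases h : a = l
    · subst h; simp
    · rw [List.map_cons, List.idxOf_cons_ne _ (fun e => h (hf e)), List.idxOf_cons_ne _ h, ih]

lemma idxOf_inj_of_mem {w : List (ι × Bool)} {l l' : ι × Bool} (h : l ∈ w)
    (he : w.idxOf l = w.idxOf l') : l = l' := (List.idxOf_inj h).1 he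

lemma PairedWord.exists_split {w : List (ι × Bool)} (hw : PairedWord w) {c : ι}
    (hc : c ∈ labels w) : ∃ x b y z, w = x ++ ((c, b) :: y ++ (c, !b) :: z) := by
  have ht := (hw.mem_labels true).1 hc
  have hf := (hw.mem_labels false).1 hc
  obtain ⟨x, z, rfl⟩ := List.append_of_mem ht
  simp only [List.mem_append, List.mem_cons, Prod.mk.injEq, true_and, Bool.false_eq_true,
    false_or] at hf
  rcases hf with hf | hf
  · obtain ⟨x1, x2, rfl⟩ := List.append_of_mem hf
    exact ⟨x1, false, x2, z, by simp⟩
  · obtain ⟨z1, z2, rfl⟩ := List.append_of_mem hf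
    exact ⟨x, true, z1, z2, by simp⟩

/-- Every nonempty paired word contains a crossing without crossings inside. -/
lemma PairedWord.exists_innermost {w : List (ι × Bool)} (hw : PairedWord w) (hne : w ≠ []) :
    ∃ x c b y z, w = x ++ ((c, b) :: y ++ (c, !b) :: z) ∧ ∀ l ∈ y, (l.1, !l.2) ∉ y := by
  classical
  have hex : ∃ n x c b y z, w = x ++ ((c, b) :: y ++ (c, !b) :: z) ∧ y.length = n := by
    obtain ⟨l, hl⟩ := List.exists_mem_of_ne_nil w hne
    obtain ⟨x, b, y, z, h⟩ := hw.exists_split (mem_labels_of_mem hl)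
    exact ⟨_, x, l.1, b, y, z, h, rfl⟩
  obtain ⟨x, c, b, y, z, h, hn⟩ := Nat.find_spec hex
  refine ⟨x, c, b, y, z, h, fun l hl hl' => ?_⟩
  have key : ∃ b' y1 y2 y3, y = y1 ++ ((l.1, b') :: y2 ++ (l.1, !b') :: y3) := by
    obtain ⟨y1, y2, rfl⟩ := List.append_of_mem hl
    simp only [List.mem_append, List.mem_cons] at hl'
    rcases hl' with h1 | h1 | h1
    · obtain ⟨y3, y4, rfl⟩ := List.append_of_mem h1
      exact ⟨!l.2, y3, y4, y2, by simp⟩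
    · simp [Prod.ext_iff] at h1
    · obtain ⟨y3, y4, rfl⟩ := List.append_of_mem h1
      exact ⟨l.2, y1, y3, y4, by simp⟩
  obtain ⟨b', y1, y2, y3, hy⟩ := key
  refine Nat.find_min hex (m := y2.length) ?_ ⟨x ++ (c, b) :: y1, l.1, b', y2,
    y3 ++ (c, !b) :: z, ?_, rfl⟩
  · rw [← hn, hy]
    simp
    omega
  · rw [h, hy]
    simp

/-- The relative order of two passages: `1` if `m` comes before `l`. -/
def orderSign (w : List (ι × Bool)) (l m : ι × Bool) : ℤ :=
  if w.idxOf m < w.idxOf l then 1 else if w.idxOf l < w.idxOf m then -1 else 0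

@[simp] lemma orderSign_self (w : List (ι × Bool)) (l : ι × Bool) : orderSign w l l = 0 := by
  simp [orderSign]

lemma orderSign_comm (w : List (ι × Bool)) (l m : ι × Bool) :
    orderSign w l m = -orderSign w m l := by
  unfold orderSign
  split_ifs <;> omega

lemma orderSign_cases {w : List (ι × Bool)} {l m : ι × Bool} (hl : l ∈ w) (h : l ≠ m) :
    orderSign w l m = 1 ∨ orderSign w l m = -1 := by
  have := mt (idxOf_inj_of_mem hl) h
  unfold orderSign
  split_ifs <;> omega

lemma orderSign_append_left {u v : List (ι × Bool)} {l m : ι × Bool} (hl : l ∈ u) (hm : m ∈ u) :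
    orderSign (u ++ v) l m = orderSign u l m := by
  unfold orderSign
  rw [List.idxOf_append_of_mem hl, List.idxOf_append_of_mem hm]

lemma orderSign_append_right {u v : List (ι × Bool)} {l m : ι × Bool} (hl : l ∉ u) (hm : m ∉ u) :
    orderSign (u ++ v) l m = orderSign v l m := by
  unfold orderSign
  rw [List.idxOf_append_of_notMem hl, List.idxOf_append_of_notMem hm]
  simp

lemma orderSign_append_lt {u v : List (ι × Bool)} {l m : ι × Bool} (hl : l ∈ u) (hm : m ∉ u) :
    orderSign (u ++ v) l m = -1 := by
  have := List.idxOf_lt_length_of_mem hl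
  unfold orderSign
  rw [List.idxOf_append_of_mem hl, List.idxOf_append_of_notMem hm]
  split_ifs <;> omega

lemma orderSign_append_gt {u v : List (ι × Bool)} {l m : ι × Bool} (hl : l ∉ u) (hm : m ∈ u) :
    orderSign (u ++ v) l m = 1 := by
  rw [orderSign_comm, orderSign_append_lt hm hl, neg_neg]

lemma orderSign_cons {u : List (ι × Bool)} {a l m : ι × Bool} (hl : l ≠ a) (hm : m ≠ a) :
    orderSign (a :: u) l m = orderSign u l m := by
  unfold orderSign
  rw [List.idxOf_cons_ne _ hl.symm, List.idxOf_cons_ne _ hm.symm]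
  simp

lemma orderSign_cons_lt {u : List (ι × Bool)} {a m : ι × Bool} (hm : m ≠ a) :
    orderSign (a :: u) a m = -1 := by
  unfold orderSign
  rw [List.idxOf_cons_ne _ hm.symm]
  simp

lemma orderSign_cons_gt {u : List (ι × Bool)} {a l : ι × Bool} (hl : l ≠ a) :
    orderSign (a :: u) l a = 1 := by
  rw [orderSign_comm, orderSign_cons_lt hl, neg_neg]

lemma orderSign_reverse {y : List (ι × Bool)} (hy : y.Nodup) {l m : ι × Bool} (hl : l ∈ y)
    (hm : m ∈ y) : orderSign y.reverse l m = -orderSign y l m := by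
  have h1 := idxOf_reverse_of_mem hy hl
  have h2 := idxOf_reverse_of_mem hy hm
  unfold orderSign
  split_ifs <;> omega

lemma orderSign_map {f : ι × Bool → ι × Bool} (hf : Function.Injective f) (w : List (ι × Bool))
    (l m : ι × Bool) : orderSign (w.map f) (f l) (f m) = orderSign w l m := by
  unfold orderSign
  rw [idxOf_map_of_injective hf, idxOf_map_of_injective hf]

/-- The indicator function of the passages in `u`. -/
def inWord (u : List (ι × Bool)) (l : ι × Bool) : ℤ := if l ∈ u then 1 else 0

lemma orderSign_rotate {u v : List (ι × Bool)} (h : PairedWord (u ++ v)) {l m : ι × Bool}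
    (hl : l ∈ u ++ v) (hm : m ∈ u ++ v) :
    orderSign (v ++ u) l m = orderSign (u ++ v) l m + 2 * (inWord u l - inWord u m) := by
  have hd := h.disjoint
  rw [List.mem_append] at hl hm
  unfold inWord
  by_cases h1 : l ∈ u <;> by_cases h2 : m ∈ u
  · have h1' : l ∉ v := fun h => hd _ h h1
    have h2' : m ∉ v := fun h => hd _ h h2
    rw [orderSign_append_right h1' h2', orderSign_append_left h1 h2]
    simp [h1, h2]
  · have h1' : l ∉ v := fun h => hd _ h h1
    have h2' : m ∈ v := by tauto
    rw [orderSign_append_gt h1' h2', orderSign_append_lt h1 h2]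
    simp [h1, h2]
  · have h1' : l ∈ v := by tauto
    have h2' : m ∉ v := fun h => hd _ h h2
    rw [orderSign_append_lt h1' h2', orderSign_append_gt h1 h2]
    simp [h1, h2]
  · have h1' : l ∈ v := by tauto
    have h2' : m ∈ v := by tauto
    rw [orderSign_append_left h1' h2', orderSign_append_right h1 h2]
    simp [h1, h2]

/-- Twice the indicator function of the part of the knot between the passage `m` and the other
passage through the same crossing, up to sign. At the two passages themselves the value is half of
the value inside. -/
def chordFlow (w : List (ι × Bool)) (m l : ι × Bool) : ℤ :=
  orderSign w l m - orderSign w l (m.1, !m.2)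

lemma chordFlow_not (w : List (ι × Bool)) (m l : ι × Bool) :
    chordFlow w (m.1, !m.2) l = -chordFlow w m l := by
  simp [chordFlow]

/-- Twice the signed linking of two crossings; it vanishes if the crossings are not linked, and
otherwise it is `2` or `-2`. -/
def chordIndex (w : List (ι × Bool)) (c d : ι) : ℤ :=
  chordFlow w (c, true) (d, true) - chordFlow w (c, true) (d, false)

/-- The two crossings are linked: their passages alternate along the knot. -/
def Linked (w : List (ι × Bool)) (c d : ι) : Prop := chordIndex w c d ≠ 0

instance (w : List (ι × Bool)) (c d : ι) : Decidable (Linked w c d) := by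
  unfold Linked; infer_instance

lemma chordIndex_comm (w : List (ι × Bool)) (c d : ι) : chordIndex w c d = -chordIndex w d c := by
  simp only [chordIndex, chordFlow, Bool.not_true, orderSign_comm w (c, _)]
  ring

lemma chordIndex_self (w : List (ι × Bool)) (c : ι) : chordIndex w c c = 0 := by
  have := chordIndex_comm w c c
  omega

lemma linked_comm (w : List (ι × Bool)) (c d : ι) : Linked w c d ↔ Linked w d c := by
  unfold Linked
  rw [chordIndex_comm]
  simp

lemma not_linked_self (w : List (ι × Bool)) (c : ι) : ¬Linked w c c := by
  simp [Linked, chordIndex_self]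

lemma chordFlow_rotate {u v : List (ι × Bool)} (h : PairedWord (u ++ v)) {l m : ι × Bool}
    (hl : l ∈ u ++ v) (hm : m ∈ u ++ v) :
    chordFlow (v ++ u) m l =
      chordFlow (u ++ v) m l - 2 * (inWord u m - inWord u (m.1, !m.2)) := by
  unfold chordFlow
  rw [orderSign_rotate h hl hm, orderSign_rotate h hl (h.2 _ hm)]
  ring

lemma chordIndex_rotate {u v : List (ι × Bool)} (h : PairedWord (u ++ v)) {c d : ι}
    (hc : c ∈ labels (u ++ v)) (hd : d ∈ labels (u ++ v)) :
    chordIndex (v ++ u) c d = chordIndex (u ++ v) c d := by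
  unfold chordIndex
  rw [chordFlow_rotate h ((h.mem_labels _).1 hd) ((h.mem_labels _).1 hc),
    chordFlow_rotate h ((h.mem_labels _).1 hd) ((h.mem_labels _).1 hc)]
  ring

lemma linked_rotate {u v : List (ι × Bool)} (h : PairedWord (u ++ v)) {c d : ι}
    (hc : c ∈ labels (u ++ v)) (hd : d ∈ labels (u ++ v)) :
    Linked (v ++ u) c d ↔ Linked (u ++ v) c d := by
  unfold Linked
  rw [chordIndex_rotate h hc hd]

/-- The flow of a crossing whose first passage is the base point. -/
lemma chordFlow_cons {y z : List (ι × Bool)} {c : ι} {b : Bool}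
    (hw : PairedWord ((c, b) :: y ++ (c, !b) :: z)) {l : ι × Bool} (hl : l ∈ y ++ z) :
    chordFlow ((c, b) :: y ++ (c, !b) :: z) (c, b) l = 2 * inWord y l := by
  obtain ⟨h1, h2⟩ := hw.remove
  have hlc := h2 l hl
  have hd := h1.disjoint
  have hcy : (c, !b) ∉ y := fun h => h2 _ (List.mem_append_left _ h) rfl
  have e1 : ∀ b', l ≠ (c, b') := fun b' h => hlc (by rw [h])
  unfold chordFlow inWord
  rw [List.cons_append, orderSign_cons_gt (e1 _), orderSign_cons (e1 _) (by simp)]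
  by_cases h : l ∈ y
  · rw [orderSign_append_lt h hcy]
    simp [h]
  · rw [orderSign_append_right h hcy, orderSign_cons_gt (e1 _)]
    simp [h]

lemma chordFlow_cons_self {y z : List (ι × Bool)} {c : ι} {b : Bool}
    (hw : PairedWord ((c, b) :: y ++ (c, !b) :: z)) (b' : Bool) :
    chordFlow ((c, b) :: y ++ (c, !b) :: z) (c, b) (c, b') = 1 := by
  have : orderSign ((c, b) :: y ++ (c, !b) :: z) (c, b) (c, !b) = -1 := by
    rw [List.cons_append, orderSign_cons_lt (by simp)]
  unfold chordFlow
  by_cases h : b' = b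
  · subst h
    rw [this]; simp
  · have h : b' = !b := by cases b <;> cases b' <;> simp_all
    subst h
    rw [orderSign_comm, this]; simp

lemma linked_cons_iff {y z : List (ι × Bool)} {c : ι} {b : Bool}
    (hw : PairedWord ((c, b) :: y ++ (c, !b) :: z)) {d : ι} (hd : d ∈ labels (y ++ z)) :
    Linked ((c, b) :: y ++ (c, !b) :: z) c d ↔ OddIn y d := by
  obtain ⟨h1, h2⟩ := hw.remove
  have e : ∀ b', chordFlow ((c, b) :: y ++ (c, !b) :: z) (c, b) (d, b') = 2 * inWord y (d, b') :=
    fun b' => chordFlow_cons hw ((h1.mem_labels _).1 hd)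
  have e2 : chordIndex ((c, b) :: y ++ (c, !b) :: z) c d =
      (if b then 1 else -1) * (2 * inWord y (d, true) - 2 * inWord y (d, false)) := by
    unfold chordIndex
    cases b
    · have := chordFlow_not ((c, false) :: y ++ (c, !false) :: z) (c, false)
      simp only [Bool.not_false] at this
      simp only [Bool.not_false] at e
      rw [Bool.not_false, this, this, e, e]
      simp only [Bool.false_eq_true, if_false]
      ring
    · rw [e, e]
      simp
  unfold Linked OddIn
  rw [e2]
  unfold inWord
  split_ifs <;> simp_all

end Positions

/-! ### Values of loop polynomials at `-2` -/

section Values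

open Polynomial

variable {ι : Type*} [Fintype ι] [DecidableEq ι]

lemma PairedWord.exists_rotate {w : List (ι × Bool)} (hw : PairedWord w) {c : ι}
    (hc : c ∈ labels w) :
    ∃ x t b y z, w = x ++ t ∧ t ++ x = (c, b) :: y ++ (c, !b) :: z := by
  obtain ⟨x, b, y, z, h⟩ := hw.exists_split hc
  exact ⟨x, _, b, y, z ++ x, h, by simp⟩

lemma PairedWord.rotate {u v : List (ι × Bool)} (h : PairedWord (u ++ v)) : PairedWord (v ++ u) :=
  h.of_perm List.perm_append_comm

/-- After a change of the base point, a nonempty paired word begins with a crossing without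
crossings inside: a kink, or a crossing which is linked with the next one. -/
lemma PairedWord.exists_normal_form {w : List (ι × Bool)} (hw : PairedWord w) (hne : w ≠ []) :
    ∃ x t c b, w = x ++ t ∧ ((∃ z, t ++ x = (c, b) :: (c, !b) :: z) ∨
      ∃ p b' z u v, t ++ x = (c, b) :: ((p, b') :: z) ++ (c, !b) :: (u ++ (p, !b') :: v) ∧
        ∀ l ∈ (p, b') :: z, (l.1, !l.2) ∉ (p, b') :: z) := by
  obtain ⟨x, c, b, y, z, rfl, hy⟩ := hw.exists_innermost hne
  refine ⟨x, _, c, b, rfl, ?_⟩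
  have hw2 := hw.rotate
  have e : (c, b) :: y ++ (c, !b) :: z ++ x = (c, b) :: y ++ (c, !b) :: (z ++ x) := by simp
  rw [e] at hw2 ⊢
  rcases y with _ | ⟨⟨p, b'⟩, y⟩
  · left
    exact ⟨z ++ x, by simp⟩
  · right
    obtain ⟨h1, h2⟩ := hw2.remove
    have h3 : (p, !b') ∈ z ++ x := by
      have h4 := h1.2 (p, b') (by simp)
      rcases List.mem_append.1 h4 with h5 | h5
      · exact absurd h5 (hy _ (by simp))
      · exact h5
    obtain ⟨u, v, huv⟩ := List.append_of_mem h3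
    exact ⟨p, b', y, u, v, by rw [huv], hy⟩

lemma orderSign_remove {y z : List (ι × Bool)} {c : ι} {b : Bool} {l m : ι × Bool}
    (hl : l.1 ≠ c) (hm : m.1 ≠ c) :
    orderSign ((c, b) :: y ++ (c, !b) :: z) l m = orderSign (y ++ z) l m := by
  have n1 : ∀ b', l ≠ (c, b') := fun b' h => hl (by rw [h])
  have n2 : ∀ b', m ≠ (c, b') := fun b' h => hm (by rw [h])
  rw [List.cons_append, orderSign_cons (n1 _) (n2 _)]
  by_cases i1 : l ∈ y <;> by_cases i2 : m ∈ y
  · rw [orderSign_append_left i1 i2, orderSign_append_left i1 i2]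
  · rw [orderSign_append_lt i1 i2, orderSign_append_lt i1 i2]
  · rw [orderSign_append_gt i1 i2, orderSign_append_gt i1 i2]
  · rw [orderSign_append_right i1 i2, orderSign_append_right i1 i2, orderSign_cons (n1 _) (n2 _)]

/-- The order of two passages after running through `y` in the reverse direction. -/
lemma orderSign_twistWord {y z : List (ι × Bool)} (h : PairedWord (y ++ z)) (l m : ι × Bool) :
    orderSign (twistWord y z) (flipMark y l) (flipMark y m) =
      orderSign (y ++ z) l m * (1 - 2 * inWord y l * inWord y m) := by
  rw [twistWord, orderSign_map (flipMark_injective y)]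
  unfold inWord
  by_cases h1 : l ∈ y <;> by_cases h2 : m ∈ y
  · rw [orderSign_append_left (by simpa) (by simpa), orderSign_append_left h1 h2,
      orderSign_reverse (List.nodup_append.1 h.1).1 h1 h2]
    simp [h1, h2]
  · rw [orderSign_append_lt (by simpa) (by simpa), orderSign_append_lt h1 h2]
    simp [h1, h2]
  · rw [orderSign_append_gt (by simpa) (by simpa), orderSign_append_gt h1 h2]
    simp [h1, h2]
  · rw [orderSign_append_right (by simpa) (by simpa), orderSign_append_right h1 h2]
    simp [h1, h2]

lemma inWord_eq (y : List (ι × Bool)) (l : ι × Bool) : inWord y l = 0 ∨ inWord y l = 1 := by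
  unfold inWord; split_ifs <;> simp

lemma oddIn_iff_inWord {y : List (ι × Bool)} {c : ι} (b : Bool) :
    OddIn y c ↔ inWord y (c, b) + inWord y (c, !b) = 1 := by
  rw [oddIn_iff b]
  unfold inWord
  split_ifs <;> simp_all

/-- The index of two crossings, computed from one passage through each of them. -/
def passageIndex (w : List (ι × Bool)) (m n : ι × Bool) : ℤ :=
  chordFlow w m n - chordFlow w m (n.1, !n.2)

lemma linked_iff_passageIndex (w : List (ι × Bool)) (m n : ι × Bool) :
    Linked w m.1 n.1 ↔ passageIndex w m n ≠ 0 := by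
  obtain ⟨c, b⟩ := m
  obtain ⟨d, b'⟩ := n
  unfold Linked chordIndex passageIndex chordFlow
  cases b <;> cases b' <;> simp only [Bool.not_true, Bool.not_false, ne_eq] <;> omega

lemma linked_append_facts {y z : List (ι × Bool)} {l m : ι × Bool} :
    (inWord y l = 0 → inWord y m = 1 → orderSign (y ++ z) l m = 1) ∧
    (inWord y l = 1 → inWord y m = 0 → orderSign (y ++ z) l m = -1) := by
  unfold inWord
  constructor
  · intro h1 h2
    exact orderSign_append_gt (by simpa using h1) (by simpa using h2)
  · intro h1 h2
    exact orderSign_append_lt (by simpa using h1) (by simpa using h2)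

lemma linked_twistWord {y z : List (ι × Bool)} (h : PairedWord (y ++ z)) {c d : ι}
    (hd : d ∈ labels (y ++ z)) (hcd : c ≠ d) :
    Linked (twistWord y z) c d ↔ (Linked (y ++ z) c d ↔ ¬(OddIn y c ∧ OddIn y d)) := by
  have e1 := linked_iff_passageIndex (twistWord y z) (flipMark y (c, true)) (flipMark y (d, true))
  simp only [flipMark_fst] at e1
  have e2 := linked_iff_passageIndex (y ++ z) (c, true) (d, true)
  simp only at e2
  have o := fun b b' => orderSign_twistWord h (d, b) (c, b')
  rw [e1, e2, oddIn_iff_inWord true, oddIn_iff_inWord true]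
  unfold passageIndex chordFlow
  rw [← flipMark_not, ← flipMark_not]
  simp only [o, Bool.not_true]
  have q := fun b b' => @linked_append_facts ι _ _ y z (d, b) (c, b')
  have r : ∀ b b', orderSign (y ++ z) (d, b) (c, b') = 1 ∨ orderSign (y ++ z) (d, b) (c, b') = -1 :=
    fun b b' => orderSign_cases ((h.mem_labels b).1 hd) (fun e => hcd (Prod.ext_iff.1 e).1.symm)
  have q1 := q true true
  have q2 := q true false
  have q3 := q false true
  have q4 := q false false
  have r1 := r true true
  have r2 := r true false
  have r3 := r false true
  have r4 := r false false
  clear e1 e2 o q r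
  generalize orderSign (y ++ z) (d, true) (c, true) = x1 at *
  generalize orderSign (y ++ z) (d, true) (c, false) = x2 at *
  generalize orderSign (y ++ z) (d, false) (c, true) = x3 at *
  generalize orderSign (y ++ z) (d, false) (c, false) = x4 at *
  rcases inWord_eq y (c, true) with h1 | h1 <;> rcases inWord_eq y (c, false) with h2 | h2 <;>
    rcases inWord_eq y (d, true) with h3 | h3 <;> rcases inWord_eq y (d, false) with h4 | h4 <;>
    simp only [h1, h2, h3, h4] at q1 q2 q3 q4 ⊢ <;> clear h1 h2 h3 h4 <;>
    rcases r1 with rfl | rfl <;> rcases r2 with rfl | rfl <;> rcases r3 with rfl | rfl <;>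
    rcases r4 with rfl | rfl <;> simp at q1 q2 q3 q4 ⊢

/-- The sum over all smoothings, each with the sign `(-1) ^ n`, of `X` to the number of circles. -/
noncomputable def signedLoopPoly (w : List (ι × Bool)) : ℤ[X] :=
  loopPoly (fun _ => -1) (fun _ => -1) w

lemma signedLoopPoly_nil : signedLoopPoly ([] : List (ι × Bool)) = X := by
  have : loopNumber ([] : List (ι × Bool)).get ∅ = 1 := by
    unfold loopNumber
    rw [Nat.card_eq_one_iff_unique]
    refine ⟨⟨fun a b => ?_⟩, ⟨Quot.mk _ 0⟩⟩
    induction a using Quot.ind with | _ a => ?_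
    induction b using Quot.ind with | _ b => ?_
    have : a = b := Fin.ext (by have := a.2; have := b.2; simp at *)
    rw [this]
  simp [signedLoopPoly, loopPoly, labels, this]

lemma signedLoopPoly_rotate {u v : List (ι × Bool)} (h : PairedWord (u ++ v)) :
    signedLoopPoly (u ++ v) = signedLoopPoly (v ++ u) := loopPoly_rotate _ _ h

lemma signedLoopPoly_kink {c : ι} {b : Bool} {z : List (ι × Bool)}
    (h : PairedWord ((c, b) :: (c, !b) :: z)) :
    signedLoopPoly ((c, b) :: (c, !b) :: z) = -(X + 1) * signedLoopPoly z := by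
  unfold signedLoopPoly
  rw [loopPoly_kink _ _ h]
  simp only [map_neg, map_one]
  ring

lemma signedLoopPoly_linked {c p : ι} {b b' : Bool} {z u v : List (ι × Bool)}
    (h : PairedWord ((c, b) :: ((p, b') :: z) ++ (c, !b) :: (u ++ (p, !b') :: v))) :
    signedLoopPoly ((c, b) :: ((p, b') :: z) ++ (c, !b) :: (u ++ (p, !b') :: v)) =
      signedLoopPoly (z ++ (v ++ u)) + signedLoopPoly (twistWord z (v ++ u)) -
        signedLoopPoly (twistWord ((p, b') :: z) (u ++ (p, !b') :: v)) := by
  have hr := h.remove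
  have hcz : c ∉ labels (z ++ (v ++ u)) := notMem_labels fun l hl => hr.2 l (by
    simp only [List.mem_append, List.mem_cons] at hl ⊢; tauto)
  have hpc : p ≠ c := hr.2 (p, b') (by simp)
  have e := loopPoly_linked (y := []) (z := z) (u := u) (v := v) (c := c) (p := p) (b := b)
    (b' := b') (Function.update (fun _ => (-1 : ℤ)) c 1) (Function.update (fun _ => (-1 : ℤ)) c 0)
    (by simpa using h) (by simp) (by simp)
  simp only [List.nil_append, List.append_nil] at e
  unfold signedLoopPoly
  rw [loopPoly_resolve _ _ h, e, Function.update_of_ne hpc, Function.update_of_ne hpc,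
    loopPoly_congr (α' := fun _ => -1) (β' := fun _ => -1) (w := z ++ (v ++ u)),
    loopPoly_congr (α' := fun _ => -1) (β' := fun _ => -1) (w := twistWord z (v ++ u)),
    loopPoly_congr (α' := fun _ => -1) (β' := fun _ => -1) (w := twistWord ((p, b') :: z) _)]
  · simp only [map_neg, map_one]
    ring
  · intro d _
    simp [twistCoeff]
  · intro d hd
    rw [labels_twistWord] at hd
    have : d ≠ c := fun h => hcz (h ▸ hd)
    simp [twistCoeff, Function.update_of_ne this]
  · intro d hd
    have : d ≠ c := fun h => hcz (h ▸ hd)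
    simp [Function.update_of_ne this]

theorem eval_signedLoopPoly {w : List (ι × Bool)} (hw : PairedWord w) :
    (signedLoopPoly w).eval (-2) = -2 := by
  induction hn : w.length using Nat.strong_induction_on generalizing w with
  | _ n ih =>
    by_cases hne : w = []
    · rw [hne, signedLoopPoly_nil]; simp
    obtain ⟨x, t, c, b, rfl, h⟩ := hw.exists_normal_form hne
    have hlen : (t ++ x).length = n := by rw [← hn]; simp [add_comm]
    rw [signedLoopPoly_rotate hw]
    have hw := hw.rotate
    rcases h with ⟨z, h⟩ | ⟨p, b', z, u, v, h, -⟩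
    · rw [h] at hw hlen ⊢
      have hr : PairedWord z := (PairedWord.remove (y := []) hw).1
      rw [signedLoopPoly_kink hw, eval_mul, ih _ (by simp at hlen ⊢; omega) hr rfl]
      simp
    · rw [h] at hw hlen ⊢
      have hr := hw.remove.1
      have hr2 : PairedWord (z ++ (v ++ u)) := by
        have : PairedWord ((p, b') :: (z ++ u) ++ (p, !b') :: v) := by simpa using hr
        exact this.remove.1.of_perm (by
          rw [List.append_assoc]; exact List.Perm.append_left _ List.perm_append_comm)
      simp at hlen
      rw [signedLoopPoly_linked hw, eval_sub, eval_add,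
        ih _ (by simp; omega) hr2 rfl,
        ih _ (by simp [twistWord]; omega) hr2.twist rfl,
        ih _ (by simp [twistWord]; omega) hr.twist rfl]
      norm_num

/-- The weight of the oriented smoothing of a crossing of which nothing is prescribed (`none`) or
which is smoothed with (`some true`) or against (`some false`) the orientation. -/
def orientedCoeff (s : ι → Option Bool) (c : ι) : ℤ :=
  match s c with
  | none => -1
  | some true => 1
  | some false => 0

/-- The weight of the unoriented smoothing, as for `orientedCoeff`. -/
def unorientedCoeff (s : ι → Option Bool) (c : ι) : ℤ :=
  match s c with
  | none => -1
  | some true => 0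
  | some false => 1

/-- The loop polynomial with some prescribed smoothings. -/
noncomputable def partialLoopPoly (s : ι → Option Bool) (w : List (ι × Bool)) : ℤ[X] :=
  loopPoly (orientedCoeff s) (unorientedCoeff s) w

/-- The prescribed smoothings after running through `y` in the reverse direction. -/
def twistState (y : List (ι × Bool)) (s : ι → Option Bool) (c : ι) : Option Bool :=
  if OddIn y c then (s c).map not else s c

lemma partialLoopPoly_none (w : List (ι × Bool)) :
    partialLoopPoly (fun _ => none) w = signedLoopPoly w := rfl

lemma partialLoopPoly_rotate (s : ι → Option Bool) {u v : List (ι × Bool)}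
    (h : PairedWord (u ++ v)) : partialLoopPoly s (u ++ v) = partialLoopPoly s (v ++ u) :=
  loopPoly_rotate _ _ h

lemma partialLoopPoly_congr {s s' : ι → Option Bool} {w : List (ι × Bool)}
    (h : ∀ c ∈ labels w, s c = s' c) : partialLoopPoly s w = partialLoopPoly s' w :=
  loopPoly_congr fun c hc => by simp [orientedCoeff, unorientedCoeff, h c hc]

lemma twistCoeff_twistState (y : List (ι × Bool)) (s : ι → Option Bool) :
    twistCoeff y (orientedCoeff s) (unorientedCoeff s) = orientedCoeff (twistState y s) ∧
    twistCoeff y (unorientedCoeff s) (orientedCoeff s) = unorientedCoeff (twistState y s) := by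
  constructor <;> funext c <;>
    rcases h : s c with _ | _ | _ <;>
    by_cases ho : OddIn y c <;>
    simp [twistCoeff, twistState, orientedCoeff, unorientedCoeff, h, ho]

lemma partialLoopPoly_resolve {s : ι → Option Bool} {c : ι} {b : Bool} {y z : List (ι × Bool)}
    (h : PairedWord ((c, b) :: y ++ (c, !b) :: z)) (hs : s c = none) :
    partialLoopPoly (Function.update s c (some true)) ((c, b) :: y ++ (c, !b) :: z) =
      -partialLoopPoly s ((c, b) :: y ++ (c, !b) :: z) -
        partialLoopPoly (twistState y s) (twistWord y z) := by
  have e := loopPoly_resolve (orientedCoeff s) (unorientedCoeff s) h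
  rw [(twistCoeff_twistState y s).1, (twistCoeff_twistState y s).2] at e
  have h1 : orientedCoeff s c = -1 := by simp [orientedCoeff, hs]
  have h2 : unorientedCoeff s c = -1 := by simp [unorientedCoeff, hs]
  rw [h1, h2] at e
  have h3 : Function.update (orientedCoeff s) c 1 =
      orientedCoeff (Function.update s c (some true)) := by
    funext d
    by_cases hd : d = c
    · subst hd; simp [orientedCoeff]
    · simp [orientedCoeff, hd]
  have h4 : Function.update (unorientedCoeff s) c 0 =
      unorientedCoeff (Function.update s c (some true)) := by
    funext d
    by_cases hd : d = c
    · subst hd; simp [unorientedCoeff]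
    · simp [unorientedCoeff, hd]
  rw [h3, h4] at e
  unfold partialLoopPoly
  rw [e]
  simp

lemma partialLoopPoly_resolve_false {s : ι → Option Bool} {c : ι} {b : Bool}
    {y z : List (ι × Bool)} (h : PairedWord ((c, b) :: y ++ (c, !b) :: z))
    (hs : s c = some false) :
    partialLoopPoly s ((c, b) :: y ++ (c, !b) :: z) =
      partialLoopPoly (twistState y s) (twistWord y z) := by
  have e := loopPoly_resolve (orientedCoeff s) (unorientedCoeff s) h
  rw [(twistCoeff_twistState y s).1, (twistCoeff_twistState y s).2] at e
  have h1 : orientedCoeff s c = 0 := by simp [orientedCoeff, hs]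
  have h2 : unorientedCoeff s c = 1 := by simp [unorientedCoeff, hs]
  rw [h1, h2] at e
  unfold partialLoopPoly
  rw [e]
  simp

/-- The state which prescribes the smoothing of one crossing. -/
def oneState (c : ι) (a : Bool) : ι → Option Bool := Function.update (fun _ => none) c (some a)

/-- The state which prescribes the smoothings of two crossings. -/
def twoState (c d : ι) (a a' : Bool) : ι → Option Bool :=
  Function.update (oneState c a) d (some a')

/-- The value at `-2` with one prescribed smoothing. -/
lemma eval_oneState {w : List (ι × Bool)} (hw : PairedWord w) {c : ι} (hc : c ∈ labels w)
    (a : Bool) : (partialLoopPoly (oneState c a) w).eval (-2) = if a then 4 else -2 := by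
  obtain ⟨x, t, b, y, z, rfl, h⟩ := hw.exists_rotate hc
  rw [partialLoopPoly_rotate _ hw]
  have hw := hw.rotate
  rw [h] at hw ⊢
  have hr := hw.remove
  have hz := notMem_labels hr.2
  cases a
  · rw [partialLoopPoly_resolve_false hw (by simp [oneState]),
      partialLoopPoly_congr (s' := fun _ => none), partialLoopPoly_none,
      eval_signedLoopPoly hr.1.twist]
    · simp
    · intro d hd
      rw [labels_twistWord] at hd
      have : d ≠ c := fun h => hz (h ▸ hd)
      simp [twistState, oneState, this]
  · have : twistState y (fun _ : ι => none) = fun _ => none := by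
      funext d; simp [twistState]
    rw [oneState, partialLoopPoly_resolve hw rfl, this, partialLoopPoly_none, partialLoopPoly_none,
      eval_sub, eval_neg, eval_signedLoopPoly hw, eval_signedLoopPoly hr.1.twist]
    simp

/-- The value at `-2` with two prescribed smoothings. -/
lemma eval_twoState {w : List (ι × Bool)} (hw : PairedWord w) {c d : ι} (hc : c ∈ labels w)
    (hd : d ∈ labels w) (hcd : c ≠ d) (a a' : Bool) :
    (partialLoopPoly (twoState c d a a') w).eval (-2) =
      if a ∧ a' then (if Linked w c d then -2 else -8)
      else if a ∨ a' then (if Linked w c d then -2 else 4)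
      else if Linked w c d then 4 else -2 := by
  obtain ⟨x, t, b, y, z, rfl, h⟩ := hw.exists_rotate hd
  rw [partialLoopPoly_rotate _ hw]
  have hL := (linked_rotate hw hc hd).symm.trans (linked_comm _ _ _)
  simp only [hL]
  clear hL
  have hl := labels_perm (List.perm_append_comm : (x ++ t).Perm (t ++ x))
  rw [hl] at hc hd
  have hw := hw.rotate
  rw [h] at hw hc hd ⊢
  have hr := hw.remove
  have hz := notMem_labels hr.2
  have hc' : c ∈ labels (y ++ z) := by
    rw [labels_remove, Finset.mem_insert] at hc
    exact hc.resolve_left hcd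
  have hc2 : c ∈ labels (twistWord y z) := by rwa [labels_twistWord]
  simp only [linked_cons_iff hw hc']
  cases a'
  · rw [partialLoopPoly_resolve_false hw (by simp [twoState]),
      partialLoopPoly_congr (s' := oneState c (if OddIn y c then !a else a)),
      eval_oneState hr.1.twist hc2]
    · by_cases ho : OddIn y c <;> cases a <;> simp [ho]
    · intro e he
      rw [labels_twistWord] at he
      have : e ≠ d := fun h => hz (h ▸ he)
      by_cases hec : e = c
      · subst hec
        by_cases ho : OddIn y e <;> simp [twistState, twoState, oneState, this, ho]
      · simp [twistState, twoState, oneState, this, hec]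
  · rw [twoState, partialLoopPoly_resolve hw (by simp [oneState, hcd.symm]), eval_sub, eval_neg,
      eval_oneState hw hc, partialLoopPoly_congr (w := twistWord y z)
        (s' := oneState c (if OddIn y c then !a else a)), eval_oneState hr.1.twist hc2]
    · by_cases ho : OddIn y c <;> cases a <;> simp [ho]
    · intro e he
      by_cases hec : e = c
      · subst hec
        by_cases ho : OddIn y e <;> simp [twistState, oneState, ho]
      · simp [twistState, oneState, hec]

/-- The value at `-2` if three crossings are smoothed with the orientation. -/
lemma eval_threeState {w : List (ι × Bool)} (hw : PairedWord w) {c d e : ι} (hc : c ∈ labels w)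
    (hd : d ∈ labels w) (he : e ∈ labels w) (hcd : c ≠ d) (hce : c ≠ e) (hde : d ≠ e) :
    (partialLoopPoly (Function.update (twoState c d true true) e (some true)) w).eval (-2) =
      if Linked w c d ∨ Linked w c e ∨ Linked w d e then 4 else 16 := by
  obtain ⟨x, t, b, y, z, rfl, h⟩ := hw.exists_rotate he
  rw [partialLoopPoly_rotate _ hw]
  have hL1 := (linked_rotate hw hc hd).symm
  have hL2 := (linked_rotate hw hc he).symm.trans (linked_comm _ _ _)
  have hL3 := (linked_rotate hw hd he).symm.trans (linked_comm _ _ _)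
  simp only [hL1, hL2, hL3]
  clear hL1 hL2 hL3
  have hl := labels_perm (List.perm_append_comm : (x ++ t).Perm (t ++ x))
  rw [hl] at hc hd he
  have hw := hw.rotate
  rw [h] at hw hc hd he ⊢
  have hr := hw.remove
  have hz := notMem_labels hr.2
  have hc' : c ∈ labels (y ++ z) := by
    rw [labels_remove, Finset.mem_insert] at hc
    exact hc.resolve_left hce
  have hd' : d ∈ labels (y ++ z) := by
    rw [labels_remove, Finset.mem_insert] at hd
    exact hd.resolve_left hde
  have hl0 : Linked ((e, b) :: y ++ (e, !b) :: z) c d ↔ Linked (y ++ z) c d := by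
    have o : ∀ b1 b2, orderSign ((e, b) :: y ++ (e, !b) :: z) (d, b1) (c, b2) =
        orderSign (y ++ z) (d, b1) (c, b2) := fun b1 b2 => orderSign_remove hde hce
    simp only [Linked, chordIndex, chordFlow, o]
  have hlt := linked_twistWord hr.1 hd' hcd
  rw [partialLoopPoly_resolve hw (by simp [twoState, oneState, hce.symm, hde.symm]), eval_sub,
    eval_neg, eval_twoState hw hc hd hcd, partialLoopPoly_congr (w := twistWord y z)
      (s' := twoState c d (!decide (OddIn y c)) (!decide (OddIn y d))),
    eval_twoState hr.1.twist (by rwa [labels_twistWord]) (by rwa [labels_twistWord]) hcd]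
  · simp only [linked_cons_iff hw hc', linked_cons_iff hw hd', hl0, hlt]
    by_cases h1 : OddIn y c <;> by_cases h2 : OddIn y d <;> by_cases h3 : Linked (y ++ z) c d <;>
      simp [h1, h2, h3]
  · intro f _
    by_cases hfd : f = d
    · subst hfd
      by_cases ho : OddIn y f <;> simp [twistState, twoState, oneState, ho]
    · by_cases hfc : f = c
      · subst hfc
        by_cases ho : OddIn y f <;> simp [twistState, twoState, oneState, ho, hfd]
      · simp [twistState, twoState, oneState, hfd, hfc]

/-- Twisting at a crossing expresses the loop polynomial in which this crossing is smoothed with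
the orientation. -/
lemma partialLoopPoly_oneState {c : ι} {b : Bool} {y z : List (ι × Bool)}
    (h : PairedWord ((c, b) :: y ++ (c, !b) :: z)) :
    partialLoopPoly (oneState c true) ((c, b) :: y ++ (c, !b) :: z) =
      -signedLoopPoly ((c, b) :: y ++ (c, !b) :: z) - signedLoopPoly (twistWord y z) := by
  have : twistState y (fun _ : ι => none) = fun _ => none := by
    funext d; simp [twistState]
  rw [oneState, partialLoopPoly_resolve h rfl, this, partialLoopPoly_none, partialLoopPoly_none]

end Values

/-! ### Isotropic words -/

section Isotropic

variable {ι : Type*} [Fintype ι] [DecidableEq ι]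

/-- The intersection form on weights on the passages: at every crossing, the branches marked `true`
are intersected with the ones marked `false`. -/
def pairing (L : Finset ι) (f g : ι × Bool → ℤ) : ℤ :=
  ∑ c ∈ L, (f (c, true) * g (c, false) - f (c, false) * g (c, true))

/-- All intersection numbers of the closed curves that run along the knot, either completely or from
a crossing to itself, vanish. This holds if the knot is drawn on the sphere. -/
def Isotropic (w : List (ι × Bool)) : Prop :=
  ∀ m ∈ w, pairing (labels w) (chordFlow w m) 1 = 0 ∧
    ∀ n ∈ w, pairing (labels w) (chordFlow w m) (chordFlow w n) = 0

/-- The integral combinations of the knot and of the closed curves along it. -/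
def flowSpan (w : List (ι × Bool)) : Submodule ℤ (ι × Bool → ℤ) :=
  Submodule.span ℤ (insert 1 (chordFlow w '' {m | m ∈ w}))

lemma one_mem_flowSpan (w : List (ι × Bool)) : 1 ∈ flowSpan w :=
  Submodule.subset_span (Set.mem_insert _ _)

lemma chordFlow_mem_flowSpan {w : List (ι × Bool)} {m : ι × Bool} (hm : m ∈ w) :
    chordFlow w m ∈ flowSpan w :=
  Submodule.subset_span (Set.mem_insert_of_mem _ ⟨m, hm, rfl⟩)

lemma pairing_add_left (L : Finset ι) (f f' g : ι × Bool → ℤ) :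
    pairing L (f + f') g = pairing L f g + pairing L f' g := by
  unfold pairing
  rw [← Finset.sum_add_distrib]
  exact Finset.sum_congr rfl fun c _ => by simp only [Pi.add_apply]; ring

lemma pairing_smul_left (L : Finset ι) (a : ℤ) (f g : ι × Bool → ℤ) :
    pairing L (a • f) g = a * pairing L f g := by
  unfold pairing
  rw [Finset.mul_sum]
  exact Finset.sum_congr rfl fun c _ => by simp only [Pi.smul_apply, smul_eq_mul]; ring

lemma pairing_comm (L : Finset ι) (f g : ι × Bool → ℤ) : pairing L f g = -pairing L g f := by
  unfold pairing
  rw [← Finset.sum_neg_distrib]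
  exact Finset.sum_congr rfl fun c _ => by ring

lemma pairing_zero_left (L : Finset ι) (g : ι × Bool → ℤ) : pairing L 0 g = 0 := by
  simp [pairing]

lemma pairing_congr {L : Finset ι} {f f' g g' : ι × Bool → ℤ}
    (hf : ∀ l : ι × Bool, l.1 ∈ L → f l = f' l) (hg : ∀ l : ι × Bool, l.1 ∈ L → g l = g' l) :
    pairing L f g = pairing L f' g' :=
  Finset.sum_congr rfl fun c hc => by
    rw [hf (c, true) hc, hf (c, false) hc, hg (c, true) hc, hg (c, false) hc]

lemma pairing_singleton (c : ι) (b : Bool) (f g : ι × Bool → ℤ) :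
    pairing {c} f g = (if b then 1 else -1) * (f (c, b) * g (c, !b) - f (c, !b) * g (c, b)) := by
  cases b <;> simp [pairing]

lemma Isotropic.pairing_eq_zero {w : List (ι × Bool)} (hw : Isotropic w) {f g : ι × Bool → ℤ}
    (hf : f ∈ flowSpan w) (hg : g ∈ flowSpan w) : pairing (labels w) f g = 0 := by
  have h1 : ∀ m ∈ w, ∀ g ∈ flowSpan w, pairing (labels w) (chordFlow w m) g = 0 := by
    intro m hm g hg
    rw [pairing_comm, neg_eq_zero]
    induction hg using Submodule.span_induction with
    | mem x hx =>
      rw [pairing_comm, neg_eq_zero]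
      rcases hx with rfl | ⟨n, hn, rfl⟩
      · exact (hw m hm).1
      · exact (hw m hm).2 n hn
    | zero => exact pairing_zero_left _ _
    | add x y _ _ hx hy => rw [pairing_add_left, hx, hy, add_zero]
    | smul a x _ hx => rw [pairing_smul_left, hx, mul_zero]
  induction hf using Submodule.span_induction with
  | mem x hx =>
    rcases hx with rfl | ⟨n, hn, rfl⟩
    · rw [pairing_comm, neg_eq_zero]
      induction hg using Submodule.span_induction with
      | mem x hx =>
        rcases hx with rfl | ⟨n, hn, rfl⟩
        · simp [pairing]
        · exact (hw n hn).1
      | zero => exact pairing_zero_left _ _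
      | add x y _ _ hx hy => rw [pairing_add_left, hx, hy, add_zero]
      | smul a x _ hx => rw [pairing_smul_left, hx, mul_zero]
    · exact h1 n hn g hg
  | zero => exact pairing_zero_left _ _
  | add x y _ _ hx hy => rw [pairing_add_left, hx, hy, add_zero]
  | smul a x _ hx => rw [pairing_smul_left, hx, mul_zero]

lemma pairing_flipMark (y : List (ι × Bool)) (L : Finset ι) (f g : ι × Bool → ℤ) :
    pairing L f g = pairing L (fun l => (1 - 2 * inWord y l) * f (flipMark y l))
      (fun l => (1 - 2 * inWord y l) * g (flipMark y l)) := by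
  refine Finset.sum_congr rfl fun c _ => ?_
  unfold flipMark inWord OddIn
  by_cases h1 : (c, true) ∈ y <;> by_cases h2 : (c, false) ∈ y <;> simp [h1, h2] <;> ring

/-- If the closed curves along a word `w'` are combinations of the closed curves along an isotropic
word `w`, away from the crossings `K` of `w` which do not occur in `w'`, and do not intersect at
the crossings in `K`, then `w'` is isotropic. The parts of `w` in `y` are run through in the
reverse direction in `w'`. -/
lemma Isotropic.transfer {w w' : List (ι × Bool)} (hw : Isotropic w)
    (y : List (ι × Bool)) (K : Finset ι) (hL : labels w = K ∪ labels w')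
    (hK : Disjoint K (labels w')) (F : ι × Bool → ι × Bool → ℤ) (G : ι × Bool → ℤ)
    (hF : ∀ m : ι × Bool, m.1 ∈ labels w' → F m ∈ flowSpan w) (hG : G ∈ flowSpan w)
    (hFe : ∀ m l : ι × Bool, m.1 ∈ labels w' → l.1 ∈ labels w' →
      (1 - 2 * inWord y l) * chordFlow w' (flipMark y m) (flipMark y l) = F m l)
    (hGe : ∀ l : ι × Bool, l.1 ∈ labels w' → 1 - 2 * inWord y l = G l)
    (hKF : ∀ m n : ι × Bool, m.1 ∈ labels w' → n.1 ∈ labels w' → pairing K (F m) (F n) = 0)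
    (hKG : ∀ m : ι × Bool, m.1 ∈ labels w' → pairing K (F m) G = 0) : Isotropic w' := by
  have hsum : ∀ f g, pairing (labels w) f g = pairing K f g + pairing (labels w') f g := by
    intro f g
    unfold pairing
    rw [hL, Finset.sum_union hK]
  have key : ∀ m : ι × Bool, m.1 ∈ labels w' →
      pairing (labels w') (chordFlow w' (flipMark y m)) 1 = 0 ∧
      ∀ n : ι × Bool, n.1 ∈ labels w' →
        pairing (labels w') (chordFlow w' (flipMark y m)) (chordFlow w' (flipMark y n)) = 0 := by
    intro m hm
    constructor
    · rw [pairing_flipMark y, pairing_congr (f' := F m) (g' := G) (fun l hl => hFe m l hm hl)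
        (fun l hl => by simpa using hGe l hl)]
      have := hsum (F m) G
      rw [hw.pairing_eq_zero (hF m hm) hG, hKG m hm] at this
      omega
    · intro n hn
      rw [pairing_flipMark y, pairing_congr (f' := F m) (g' := F n) (fun l hl => hFe m l hm hl)
        (fun l hl => hFe n l hn hl)]
      have := hsum (F m) (F n)
      rw [hw.pairing_eq_zero (hF m hm) (hF n hn), hKF m n hm hn] at this
      omega
  intro m hm
  have hm' : (flipMark y m).1 ∈ labels w' := by
    rw [flipMark_fst]; exact mem_labels_of_mem hm
  obtain ⟨h1, h2⟩ := key _ hm'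
  rw [flipMark_flipMark] at h1 h2
  refine ⟨h1, fun n hn => ?_⟩
  have hn' : (flipMark y n).1 ∈ labels w' := by
    rw [flipMark_fst]; exact mem_labels_of_mem hn
  have := h2 _ hn'
  rwa [flipMark_flipMark] at this

lemma inWord_nil (l : ι × Bool) : inWord [] l = 0 := by simp [inWord]

lemma flipMark_nil (l : ι × Bool) : flipMark [] l = l := by simp [flipMark, OddIn]

lemma PairedWord.mem_iff {w : List (ι × Bool)} (hw : PairedWord w) {m : ι × Bool} :
    m ∈ w ↔ m.1 ∈ labels w := (hw.mem_labels m.2).symm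

lemma Isotropic.rotate {u v : List (ι × Bool)} (h : PairedWord (u ++ v))
    (hi : Isotropic (u ++ v)) : Isotropic (v ++ u) := by
  have hl : labels (u ++ v) = labels (v ++ u) := labels_perm List.perm_append_comm
  refine hi.transfer [] ∅ (by simpa using hl) (by simp)
    (fun m => chordFlow (u ++ v) m - (2 * (inWord u m - inWord u (m.1, !m.2))) • 1) 1
    (fun m hm => ?_) (one_mem_flowSpan _) (fun m l hm hl' => ?_) (fun l _ => by simp [inWord_nil])
    (fun _ _ _ _ => by simp [pairing]) (fun _ _ => by simp [pairing])
  · exact Submodule.sub_mem _ (chordFlow_mem_flowSpan (h.mem_iff.2 (hl ▸ hm)))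
      (Submodule.smul_mem _ _ (one_mem_flowSpan _))
  · rw [flipMark_nil, flipMark_nil, chordFlow_rotate h (h.mem_iff.2 (hl ▸ hl'))
      (h.mem_iff.2 (hl ▸ hm))]
    simp [inWord_nil]

/-- The flows along a word of which one part is run through in the reverse direction. -/
lemma chordFlow_twistWord {y z : List (ι × Bool)} (h : PairedWord (y ++ z)) {l m : ι × Bool}
    (hm : m ∈ y ++ z) :
    (1 - 2 * inWord y l) * chordFlow (twistWord y z) (flipMark y m) (flipMark y l) =
      chordFlow (y ++ z) m l - 2 * inWord y l * (inWord y m - inWord y (m.1, !m.2)) := by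
  have key : ∀ m, m ∈ y ++ z →
      (1 - 2 * inWord y l) * orderSign (twistWord y z) (flipMark y l) (flipMark y m) =
      orderSign (y ++ z) l m + 2 * inWord y l * (1 - inWord y m) := by
    intro m hm
    rw [orderSign_twistWord h]
    have := (@linked_append_facts ι _ _ y z l m).2
    rcases inWord_eq y l with h1 | h1 <;> rcases inWord_eq y m with h2 | h2 <;>
      simp only [h1, h2] at this ⊢ <;> simp at this <;> omega
  unfold chordFlow
  rw [← flipMark_not, mul_sub, key m hm, key _ (h.2 m hm)]
  ring

lemma chordFlow_remove {y z : List (ι × Bool)} {c : ι} {b : Bool} {l m : ι × Bool}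
    (hl : l.1 ≠ c) (hm : m.1 ≠ c) :
    chordFlow ((c, b) :: y ++ (c, !b) :: z) m l = chordFlow (y ++ z) m l := by
  unfold chordFlow
  rw [orderSign_remove hl hm, orderSign_remove hl (m := (m.1, !m.2)) hm]

/-- The flow of another crossing at the passages of a crossing at the base point. -/
lemma chordFlow_cons_other {y z : List (ι × Bool)} {c : ι} {b : Bool}
    (hw : PairedWord ((c, b) :: y ++ (c, !b) :: z)) {m : ι × Bool} (hm : m.1 ≠ c) :
    chordFlow ((c, b) :: y ++ (c, !b) :: z) m (c, b) = 0 ∧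
    chordFlow ((c, b) :: y ++ (c, !b) :: z) m (c, !b) =
      2 * (inWord y m - inWord y (m.1, !m.2)) := by
  obtain ⟨h1, h2⟩ := hw.remove
  have hcy : (c, !b) ∉ y := fun h => h2 _ (List.mem_append_left _ h) rfl
  have n : ∀ m : ι × Bool, m.1 ≠ c → ∀ b', m ≠ (c, b') := fun m hm b' h => hm (by rw [h])
  have key : ∀ m : ι × Bool, m.1 ≠ c → orderSign ((c, b) :: y ++ (c, !b) :: z) (c, b) m = -1 ∧
      orderSign ((c, b) :: y ++ (c, !b) :: z) (c, !b) m = 2 * inWord y m - 1 := by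
    intro m hm
    rw [List.cons_append, orderSign_cons_lt (n m hm _), orderSign_cons (by simp) (n m hm _)]
    refine ⟨rfl, ?_⟩
    unfold inWord
    by_cases h : m ∈ y
    · rw [orderSign_append_gt hcy h]; simp [h]
    · rw [orderSign_append_right hcy h, orderSign_cons_lt (n m hm _)]; simp [h]
  unfold chordFlow
  rw [(key m hm).1, (key (m.1, !m.2) hm).1, (key m hm).2, (key (m.1, !m.2) hm).2]
  constructor <;> ring

/-- Smoothing a crossing against the orientation. -/
lemma Isotropic.twist {y z : List (ι × Bool)} {c : ι} {b : Bool}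
    (hw : PairedWord ((c, b) :: y ++ (c, !b) :: z)) (hi : Isotropic ((c, b) :: y ++ (c, !b) :: z)) :
    Isotropic (twistWord y z) := by
  obtain ⟨h1, h2⟩ := hw.remove
  have hlt := labels_twistWord y z
  have hcl : c ∉ labels (y ++ z) := notMem_labels h2
  have hne : ∀ m : ι × Bool, m.1 ∈ labels (twistWord y z) → m.1 ≠ c := fun m hm h =>
    hcl (by rw [← hlt, ← h]; exact hm)
  have hmem : ∀ m : ι × Bool, m.1 ∈ labels (twistWord y z) → m ∈ y ++ z := fun m hm =>
    h1.mem_iff.2 (hlt ▸ hm)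
  have hc : (c, b) ∈ (c, b) :: y ++ (c, !b) :: z := by simp
  refine hi.transfer y {c} ?_ ?_ (fun m => chordFlow ((c, b) :: y ++ (c, !b) :: z) m -
      (inWord y m - inWord y (m.1, !m.2)) • chordFlow ((c, b) :: y ++ (c, !b) :: z) (c, b))
    (1 - chordFlow ((c, b) :: y ++ (c, !b) :: z) (c, b)) (fun m hm => ?_) ?_ (fun m l hm hl => ?_)
    (fun l hl => ?_) (fun m n hm hn => ?_) (fun m hm => ?_)
  · rw [labels_remove, hlt]; rfl
  · rw [hlt]; simpa using hcl
  · refine Submodule.sub_mem _ (chordFlow_mem_flowSpan ?_)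
      (Submodule.smul_mem _ _ (chordFlow_mem_flowSpan hc))
    have := hmem m hm
    simp only [List.mem_append, List.mem_cons] at this ⊢
    tauto
  · exact Submodule.sub_mem _ (one_mem_flowSpan _) (chordFlow_mem_flowSpan hc)
  · rw [chordFlow_twistWord h1 (hmem m hm)]
    simp only [Pi.sub_apply, Pi.smul_apply, smul_eq_mul]
    rw [chordFlow_cons hw (hmem l hl), chordFlow_remove (hne l hl) (hne m hm)]
    ring
  · simp only [Pi.sub_apply, Pi.one_apply]
    rw [chordFlow_cons hw (hmem l hl)]
  · rw [pairing_singleton c b]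
    simp only [Pi.sub_apply, Pi.smul_apply, smul_eq_mul, chordFlow_cons_self hw]
    rw [(chordFlow_cons_other hw (hne m hm)).1, (chordFlow_cons_other hw (hne m hm)).2,
      (chordFlow_cons_other hw (hne n hn)).1, (chordFlow_cons_other hw (hne n hn)).2]
    ring
  · rw [pairing_singleton c b]
    simp only [Pi.sub_apply, Pi.smul_apply, smul_eq_mul, chordFlow_cons_self hw, Pi.one_apply]
    ring

lemma twistWord_nil (z : List (ι × Bool)) : twistWord [] z = z := by
  have : flipMark ([] : List (ι × Bool)) = id := by funext l; exact flipMark_nil l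
  simp [twistWord, this]

/-- Removing a kink. -/
lemma Isotropic.kink {z : List (ι × Bool)} {c : ι} {b : Bool}
    (hw : PairedWord ((c, b) :: (c, !b) :: z)) (hi : Isotropic ((c, b) :: (c, !b) :: z)) :
    Isotropic z := by
  have := Isotropic.twist (y := []) hw hi
  rwa [twistWord_nil] at this

/-- Positions in a word that begins with a pair of linked crossings. -/
lemma idxOf_linked {c p : ι} {b b' : Bool} {z u v : List (ι × Bool)}
    (hw : PairedWord ((c, b) :: ((p, b') :: z) ++ (c, !b) :: (u ++ (p, !b') :: v))) :
    (∀ l ∈ z ++ (v ++ u), l.1 ≠ c ∧ l.1 ≠ p) ∧ p ≠ c ∧ PairedWord (z ++ (v ++ u)) ∧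
    labels ((c, b) :: ((p, b') :: z) ++ (c, !b) :: (u ++ (p, !b') :: v)) =
      {c, p} ∪ labels (z ++ (v ++ u)) := by
  obtain ⟨h1, h2⟩ := hw.remove
  have h3 : PairedWord ((p, b') :: (z ++ u) ++ (p, !b') :: v) := by simpa using h1
  obtain ⟨h4, h5⟩ := h3.remove
  have hp : (z ++ u ++ v).Perm (z ++ (v ++ u)) := by
    rw [List.append_assoc]; exact List.Perm.append_left _ List.perm_append_comm
  refine ⟨fun l hl => ⟨h2 l ?_, h5 l (hp.mem_iff.2 hl)⟩, h2 (p, b') (by simp), h4.of_perm hp, ?_⟩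
  · simp only [List.mem_append, List.mem_cons] at hl ⊢
    tauto
  · have e : (p, b') :: z ++ (u ++ (p, !b') :: v) = (p, b') :: (z ++ u) ++ (p, !b') :: v := by simp
    rw [labels_remove, e, labels_remove, labels_perm hp]
    ext d
    simp

/-- The order of the passages around two linked crossings. -/
lemma orderSign_linked {c p : ι} {b b' : Bool} {z u v : List (ι × Bool)}
    (hw : PairedWord ((c, b) :: ((p, b') :: z) ++ (c, !b) :: (u ++ (p, !b') :: v)))
    {l m : ι × Bool} (hl : l ∈ z ++ (v ++ u)) (hm : m ∈ z ++ (v ++ u)) :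
    orderSign (z ++ (v ++ u)) l m =
        orderSign ((c, b) :: ((p, b') :: z) ++ (c, !b) :: (u ++ (p, !b') :: v)) l m +
          2 * (inWord u l * inWord v m - inWord v l * inWord u m) ∧
      inWord z m + inWord u m + inWord v m = 1 := by
  obtain ⟨h1, h2, h3, -⟩ := idxOf_linked hw
  have hlc : ∀ x, l ≠ (c, x) := fun x e => (h1 l hl).1 (by rw [e])
  have hlp : ∀ x, l ≠ (p, x) := fun x e => (h1 l hl).2 (by rw [e])
  have hmc : ∀ x, m ≠ (c, x) := fun x e => (h1 m hm).1 (by rw [e])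
  have hmp : ∀ x, m ≠ (p, x) := fun x e => (h1 m hm).2 (by rw [e])
  have d1 := h3.disjoint
  have d2 : ∀ l ∈ u, l ∉ v := (fun l hl hl' =>
    (List.nodup_append.1 (List.nodup_append.1 h3.1).2.1).2.2 _ hl' _ hl rfl)
  rw [List.cons_append, orderSign_cons (hlc _) (hmc _), List.cons_append,
    orderSign_cons (hlp _) (hmp _)]
  have e1 : ∀ l, l ∈ z ++ (v ++ u) → (l ∈ z ∧ l ∉ u ∧ l ∉ v) ∨ (l ∉ z ∧ l ∈ u ∧ l ∉ v) ∨
      (l ∉ z ∧ l ∉ u ∧ l ∈ v) := by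
    intro l hl
    by_cases hz : l ∈ z
    · have a1 : l ∉ v := fun h => d1 l (by simp [h]) hz
      have a2 : l ∉ u := fun h => d1 l (by simp [h]) hz
      tauto
    · by_cases hu : l ∈ u
      · have := d2 l hu
        tauto
      · simp only [List.mem_append] at hl
        tauto
  have key : orderSign (z ++ (v ++ u)) l m = orderSign (z ++ (u ++ v)) l m +
      2 * (inWord u l * inWord v m - inWord v l * inWord u m) := by
    rcases e1 l hl with ⟨a1, a2, a3⟩ | ⟨a1, a2, a3⟩ | ⟨a1, a2, a3⟩ <;>
      rcases e1 m hm with ⟨b1, b2, b3⟩ | ⟨b1, b2, b3⟩ | ⟨b1, b2, b3⟩ <;>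
      simp [inWord, a1, a2, a3, b1, b2, b3, orderSign_append_left, orderSign_append_right,
        orderSign_append_lt, orderSign_append_gt]
  have key2 : orderSign (z ++ (c, !b) :: (u ++ (p, !b') :: v)) l m =
      orderSign (z ++ (u ++ v)) l m := by
    rcases e1 l hl with ⟨a1, a2, a3⟩ | ⟨a1, a2, a3⟩ | ⟨a1, a2, a3⟩ <;>
      rcases e1 m hm with ⟨b1, b2, b3⟩ | ⟨b1, b2, b3⟩ | ⟨b1, b2, b3⟩ <;>
      simp [a1, a2, b1, b2, orderSign_append_left, orderSign_append_right,
        orderSign_append_lt, orderSign_append_gt, orderSign_cons, hlc, hlp, hmc, hmp]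
  refine ⟨by rw [key, key2], ?_⟩
  rcases e1 m hm with ⟨b1, b2, b3⟩ | ⟨b1, b2, b3⟩ | ⟨b1, b2, b3⟩ <;> simp [inWord, b1, b2, b3]

/-- The flow of a third crossing at two linked crossings. -/
lemma chordFlow_linked {c p : ι} {b b' : Bool} {z u v : List (ι × Bool)}
    (hw : PairedWord ((c, b) :: ((p, b') :: z) ++ (c, !b) :: (u ++ (p, !b') :: v)))
    {m : ι × Bool} (hm : m ∈ z ++ (v ++ u)) (f : ι × Bool → ℤ)
    (hf : f = chordFlow ((c, b) :: ((p, b') :: z) ++ (c, !b) :: (u ++ (p, !b') :: v)) m) :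
    f (c, b) = 0 ∧ f (c, !b) = 2 * (inWord z m - inWord z (m.1, !m.2)) ∧ f (p, b') = 0 ∧
      f (p, !b') = -2 * (inWord v m - inWord v (m.1, !m.2)) := by
  obtain ⟨h1, h2, h3, -⟩ := idxOf_linked hw
  have hd := List.nodup_append.1 hw.1
  have hd1 := hd.1
  have hd2 := hd.2.1
  simp only [List.nodup_cons, List.mem_cons, Prod.mk.injEq, not_or, List.nodup_append,
    List.mem_append] at hd1 hd2
  have nz : (p, !b') ∉ z := fun h => hd.2.2 _ (by simp [h]) (p, !b') (by simp) rfl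
  have nz2 : (p, b') ∉ z := hd1.2.1
  have nc : (c, !b) ∉ z := fun h => hd.2.2 _ (by simp [h]) (c, !b) (by simp) rfl
  have nu : (p, !b') ∉ u := fun h => hd2.2.2.2 _ h (p, !b') (by simp) rfl
  have nv : (p, !b') ∉ v := by simpa using hd2.2.2.1.1
  have key : ∀ m, m ∈ z ++ (v ++ u) →
      orderSign ((c, b) :: ((p, b') :: z) ++ (c, !b) :: (u ++ (p, !b') :: v)) (c, b) m = -1 ∧
      orderSign ((c, b) :: ((p, b') :: z) ++ (c, !b) :: (u ++ (p, !b') :: v)) (c, !b) m =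
        2 * inWord z m - 1 ∧
      orderSign ((c, b) :: ((p, b') :: z) ++ (c, !b) :: (u ++ (p, !b') :: v)) (p, b') m = -1 ∧
      orderSign ((c, b) :: ((p, b') :: z) ++ (c, !b) :: (u ++ (p, !b') :: v)) (p, !b') m =
        1 - 2 * inWord v m := by
    intro m hm
    have hmc : ∀ x, m ≠ (c, x) := fun x e => (h1 m hm).1 (by rw [e])
    have hmp : ∀ x, m ≠ (p, x) := fun x e => (h1 m hm).2 (by rw [e])
    have d1 := h3.disjoint m
    have d2 : m ∈ u → m ∉ v := (fun hl hl' =>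
      (List.nodup_append.1 (List.nodup_append.1 h3.1).2.1).2.2 _ hl' _ hl rfl)
    simp only [List.mem_append] at hm d1
    rw [List.cons_append, List.cons_append, orderSign_cons_lt (hmc _),
      orderSign_cons (by simp) (hmc _), orderSign_cons (by simp [h2.symm]) (hmp _),
      orderSign_cons (by simp [h2]) (hmc _), orderSign_cons_lt (hmp _),
      orderSign_cons (by simp [h2]) (hmc _), orderSign_cons (by simp) (hmp _)]
    refine ⟨rfl, ?_, rfl, ?_⟩
    · by_cases hz : m ∈ z
      · rw [orderSign_append_gt nc hz]
        simp [inWord, hz]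
      · rw [orderSign_append_right nc hz, orderSign_cons_lt (hmc _)]
        simp [inWord, hz]
    · by_cases hz : m ∈ z
      · rw [orderSign_append_gt nz hz]
        have : m ∉ v := by tauto
        simp [inWord, this]
      · rw [orderSign_append_right nz hz, orderSign_cons (by simp [h2]) (hmc _)]
        by_cases hu : m ∈ u
        · rw [orderSign_append_gt nu hu]
          simp [inWord, d2 hu]
        · rw [orderSign_append_right nu hu, orderSign_cons_lt (hmp _)]
          have : m ∈ v := by tauto
          simp [inWord, this]
  have k1 := key m hm
  have k2 := key _ (h3.2 m hm)
  subst hf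
  unfold chordFlow
  rw [k1.1, k1.2.1, k1.2.2.1, k1.2.2.2, k2.1, k2.2.1, k2.2.2.1, k2.2.2.2]
  refine ⟨?_, ?_, ?_, ?_⟩ <;> ring

/-- The flows of two linked crossings. -/
lemma chordFlow_linked_self {c p : ι} {b b' : Bool} {z u v : List (ι × Bool)}
    (hw : PairedWord ((c, b) :: ((p, b') :: z) ++ (c, !b) :: (u ++ (p, !b') :: v)))
    (f g : ι × Bool → ℤ)
    (hf : f = chordFlow ((c, b) :: ((p, b') :: z) ++ (c, !b) :: (u ++ (p, !b') :: v)) (c, b))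
    (hg : g = chordFlow ((c, b) :: ((p, b') :: z) ++ (c, !b) :: (u ++ (p, !b') :: v)) (p, b')) :
    (f (c, b) = 1 ∧ f (c, !b) = 1 ∧ f (p, b') = 2 ∧ f (p, !b') = 0) ∧
    (g (c, b) = 0 ∧ g (c, !b) = 2 ∧ g (p, b') = 1 ∧ g (p, !b') = 1) ∧
    ∀ l ∈ z ++ (v ++ u), f l = 2 * inWord z l ∧ g l = 2 - 2 * inWord v l := by
  obtain ⟨h1, h2, h3, -⟩ := idxOf_linked hw
  obtain ⟨r1, r2⟩ := hw.remove
  have hd := List.nodup_append.1 hw.1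
  have nzp : (p, !b') ∉ z := fun h => hd.2.2 _ (by simp [h]) (p, !b') (by simp) rfl
  have hpp : inWord ((p, b') :: z) (p, b') = 1 := by simp [inWord]
  have hpq : inWord ((p, b') :: z) (p, !b') = 0 := by simp [inWord, nzp]
  have e1 := chordFlow_cons_other hw (m := (p, b')) h2
  simp only [hpp, hpq] at e1
  have e2 : chordFlow ((c, b) :: ((p, b') :: z) ++ (c, !b) :: (u ++ (p, !b') :: v)) (p, b') =
    fun l => orderSign ((c, b) :: ((p, b') :: z) ++ (c, !b) :: (u ++ (p, !b') :: v)) l (p, b') -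
      orderSign ((c, b) :: ((p, b') :: z) ++ (c, !b) :: (u ++ (p, !b') :: v)) l (p, !b') := rfl
  have hself : orderSign ((c, b) :: ((p, b') :: z) ++ (c, !b) :: (u ++ (p, !b') :: v))
      (p, b') (p, !b') = -1 := by
    rw [orderSign_remove h2 h2, List.cons_append, orderSign_cons_lt (by simp)]
  refine ⟨⟨?_, ?_, ?_, ?_⟩, ⟨?_, ?_, ?_, ?_⟩, fun l hl => ⟨?_, ?_⟩⟩
  · rw [hf, chordFlow_cons_self hw]
  · rw [hf, chordFlow_cons_self hw]
  · rw [hf, chordFlow_cons hw (by simp), hpp]; rfl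
  · rw [hf, chordFlow_cons hw (by simp), hpq]; rfl
  · rw [hg, e1.1]
  · rw [hg, e1.2]; rfl
  · rw [hg, e2]
    simp only [orderSign_self, hself]
    rfl
  · rw [hg, e2]
    simp only [orderSign_self, orderSign_comm _ (p, !b') (p, b'), hself]
    rfl
  · rw [hf, chordFlow_cons hw (by simp only [List.mem_append, List.mem_cons] at hl ⊢; tauto)]
    have : l ≠ (p, b') := fun e => (h1 l hl).2 (by rw [e])
    simp [inWord, this]
  · have k := chordFlow_linked hw hl _ rfl
    have hlp : ∀ x, l ≠ (p, x) := fun x e => (h1 l hl).2 (by rw [e])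
    have hlc : l.1 ≠ c := (h1 l hl).1
    have d1 := h3.disjoint l
    have d2 : l ∈ u → l ∉ v := (fun hl hl' =>
      (List.nodup_append.1 (List.nodup_append.1 h3.1).2.1).2.2 _ hl' _ hl rfl)
    rw [hg, chordFlow_remove hlc h2]
    unfold chordFlow
    rw [List.cons_append, orderSign_cons_gt (hlp _), orderSign_cons (hlp _) (by simp)]
    simp only [List.mem_append] at hl d1
    by_cases hz : l ∈ z
    · have : l ∉ v := by tauto
      rw [orderSign_append_lt hz nzp]
      simp [inWord, this]
    · rw [orderSign_append_right hz nzp]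
      have nu : (p, !b') ∉ u := by
        have := hd.2.1
        simp only [List.nodup_cons, List.nodup_append] at this
        exact fun h => this.2.2.2 _ h (p, !b') (by simp) rfl
      by_cases hu : l ∈ u
      · rw [orderSign_append_lt hu nu]
        simp [inWord, d2 hu]
      · rw [orderSign_append_right hu nu, orderSign_cons_gt (hlp _)]
        have : l ∈ v := by tauto
        simp [inWord, this]

/-- Smoothing two linked crossings, either both with the orientation or only the first one. -/
lemma Isotropic.smooth_linked {c p : ι} {b b' : Bool} {z u v : List (ι × Bool)}
    (hw : PairedWord ((c, b) :: ((p, b') :: z) ++ (c, !b) :: (u ++ (p, !b') :: v)))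
    (hi : Isotropic ((c, b) :: ((p, b') :: z) ++ (c, !b) :: (u ++ (p, !b') :: v))) :
    Isotropic (z ++ (v ++ u)) ∧ Isotropic (twistWord z (v ++ u)) := by
  obtain ⟨h1, h2, h3, hL⟩ := idxOf_linked hw
  obtain ⟨⟨f1, f2, f3, f4⟩, ⟨g1, g2, g3, g4⟩, hfg⟩ := chordFlow_linked_self hw _ _ rfl rfl
  have hmem : ∀ m : ι × Bool, m.1 ∈ labels (z ++ (v ++ u)) → m ∈ z ++ (v ++ u) := fun m hm =>
    h3.mem_iff.2 hm
  have hsum := fun m hm => (orderSign_linked hw (l := m) hm hm).2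
  have hch := fun m hm => chordFlow_linked hw (m := m) hm _ rfl
  have hord := fun l m hl hm => (orderSign_linked hw (l := l) (m := m) hl hm).1
  have hmw : ∀ m ∈ z ++ (v ++ u),
      m ∈ (c, b) :: ((p, b') :: z) ++ (c, !b) :: (u ++ (p, !b') :: v) := by
    intro m hm
    simp only [List.mem_append, List.mem_cons] at hm ⊢
    tauto
  have hcw : (c, b) ∈ (c, b) :: ((p, b') :: z) ++ (c, !b) :: (u ++ (p, !b') :: v) := by simp
  have hpw : (p, b') ∈ (c, b) :: ((p, b') :: z) ++ (c, !b) :: (u ++ (p, !b') :: v) := by simp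
  have hdis : Disjoint {c, p} (labels (z ++ (v ++ u))) := by
    rw [Finset.disjoint_left]
    intro d hd hd'
    have := h1 _ ((h3.mem_labels true).1 hd')
    simp only [Finset.mem_insert, Finset.mem_singleton] at hd
    tauto
  generalize hW : (c, b) :: ((p, b') :: z) ++ (c, !b) :: (u ++ (p, !b') :: v) = W at *
  -- `F m` is the flow of `m` in the smoothed word
  let F : ι × Bool → ι × Bool → ℤ := fun m => chordFlow W m +
    (inWord v m - inWord v (m.1, !m.2)) • (chordFlow W (p, b') - chordFlow W (c, b)) -
    (inWord u m - inWord u (m.1, !m.2)) • ((2 : ℤ) • 1 - chordFlow W (p, b'))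
  have hFspan : ∀ m ∈ z ++ (v ++ u), F m ∈ flowSpan W := fun m hm =>
    Submodule.sub_mem _ (Submodule.add_mem _ (chordFlow_mem_flowSpan (hmw m hm))
      (Submodule.smul_mem _ _ (Submodule.sub_mem _ (chordFlow_mem_flowSpan hpw)
        (chordFlow_mem_flowSpan hcw)))) (Submodule.smul_mem _ _ (Submodule.sub_mem _
          (Submodule.smul_mem _ _ (one_mem_flowSpan _)) (chordFlow_mem_flowSpan hpw)))
  have hFval : ∀ m l, F m l = chordFlow W m l + (inWord v m - inWord v (m.1, !m.2)) *
      (chordFlow W (p, b') l - chordFlow W (c, b) l) - (inWord u m - inWord u (m.1, !m.2)) *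
        (2 - chordFlow W (p, b') l) := by
    intro m l
    simp [F]
  have hFe : ∀ m l, m ∈ z ++ (v ++ u) → l ∈ z ++ (v ++ u) →
      chordFlow (z ++ (v ++ u)) m l = F m l := by
    intro m l hm hl
    rw [hFval, (hfg l hl).1, (hfg l hl).2]
    unfold chordFlow
    rw [hord l m hl hm, hord l _ hl (h3.2 m hm)]
    linear_combination 2 * (inWord v m - inWord v (m.1, !m.2)) * hsum l hl
  have hFK : ∀ m ∈ z ++ (v ++ u), ∃ x, F m (c, b) = x ∧ F m (c, !b) = x ∧
      F m (p, b') = inWord z m - inWord z (m.1, !m.2) ∧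
      F m (p, !b') = inWord z m - inWord z (m.1, !m.2) := by
    intro m hm
    obtain ⟨k1, k2, k3, k4⟩ := hch m hm
    have s1 := hsum m hm
    have s2 := hsum _ (h3.2 m hm)
    simp only [hFval, k1, k2, k3, k4, f1, f2, f3, f4, g1, g2, g3, g4]
    refine ⟨_, rfl, ?_, ?_, ?_⟩ <;> linarith
  have hKsum : ∀ f g : ι × Bool → ℤ, pairing {c, p} f g =
      (if b then 1 else -1) * (f (c, b) * g (c, !b) - f (c, !b) * g (c, b)) +
      (if b' then 1 else -1) * (f (p, b') * g (p, !b') - f (p, !b') * g (p, b')) := by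
    intro f g
    rw [← pairing_singleton, ← pairing_singleton]
    unfold pairing
    rw [Finset.sum_pair h2.symm, Finset.sum_singleton, Finset.sum_singleton]
  constructor
  · refine hi.transfer [] {c, p} hL hdis F 1 (fun m hm => hFspan m (hmem m hm))
      (one_mem_flowSpan _) (fun m l hm hl => ?_) (fun l hl => by simp [inWord_nil])
      (fun m n hm hn => ?_) (fun m hm => ?_)
    · rw [flipMark_nil, flipMark_nil, inWord_nil, hFe m l (hmem m hm) (hmem l hl)]
      ring
    · obtain ⟨x, a1, a2, a3, a4⟩ := hFK m (hmem m hm)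
      obtain ⟨y, b1, b2, b3, b4⟩ := hFK n (hmem n hn)
      rw [hKsum, a1, a2, a3, a4, b1, b2, b3, b4]
      ring
    · obtain ⟨x, a1, a2, a3, a4⟩ := hFK m (hmem m hm)
      rw [hKsum, a1, a2, a3, a4]
      simp
  · have hlt := labels_twistWord z (v ++ u)
    rw [← hlt] at hL hdis hmem
    refine hi.transfer z {c, p} hL hdis
      (fun m => F m - (inWord z m - inWord z (m.1, !m.2)) • chordFlow W (c, b))
      (1 - chordFlow W (c, b)) (fun m hm => ?_) ?_ (fun m l hm hl => ?_) (fun l hl => ?_)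
      (fun m n hm hn => ?_) (fun m hm => ?_)
    · exact Submodule.sub_mem _ (hFspan m (hmem m hm))
        (Submodule.smul_mem _ _ (chordFlow_mem_flowSpan hcw))
    · exact Submodule.sub_mem _ (one_mem_flowSpan _) (chordFlow_mem_flowSpan hcw)
    · rw [chordFlow_twistWord h3 (hmem m hm), hFe m l (hmem m hm) (hmem l hl)]
      simp only [Pi.sub_apply, Pi.smul_apply, smul_eq_mul]
      rw [(hfg l (hmem l hl)).1]
      ring
    · simp only [Pi.sub_apply, Pi.one_apply]
      rw [(hfg l (hmem l hl)).1]
    · obtain ⟨x, a1, a2, a3, a4⟩ := hFK m (hmem m hm)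
      obtain ⟨y, b1, b2, b3, b4⟩ := hFK n (hmem n hn)
      rw [hKsum]
      simp only [Pi.sub_apply, Pi.smul_apply, smul_eq_mul]
      rw [a1, a2, a3, a4, b1, b2, b3, b4, f1, f2, f3, f4]
      ring
    · obtain ⟨x, a1, a2, a3, a4⟩ := hFK m (hmem m hm)
      rw [hKsum]
      simp only [Pi.sub_apply, Pi.smul_apply, smul_eq_mul, Pi.one_apply]
      rw [a1, a2, a3, a4, f1, f2, f3, f4]
      ring

end Isotropic

/-! ### The number of circles, averaged over all smoothings -/

section ArrowSum

open Polynomial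

variable {ι : Type*} [Fintype ι] [DecidableEq ι]

/-- The sum of the orders of the passages through two crossings. It is `2` or `-2` if the crossings
are linked, according to which one is passed first. -/
def orderSum (w : List (ι × Bool)) (c d : ι) : ℤ :=
  orderSign w (d, true) (c, true) + orderSign w (d, true) (c, false) +
    orderSign w (d, false) (c, true) + orderSign w (d, false) (c, false)

/-- Eight times the sum, over all pairs of linked crossings in `L`, of the product of the marks of
the first passages, where `true` counts as `1` and `false` as `-1`. -/
def arrowSum (w : List (ι × Bool)) (L : Finset ι) : ℤ :=
  ∑ c ∈ L, ∑ d ∈ L, chordIndex w c d * orderSum w c d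

lemma orderSum_comm (w : List (ι × Bool)) (c d : ι) : orderSum w c d = -orderSum w d c := by
  simp only [orderSum, orderSign_comm w (c, _)]
  ring

lemma chordIndex_eq (w : List (ι × Bool)) (c d : ι) : chordIndex w c d =
    orderSign w (d, true) (c, true) - orderSign w (d, true) (c, false) -
      orderSign w (d, false) (c, true) + orderSign w (d, false) (c, false) := by
  simp only [chordIndex, chordFlow, Bool.not_true]
  ring

lemma arrowSum_congr {w w' : List (ι × Bool)} {L : Finset ι}
    (h : ∀ c ∈ L, ∀ d ∈ L, ∀ b b', orderSign w' (d, b') (c, b) = orderSign w (d, b') (c, b)) :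
    arrowSum w' L = arrowSum w L := by
  refine Finset.sum_congr rfl fun c hc => Finset.sum_congr rfl fun d hd => ?_
  simp only [chordIndex_eq, orderSum, h c hc d hd]

lemma sum_chordIndex (w : List (ι × Bool)) (L : Finset ι) (c : ι) :
    ∑ d ∈ L, chordIndex w c d = pairing L (chordFlow w (c, true)) 1 := by
  simp [chordIndex, pairing]

lemma arrowSum_shift {w w' : List (ι × Bool)} {L : Finset ι} (n : ι × Bool → ℤ)
    (h : ∀ c ∈ L, ∀ d ∈ L, ∀ b b', orderSign w' (d, b') (c, b) =
      orderSign w (d, b') (c, b) + 2 * (n (d, b') - n (c, b)))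
    (h0 : ∀ c ∈ L, ∑ d ∈ L, chordIndex w c d = 0) : arrowSum w' L = arrowSum w L := by
  have e : ∀ c ∈ L, ∀ d ∈ L, chordIndex w' c d * orderSum w' c d =
      chordIndex w c d * orderSum w c d -
        4 * (chordIndex w d c * (n (d, true) + n (d, false))) -
          4 * (chordIndex w c d * (n (c, true) + n (c, false))) := by
    intro c hc d hd
    have h1 : chordIndex w' c d = chordIndex w c d := by
      simp only [chordIndex_eq, h c hc d hd]; ring
    have h2 : orderSum w' c d = orderSum w c d +
        4 * (n (d, true) + n (d, false)) - 4 * (n (c, true) + n (c, false)) := by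
      simp only [orderSum, h c hc d hd]; ring
    rw [h1, h2, chordIndex_comm w d c]
    ring
  unfold arrowSum
  rw [Finset.sum_congr rfl fun c hc => Finset.sum_congr rfl fun d hd => e c hc d hd]
  simp only [Finset.sum_sub_distrib, ← Finset.mul_sum, ← Finset.sum_mul]
  rw [Finset.sum_comm (f := fun c d => chordIndex w d c * (n (d, true) + n (d, false)))]
  simp only [← Finset.sum_mul]
  have : ∑ c ∈ L, (∑ d ∈ L, chordIndex w c d) * (n (c, true) + n (c, false)) = 0 :=
    Finset.sum_eq_zero fun c hc => by rw [h0 c hc, zero_mul]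
  rw [this]
  ring

lemma Isotropic.sum_chordIndex {w : List (ι × Bool)} (hw : PairedWord w) (hi : Isotropic w) {c : ι}
    (hc : c ∈ labels w) : ∑ d ∈ labels w, chordIndex w c d = 0 := by
  rw [_root_.sum_chordIndex]
  exact (hi _ ((hw.mem_labels true).1 hc)).1

lemma Isotropic.arrowSum_rotate {u v : List (ι × Bool)} (h : PairedWord (u ++ v))
    (hi : Isotropic (u ++ v)) :
    arrowSum (v ++ u) (labels (v ++ u)) = arrowSum (u ++ v) (labels (u ++ v)) := by
  rw [← labels_perm (List.perm_append_comm : (u ++ v).Perm (v ++ u))]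
  exact arrowSum_shift (inWord u) (fun c hc d hd b b' =>
    orderSign_rotate h ((h.mem_labels _).1 hd) ((h.mem_labels _).1 hc))
    fun c hc => hi.sum_chordIndex h hc

/-- The arrow sum of a word, compared with the word in which a part `y` without pairs is run through
in the reverse direction. -/
lemma arrowSum_add_twistWord {y z : List (ι × Bool)} (h : PairedWord (y ++ z))
    (hy : ∀ l ∈ y, (l.1, !l.2) ∉ y) :
    arrowSum (y ++ z) (labels (y ++ z)) + arrowSum (twistWord y z) (labels (y ++ z)) =
      2 * arrowSum (y ++ z) ((labels (y ++ z)).filter fun c => ¬OddIn y c) +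
        4 * ((∑ c ∈ labels (y ++ z), (inWord y (c, true) - inWord y (c, false))) ^ 2 -
          ((labels (y ++ z)).filter fun c => OddIn y c).card) := by
  set L := labels (y ++ z)
  have hin : ∀ c, (inWord y (c, true) = 0 ∧ inWord y (c, false) = 0 ∧ ¬OddIn y c ∧
      ∀ b, flipMark y (c, b) = (c, b)) ∨
      (inWord y (c, true) = 1 ∧ inWord y (c, false) = 0 ∧ OddIn y c ∧
        ∀ b, flipMark y (c, b) = (c, !b)) ∨
      (inWord y (c, true) = 0 ∧ inWord y (c, false) = 1 ∧ OddIn y c ∧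
        ∀ b, flipMark y (c, b) = (c, !b)) := by
    intro c
    have := hy (c, true)
    unfold inWord flipMark OddIn
    by_cases h1 : (c, true) ∈ y <;> by_cases h2 : (c, false) ∈ y <;> simp_all
  have key : ∀ c ∈ L, ∀ d ∈ L, chordIndex (y ++ z) c d * orderSum (y ++ z) c d +
      chordIndex (twistWord y z) c d * orderSum (twistWord y z) c d =
      2 * (if ¬OddIn y c then (if ¬OddIn y d then chordIndex (y ++ z) c d * orderSum (y ++ z) c d
        else 0) else 0) +
      (4 * ((inWord y (c, true) - inWord y (c, false)) * (inWord y (d, true) - inWord y (d, false)))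
        - if c = d then (if OddIn y c then 4 else 0) else 0) := by
    intro c hc d hd
    by_cases hcd : c = d
    · subst hcd
      rw [chordIndex_self, chordIndex_self]
      rcases hin c with ⟨h1, h2, h3, -⟩ | ⟨h1, h2, h3, -⟩ | ⟨h1, h2, h3, -⟩ <;>
        simp [h1, h2, h3]
    -- The claim is now a finite check over the possible orders of the four passages.
    have q := fun b b' => @linked_append_facts ι _ _ y z (d, b) (c, b')
    have r : ∀ b b', orderSign (y ++ z) (d, b) (c, b') = 1 ∨
        orderSign (y ++ z) (d, b) (c, b') = -1 :=
      fun b b' => orderSign_cases ((h.mem_labels b).1 hd) (fun e => hcd (Prod.ext_iff.1 e).1.symm)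
    have o := fun b b' => orderSign_twistWord h (d, b) (c, b')
    have q1 := q true true
    have q2 := q true false
    have q3 := q false true
    have q4 := q false false
    have r1 := r true true
    have r2 := r true false
    have r3 := r false true
    have r4 := r false false
    have o1 := o true true
    have o2 := o true false
    have o3 := o false true
    have o4 := o false false
    clear q r o
    simp only [chordIndex_eq, orderSum]
    generalize orderSign (y ++ z) (d, true) (c, true) = x1 at *
    generalize orderSign (y ++ z) (d, true) (c, false) = x2 at *
    generalize orderSign (y ++ z) (d, false) (c, true) = x3 at *
    generalize orderSign (y ++ z) (d, false) (c, false) = x4 at *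
    rcases hin c with ⟨h1, h2, h3, h4⟩ | ⟨h1, h2, h3, h4⟩ | ⟨h1, h2, h3, h4⟩ <;>
      rcases hin d with ⟨k1, k2, k3, k4⟩ | ⟨k1, k2, k3, k4⟩ | ⟨k1, k2, k3, k4⟩ <;>
      simp only [h1, h2, k1, k2, h4, k4, Bool.not_true, Bool.not_false] at q1 q2 q3 q4 o1 o2 o3 o4 ⊢
      <;> simp only [o1, o2, o3, o4, h3, k3, hcd, if_false, if_true, not_true, not_false_iff] <;>
      clear h1 h2 h3 h4 k1 k2 k3 k4 o1 o2 o3 o4 <;>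
      rcases r1 with rfl | rfl <;> rcases r2 with rfl | rfl <;> rcases r3 with rfl | rfl <;>
      rcases r4 with rfl | rfl <;> simp at q1 q2 q3 q4 ⊢
  have hsum : ∑ c ∈ L, ∑ d ∈ L, (if c = d then (if OddIn y c then (4 : ℤ) else 0) else 0) =
      4 * (L.filter fun c => OddIn y c).card := by
    simp only [Finset.sum_ite_eq]
    rw [Finset.sum_congr rfl (g := fun c => if OddIn y c then (4 : ℤ) else 0)
      (fun c hc => by simp [hc])]
    rw [← Finset.sum_filter, Finset.sum_const, nsmul_eq_mul, mul_comm]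
  unfold arrowSum
  rw [← Finset.sum_add_distrib, Finset.sum_congr rfl fun c hc => by
    rw [← Finset.sum_add_distrib, Finset.sum_congr rfl fun d hd => key c hc d hd]]
  simp only [Finset.sum_add_distrib, Finset.sum_sub_distrib, ← Finset.mul_sum, hsum]
  rw [Finset.sum_filter, ← Finset.sum_mul, pow_two]
  simp only [Finset.sum_filter]
  have : ∀ c, (∑ d ∈ L, if ¬OddIn y c then (if ¬OddIn y d then
      chordIndex (y ++ z) c d * orderSum (y ++ z) c d else 0) else 0) =
      if ¬OddIn y c then (∑ d ∈ L, if ¬OddIn y d then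
        chordIndex (y ++ z) c d * orderSum (y ++ z) c d else 0) else 0 := by
    intro c
    split_ifs <;> simp
  simp only [this, Finset.sum_sub_distrib]
  ring

lemma chordIndex_cons {y z : List (ι × Bool)} {c : ι} {b : Bool}
    (hw : PairedWord ((c, b) :: y ++ (c, !b) :: z)) {d : ι} (hd : d ∈ labels (y ++ z)) :
    chordIndex ((c, b) :: y ++ (c, !b) :: z) c d =
      (if b then 1 else -1) * (2 * (inWord y (d, true) - inWord y (d, false))) := by
  obtain ⟨h1, h2⟩ := hw.remove
  have e : ∀ b', chordFlow ((c, b) :: y ++ (c, !b) :: z) (c, b) (d, b') = 2 * inWord y (d, b') :=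
    fun b' => chordFlow_cons hw ((h1.mem_labels _).1 hd)
  unfold chordIndex
  cases b
  · have := chordFlow_not ((c, false) :: y ++ (c, !false) :: z) (c, false)
    simp only [Bool.not_false] at this
    simp only [Bool.not_false] at e
    rw [Bool.not_false, this, this, e, e]
    simp only [Bool.false_eq_true, if_false]
    ring
  · rw [e, e]
    simp only [if_true]
    ring

/-- The sum of the marks of the passages between two passages through the same crossing vanishes. -/
lemma Isotropic.sum_inWord {y z : List (ι × Bool)} {c : ι} {b : Bool}
    (hw : PairedWord ((c, b) :: y ++ (c, !b) :: z))
    (hi : Isotropic ((c, b) :: y ++ (c, !b) :: z)) :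
    ∑ d ∈ labels (y ++ z), (inWord y (d, true) - inWord y (d, false)) = 0 := by
  have hz := notMem_labels hw.remove.2
  have h := hi.sum_chordIndex hw (c := c) (by rw [labels_remove]; exact Finset.mem_insert_self _ _)
  rw [labels_remove, Finset.sum_insert hz, chordIndex_self,
    Finset.sum_congr rfl fun d hd => chordIndex_cons hw hd, ← Finset.mul_sum, ← Finset.mul_sum] at h
  split_ifs at h <;> omega

lemma orderSum_cons {y z : List (ι × Bool)} {c : ι} {b : Bool}
    (hw : PairedWord ((c, b) :: y ++ (c, !b) :: z)) {d : ι} (hd : d ∈ labels (y ++ z)) :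
    orderSum ((c, b) :: y ++ (c, !b) :: z) c d =
      4 - 2 * (inWord y (d, true) + inWord y (d, false)) := by
  obtain ⟨h1, h2⟩ := hw.remove
  have hdc : d ≠ c := fun e => notMem_labels h2 (e ▸ hd)
  have hcy : (c, !b) ∉ y := fun h => h2 _ (List.mem_append_left _ h) rfl
  have k : ∀ x, orderSign ((c, b) :: y ++ (c, !b) :: z) (d, x) (c, b) = 1 ∧
      orderSign ((c, b) :: y ++ (c, !b) :: z) (d, x) (c, !b) = 1 - 2 * inWord y (d, x) := by
    intro x
    rw [List.cons_append, orderSign_cons_gt (by simp [hdc]),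
      orderSign_cons (by simp [hdc]) (by simp)]
    refine ⟨rfl, ?_⟩
    by_cases h : (d, x) ∈ y
    · rw [orderSign_append_lt h hcy]; simp [inWord, h]
    · rw [orderSign_append_right h hcy, orderSign_cons_gt (by simp [hdc])]; simp [inWord, h]
  have k1 := k true
  have k2 := k false
  unfold orderSum
  cases b <;> simp only [Bool.not_true, Bool.not_false] at k1 k2 ⊢ <;>
    rw [k1.1, k1.2, k2.1, k2.2] <;> ring

/-- A crossing at the base point does not contribute to the arrow sum. -/
lemma Isotropic.arrowSum_remove {y z : List (ι × Bool)} {c : ι} {b : Bool}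
    (hw : PairedWord ((c, b) :: y ++ (c, !b) :: z))
    (hi : Isotropic ((c, b) :: y ++ (c, !b) :: z)) :
    arrowSum ((c, b) :: y ++ (c, !b) :: z) (labels ((c, b) :: y ++ (c, !b) :: z)) =
      arrowSum (y ++ z) (labels (y ++ z)) := by
  have hz := notMem_labels hw.remove.2
  have hr : arrowSum ((c, b) :: y ++ (c, !b) :: z) (labels (y ++ z)) =
      arrowSum (y ++ z) (labels (y ++ z)) :=
    arrowSum_congr fun d hd e he _ _ => orderSign_remove (fun h => hz (h ▸ he))
      (fun h => hz (h ▸ hd))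
  have hk : ∀ d ∈ labels (y ++ z), chordIndex ((c, b) :: y ++ (c, !b) :: z) c d *
      orderSum ((c, b) :: y ++ (c, !b) :: z) c d =
        (if b then 1 else -1) * 4 * (inWord y (d, true) - inWord y (d, false)) := by
    intro d hd
    rw [chordIndex_cons hw hd, orderSum_cons hw hd]
    rcases inWord_eq y (d, true) with h1 | h1 <;> rcases inWord_eq y (d, false) with h2 | h2 <;>
      rw [h1, h2] <;> split_ifs <;> norm_num
  have h0 : ∑ d ∈ labels (y ++ z), chordIndex ((c, b) :: y ++ (c, !b) :: z) c d *
      orderSum ((c, b) :: y ++ (c, !b) :: z) c d = 0 := by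
    rw [Finset.sum_congr rfl hk, ← Finset.mul_sum, hi.sum_inWord hw, mul_zero]
  rw [← hr]
  unfold arrowSum
  rw [labels_remove, Finset.sum_insert hz, Finset.sum_insert hz, chordIndex_self, h0]
  have : ∀ d ∈ labels (y ++ z), ∑ e ∈ insert c (labels (y ++ z)),
      chordIndex ((c, b) :: y ++ (c, !b) :: z) d e * orderSum ((c, b) :: y ++ (c, !b) :: z) d e =
      chordIndex ((c, b) :: y ++ (c, !b) :: z) c d * orderSum ((c, b) :: y ++ (c, !b) :: z) c d +
      ∑ e ∈ labels (y ++ z),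
        chordIndex ((c, b) :: y ++ (c, !b) :: z) d e * orderSum ((c, b) :: y ++ (c, !b) :: z) d e := by
    intro d _
    rw [Finset.sum_insert hz, chordIndex_comm _ d c, orderSum_comm _ d c, neg_mul_neg]
  rw [Finset.sum_congr rfl this, Finset.sum_add_distrib, h0]
  simp

/-- The crossings outside of `y` satisfy the first condition on isotropic words by themselves. -/
lemma Isotropic.sum_chordIndex_outside {y z : List (ι × Bool)} {c : ι} {b : Bool}
    (hw : PairedWord ((c, b) :: y ++ (c, !b) :: z))
    (hi : Isotropic ((c, b) :: y ++ (c, !b) :: z)) (hy : ∀ l ∈ y, (l.1, !l.2) ∉ y) {d : ι}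
    (hd : d ∈ labels (y ++ z)) (hdo : ¬OddIn y d) :
    ∑ e ∈ (labels (y ++ z)).filter (fun e => ¬OddIn y e),
      chordIndex ((c, b) :: y ++ (c, !b) :: z) d e = 0 := by
  obtain ⟨h1, h2⟩ := hw.remove
  have hz := notMem_labels h2
  have hdc : d ≠ c := fun h => hz (h ▸ hd)
  have hmem : ∀ e ∈ labels (y ++ z), ∀ x, (e, x) ∈ y ++ z := fun e he x => (h1.mem_labels x).1 he
  have hsub : ∀ l, l ∈ y ++ z → l ∈ (c, b) :: y ++ (c, !b) :: z := by
    intro l hl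
    simp only [List.mem_append, List.mem_cons] at hl ⊢
    tauto
  have hno : ∀ x, (d, x) ∉ y := by
    intro x hx
    have := hy _ hx
    exact hdo ((oddIn_iff x).2 (by simp_all))
  have i1 := hi.pairing_eq_zero (chordFlow_mem_flowSpan (hsub _ (hmem d hd true)))
    (Submodule.sub_mem _ (Submodule.smul_mem _ 2 (one_mem_flowSpan _))
      (chordFlow_mem_flowSpan (m := (c, b)) (by simp)))
  rw [labels_remove] at i1
  unfold pairing at i1
  obtain ⟨k1, k2⟩ := chordFlow_cons_other hw (m := (d, true)) hdc
  have k3 : ∀ x, chordFlow ((c, b) :: y ++ (c, !b) :: z) (d, true) (c, x) = 0 := by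
    intro x
    by_cases hx : x = b
    · rw [hx, k1]
    · have : x = !b := by cases x <;> cases b <;> simp_all
      rw [this, k2]
      simp [inWord, hno]
  rw [Finset.sum_insert hz, k3, k3, zero_mul, zero_mul, sub_zero, zero_add] at i1
  have key : ∀ e ∈ labels (y ++ z),
      chordFlow ((c, b) :: y ++ (c, !b) :: z) (d, true) (e, true) *
        ((2 : ℤ) • (1 : ι × Bool → ℤ) - chordFlow ((c, b) :: y ++ (c, !b) :: z) (c, b)) (e, false) -
      chordFlow ((c, b) :: y ++ (c, !b) :: z) (d, true) (e, false) *
        ((2 : ℤ) • (1 : ι × Bool → ℤ) - chordFlow ((c, b) :: y ++ (c, !b) :: z) (c, b)) (e, true) =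
      if ¬OddIn y e then 2 * chordIndex ((c, b) :: y ++ (c, !b) :: z) d e else 0 := by
    intro e he
    have hz0 : ∀ x, (e, x) ∈ y → chordFlow ((c, b) :: y ++ (c, !b) :: z) (d, true) (e, x) = 0 := by
      intro x hx
      rw [chordFlow_remove (h2 _ (hmem e he x)) hdc]
      unfold chordFlow
      rw [orderSign_append_lt hx (hno _), orderSign_append_lt hx (hno _)]
      rfl
    simp only [Pi.sub_apply, Pi.smul_apply, Pi.one_apply, smul_eq_mul,
      chordFlow_cons hw (hmem e he _)]
    have hye := hy (e, true)
    by_cases a1 : (e, true) ∈ y <;> by_cases a2 : (e, false) ∈ y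
    · exact absurd a2 (hye a1)
    · have : OddIn y e := by simp [OddIn, a1, a2]
      have h0 := hz0 _ a1
      rw [List.cons_append] at h0
      simp [inWord, a1, a2, this, h0]
    · have : OddIn y e := by simp [OddIn, a1, a2]
      have h0 := hz0 _ a2
      rw [List.cons_append] at h0
      simp [inWord, a1, a2, this, h0]
    · have : ¬OddIn y e := by simp [OddIn, a1, a2]
      simp only [inWord, a1, a2, this, if_false, not_false_iff, if_true, chordIndex]
      ring
  rw [Finset.sum_congr rfl key, ← Finset.sum_filter, ← Finset.mul_sum] at i1
  omega

/-- The number of circles, averaged over all smoothings with the weights that give the value of the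
Jones polynomial at `1`, is determined by the arrow sum. -/
theorem Isotropic.eval_derivative {w : List (ι × Bool)} (hw : PairedWord w) (hi : Isotropic w) :
    4 * (derivative (signedLoopPoly w)).eval (-2) =
      4 + 8 * (labels w).card + 3 * arrowSum w (labels w) := by
  induction hn : w.length using Nat.strong_induction_on generalizing w with
  | _ n ih =>
    by_cases hne : w = []
    · rw [hne, signedLoopPoly_nil]; simp [labels, arrowSum]
    -- After rotation the word begins at an innermost crossing `c`, which is a kink or is linked with
    -- the crossing `p` that is passed next; all words in the recurrence for a linked pair are shorter.
    obtain ⟨x, t, c, b, rfl, h⟩ := hw.exists_normal_form hne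
    have hlen : (t ++ x).length = n := by rw [← hn]; simp [add_comm]
    rw [signedLoopPoly_rotate hw, ← hi.arrowSum_rotate hw,
      labels_perm (List.perm_append_comm : (x ++ t).Perm (t ++ x))]
    have hi := hi.rotate hw
    have hw := hw.rotate
    rcases h with ⟨z, h⟩ | ⟨p, b', z, u, v, h, hy⟩
    · rw [h] at hw hlen hi ⊢
      have hr : PairedWord z := (PairedWord.remove (y := []) hw).1
      have hz : c ∉ labels z := notMem_labels (PairedWord.remove (y := []) hw).2
      have e1 := hi.kink hw
      have e2 := ih _ (by simp at hlen; omega) hr e1 rfl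
      have e3 := Isotropic.arrowSum_remove (y := []) hw hi
      have e4 := labels_remove (c := c) (b := b) (y := []) (z := z)
      simp only [List.cons_append, List.nil_append] at e3 e4
      rw [signedLoopPoly_kink hw, e3, e4, Finset.card_insert_of_notMem hz]
      simp only [derivative_mul, derivative_neg, derivative_add, derivative_X, derivative_one,
        add_zero, eval_add, eval_mul, eval_neg, eval_one, eval_X, eval_signedLoopPoly hr]
      push_cast
      linarith
    · rw [h] at hw hlen hi ⊢
      obtain ⟨hr, hr'⟩ := hw.remove
      obtain ⟨s1, s2⟩ := hi.smooth_linked hw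
      obtain ⟨n1, n2, n3, -⟩ := idxOf_linked hw
      have s3 := hi.twist hw
      simp at hlen
      have e1 := ih _ (by simp; omega) n3 s1 rfl
      have e2 := ih _ (by simp [twistWord]; omega) n3.twist s2 rfl
      have e3 := ih _ (by simp [twistWord]; omega) hr.twist s3 rfl
      have hz := notMem_labels hr'
      have e4 := labels_remove (c := p) (b := b') (y := z ++ u) (z := v)
      have e5 : (p, b') :: z ++ (u ++ (p, !b') :: v) = (p, b') :: (z ++ u) ++ (p, !b') :: v := by
        simp
      have hpz : p ∉ labels (z ++ (v ++ u)) := notMem_labels fun l hl => (n1 l hl).2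
      have hlab : labels ((p, b') :: z ++ (u ++ (p, !b') :: v)) =
          insert p (labels (z ++ (v ++ u))) := by
        rw [e5, e4, labels_perm (v := z ++ u ++ v) (w := z ++ (v ++ u))]
        rw [List.append_assoc]; exact List.Perm.append_left _ List.perm_append_comm
      have hyz : ∀ l ∈ z, (l.1, !l.2) ∉ z := fun l hl hl' =>
        hy l (List.mem_cons_of_mem _ hl) (List.mem_cons_of_mem _ hl')
      -- The recurrence for the arrow sums consists of the two relations `t1` and `t2` between a word and
      -- the word with a part reversed; their common term is identified by `hrot`.
      have t1 := arrowSum_add_twistWord hr hy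
      have t2 := arrowSum_add_twistWord n3 hyz
      have hnp : ∀ x, (p, x) ∉ z := fun x hx => (n1 _ (List.mem_append_left _ hx)).2 rfl
      have hin : ∀ d ≠ p, ∀ x, inWord ((p, b') :: z) (d, x) = inWord z (d, x) := by
        intro d hd x
        simp [inWord, hd]
      have hodd : ∀ d ≠ p, (OddIn ((p, b') :: z) d ↔ OddIn z d) := by
        intro d hd
        simp [OddIn, hd]
      have hoddp : OddIn ((p, b') :: z) p := by
        cases b' <;> simp [OddIn, hnp]
      have hin0 := hi.sum_inWord hw
      have hfil : (labels ((p, b') :: z ++ (u ++ (p, !b') :: v))).filter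
          (fun d => ¬OddIn ((p, b') :: z) d) =
          (labels (z ++ (v ++ u))).filter fun d => ¬OddIn z d := by
        rw [hlab, Finset.filter_insert, if_neg (by simpa using hoddp)]
        refine Finset.filter_congr fun d hd => ?_
        rw [hodd d (fun e => hpz (e ▸ hd))]
      have hfil2 : ((labels ((p, b') :: z ++ (u ++ (p, !b') :: v))).filter
          (fun d => OddIn ((p, b') :: z) d)).card =
          ((labels (z ++ (v ++ u))).filter fun d => OddIn z d).card + 1 := by
        rw [hlab, Finset.filter_insert, if_pos hoddp, Finset.card_insert_of_notMem (by simp [hpz])]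
        congr 2
        exact Finset.filter_congr fun d hd => hodd d (fun e => hpz (e ▸ hd))
      have hrot : arrowSum (z ++ (v ++ u)) ((labels (z ++ (v ++ u))).filter fun d => ¬OddIn z d) =
          arrowSum ((p, b') :: z ++ (u ++ (p, !b') :: v))
            ((labels (z ++ (v ++ u))).filter fun d => ¬OddIn z d) := by
        have a1 : arrowSum ((c, b) :: ((p, b') :: z) ++ (c, !b) :: (u ++ (p, !b') :: v))
            ((labels (z ++ (v ++ u))).filter fun d => ¬OddIn z d) =
            arrowSum ((p, b') :: z ++ (u ++ (p, !b') :: v))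
            ((labels (z ++ (v ++ u))).filter fun d => ¬OddIn z d) := by
          refine arrowSum_congr fun d hd e he x x' => orderSign_remove ?_ ?_
          · exact (n1 _ ((n3.mem_labels x').1 (Finset.mem_filter.1 he).1)).1
          · exact (n1 _ ((n3.mem_labels x).1 (Finset.mem_filter.1 hd).1)).1
        have hnz : ∀ d ∈ (labels (z ++ (v ++ u))).filter (fun d => ¬OddIn z d), ∀ x,
            inWord z (d, x) = 0 := by
          intro d hd x
          rw [Finset.mem_filter, oddIn_iff x] at hd
          unfold inWord
          rw [if_neg]
          intro hx
          have := hyz _ hx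
          tauto
        rw [← a1]
        refine arrowSum_shift (inWord u) (fun d hd e he x x' => ?_) (fun d hd => ?_)
        · have hd' := (n3.mem_labels x).1 (Finset.mem_filter.1 hd).1
          have he' := (n3.mem_labels x').1 (Finset.mem_filter.1 he).1
          obtain ⟨o1, o2⟩ := orderSign_linked hw he' hd'
          obtain ⟨-, o3⟩ := orderSign_linked hw he' he'
          rw [hnz d hd] at o2
          rw [hnz e he] at o3
          rw [o1]
          linear_combination 2 * inWord u (e, x') * o2 - 2 * inWord u (d, x) * o3
        · rw [← hfil]
          rw [← hfil, Finset.mem_filter] at hd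
          exact hi.sum_chordIndex_outside hw hy hd.1 hd.2
      rw [hlab, Finset.sum_insert hpz] at hin0 t1
      rw [Finset.sum_congr rfl fun d hd => by
        rw [hin d (fun e => hpz (e ▸ hd)), hin d (fun e => hpz (e ▸ hd))]] at hin0 t1
      rw [hlab] at hfil hfil2
      rw [hfil, hfil2, ← hrot, hin0] at t1
      -- The crossing `p` contributes `1` or `-1` to a vanishing sum.
      have hsq : (∑ d ∈ labels (z ++ (v ++ u)), (inWord z (d, true) - inWord z (d, false))) ^ 2 =
          1 := by
        have : inWord ((p, b') :: z) (p, true) - inWord ((p, b') :: z) (p, false) = 1 ∨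
            inWord ((p, b') :: z) (p, true) - inWord ((p, b') :: z) (p, false) = -1 := by
          cases b' <;> simp [inWord, hnp]
        rcases this with h | h <;> rw [h] at hin0
        · have : ∑ d ∈ labels (z ++ (v ++ u)), (inWord z (d, true) - inWord z (d, false)) = -1 := by
            omega
          rw [this]; norm_num
        · have : ∑ d ∈ labels (z ++ (v ++ u)), (inWord z (d, true) - inWord z (d, false)) = 1 := by
            omega
          rw [this]; norm_num
      rw [hsq] at t2
      have e6 := hi.arrowSum_remove hw
      rw [signedLoopPoly_linked hw, e6, labels_remove, Finset.card_insert_of_notMem hz, hlab,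
        Finset.card_insert_of_notMem hpz]
      rw [labels_twistWord] at e2 e3
      rw [hlab, Finset.card_insert_of_notMem hpz] at e3
      simp only [derivative_add, derivative_sub, eval_add, eval_sub]
      push_cast at *
      linarith

end ArrowSum

/-! ### Words of planar diagrams -/

section PairedSums

variable {ι : Type*} [Fintype ι] [DecidableEq ι]

lemma PairedWord.sum_map {w : List (ι × Bool)} (hw : PairedWord w) {M : Type*} [AddCommMonoid M]
    (g : ι × Bool → M) : (w.map g).sum = ∑ c ∈ labels w, (g (c, true) + g (c, false)) := by
  rw [← List.sum_toFinset _ hw.1]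
  have : w.toFinset = labels w ×ˢ (Finset.univ : Finset Bool) := by
    ext ⟨c, b⟩
    simp [hw.mem_labels b]
  rw [this, Finset.sum_product]
  exact Finset.sum_congr rfl fun c _ => by simp

lemma PairedWord.length_eq {w : List (ι × Bool)} (hw : PairedWord w) :
    w.length = 2 * (labels w).card := by
  have := hw.sum_map (fun _ => 1)
  simp at this
  omega

end PairedSums

namespace GaussWord

/-- The label and the mark of a passage. The mark is `true` for the strand from south-west to
north-east if both strands of the crossing are drawn upwards. -/
def flatLetter (N : ℕ) (p : Passage) : Fin (N + 1) × Bool :=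
  (Fin.ofNat (N + 1) p.label, decide (p.isOver = true ↔ p.sign = 1))

/-- The underlying plane curve of a diagram, without the information which strand is on top. The
labels are assumed to be at most `N`. -/
def flatten (N : ℕ) (w : GaussWord) : List (Fin (N + 1) × Bool) := w.map (flatLetter N)

lemma fin_ofNat_inj {N a b : ℕ} (ha : a ≤ N) (hb : b ≤ N) :
    Fin.ofNat (N + 1) a = Fin.ofNat (N + 1) b ↔ a = b := by
  rw [Fin.ext_iff]
  simp only [Fin.val_ofNat]
  rw [Nat.mod_eq_of_lt (by omega), Nat.mod_eq_of_lt (by omega)]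

lemma WellFormed.sign_eq {w : GaussWord} (hw : w.WellFormed) {p q : Passage} (hp : p ∈ w)
    (hq : q ∈ w) (h : p.label = q.label) (ho : p.isOver = q.isOver) : p = q :=
  List.inj_on_of_nodup_map hw.1 hp hq (by simp [h, ho])

lemma WellFormed.sign_eq_of_ne {w : GaussWord} (hw : w.WellFormed) {p q : Passage} (hp : p ∈ w)
    (hq : q ∈ w) (h : p.label = q.label) (ho : p.isOver ≠ q.isOver) :
    q = ⟨p.label, !p.isOver, p.sign⟩ := by
  refine hw.sign_eq hq (hw.2 p hp) h.symm ?_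
  cases h1 : p.isOver <;> cases h2 : q.isOver <;> simp_all

lemma WellFormed.sign_eq' {w : GaussWord} (hw : w.WellFormed) {p q : Passage} (hp : p ∈ w)
    (hq : q ∈ w) (h : p.label = q.label) : p.sign = q.sign := by
  by_cases ho : p.isOver = q.isOver
  · rw [hw.sign_eq hp hq h ho]
  · rw [hw.sign_eq_of_ne hp hq h ho]

variable {N : ℕ}

lemma flatLetter_partner (p : Passage) : flatLetter N ⟨p.label, !p.isOver, p.sign⟩ =
    ((flatLetter N p).1, !(flatLetter N p).2) := by
  unfold flatLetter
  cases h : p.isOver <;> by_cases hs : p.sign = 1 <;> simp [hs]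

lemma flatLetter_injOn {w : GaussWord} (hw : w.WellFormed) (hN : ∀ p ∈ w, p.label ≤ N)
    {p q : Passage} (hp : p ∈ w) (hq : q ∈ w) (h : flatLetter N p = flatLetter N q) : p = q := by
  obtain ⟨h1, h2⟩ := Prod.ext_iff.1 h
  have h3 := (fin_ofNat_inj (hN p hp) (hN q hq)).1 h1
  by_cases ho : p.isOver = q.isOver
  · exact hw.sign_eq hp hq h3 ho
  · rw [hw.sign_eq_of_ne hp hq h3 ho, flatLetter_partner] at h
    have := (Prod.ext_iff.1 h).2
    simp at this

lemma WellFormed.pairedWord {w : GaussWord} (hw : w.WellFormed) (hN : ∀ p ∈ w, p.label ≤ N) :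
    PairedWord (w.flatten N) := by
  constructor
  · exact List.Nodup.map_on (fun p hp q hq h => flatLetter_injOn hw hN hp hq h)
      (List.Nodup.of_map _ hw.1)
  · intro l hl
    obtain ⟨p, hp, rfl⟩ := List.mem_map.1 hl
    exact List.mem_map.2 ⟨_, hw.2 p hp, flatLetter_partner p⟩

lemma idxOf_flatten {w : GaussWord} (hw : w.WellFormed) (hN : ∀ p ∈ w, p.label ≤ N)
    (i : Fin w.length) : (w.flatten N).idxOf (flatLetter N (w.get i)) = i := by
  have hlen : (w.flatten N).length = w.length := by simp [flatten]
  have := (hw.pairedWord hN).1.idxOf_getElem i (by omega)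
  simpa [flatten] using this

lemma exists_get {w : GaussWord} {l : Fin (N + 1) × Bool} (hl : l ∈ w.flatten N) :
    ∃ i : Fin w.length, flatLetter N (w.get i) = l := by
  obtain ⟨p, hp, rfl⟩ := List.mem_map.1 hl
  obtain ⟨i, hi⟩ := List.get_of_mem hp
  exact ⟨i, by rw [hi]⟩

lemma sum_flatten {w : GaussWord} {M : Type*} [AddCommMonoid M] (g : Fin (N + 1) × Bool → M) :
    ((w.flatten N).map g).sum = ∑ i : Fin w.length, g (flatLetter N (w.get i)) := by
  rw [flatten, List.map_map, ← List.sum_ofFn]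
  congr 1
  apply List.ext_getElem <;> simp

/-- Flows on the edges: at every crossing, as much flows in as out. -/
def flows (N : ℕ) (w : GaussWord) : Submodule ℚ (Fin (w.length + 1) → ℚ) where
  carrier := {z | z 0 = z (Fin.last _) ∧ ∀ a b : Fin w.length,
    flatLetter N (w.get b) = ((flatLetter N (w.get a)).1, !(flatLetter N (w.get a)).2) →
    z a.castSucc + z b.castSucc = z a.succ + z b.succ}
  add_mem' := by
    rintro x y ⟨h1, h2⟩ ⟨h3, h4⟩
    refine ⟨by simp [h1, h3], fun a b h => ?_⟩
    have := h2 a b h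
    have := h4 a b h
    simp only [Pi.add_apply]
    linarith
  zero_mem' := by simp
  smul_mem' := by
    rintro t x ⟨h1, h2⟩
    refine ⟨by simp [h1], fun a b h => ?_⟩
    have := h2 a b h
    simp only [Pi.smul_apply, smul_eq_mul]
    linear_combination t * this

/-- The flow which is the coboundary of a function on the faces. -/
noncomputable def faceFlow (w : GaussWord) :
    (Quot w.Corner → ℚ) →ₗ[ℚ] (Fin (w.length + 1) → ℚ) where
  toFun φ e := φ (Quot.mk _ (e, true)) - φ (Quot.mk _ (e, false))
  map_add' φ ψ := by
    funext e
    simp only [Pi.add_apply]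
    ring
  map_smul' t φ := by
    funext e
    simp only [Pi.smul_apply, smul_eq_mul, RingHom.id_apply]
    ring

/-- The relations between the values of a function on the faces around a crossing. -/
lemma corner_relations {w : GaussWord} (hN : ∀ p ∈ w, p.label ≤ N) {M : Type*}
    (φ : Quot w.Corner → M) {a b : Fin w.length} (ha : (flatLetter N (w.get a)).2 = true)
    (hb : flatLetter N (w.get b) = ((flatLetter N (w.get a)).1, false)) :
    φ (Quot.mk _ (a.succ, true)) = φ (Quot.mk _ (b.succ, false)) ∧
    φ (Quot.mk _ (b.succ, true)) = φ (Quot.mk _ (a.castSucc, true)) ∧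
    φ (Quot.mk _ (a.castSucc, false)) = φ (Quot.mk _ (b.castSucc, true)) ∧
    φ (Quot.mk _ (b.castSucc, false)) = φ (Quot.mk _ (a.succ, false)) := by
  obtain ⟨h1, h2⟩ := Prod.ext_iff.1 hb
  have h3 : (w.get a).label = (w.get b).label :=
    ((fin_ofNat_inj (hN _ (List.get_mem w b)) (hN _ (List.get_mem w a))).1 h1).symm
  have h4 : (w.get a).isOver = true ↔ (w.get a).sign = 1 := of_decide_eq_true ha
  have h5 : (w.get b).isOver = true ↔ ¬(w.get b).sign = 1 := by
    simp only [flatLetter, decide_eq_false_iff_not] at h2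
    tauto
  exact ⟨congrArg φ (Quot.sound (.north a b h3 h4 h5)), congrArg φ (Quot.sound (.west a b h3 h4 h5)),
    congrArg φ (Quot.sound (.south a b h3 h4 h5)), congrArg φ (Quot.sound (.east a b h3 h4 h5))⟩

lemma exists_partner {w : GaussWord} (hw : w.WellFormed) (hN : ∀ p ∈ w, p.label ≤ N)
    (a : Fin w.length) : ∃ b : Fin w.length,
      flatLetter N (w.get b) = ((flatLetter N (w.get a)).1, !(flatLetter N (w.get a)).2) :=
  exists_get ((hw.pairedWord hN).2 _ (List.mem_map_of_mem (List.get_mem w a)))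

lemma faceFlow_mem_flows {w : GaussWord} (hN : ∀ p ∈ w, p.label ≤ N)
    (φ : Quot w.Corner → ℚ) : faceFlow w φ ∈ flows N w := by
  constructor
  · exact congrArg₂ (· - ·) (congrArg φ (Quot.sound (.base true))) (congrArg φ (Quot.sound (.base false)))
  · intro a b h
    simp only [faceFlow, LinearMap.coe_mk, AddHom.coe_mk]
    cases hm : (flatLetter N (w.get a)).2
    · rw [hm] at h
      have h' : flatLetter N (w.get a) = ((flatLetter N (w.get b)).1, false) := by
        rw [h, ← hm]
      obtain ⟨h1, h2, h3, h4⟩ := corner_relations hN φ (by rw [h]; rfl) h'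
      linear_combination -h1 - h2 - h3 - h4
    · rw [hm] at h
      obtain ⟨h1, h2, h3, h4⟩ := corner_relations hN φ hm h
      linear_combination -h1 - h2 - h3 - h4

lemma eq_of_faceFlow_eq_zero {w : GaussWord} (hw : w.WellFormed) (hN : ∀ p ∈ w, p.label ≤ N)
    (φ : Quot w.Corner → ℚ) (h : faceFlow w φ = 0) (q : Quot w.Corner) :
    φ q = φ (Quot.mk _ (0, true)) := by
  have h0 : ∀ e, φ (Quot.mk _ (e, true)) = φ (Quot.mk _ (e, false)) := fun e =>
    sub_eq_zero.1 (congrFun h e)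
  have h1 : ∀ e, φ (Quot.mk _ (e, true)) = φ (Quot.mk _ (0, true)) := by
    intro e
    induction e using Fin.induction with
    | zero => rfl
    | succ i ih =>
      rw [← ih]
      obtain ⟨j, hj⟩ := exists_partner hw hN i
      cases hm : (flatLetter N (w.get i)).2
      · rw [hm] at hj
        obtain ⟨h1, h2, h3, h4⟩ := corner_relations hN φ (a := j) (b := i) (by rw [hj]; rfl)
          (by rw [hj, ← hm])
        rw [h0 i.succ, ← h1, h0, ← h4, h0]
      · rw [hm] at hj
        obtain ⟨h1, h2, h3, h4⟩ := corner_relations hN φ (a := i) (b := j) hm hj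
        rw [h1, ← h0, h2]
  induction q using Quot.ind with | _ q => ?_
  obtain ⟨e, s⟩ := q
  cases s
  · rw [← h0, h1]
  · exact h1 e

/-- A flow is determined by its value on edge `0` and its jumps at the passages marked `true`: the
jumps at the two passages through a crossing are opposite. -/
lemma finrank_flows_le {w : GaussWord} (hw : w.WellFormed) (hN : ∀ p ∈ w, p.label ≤ N) :
    Module.finrank ℚ (flows N w) ≤ (labels (w.flatten N)).card + 1 := by
  have hP := hw.pairedWord hN
  have hpos : ∀ c : labels (w.flatten N), ∃ i : Fin w.length,
      flatLetter N (w.get i) = ((c : Fin (N + 1)), true) := fun c =>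
    exists_get ((hP.mem_labels true).1 c.2)
  choose pos hpos using hpos
  let g : (Fin (w.length + 1) → ℚ) →ₗ[ℚ] (Option (labels (w.flatten N)) → ℚ) :=
    { toFun := fun z o => match o with
        | none => z 0
        | some c => z (pos c).succ - z (pos c).castSucc
      map_add' := by
        intro x y
        funext o
        cases o
        · rfl
        · simp only [Pi.add_apply]; ring
      map_smul' := by
        intro t x
        funext o
        cases o
        · rfl
        · simp only [Pi.smul_apply, smul_eq_mul, RingHom.id_apply]; ring }
  have hinj : Function.Injective (g.comp (flows N w).subtype) := by
    rw [← LinearMap.ker_eq_bot, LinearMap.ker_eq_bot']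
    rintro ⟨z, hz0, hz⟩ h
    have hg0 : z 0 = 0 := congrFun h none
    have hgc : ∀ c, z (pos c).succ - z (pos c).castSucc = 0 := fun c => congrFun h (some c)
    have hz1 : ∀ e, z e = 0 := by
      intro e
      induction e using Fin.induction with
      | zero => exact hg0
      | succ i ih =>
        have hmem : flatLetter N (w.get i) ∈ w.flatten N := List.mem_map_of_mem (List.get_mem w i)
        have hc := hgc ⟨_, mem_labels_of_mem hmem⟩
        have hp := hpos ⟨_, mem_labels_of_mem hmem⟩
        set j := pos ⟨_, mem_labels_of_mem hmem⟩
        cases hm : (flatLetter N (w.get i)).2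
        · have := hz j i (by rw [hp, Bool.not_true, ← hm])
          linarith
        · have hij : w.get i = w.get j := by
            refine flatLetter_injOn hw hN (List.get_mem w i) (List.get_mem w j) ?_
            rw [hp, ← hm]
          have hij' : i = j := (List.Nodup.of_map _ hw.1).injective_get hij
          rw [← hij'] at hc
          linarith
    exact Subtype.ext (funext hz1)
  have := LinearMap.finrank_le_finrank_of_injective hinj
  simpa using this

/-- On the sphere, every flow is the coboundary of a function on the faces. -/
lemma Planar.range_faceFlow {w : GaussWord} (hp : w.Planar) (hw : w.WellFormed)
    (hN : ∀ p ∈ w, p.label ≤ N) : LinearMap.range (faceFlow w) = flows N w := by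
  have hfin : Finite (Quot w.Corner) := Finite.of_surjective _ Quot.mk_surjective
  have := Fintype.ofFinite (Quot w.Corner)
  refine Submodule.eq_of_le_of_finrank_le ?_ ?_
  · rintro _ ⟨φ, rfl⟩
    exact faceFlow_mem_flows hN φ
  · have h1 := LinearMap.finrank_range_add_finrank_ker (faceFlow w)
    have h2 : Module.finrank ℚ (LinearMap.ker (faceFlow w)) ≤ 1 := by
      refine finrank_le_one ⟨1, ?_⟩ fun φ => ⟨φ.1 (Quot.mk _ (0, true)), ?_⟩
      · ext e; simp [faceFlow]
      · refine Subtype.ext (funext fun q => ?_)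
        rw [eq_of_faceFlow_eq_zero hw hN φ.1 φ.2 q]
        simp
    have h3 := finrank_flows_le hw hN
    have h4 : Module.finrank ℚ (Quot w.Corner → ℚ) = w.faceCount := by
      rw [Module.finrank_fintype_fun_eq_card, faceCount, Nat.card_eq_fintype_card]
    have h5 := (hw.pairedWord hN).length_eq
    have h6 : (w.flatten N).length = w.length := by simp [flatten]
    unfold Planar at hp
    omega

/-- The function on the edges which is `1` behind the position `k` and `-1` before it. -/
def edgeSide {w : GaussWord} (k : Fin w.length) (e : Fin (w.length + 1)) : ℚ :=
  if k.castSucc < e then 1 else -1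

lemma edgeSide_mean {w : GaussWord} (hw : w.WellFormed) (hN : ∀ p ∈ w, p.label ≤ N)
    (i k : Fin w.length) : edgeSide k i.castSucc + edgeSide k i.succ =
      2 * (orderSign (w.flatten N) (flatLetter N (w.get i)) (flatLetter N (w.get k)) : ℚ) := by
  unfold orderSign edgeSide
  rw [idxOf_flatten hw hN, idxOf_flatten hw hN]
  simp only [Fin.lt_def, Fin.val_castSucc, Fin.val_succ]
  split_ifs <;> first | omega | norm_num

lemma edgeSide_jump {w : GaussWord} (i k : Fin w.length) :
    edgeSide k i.succ - edgeSide k i.castSucc = if i = k then 2 else 0 := by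
  unfold edgeSide
  simp only [Fin.lt_def, Fin.val_castSucc, Fin.val_succ, Fin.ext_iff]
  split_ifs <;> first | omega | norm_num

lemma edgeSide_zero {w : GaussWord} (k : Fin w.length) : edgeSide k 0 = -1 := by
  simp [edgeSide]

lemma edgeSide_last {w : GaussWord} (k : Fin w.length) : edgeSide k (Fin.last _) = 1 := by
  simp [edgeSide, Fin.lt_def]

lemma sum_telescope {m : ℕ} (f : Fin (m + 1) → ℚ) :
    ∑ i : Fin m, (f i.succ - f i.castSucc) = f (Fin.last _) - f 0 := by
  induction m with
  | zero => simp
  | succ m ih =>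
    rw [Fin.sum_univ_castSucc]
    have := ih (fun i => f i.castSucc)
    simp only [Fin.succ_castSucc, Fin.succ_last] at *
    rw [this]
    simp

/-- The word of a diagram on the sphere is isotropic: a function on the faces whose coboundary is a
closed curve changes, along any other closed curve, by the intersection number. -/
theorem Planar.isotropic {w : GaussWord} (hp : w.Planar) (hw : w.WellFormed)
    (hN : ∀ p ∈ w, p.label ≤ N) : Isotropic (w.flatten N) := by
  have hP := hw.pairedWord hN
  have hr := hp.range_faceFlow hw hN
  have hnd := List.Nodup.of_map _ hw.1
  have hinj : ∀ i j : Fin w.length, flatLetter N (w.get i) = flatLetter N (w.get j) → i = j :=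
    fun i j h => hnd.injective_get
      (flatLetter_injOn hw hN (List.get_mem w i) (List.get_mem w j) h)
  set W := w.flatten N with hW
  choose bar hbar using exists_partner hw hN
  have hbb : ∀ i, bar (bar i) = i := fun i => hinj _ _ (by rw [hbar, hbar]; simp)
  -- The flow of the closed curve between the two passages through a crossing.
  let z : Fin w.length → Fin (w.length + 1) → ℚ := fun k e => edgeSide k e - edgeSide (bar k) e
  have hzmean : ∀ k i : Fin w.length, z k i.castSucc + z k i.succ =
      2 * (chordFlow W (flatLetter N (w.get k)) (flatLetter N (w.get i)) : ℚ) := by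
    intro k i
    have h1 := edgeSide_mean hw hN i k
    have h2 := edgeSide_mean hw hN i (bar k)
    rw [hbar] at h2
    simp only [z, chordFlow, Int.cast_sub]
    linear_combination h1 - h2
  have hzjump : ∀ k i : Fin w.length, z k i.succ - z k i.castSucc =
      (if i = k then 2 else 0) - if i = bar k then 2 else 0 := by
    intro k i
    rw [← edgeSide_jump, ← edgeSide_jump]
    simp only [z]
    ring
  have hz0 : ∀ k, z k 0 = 0 := fun k => by simp [z, edgeSide_zero]
  have hz1 : ∀ k, z k (Fin.last _) = 0 := fun k => by simp [z, edgeSide_last]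
  have hzflow : ∀ k, z k ∈ flows N w := by
    intro k
    refine ⟨by rw [hz0, hz1], fun a b hab => ?_⟩
    have hb : b = bar a := hinj _ _ (by rw [hab, hbar])
    have h1 := hzjump k a
    have h2 := hzjump k b
    have e1 : b = bar k ↔ a = k := by
      rw [hb]
      exact ⟨fun h => by rw [← hbb a, h, hbb], fun h => by rw [h]⟩
    have e2 : b = k ↔ a = bar k := by
      rw [hb]
      exact ⟨fun h => by rw [← h, hbb], fun h => by rw [h, hbb]⟩
    simp only [e1, e2] at h2
    linarith
  have hpot : ∀ k, ∃ φ, faceFlow w φ = z k := fun k => by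
    have := hzflow k
    rwa [← hr] at this
  choose φ hφ using hpot
  -- Twice the mean of the potential on the two sides of an edge.
  let ψ : Fin w.length → Fin (w.length + 1) → ℚ := fun k e =>
    φ k (Quot.mk _ (e, true)) + φ k (Quot.mk _ (e, false))
  have hψ0 : ∀ k, ψ k 0 = ψ k (Fin.last _) := fun k =>
    congrArg₂ (· + ·) (congrArg (φ k) (Quot.sound (.base true)))
      (congrArg (φ k) (Quot.sound (.base false)))
  have hzφ : ∀ k e, z k e = φ k (Quot.mk _ (e, true)) - φ k (Quot.mk _ (e, false)) := fun k e => by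
    rw [← hφ]; rfl
  have hψjump : ∀ k i, ψ k i.succ - ψ k i.castSucc =
      -(if (flatLetter N (w.get i)).2 then 1 else -1) *
        (z k (bar i).castSucc + z k (bar i).succ) := by
    intro k i
    have hb := hbar i
    simp only [hzφ, ψ]
    cases hm : (flatLetter N (w.get i)).2
    · rw [hm] at hb
      obtain ⟨h1, h2, h3, h4⟩ := corner_relations hN (φ k) (a := bar i) (b := i) (by rw [hb]; rfl)
        (by rw [hb, ← hm])
      simp only [Bool.false_eq_true, if_false]
      linear_combination -h1 + h2 + h3 - h4
    · rw [hm] at hb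
      obtain ⟨h1, h2, h3, h4⟩ := corner_relations hN (φ k) (a := i) (b := bar i) hm hb
      simp only [if_true]
      linear_combination h1 + h2 - h3 - h4
  have hψsum : ∀ k i, ψ k (bar i).succ + ψ k (bar i).castSucc = ψ k i.succ + ψ k i.castSucc := by
    intro k i
    have hb := hbar i
    simp only [ψ]
    cases hm : (flatLetter N (w.get i)).2
    · rw [hm] at hb
      obtain ⟨h1, h2, h3, h4⟩ := corner_relations hN (φ k) (a := bar i) (b := i) (by rw [hb]; rfl)
        (by rw [hb, ← hm])
      linear_combination h1 - h2 + h3 - h4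
    · rw [hm] at hb
      obtain ⟨h1, h2, h3, h4⟩ := corner_relations hN (φ k) (a := i) (b := bar i) hm hb
      linear_combination -h1 + h2 - h3 + h4
  -- The intersection number of a curve with a weighted curve, as a sum along the latter.
  have hpair : ∀ (k : Fin w.length) (f : Fin (N + 1) × Bool → ℤ),
      2 * (pairing (labels W) f (chordFlow W (flatLetter N (w.get k))) : ℚ) =
        -∑ i : Fin w.length, (f (flatLetter N (w.get i)) : ℚ) *
          (ψ k i.succ - ψ k i.castSucc) := by
    intro k f
    have h1 := hP.sum_map (fun l => (f l : ℚ) * ((if l.2 then 1 else -1) *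
      (2 * (chordFlow W (flatLetter N (w.get k)) (l.1, !l.2) : ℚ))))
    rw [hW, sum_flatten, ← hW] at h1
    rw [← Finset.sum_neg_distrib]
    calc _ = _ := ?_
      _ = _ := h1.symm
      _ = _ := ?_
    · unfold pairing
      push_cast
      rw [Finset.mul_sum]
      refine Finset.sum_congr rfl fun c _ => ?_
      simp
      ring
    · refine Finset.sum_congr rfl fun i _ => ?_
      rw [hψjump, hzmean, hbar]
      ring
  have hF : ∀ m ∈ W, ∃ k : Fin w.length, flatLetter N (w.get k) = m := fun m hm => exists_get hm
  intro m hm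
  obtain ⟨k, rfl⟩ := hF m hm
  constructor
  · rw [pairing_comm, neg_eq_zero]
    have := hpair k 1
    simp only [Pi.one_apply, Int.cast_one, one_mul, sum_telescope, hψ0, sub_self, neg_zero] at this
    have h2 : (pairing (labels W) 1 (chordFlow W (flatLetter N (w.get k))) : ℚ) = 0 := by linarith
    exact_mod_cast h2
  · intro n hn
    obtain ⟨j, rfl⟩ := hF n hn
    have h1 := hpair j (chordFlow W (flatLetter N (w.get k)))
    -- Summation by parts: `ψ j` takes the same value on both strands of the crossing of `k`, so that
    -- the jumps of `z k` there cancel.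
    have h2 : ∀ i : Fin w.length, (chordFlow W (flatLetter N (w.get k)) (flatLetter N (w.get i)) : ℚ)
        * (ψ j i.succ - ψ j i.castSucc) = (z k i.succ * ψ j i.succ - z k i.castSucc * ψ j i.castSucc)
          - ((if i = k then (ψ j i.succ + ψ j i.castSucc) else 0) -
            if i = bar k then (ψ j i.succ + ψ j i.castSucc) else 0) := by
      intro i
      have e1 := hzmean k i
      have e2 := hzjump k i
      have e3 : ((if i = k then (ψ j i.succ + ψ j i.castSucc) else 0) -
            if i = bar k then (ψ j i.succ + ψ j i.castSucc) else 0) =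
          (z k i.succ - z k i.castSucc) / 2 * (ψ j i.succ + ψ j i.castSucc) := by
        rw [e2]
        split_ifs <;> ring
      rw [e3]
      linear_combination (-(ψ j i.succ - ψ j i.castSucc) / 2) * e1
    rw [Finset.sum_congr rfl fun i _ => h2 i, Finset.sum_sub_distrib,
      sum_telescope (fun e => z k e * ψ j e), Finset.sum_sub_distrib] at h1
    simp only [Finset.sum_ite_eq', Finset.mem_univ, if_true, hz0, hz1, hψsum] at h1
    have h3 : (pairing (labels W) (chordFlow W (flatLetter N (w.get k)))
      (chordFlow W (flatLetter N (w.get j))) : ℚ) = 0 := by linarith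
    exact_mod_cast h3

end GaussWord

/-! ### The Jones polynomial as a sum over smoothings -/

section LoopNumber

variable {ι : Type*} [Fintype ι] [DecidableEq ι]

lemma loopNumber_congr (l : List (ι × Bool)) {m : ℕ} (h : l.length = m) (a : Fin m → ι × Bool)
    (ha : ∀ i, a i = l.get (Fin.cast h.symm i)) (T : Finset ι) :
    loopNumber a T = loopNumber l.get T := by
  subst h
  congr 1
  funext i
  exact ha i

end LoopNumber

namespace GaussWord

variable {N : ℕ}

open Classical in
/-- The sign of the crossing with the label `c`. -/
noncomputable def signAt (N : ℕ) (w : GaussWord) (c : Fin (N + 1)) : ℤ :=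
  if ∃ p ∈ w, Fin.ofNat (N + 1) p.label = c ∧ p.sign = 1 then 1 else -1

lemma signAt_eq {w : GaussWord} (hw : w.WellFormed) (hN : ∀ p ∈ w, p.label ≤ N) {p : Passage}
    (hp : p ∈ w) : signAt N w (Fin.ofNat (N + 1) p.label) = p.sign := by
  unfold signAt
  split_ifs with h
  · obtain ⟨q, hq, h1, h2⟩ := h
    rw [hw.sign_eq' hp hq ((fin_ofNat_inj (hN q hq) (hN p hp)).1 h1).symm, h2]
    rfl
  · have : p.sign ≠ 1 := fun h1 => h ⟨p, hp, rfl, h1⟩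
    rw [(Int.units_eq_one_or p.sign).resolve_left this]
    rfl

lemma signAt_cases (w : GaussWord) (c : Fin (N + 1)) : signAt N w c = 1 ∨ signAt N w c = -1 := by
  unfold signAt
  split_ifs <;> simp

lemma labels_flatten (w : GaussWord) :
    labels (w.flatten N) = w.crossings.image (Fin.ofNat (N + 1)) := by
  ext c
  simp [labels, flatten, crossings, flatLetter]

lemma mem_crossings {w : GaussWord} {x : ℕ} : x ∈ w.crossings ↔ ∃ p ∈ w, p.label = x := by
  simp [crossings]

lemma ofNat_injOn {w : GaussWord} (hN : ∀ p ∈ w, p.label ≤ N) :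
    Set.InjOn (Fin.ofNat (N + 1)) (w.crossings : Set ℕ) := by
  intro x hx y hy h
  obtain ⟨p, hp, rfl⟩ := mem_crossings.1 hx
  obtain ⟨q, hq, rfl⟩ := mem_crossings.1 hy
  exact (fin_ofNat_inj (hN p hp) (hN q hq)).1 h

lemma writhe_eq {w : GaussWord} (hw : w.WellFormed) (hN : ∀ p ∈ w, p.label ≤ N) :
    w.writhe = ∑ c ∈ labels (w.flatten N), signAt N w c := by
  have h1 : (w.filter Passage.isOver).map (fun p => (p.sign : ℤ)) =
      ((w.filter Passage.isOver).map fun p => Fin.ofNat (N + 1) p.label).map (signAt N w) := by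
    rw [List.map_map]
    refine List.map_congr_left fun p hp => ?_
    exact (signAt_eq hw hN (List.mem_filter.1 hp).1).symm
  have h2 : ((w.filter Passage.isOver).map fun p => Fin.ofNat (N + 1) p.label).Nodup := by
    refine List.Nodup.map_on (fun p hp q hq h => ?_) ((List.Nodup.of_map _ hw.1).filter _)
    rw [List.mem_filter] at hp hq
    exact hw.sign_eq hp.1 hq.1 ((fin_ofNat_inj (hN p hp.1) (hN q hq.1)).1 h) (by rw [hp.2, hq.2])
  unfold writhe
  rw [h1, ← List.sum_toFinset _ h2]
  congr 1
  ext c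
  rw [mem_labels_iff]
  simp only [List.mem_toFinset, List.mem_map, List.mem_filter, flatten]
  constructor
  · rintro ⟨p, ⟨hp, -⟩, rfl⟩
    exact ⟨_, ⟨p, hp, rfl⟩, rfl⟩
  · rintro ⟨_, ⟨p, hp, rfl⟩, rfl⟩
    cases ho : p.isOver
    · exact ⟨_, ⟨hw.2 p hp, by simp [ho]⟩, rfl⟩
    · exact ⟨p, ⟨hp, ho⟩, rfl⟩

/-- The smoothing of the diagram that corresponds to a set of crossings with `A`-smoothing: the set
of crossings which are smoothed with the orientation. -/
noncomputable def orientedSet (N : ℕ) (w : GaussWord) (S : Finset ℕ) : Finset (Fin (N + 1)) :=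
  (w.crossings.filter fun x => x ∈ S ↔ signAt N w (Fin.ofNat (N + 1) x) = 1).image
    (Fin.ofNat (N + 1))

lemma mem_orientedSet {w : GaussWord} (hN : ∀ p ∈ w, p.label ≤ N) {S : Finset ℕ} {x : ℕ}
    (hx : x ∈ w.crossings) : Fin.ofNat (N + 1) x ∈ orientedSet N w S ↔
      (x ∈ S ↔ signAt N w (Fin.ofNat (N + 1) x) = 1) := by
  unfold orientedSet
  simp only [Finset.mem_image, Finset.mem_filter]
  constructor
  · rintro ⟨y, ⟨hy, h⟩, he⟩
    rw [← ofNat_injOn hN hy hx he]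
    exact h
  · exact fun h => ⟨x, ⟨hx, h⟩, rfl⟩

lemma loopCount_eq {w : GaussWord} (hw : w.WellFormed) (hN : ∀ p ∈ w, p.label ≤ N)
    (S : Finset ℕ) : w.loopCount S = loopNumber (w.flatten N).get (orientedSet N w S) := by
  rw [← loopNumber_congr (w.flatten N) (m := w.length) (by simp [flatten])
    (fun i => flatLetter N (w.get i)) (fun i => by
      simp only [flatten, List.get_eq_getElem, List.getElem_map]; rfl)]
  unfold loopCount loopNumber
  have hl : ∀ i j : Fin w.length, (w.get i).label = (w.get j).label ↔
      (flatLetter N (w.get i)).1 = (flatLetter N (w.get j)).1 := fun i j =>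
    (fin_ofNat_inj (hN _ (List.get_mem w i)) (hN _ (List.get_mem w j))).symm
  have ho : ∀ i j : Fin w.length, (w.get i).label = (w.get j).label →
      ((w.get i).isOver ≠ (w.get j).isOver ↔
        (flatLetter N (w.get i)).2 ≠ (flatLetter N (w.get j)).2) := by
    intro i j h
    have hs := hw.sign_eq' (List.get_mem w i) (List.get_mem w j) h
    simp only [flatLetter, hs]
    cases (w.get i).isOver <;> cases (w.get j).isOver <;> simp
  have hT : ∀ i : Fin w.length, ((w.get i).label ∈ S ↔ (w.get i).sign = 1) ↔
      (flatLetter N (w.get i)).1 ∈ orientedSet N w S := by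
    intro i
    have hmem := List.get_mem w i
    simp only [flatLetter]
    rw [mem_orientedSet hN (mem_crossings.2 ⟨_, hmem, rfl⟩), signAt_eq hw hN hmem]
    simp
  have : w.Joined S = Glue (fun i => flatLetter N (w.get i)) (orientedSet N w S) := by
    funext e f
    apply propext
    constructor
    · rintro (_ | ⟨i, j, h1, h2, h3⟩ | ⟨i, j, h1, h2, h3⟩ | ⟨i, j, h1, h2, h3⟩)
      · exact .base
      · exact .oriented i j ((hl i j).1 h1) ((ho i j h1).1 h2) ((hT i).1 h3)
      · exact .unoriented_in i j ((hl i j).1 h1) ((ho i j h1).1 h2) (fun h => h3 ((hT i).2 h))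
      · exact .unoriented_out i j ((hl i j).1 h1) ((ho i j h1).1 h2) (fun h => h3 ((hT i).2 h))
    · rintro (_ | ⟨i, j, h1, h2, h3⟩ | ⟨i, j, h1, h2, h3⟩ | ⟨i, j, h1, h2, h3⟩)
      · exact .base
      · have h1 := (hl i j).2 h1
        exact .oriented i j h1 ((ho i j h1).2 h2) ((hT i).2 h3)
      · have h1 := (hl i j).2 h1
        exact .unoriented_in i j h1 ((ho i j h1).2 h2) (fun h => h3 ((hT i).1 h))
      · have h1 := (hl i j).2 h1
        exact .unoriented_out i j h1 ((ho i j h1).2 h2) (fun h => h3 ((hT i).1 h))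
  rw [this]

lemma prod_ite_mem_sdiff {α M : Type*} [DecidableEq α] [CommMonoid M] {T L : Finset α} (h : T ⊆ L)
    (f g : α → M) : (∏ c ∈ T, f c) * ∏ c ∈ L \ T, g c = ∏ c ∈ L, if c ∈ T then f c else g c := by
  rw [Finset.prod_ite]
  congr 1
  · congr 1
    ext c
    simp only [Finset.mem_filter]
    exact ⟨fun hc => ⟨h hc, hc⟩, fun hc => hc.2⟩
  · congr 1
    ext c
    simp

/-- The Kauffman bracket as a sum over the smoothings of the underlying curve. -/
lemma bracket_eq {w : GaussWord} (hw : w.WellFormed) (hN : ∀ p ∈ w, p.label ≤ N) (A : ℝ) :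
    w.bracket A = ∑ T ∈ (labels (w.flatten N)).powerset,
      ((∏ c ∈ T, A ^ signAt N w c) * ∏ c ∈ labels (w.flatten N) \ T, A ^ (-signAt N w c)) *
        (-A ^ 2 - (A⁻¹) ^ 2) ^ (loopNumber (w.flatten N).get T - 1) := by
  unfold bracket
  have hinj := ofNat_injOn hN
  refine Finset.sum_bij' (fun S _ => orientedSet N w S)
    (fun T _ => w.crossings.filter fun x =>
      (Fin.ofNat (N + 1) x ∈ T ↔ signAt N w (Fin.ofNat (N + 1) x) = 1)) ?_ ?_ ?_ ?_ ?_
  · intro S _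
    rw [Finset.mem_powerset, labels_flatten]
    exact Finset.image_subset_image (Finset.filter_subset _ _)
  · intro T _
    rw [Finset.mem_powerset]
    exact Finset.filter_subset _ _
  · intro S hS
    rw [Finset.mem_powerset] at hS
    ext x
    rw [Finset.mem_filter]
    constructor
    · rintro ⟨hx, h⟩
      rw [mem_orientedSet hN hx] at h
      tauto
    · intro h
      refine ⟨hS h, ?_⟩
      rw [mem_orientedSet hN (hS h)]
      tauto
  · intro T hT
    rw [Finset.mem_powerset, labels_flatten] at hT
    ext c
    constructor
    · intro h
      obtain ⟨x, hx, rfl⟩ := Finset.mem_image.1 h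
      have hx' := (Finset.mem_filter.1 hx).1
      rw [mem_orientedSet hN hx', Finset.mem_filter] at h
      tauto
    · intro h
      obtain ⟨x, hx, rfl⟩ := Finset.mem_image.1 (hT h)
      rw [mem_orientedSet hN hx, Finset.mem_filter]
      tauto
  · intro S hS
    rw [Finset.mem_powerset] at hS
    have hsub : orientedSet N w S ⊆ labels (w.flatten N) := by
      rw [labels_flatten]
      exact Finset.image_subset_image (Finset.filter_subset _ _)
    rw [loopCount_eq hw hN S, prod_ite_mem_sdiff hsub, labels_flatten, Finset.prod_image hinj,
      ← Finset.prod_const, ← Finset.prod_const, prod_ite_mem_sdiff hS]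
    congr 1
    refine Finset.prod_congr rfl fun x hx => ?_
    rw [if_congr (mem_orientedSet hN hx) rfl rfl]
    rcases signAt_cases w (Fin.ofNat (N + 1) x) with h | h <;> rw [h] <;> by_cases hS : x ∈ S <;>
      simp [hS]

/-- The normalized sum over the smoothings with values in a field. -/
noncomputable def jonesSum {K : Type*} [Field K] (N : ℕ) (w : GaussWord) (A : K) : K :=
  ∑ T ∈ (labels (w.flatten N)).powerset, (-1) ^ (labels (w.flatten N)).card *
    A ^ (2 * ∑ c ∈ T, signAt N w c - 4 * ∑ c ∈ labels (w.flatten N), signAt N w c) *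
      (-A ^ 2 - (A⁻¹) ^ 2) ^ (loopNumber (w.flatten N).get T - 1)

lemma prod_zpow_sign {K : Type*} [Field K] {A : K} (hA : A ≠ 0) {L T : Finset (Fin (N + 1))}
    (hT : T ⊆ L) (s : Fin (N + 1) → ℤ) :
    (∏ c ∈ T, A ^ s c) * ∏ c ∈ L \ T, A ^ (-s c) = A ^ (2 * ∑ c ∈ T, s c - ∑ c ∈ L, s c) := by
  have hz : ∀ (X : Finset (Fin (N + 1))) (f : Fin (N + 1) → ℤ),
      ∏ c ∈ X, A ^ f c = A ^ ∑ c ∈ X, f c := by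
    intro X f
    classical
    induction X using Finset.induction_on with
    | empty => simp
    | insert a X ha ih => rw [Finset.prod_insert ha, Finset.sum_insert ha, ih, zpow_add₀ hA]
  rw [hz, hz, ← zpow_add₀ hA, ← Finset.sum_sdiff (f := s) hT]
  congr 1
  rw [Finset.sum_neg_distrib]
  ring

lemma neg_one_zpow_writhe {K : Type*} [Field K] (L : Finset (Fin (N + 1))) (w : GaussWord) :
    (-1 : K) ^ (-∑ c ∈ L, signAt N w c) = (-1) ^ L.card := by
  classical
  induction L using Finset.induction_on with
  | empty => simp
  | insert a X ha ih =>
    rw [Finset.sum_insert ha, Finset.card_insert_of_notMem ha, neg_add, zpow_add₀ (by simp), ih,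
      pow_succ']
    rcases signAt_cases w a with h | h <;> rw [h] <;> simp

lemma jonesSum_eq {K : Type*} [Field K] {w : GaussWord} {A : K} (hA : A ≠ 0) :
    jonesSum N w A = (-A ^ 3) ^ (-∑ c ∈ labels (w.flatten N), signAt N w c) *
      ∑ T ∈ (labels (w.flatten N)).powerset,
      ((∏ c ∈ T, A ^ signAt N w c) * ∏ c ∈ labels (w.flatten N) \ T, A ^ (-signAt N w c)) *
        (-A ^ 2 - (A⁻¹) ^ 2) ^ (loopNumber (w.flatten N).get T - 1) := by
  unfold jonesSum
  conv_rhs => rw [Finset.mul_sum]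
  refine Finset.sum_congr rfl fun T hT => ?_
  rw [Finset.mem_powerset] at hT
  rw [prod_zpow_sign hA hT, neg_eq_neg_one_mul (A ^ 3), mul_zpow, neg_one_zpow_writhe,
    ← zpow_natCast A 3, ← zpow_mul, mul_assoc, mul_assoc, ← mul_assoc (A ^ _) (A ^ _),
    ← zpow_add₀ hA]
  congr 3
  push_cast
  ring_nf

lemma jones_eq {w : GaussWord} (hw : w.WellFormed) (hN : ∀ p ∈ w, p.label ≤ N) {t : ℝ}
    (ht : 0 < t) : w.jones t = jonesSum N w (t ^ (-(1 / 4) : ℝ)) := by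
  rw [jones, jonesSum_eq (Real.rpow_pos_of_pos ht _).ne', bracket_eq hw hN, writhe_eq hw hN]

end GaussWord

/-! ### Derivatives of the Jones polynomial at `1` -/

section PowerSums

open Filter Topology

/-- A sum of real powers, given by its coefficients and exponents. -/
noncomputable def powerSum (l : List (ℝ × ℝ)) (t : ℝ) : ℝ := (l.map fun p => p.1 * t ^ p.2).sum

/-- The sum of the coefficients, weighted with a power of the exponents. -/
def moment (l : List (ℝ × ℝ)) (r : ℕ) : ℝ := (l.map fun p => p.1 * p.2 ^ r).sum

lemma hasDerivAt_powerSum (l : List (ℝ × ℝ)) {t : ℝ} (ht : 0 < t) :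
    HasDerivAt (powerSum l) (powerSum (l.map fun p => (p.1 * p.2, p.2 - 1)) t) t := by
  induction l with
  | nil =>
    have : powerSum [] = fun _ => 0 := by funext x; simp [powerSum]
    rw [this]
    simpa [powerSum] using hasDerivAt_const t (0 : ℝ)
  | cons p l ih =>
    have h := ((Real.hasDerivAt_rpow_const (x := t) (p := p.2) (Or.inl ht.ne')).const_mul p.1).add ih
    refine (h.congr_deriv ?_).congr_of_eventuallyEq ?_
    · simp [powerSum]
      ring
    · exact Eventually.of_forall fun x => by simp [powerSum]

lemma iteratedDeriv_powerSum {f : ℝ → ℝ} {l : List (ℝ × ℝ)} (h : ∀ t, 0 < t → f t = powerSum l t)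
    (k : ℕ) : ∀ t, 0 < t → iteratedDeriv k f t =
      powerSum ((fun l : List (ℝ × ℝ) => l.map fun p => (p.1 * p.2, p.2 - 1))^[k] l) t := by
  induction k with
  | zero => intro t ht; simpa using h t ht
  | succ k ih =>
    intro t ht
    rw [iteratedDeriv_succ, Function.iterate_succ_apply']
    have : iteratedDeriv k f =ᶠ[𝓝 t]
        powerSum ((fun l : List (ℝ × ℝ) => l.map fun p => (p.1 * p.2, p.2 - 1))^[k] l) := by
      filter_upwards [lt_mem_nhds ht] with x hx
      exact ih x hx
    rw [this.deriv_eq]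
    exact (hasDerivAt_powerSum _ ht).deriv

/-- A function on the positive reals which is a sum of real powers, with the given moments. -/
def HasMoments (f : ℝ → ℝ) (m : Fin 4 → ℝ) : Prop :=
  ∃ l : List (ℝ × ℝ), (∀ t, 0 < t → f t = powerSum l t) ∧ ∀ r : Fin 4, moment l r = m r

lemma HasMoments.iteratedDeriv_two {f : ℝ → ℝ} {m : Fin 4 → ℝ} (h : HasMoments f m) :
    iteratedDeriv 2 f 1 = m 2 - m 1 := by
  obtain ⟨l, hl, hm⟩ := h
  rw [iteratedDeriv_powerSum hl 2 1 one_pos, ← hm, ← hm]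
  clear hl hm
  simp only [Function.iterate_succ, Function.iterate_zero, Function.comp_apply, id]
  induction l with
  | nil => simp [powerSum, moment]
  | cons p l ih =>
    simp [powerSum, moment] at ih ⊢
    rw [ih]
    ring

lemma HasMoments.iteratedDeriv_three {f : ℝ → ℝ} {m : Fin 4 → ℝ} (h : HasMoments f m) :
    iteratedDeriv 3 f 1 = m 3 - 3 * m 2 + 2 * m 1 := by
  obtain ⟨l, hl, hm⟩ := h
  rw [iteratedDeriv_powerSum hl 3 1 one_pos, ← hm, ← hm, ← hm]
  clear hl hm
  simp only [Function.iterate_succ, Function.iterate_zero, Function.comp_apply, id]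
  induction l with
  | nil => simp [powerSum, moment]
  | cons p l ih =>
    simp [powerSum, moment] at ih ⊢
    rw [ih]
    ring

lemma HasMoments.add {f g : ℝ → ℝ} {m m' : Fin 4 → ℝ} (hf : HasMoments f m)
    (hg : HasMoments g m') : HasMoments (fun t => f t + g t) (fun r => m r + m' r) := by
  obtain ⟨l, hl, hm⟩ := hf
  obtain ⟨l', hl', hm'⟩ := hg
  refine ⟨l ++ l', fun t ht => ?_, fun r => ?_⟩
  · simp only [hl t ht, hl' t ht]
    simp [powerSum]
  · simp only [← hm, ← hm']
    simp [moment]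

lemma HasMoments.sum {α : Type*} {s : Finset α} {f : α → ℝ → ℝ} {m : α → Fin 4 → ℝ}
    (h : ∀ i ∈ s, HasMoments (f i) (m i)) :
    HasMoments (fun t => ∑ i ∈ s, f i t) (fun r => ∑ i ∈ s, m i r) := by
  classical
  induction s using Finset.induction_on with
  | empty => exact ⟨[], by simp [powerSum], by simp [moment]⟩
  | insert a s ha ih =>
    simp only [Finset.sum_insert ha]
    exact (h a (Finset.mem_insert_self _ _)).add
      (ih fun i hi => h i (Finset.mem_insert_of_mem hi))

/-- Multiplication with a power. -/
lemma HasMoments.mul_rpow {f : ℝ → ℝ} {m : Fin 4 → ℝ} (hf : HasMoments f m) (a x : ℝ) :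
    HasMoments (fun t => f t * (a * t ^ x)) ![a * m 0, a * (m 1 + x * m 0),
      a * (m 2 + 2 * x * m 1 + x ^ 2 * m 0),
      a * (m 3 + 3 * x * m 2 + 3 * x ^ 2 * m 1 + x ^ 3 * m 0)] := by
  obtain ⟨l, hl, hm⟩ := hf
  refine ⟨l.map fun p => (a * p.1, p.2 + x), fun t ht => ?_, fun r => ?_⟩
  · simp only [hl t ht]
    clear hl hm
    induction l with
    | nil => simp [powerSum]
    | cons p l ih =>
      simp only [powerSum, List.map_cons, List.sum_cons] at ih ⊢
      rw [add_mul, ih, Real.rpow_add ht]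
      ring
  · have e0 := hm 0
    have e1 := hm 1
    have e2 := hm 2
    have e3 := hm 3
    rw [← e0, ← e1, ← e2, ← e3]
    clear hl hm e0 e1 e2 e3
    induction l with
    | nil => fin_cases r <;> simp [moment]
    | cons p l ih =>
      fin_cases r <;> simp [moment] at ih ⊢ <;> rw [ih] <;> ring

lemma HasMoments.congr {f : ℝ → ℝ} {m m' : Fin 4 → ℝ} (h : HasMoments f m)
    (hm : ∀ r, m r = m' r) : HasMoments f m' := by
  rwa [← funext hm]

/-- A summand of the Jones polynomial. -/
lemma hasMoments_term (a x : ℝ) (k : ℕ) :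
    HasMoments (fun t => a * t ^ x * (-t ^ (-(1 / 2) : ℝ) - t ^ (1 / 2 : ℝ)) ^ k)
      ![a * (-2) ^ k, a * (-2) ^ k * x, a * (-2) ^ k * (x ^ 2 + k / 4),
        a * (-2) ^ k * (x ^ 3 + 3 * x * k / 4)] := by
  induction k with
  | zero =>
    refine ⟨[(a, x)], fun t _ => by simp [powerSum], fun r => ?_⟩
    fin_cases r <;> simp [moment]
  | succ k ih =>
    have h := (ih.mul_rpow (-1) (-(1 / 2))).add (ih.mul_rpow (-1) (1 / 2))
    have e : (fun t : ℝ => a * t ^ x * (-t ^ (-(1 / 2) : ℝ) - t ^ (1 / 2 : ℝ)) ^ (k + 1)) =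
        fun t => a * t ^ x * (-t ^ (-(1 / 2) : ℝ) - t ^ (1 / 2 : ℝ)) ^ k *
          (-1 * t ^ (-(1 / 2) : ℝ)) + a * t ^ x * (-t ^ (-(1 / 2) : ℝ) - t ^ (1 / 2 : ℝ)) ^ k *
          (-1 * t ^ (1 / 2 : ℝ)) := by
      funext t
      ring
    rw [e]
    refine h.congr fun r => ?_
    fin_cases r <;> simp <;> ring

end PowerSums

namespace GaussWord

variable {N : ℕ}

/-- The exponent of a smoothing. -/
noncomputable def exponent (N : ℕ) (w : GaussWord) (T : Finset (Fin (N + 1))) : ℝ :=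
  ∑ c ∈ labels (w.flatten N), (signAt N w c : ℝ) - (∑ c ∈ T, (signAt N w c : ℝ)) / 2

/-- The average over all smoothings, with the weights that occur in the Jones polynomial at `1`. -/
noncomputable def stateAvg (N : ℕ) (w : GaussWord) (f : Finset (Fin (N + 1)) → ℝ) : ℝ :=
  ∑ T ∈ (labels (w.flatten N)).powerset, (-1) ^ (labels (w.flatten N)).card *
    (-2) ^ (loopNumber (w.flatten N).get T - 1) * f T

lemma hasMoments_jones {w : GaussWord} (hw : w.WellFormed) (hN : ∀ p ∈ w, p.label ≤ N) :
    HasMoments w.jones ![stateAvg N w fun _ => 1, stateAvg N w (exponent N w),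
      stateAvg N w fun T => exponent N w T ^ 2 + (loopNumber (w.flatten N).get T - 1 : ℕ) / 4,
      stateAvg N w fun T => exponent N w T ^ 3 +
        3 * exponent N w T * (loopNumber (w.flatten N).get T - 1 : ℕ) / 4] := by
  have h : HasMoments (fun t => ∑ T ∈ (labels (w.flatten N)).powerset,
      (-1) ^ (labels (w.flatten N)).card * t ^ exponent N w T *
        (-t ^ (-(1 / 2) : ℝ) - t ^ (1 / 2 : ℝ)) ^ (loopNumber (w.flatten N).get T - 1)) _ :=
    HasMoments.sum fun T _ => hasMoments_term _ _ _
  obtain ⟨l, hl, hm⟩ := h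
  refine ⟨l, fun t ht => ?_, fun r => ?_⟩
  · rw [← hl t ht, jones_eq hw hN ht, jonesSum]
    refine Finset.sum_congr rfl fun T _ => ?_
    have e1 : (t ^ (-(1 / 4) : ℝ)) ^ (2 * ∑ c ∈ T, signAt N w c -
        4 * ∑ c ∈ labels (w.flatten N), signAt N w c) = t ^ exponent N w T := by
      rw [← Real.rpow_intCast, ← Real.rpow_mul ht.le]
      congr 1
      unfold exponent
      push_cast
      ring
    have e2 : (t ^ (-(1 / 4) : ℝ)) ^ 2 = t ^ (-(1 / 2) : ℝ) := by
      rw [← Real.rpow_natCast, ← Real.rpow_mul ht.le]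
      norm_num
    have e3 : ((t ^ (-(1 / 4) : ℝ))⁻¹) ^ 2 = t ^ (1 / 2 : ℝ) := by
      rw [← Real.rpow_neg ht.le, ← Real.rpow_natCast, ← Real.rpow_mul ht.le]
      norm_num
    rw [e1, e2, e3]
  · rw [hm]
    fin_cases r <;> simp [stateAvg]

end GaussWord

/-! ### Averages over all smoothings -/

section Averages

open Polynomial

variable {ι : Type*} [Fintype ι] [DecidableEq ι]

/-- The state in which the crossings in `F` are smoothed with the orientation. -/
def setState (F : Finset ι) (c : ι) : Option Bool := if c ∈ F then some true else none

lemma partialLoopPoly_setState {w : List (ι × Bool)} {F : Finset ι} (hF : F ⊆ labels w) :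
    partialLoopPoly (setState F) w = ∑ T ∈ (labels w).powerset,
      C ((-1) ^ (labels w).card * ((-1) ^ F.card * ∏ c ∈ F, if c ∈ T then 1 else 0)) *
        X ^ loopNumber w.get T := by
  unfold partialLoopPoly loopPoly
  refine Finset.sum_congr rfl fun T hT => ?_
  rw [Finset.mem_powerset] at hT
  congr 2
  rw [GaussWord.prod_ite_mem_sdiff hT, ← Finset.prod_const, ← Finset.prod_const,
    ← Finset.prod_mul_distrib (s := F)]
  have h1 : ∏ c ∈ F, ((-1 : ℤ) * if c ∈ T then 1 else 0) =
      ∏ c ∈ labels w, if c ∈ F then ((-1 : ℤ) * if c ∈ T then 1 else 0) else 1 := by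
    rw [← Finset.prod_filter]
    congr 1
    ext c
    simp only [Finset.mem_filter]
    exact ⟨fun h => ⟨hF h, h⟩, fun h => h.2⟩
  rw [h1, ← Finset.prod_mul_distrib]
  refine Finset.prod_congr rfl fun c _ => ?_
  by_cases h2 : c ∈ F <;> by_cases h3 : c ∈ T <;>
    simp [orientedCoeff, unorientedCoeff, setState, h2, h3]

lemma oneState_eq (c : ι) : oneState c true = setState {c} := by
  funext d
  by_cases h : d = c
  · subst h; simp [oneState, setState]
  · simp [oneState, setState, h]

lemma twoState_eq (c d : ι) : twoState c d true true = setState {c, d} := by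
  funext e
  by_cases h : e = d
  · subst h; simp [twoState, setState]
  · by_cases h' : e = c
    · subst h'; simp [twoState, oneState, setState, h]
    · simp [twoState, oneState, setState, h, h']

lemma threeState_eq (c d e : ι) :
    Function.update (twoState c d true true) e (some true) = setState {c, d, e} := by
  rw [twoState_eq]
  funext f
  by_cases h : f = e
  · subst h; simp [setState]
  · simp [setState, h]

/-- The order of two passages if the part of the knot between the two passages through `c` is run
through in the reverse direction. -/
def twistOrder (w : List (ι × Bool)) (c : ι) (l m : ι × Bool) : ℤ :=
  if chordFlow w (c, true) l ≠ 0 ∧ chordFlow w (c, true) m ≠ 0 then -orderSign w l m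
  else orderSign w l m

/-- The sign `-1` for the passages between the two passages through `c`. -/
def sideSign (w : List (ι × Bool)) (c : ι) (l : ι × Bool) : ℤ :=
  if chordFlow w (c, true) l = 0 then 1 else -1

/-- A summand of the arrow sum of the diagram in which `c` is smoothed against the orientation. -/
def twistTerm (w : List (ι × Bool)) (c d e : ι) : ℤ :=
  sideSign w c (d, true) * sideSign w c (d, false) * (sideSign w c (e, true) *
    sideSign w c (e, false)) *
  ((twistOrder w c (e, true) (d, true) - twistOrder w c (e, true) (d, false) -
      twistOrder w c (e, false) (d, true) + twistOrder w c (e, false) (d, false)) *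
    (twistOrder w c (e, true) (d, true) + twistOrder w c (e, true) (d, false) +
      twistOrder w c (e, false) (d, true) + twistOrder w c (e, false) (d, false)))

lemma orderSum_flipMark (y : List (ι × Bool)) (w : List (ι × Bool)) (d e : ι) :
    orderSum w d e = orderSign w (flipMark y (e, true)) (flipMark y (d, true)) +
      orderSign w (flipMark y (e, true)) (flipMark y (d, false)) +
      orderSign w (flipMark y (e, false)) (flipMark y (d, true)) +
      orderSign w (flipMark y (e, false)) (flipMark y (d, false)) := by
  unfold orderSum flipMark
  by_cases h1 : OddIn y d <;> by_cases h2 : OddIn y e <;> simp [h1, h2] <;> ring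

lemma chordIndex_flipMark (y : List (ι × Bool)) (w : List (ι × Bool)) (d e : ι) :
    chordIndex w d e = (if OddIn y d then -1 else 1) * (if OddIn y e then -1 else 1) *
      (orderSign w (flipMark y (e, true)) (flipMark y (d, true)) -
      orderSign w (flipMark y (e, true)) (flipMark y (d, false)) -
      orderSign w (flipMark y (e, false)) (flipMark y (d, true)) +
      orderSign w (flipMark y (e, false)) (flipMark y (d, false))) := by
  rw [chordIndex_eq]
  unfold flipMark
  by_cases h1 : OddIn y d <;> by_cases h2 : OddIn y e <;> simp [h1, h2] <;> ring

lemma chordFlow_eq_zero_iff {x y z : List (ι × Bool)} {c : ι} {b : Bool}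
    (hw : PairedWord (x ++ ((c, b) :: y ++ (c, !b) :: z))) {l : ι × Bool}
    (hl : l ∈ x ++ y ++ z) :
    chordFlow (x ++ ((c, b) :: y ++ (c, !b) :: z)) (c, true) l = 0 ↔ l ∉ y := by
  have h1 : chordFlow (x ++ ((c, b) :: y ++ (c, !b) :: z)) (c, true) l = 0 ↔
      chordFlow (x ++ ((c, b) :: y ++ (c, !b) :: z)) (c, b) l = 0 := by
    cases b
    · have := chordFlow_not (x ++ ((c, false) :: y ++ (c, !false) :: z)) (c, false) l
      simp only [Bool.not_false] at this ⊢
      omega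
    · rfl
  have hmem : l ∈ x ++ ((c, b) :: y ++ (c, !b) :: z) := by
    simp only [List.mem_append, List.mem_cons] at hl ⊢
    tauto
  have hcx : ∀ b', (c, b') ∉ x := by
    intro b' h
    have := (List.nodup_append.1 hw.1).2.2 _ h (c, b')
    exact this (by cases b <;> cases b' <;> simp) rfl
  have h2 := chordFlow_rotate hw hmem (m := (c, b)) (by simp)
  have h3 : inWord x (c, b) - inWord x (c, !b) = 0 := by simp [inWord, hcx]
  have hw2 := hw.rotate
  have e : (c, b) :: y ++ (c, !b) :: z ++ x = (c, b) :: y ++ (c, !b) :: (z ++ x) := by simp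
  rw [e] at h2 hw2
  rw [h1]
  have hl' : l ∈ y ++ (z ++ x) := by
    simp only [List.mem_append] at hl ⊢
    tauto
  have h4 := chordFlow_cons hw2 hl'
  simp only at h2
  rw [h3, mul_zero, sub_zero, h4] at h2
  rw [← h2]
  unfold inWord
  split_ifs <;> simp_all

/-- The arrow sum after smoothing `c` against the orientation, in terms of the original word. -/
lemma Isotropic.arrowSum_twist {x y z : List (ι × Bool)} {c : ι} {b : Bool}
    (hw : PairedWord (x ++ ((c, b) :: y ++ (c, !b) :: z)))
    (hi : Isotropic (x ++ ((c, b) :: y ++ (c, !b) :: z))) :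
    arrowSum (twistWord y (z ++ x)) (labels (y ++ (z ++ x))) =
      ∑ d ∈ labels (y ++ (z ++ x)), ∑ e ∈ labels (y ++ (z ++ x)),
        twistTerm (x ++ ((c, b) :: y ++ (c, !b) :: z)) c d e := by
  have hw2 := hw.rotate
  have hi2 := hi.rotate hw
  have e : (c, b) :: y ++ (c, !b) :: z ++ x = (c, b) :: y ++ (c, !b) :: (z ++ x) := by simp
  rw [e] at hi2 hw2
  obtain ⟨r1, r2⟩ := hw2.remove
  have hit := hi2.twist hw2
  have ht := r1.twist
  have e2 : twistWord y (z ++ x) = (y.reverse ++ z).map (flipMark y) ++ x.map (flipMark y) := by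
    simp [twistWord]
  have hlab := labels_twistWord y (z ++ x)
  rw [e2] at hit ht
  have h1 := hit.arrowSum_rotate ht
  rw [← e2, hlab, labels_perm (List.perm_append_comm : (x.map (flipMark y) ++
    (y.reverse ++ z).map (flipMark y)).Perm _), ← e2, hlab] at h1
  rw [← h1]
  have hnd := (List.nodup_append.1 hw.1)
  have hd1 : ∀ l ∈ y, l ∉ x := fun l hl hx => hnd.2.2 _ hx l (by simp [hl]) rfl
  have hd2 : ∀ l ∈ z, l ∉ x := fun l hl hx => hnd.2.2 _ hx l (by simp [hl]) rfl
  have hd3 : ∀ l ∈ z, l ∉ y := fun l hl => r1.disjoint l (by simp [hl])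
  have hyn : y.Nodup := (List.nodup_append.1 r1.1).1
  -- Reversing `y` changes the order of two passages exactly if both lie in `y`, that is, if the
  -- flow of `c` does not vanish at them.
  have hord : ∀ l ∈ y ++ (z ++ x), ∀ m ∈ y ++ (z ++ x),
      orderSign (x.map (flipMark y) ++ (y.reverse ++ z).map (flipMark y)) (flipMark y l)
        (flipMark y m) = twistOrder (x ++ ((c, b) :: y ++ (c, !b) :: z)) c l m := by
    intro l hl m hm
    have hl' : l ∈ x ++ y ++ z := by
      simp only [List.mem_append] at hl ⊢
      tauto
    have hm' : m ∈ x ++ y ++ z := by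
      simp only [List.mem_append] at hm ⊢
      tauto
    have hlc : ∀ b', l ≠ (c, b') := fun b' h => r2 l hl (by rw [h])
    have hmc : ∀ b', m ≠ (c, b') := fun b' h => r2 m hm (by rw [h])
    have hcy : (c, !b) ∉ y := fun h => r2 (c, !b) (by simp [h]) rfl
    unfold twistOrder
    rw [← List.map_append, orderSign_map (flipMark_injective y)]
    simp only [ne_eq, chordFlow_eq_zero_iff hw hl', chordFlow_eq_zero_iff hw hm', not_not]
    rw [List.cons_append]
    have c1 : (l ∈ x ∧ l ∉ y) ∨ (l ∉ x ∧ l ∈ y) ∨ (l ∉ x ∧ l ∉ y) := by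
      have := hd1 l
      tauto
    have c2 : (m ∈ x ∧ m ∉ y) ∨ (m ∉ x ∧ m ∈ y) ∨ (m ∉ x ∧ m ∉ y) := by
      have := hd1 m
      tauto
    rcases c1 with ⟨a1, a2⟩ | ⟨a1, a2⟩ | ⟨a1, a2⟩ <;>
      rcases c2 with ⟨b1, b2⟩ | ⟨b1, b2⟩ | ⟨b1, b2⟩ <;>
      simp [a1, a2, b1, b2, orderSign_append_left, orderSign_append_right, orderSign_append_lt,
        orderSign_append_gt, orderSign_cons, hlc, hmc, orderSign_reverse hyn]
  refine Finset.sum_congr rfl fun d hd => Finset.sum_congr rfl fun f hf => ?_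
  have hmem : ∀ g ∈ labels (y ++ (z ++ x)), ∀ b', (g, b') ∈ y ++ (z ++ x) := fun g hg b' =>
    (r1.mem_labels b').1 hg
  have hside : ∀ g ∈ labels (y ++ (z ++ x)), (if OddIn y g then (-1 : ℤ) else 1) =
      sideSign (x ++ ((c, b) :: y ++ (c, !b) :: z)) c (g, true) *
        sideSign (x ++ ((c, b) :: y ++ (c, !b) :: z)) c (g, false) := by
    intro g hg
    have m1 : ∀ b', (g, b') ∈ x ++ y ++ z := fun b' => by
      have := hmem g hg b'
      simp only [List.mem_append] at this ⊢
      tauto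
    unfold sideSign OddIn
    simp only [chordFlow_eq_zero_iff hw (m1 true), chordFlow_eq_zero_iff hw (m1 false)]
    by_cases a1 : (g, true) ∈ y <;> by_cases a2 : (g, false) ∈ y <;> simp [a1, a2]
  rw [chordIndex_flipMark y, orderSum_flipMark y, hside d hd, hside f hf]
  simp only [hord _ (hmem f hf _) _ (hmem d hd _)]
  unfold twistTerm
  ring

/-- The average number of circles if one crossing is smoothed with the orientation. -/
lemma Isotropic.eval_derivative_oneState {w : List (ι × Bool)} (hw : PairedWord w)
    (hi : Isotropic w) {c : ι} (hc : c ∈ labels w) :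
    -4 * (derivative (partialLoopPoly (oneState c true) w)).eval (-2) =
      16 * (labels w).card + 3 * arrowSum w (labels w) +
        3 * ∑ d ∈ (labels w).erase c, ∑ e ∈ (labels w).erase c, twistTerm w c d e := by
  obtain ⟨x, b, y, z, rfl⟩ := hw.exists_split hc
  have e : (c, b) :: y ++ (c, !b) :: z ++ x = (c, b) :: y ++ (c, !b) :: (z ++ x) := by simp
  have hw2 := hw.rotate
  have hi2 := hi.rotate hw
  have ha := hi.arrowSum_rotate hw
  have hl := labels_perm (List.perm_append_comm :
    (x ++ ((c, b) :: y ++ (c, !b) :: z)).Perm ((c, b) :: y ++ (c, !b) :: z ++ x))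
  rw [partialLoopPoly_rotate _ hw]
  have ht := hi.arrowSum_twist hw
  rw [e] at hw2 hi2 ha hl ⊢
  obtain ⟨r1, r2⟩ := hw2.remove
  have hcl := notMem_labels r2
  have he : (labels (x ++ ((c, b) :: y ++ (c, !b) :: z))).erase c = labels (y ++ (z ++ x)) := by
    rw [hl, labels_remove, Finset.erase_insert hcl]
  rw [he, ← ht, ← ha, hl, partialLoopPoly_oneState hw2]
  have h1 := hi2.eval_derivative hw2
  have h2 := (hi2.twist hw2).eval_derivative r1.twist
  rw [labels_twistWord] at h2
  have h3 : (labels ((c, b) :: y ++ (c, !b) :: (z ++ x))).card =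
      (labels (y ++ (z ++ x))).card + 1 := by
    rw [labels_remove, Finset.card_insert_of_notMem hcl]
  simp only [derivative_sub, derivative_neg, eval_sub, eval_neg]
  rw [h3] at h1 ⊢
  push_cast at h1 h2 ⊢
  linarith

end Averages

/-! ### Derivatives of the Jones polynomial in terms of linked crossings -/

namespace GaussWord

open Polynomial

variable {N : ℕ} {w : GaussWord}

/-- `1` if the crossing `c` is smoothed with the orientation. -/
def smoothed (c : Fin (N + 1)) (T : Finset (Fin (N + 1))) : ℝ := if c ∈ T then 1 else 0

lemma stateAvg_congr {f g : Finset (Fin (N + 1)) → ℝ}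
    (h : ∀ T ⊆ labels (w.flatten N), f T = g T) : stateAvg N w f = stateAvg N w g :=
  Finset.sum_congr rfl fun T hT => by rw [h T (Finset.mem_powerset.1 hT)]

lemma stateAvg_add (f g : Finset (Fin (N + 1)) → ℝ) :
    stateAvg N w (fun T => f T + g T) = stateAvg N w f + stateAvg N w g := by
  simp only [stateAvg, mul_add, Finset.sum_add_distrib]

lemma stateAvg_mul (a : ℝ) (f : Finset (Fin (N + 1)) → ℝ) :
    stateAvg N w (fun T => a * f T) = a * stateAvg N w f := by
  unfold stateAvg
  rw [Finset.mul_sum]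
  exact Finset.sum_congr rfl fun T _ => by ring

lemma stateAvg_sum {α : Type*} (s : Finset α) (f : α → Finset (Fin (N + 1)) → ℝ) :
    stateAvg N w (fun T => ∑ i ∈ s, f i T) = ∑ i ∈ s, stateAvg N w (f i) := by
  simp only [stateAvg, Finset.mul_sum]
  exact Finset.sum_comm

lemma stateAvg_prod {F : Finset (Fin (N + 1))} (hF : F ⊆ labels (w.flatten N)) :
    stateAvg N w (fun T => ∏ c ∈ F, smoothed c T) =
      (-1) ^ F.card * (-1 / 2) * ((partialLoopPoly (setState F) (w.flatten N)).eval (-2) : ℤ) := by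
  rw [partialLoopPoly_setState hF, eval_finsetSum]
  push_cast
  unfold stateAvg
  rw [Finset.mul_sum]
  refine Finset.sum_congr rfl fun T _ => ?_
  obtain ⟨l, hl⟩ := Nat.exists_eq_succ_of_ne_zero (loopNumber_pos (w.flatten N).get T).ne'
  rw [hl]
  simp only [eval_mul, eval_C, eval_pow, eval_X, smoothed]
  have : ((-1 : ℝ) ^ F.card) * (-1) ^ F.card = 1 := by
    rw [← mul_pow]; norm_num
  push_cast
  rw [pow_succ]
  linear_combination (-(-1) ^ (labels (w.flatten N)).card * (-2) ^ l *
    ∏ c ∈ F, if c ∈ T then 1 else 0) * this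

lemma stateAvg_prod_loop {F : Finset (Fin (N + 1))} (hF : F ⊆ labels (w.flatten N)) :
    stateAvg N w (fun T => (∏ c ∈ F, smoothed c T) * loopNumber (w.flatten N).get T) =
      (-1) ^ F.card *
        ((derivative (partialLoopPoly (setState F) (w.flatten N))).eval (-2) : ℤ) := by
  rw [partialLoopPoly_setState hF, derivative_sum, eval_finsetSum]
  push_cast
  unfold stateAvg
  rw [Finset.mul_sum]
  refine Finset.sum_congr rfl fun T _ => ?_
  simp only [derivative_C_mul_X_pow, eval_mul, eval_C, eval_pow, eval_X, smoothed]
  have : ((-1 : ℝ) ^ F.card) * (-1) ^ F.card = 1 := by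
    rw [← mul_pow]; norm_num
  push_cast
  linear_combination (-(-1) ^ (labels (w.flatten N)).card *
    (-2) ^ (loopNumber (w.flatten N).get T - 1) * (∏ c ∈ F, if c ∈ T then 1 else 0) *
    (loopNumber (w.flatten N).get T)) * this

lemma setState_empty : setState (∅ : Finset (Fin (N + 1))) = fun _ => none := by
  funext c; simp [setState]

lemma stateAvg_one (hP : PairedWord (w.flatten N)) : stateAvg N w (fun _ => 1) = 1 := by
  have := stateAvg_prod (w := w) (Finset.empty_subset (labels (w.flatten N)))
  rw [setState_empty, partialLoopPoly_none, eval_signedLoopPoly hP] at this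
  simpa using this

lemma smoothed_sq (c : Fin (N + 1)) (T : Finset (Fin (N + 1))) :
    smoothed c T * smoothed c T = smoothed c T := by
  unfold smoothed; split_ifs <;> simp

/-- `1` if the two crossings are linked, and `0` otherwise. -/
def link (w : List (Fin (N + 1) × Bool)) (c d : Fin (N + 1)) : ℝ := if Linked w c d then 1 else 0

/-- `1` if two of the three crossings are linked, and `0` otherwise. -/
def anyLink (w : List (Fin (N + 1) × Bool)) (c d e : Fin (N + 1)) : ℝ :=
  if Linked w c d ∨ Linked w c e ∨ Linked w d e then 1 else 0

lemma link_self (w : List (Fin (N + 1) × Bool)) (c : Fin (N + 1)) : link w c c = 0 := by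
  simp [link, not_linked_self]

lemma anyLink_self (w : List (Fin (N + 1) × Bool)) (c e : Fin (N + 1)) :
    anyLink w c c e = link w c e := by
  simp [link, anyLink, not_linked_self]

/-- `1` if the two crossings agree, and `0` otherwise. -/
def same (c d : Fin (N + 1)) : ℝ := if c = d then 1 else 0

variable (w) in
lemma stateAvg_smoothed (hP : PairedWord (w.flatten N)) {c : Fin (N + 1)}
    (hc : c ∈ labels (w.flatten N)) : stateAvg N w (smoothed c) = 2 := by
  have h := stateAvg_prod (w := w) (Finset.singleton_subset_iff.2 hc)
  rw [← oneState_eq, eval_oneState hP hc] at h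
  simp only [Finset.prod_singleton, Finset.card_singleton] at h
  rw [h]; norm_num

variable (w) in
lemma stateAvg_smoothed_two (hP : PairedWord (w.flatten N)) {c d : Fin (N + 1)}
    (hc : c ∈ labels (w.flatten N)) (hd : d ∈ labels (w.flatten N)) :
    stateAvg N w (fun T => smoothed c T * smoothed d T) =
      4 - 3 * link (w.flatten N) c d - 2 * same c d := by
  by_cases h : c = d
  · subst h
    simp only [smoothed_sq, link_self]
    rw [stateAvg_smoothed w hP hc]
    simp [same]; norm_num
  have hs : ({c, d} : Finset (Fin (N + 1))) ⊆ labels (w.flatten N) := by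
    simp [Finset.insert_subset_iff, hc, hd]
  have h1 := stateAvg_prod (w := w) hs
  rw [← twoState_eq, eval_twoState hP hc hd h] at h1
  simp only [Finset.prod_pair h, Finset.card_pair h] at h1
  rw [h1]
  unfold link same
  split_ifs <;> norm_num <;> simp_all

variable (w) in
lemma stateAvg_smoothed_three (hP : PairedWord (w.flatten N)) {c d e : Fin (N + 1)}
    (hc : c ∈ labels (w.flatten N)) (hd : d ∈ labels (w.flatten N))
    (he : e ∈ labels (w.flatten N)) :
    stateAvg N w (fun T => smoothed c T * smoothed d T * smoothed e T) =
      8 - 6 * anyLink (w.flatten N) c d e - same c d * (4 - 3 * link (w.flatten N) c e) -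
        same c e * (4 - 3 * link (w.flatten N) c d) -
        same d e * (4 - 3 * link (w.flatten N) c d) + 6 * (same c d * same c e) := by
  by_cases h1 : c = d
  · subst h1
    simp only [smoothed_sq, anyLink_self, link_self]
    rw [stateAvg_smoothed_two w hP hc he]
    by_cases h2 : c = e
    · subst h2
      simp [same, link_self]; norm_num
    · simp [same, h2]; ring
  by_cases h2 : c = e
  · subst h2
    have : ∀ T, smoothed c T * smoothed d T * smoothed c T = smoothed c T * smoothed d T := by
      intro T
      rw [mul_right_comm, smoothed_sq]
    simp only [this]
    rw [stateAvg_smoothed_two w hP hc hd]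
    simp only [anyLink, link, same, not_linked_self, linked_comm _ d c, if_neg h1,
      if_neg (Ne.symm h1), or_self, false_or, if_true]
    ring
  by_cases h3 : d = e
  · subst h3
    simp only [mul_assoc, smoothed_sq]
    rw [stateAvg_smoothed_two w hP hc hd]
    simp only [anyLink, link, same, not_linked_self, if_neg h1, or_self, or_false, if_true]
    ring
  have hs : ({c, d, e} : Finset (Fin (N + 1))) ⊆ labels (w.flatten N) := by
    simp [Finset.insert_subset_iff, hc, hd, he]
  have h4 := stateAvg_prod (w := w) hs
  rw [← threeState_eq, eval_threeState hP hc hd he h1 h2 h3, Finset.card_eq_three.2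
    ⟨c, d, e, h1, h2, h3, rfl⟩] at h4
  have h5 : ∀ T, ∏ f ∈ ({c, d, e} : Finset (Fin (N + 1))), smoothed f T =
      smoothed c T * smoothed d T * smoothed e T := fun T => by
    rw [Finset.prod_insert (by simp [h1, h2]), Finset.prod_pair h3, mul_assoc]
  simp only [h5] at h4
  rw [h4]
  simp only [same, anyLink, if_neg h1, if_neg h2, if_neg h3]
  split_ifs <;> norm_num

variable (w) in
lemma stateAvg_loops (hP : PairedWord (w.flatten N)) (hi : Isotropic (w.flatten N)) :
    stateAvg N w (fun T => loopNumber (w.flatten N).get T) =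
      1 + 2 * (labels (w.flatten N)).card +
        3 / 4 * arrowSum (w.flatten N) (labels (w.flatten N)) := by
  have h := stateAvg_prod_loop (w := w) (Finset.empty_subset (labels (w.flatten N)))
  have h2 := hi.eval_derivative hP
  rw [setState_empty, partialLoopPoly_none] at h
  have h3 : (4 : ℝ) * ((derivative (signedLoopPoly (w.flatten N))).eval (-2) : ℤ) =
    (4 + 8 * (labels (w.flatten N)).card +
      3 * arrowSum (w.flatten N) (labels (w.flatten N)) : ℤ) := by
    rw [← h2]; push_cast; ring
  push_cast at h3
  simp only [Finset.prod_empty, one_mul, Finset.card_empty, pow_zero] at h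
  rw [h]
  linarith

variable (w) in
lemma stateAvg_smoothed_loops (hP : PairedWord (w.flatten N)) (hi : Isotropic (w.flatten N))
    {c : Fin (N + 1)} (hc : c ∈ labels (w.flatten N)) :
    stateAvg N w (fun T => smoothed c T * loopNumber (w.flatten N).get T) =
      4 * (labels (w.flatten N)).card +
        3 / 4 * arrowSum (w.flatten N) (labels (w.flatten N)) +
        3 / 4 * (∑ d ∈ (labels (w.flatten N)).erase c, ∑ e ∈ (labels (w.flatten N)).erase c,
          twistTerm (w.flatten N) c d e : ℤ) := by
  have h := stateAvg_prod_loop (w := w) (Finset.singleton_subset_iff.2 hc)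
  have h2 := hi.eval_derivative_oneState hP hc
  rw [← oneState_eq] at h
  have h3 := congrArg (Int.cast (R := ℝ)) h2
  simp only [Finset.prod_singleton, Finset.card_singleton, pow_one] at h
  rw [h]
  rw [Int.cast_add, Int.cast_add, Int.cast_mul, Int.cast_mul, Int.cast_mul, Int.cast_mul] at h3
  push_cast at h3 ⊢
  linarith

/-- A crossing, as a function on the smoothings, shifted to average `0`. -/
noncomputable def centered (c : Fin (N + 1)) (T : Finset (Fin (N + 1))) : ℝ :=
  1 - smoothed c T / 2

variable (w) in
lemma exponent_eq {T : Finset (Fin (N + 1))} (hT : T ⊆ labels (w.flatten N)) :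
    exponent N w T = ∑ c ∈ labels (w.flatten N), (signAt N w c : ℝ) * centered c T := by
  unfold exponent centered smoothed
  rw [← Finset.inter_eq_right.2 hT, ← Finset.sum_ite_mem, Finset.sum_div,
    ← Finset.sum_sub_distrib]
  refine Finset.sum_congr rfl fun c _ => ?_
  have : c ∈ labels (w.flatten N) ∩ T ↔ c ∈ T := by rw [Finset.inter_eq_right.2 hT]
  simp only [this]
  split_ifs <;> ring

variable (w) in
lemma stateAvg_const (hP : PairedWord (w.flatten N)) (a : ℝ) : stateAvg N w (fun _ => a) = a := by
  have := stateAvg_mul (w := w) (N := N) a (fun _ => 1)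
  simpa [stateAvg_one hP] using this

variable (w) in
lemma stateAvg_centered (hP : PairedWord (w.flatten N)) {c : Fin (N + 1)}
    (hc : c ∈ labels (w.flatten N)) : stateAvg N w (centered c) = 0 := by
  have : centered c = fun T => 1 + (-1 / 2) * smoothed c T := by
    funext T; unfold centered; ring
  rw [this, stateAvg_add, stateAvg_mul, stateAvg_one hP]
  rw [stateAvg_smoothed w hP hc]
  norm_num

variable (w) in
lemma stateAvg_centered_two (hP : PairedWord (w.flatten N)) {c d : Fin (N + 1)}
    (hc : c ∈ labels (w.flatten N)) (hd : d ∈ labels (w.flatten N)) :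
    stateAvg N w (fun T => centered c T * centered d T) =
      -(3 / 4) * link (w.flatten N) c d - same c d / 2 := by
  have : (fun T => centered c T * centered d T) = fun T => 1 + (-1 / 2) * smoothed c T +
      (-1 / 2) * smoothed d T + (1 / 4) * (smoothed c T * smoothed d T) := by
    funext T; unfold centered; ring
  rw [this, stateAvg_add, stateAvg_add, stateAvg_add, stateAvg_mul, stateAvg_mul, stateAvg_mul,
    stateAvg_one hP, stateAvg_smoothed_two w hP hc hd, stateAvg_smoothed w hP hc,
    stateAvg_smoothed w hP hd]
  ring

variable (w) in
lemma stateAvg_centered_three (hP : PairedWord (w.flatten N)) {c d e : Fin (N + 1)}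
    (hc : c ∈ labels (w.flatten N)) (hd : d ∈ labels (w.flatten N))
    (he : e ∈ labels (w.flatten N)) :
    stateAvg N w (fun T => centered c T * centered d T * centered e T) =
      -(3 / 4) * (link (w.flatten N) c d + link (w.flatten N) c e + link (w.flatten N) d e) +
        3 / 4 * anyLink (w.flatten N) c d e - 3 / 8 * (same c d * link (w.flatten N) c e +
          same c e * link (w.flatten N) c d + same d e * link (w.flatten N) c d) -
        3 / 4 * (same c d * same c e) := by
  have : (fun T => centered c T * centered d T * centered e T) = fun T => 1 +
      (-1 / 2) * smoothed c T + (-1 / 2) * smoothed d T + (-1 / 2) * smoothed e T +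
      (1 / 4) * (smoothed c T * smoothed d T) + (1 / 4) * (smoothed c T * smoothed e T) +
      (1 / 4) * (smoothed d T * smoothed e T) +
      (-1 / 8) * (smoothed c T * smoothed d T * smoothed e T) := by
    funext T; unfold centered; ring
  rw [this]
  simp only [stateAvg_add, stateAvg_mul]
  rw [stateAvg_one hP, stateAvg_smoothed_two w hP hc hd, stateAvg_smoothed_two w hP hc he,
    stateAvg_smoothed_two w hP hd he, stateAvg_smoothed_three w hP hc hd he]
  rw [stateAvg_smoothed w hP hc, stateAvg_smoothed w hP hd, stateAvg_smoothed w hP he]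
  ring

variable (w) in
lemma stateAvg_exponent (hP : PairedWord (w.flatten N)) :
    stateAvg N w (exponent N w) = 0 := by
  rw [stateAvg_congr fun T hT => exponent_eq w hT, stateAvg_sum]
  refine Finset.sum_eq_zero fun c hc => ?_
  rw [stateAvg_mul, stateAvg_centered w hP hc, mul_zero]

variable (w) in
lemma stateAvg_loops_sub_one (f : Finset (Fin (N + 1)) → ℝ) (a : ℝ) :
    stateAvg N w (fun T => f T + a * (loopNumber (w.flatten N).get T - 1 : ℕ)) =
      stateAvg N w (fun T => f T + (a * loopNumber (w.flatten N).get T - a)) :=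
  stateAvg_congr fun T _ => by
    rw [Nat.cast_sub (loopNumber_pos _ _)]
    push_cast
    ring

variable (N w) in
/-- The number of ordered pairs of linked crossings, counted with the product of their signs. -/
noncomputable def linkSum : ℝ := ∑ c ∈ labels (w.flatten N), ∑ d ∈ labels (w.flatten N),
  (signAt N w c : ℝ) * signAt N w d * link (w.flatten N) c d

variable (w) in
lemma stateAvg_exponent_sq (hP : PairedWord (w.flatten N)) :
    stateAvg N w (fun T => exponent N w T ^ 2) =
      -(3 / 4) * linkSum N w - (labels (w.flatten N)).card / 2 := by
  have : ∀ T ⊆ labels (w.flatten N), exponent N w T ^ 2 = ∑ c ∈ labels (w.flatten N),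
      ∑ d ∈ labels (w.flatten N), (signAt N w c * signAt N w d : ℝ) *
        (centered c T * centered d T) := by
    intro T hT
    rw [exponent_eq w hT, sq, Finset.sum_mul_sum]
    exact Finset.sum_congr rfl fun c _ => Finset.sum_congr rfl fun d _ => by ring
  rw [stateAvg_congr this, stateAvg_sum]
  have h2 : ∀ c ∈ labels (w.flatten N), stateAvg N w (fun T => ∑ d ∈ labels (w.flatten N),
      (signAt N w c * signAt N w d : ℝ) * (centered c T * centered d T)) =
      -(3 / 4) * (∑ d ∈ labels (w.flatten N), (signAt N w c : ℝ) * signAt N w d *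
        link (w.flatten N) c d) - 1 / 2 := by
    intro c hc
    rw [stateAvg_sum]
    have h3 : ∀ d ∈ labels (w.flatten N), stateAvg N w (fun T =>
        (signAt N w c * signAt N w d : ℝ) * (centered c T * centered d T)) =
        -(3 / 4) * ((signAt N w c : ℝ) * signAt N w d * link (w.flatten N) c d) +
          if c = d then -1 / 2 else 0 := by
      intro d hd
      rw [stateAvg_mul, stateAvg_centered_two w hP hc hd]
      unfold same
      split_ifs with h
      · subst h
        have : (signAt N w c * signAt N w c : ℝ) = 1 := by
          rcases signAt_cases w c with h | h <;> rw [h] <;> norm_num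
        rw [this, link_self]
        norm_num
      · ring
    rw [Finset.sum_congr rfl h3, Finset.sum_add_distrib, Finset.sum_ite_eq, if_pos hc,
      Finset.mul_sum]
    ring
  rw [Finset.sum_congr rfl h2, Finset.sum_sub_distrib, ← Finset.mul_sum]
  simp [linkSum]
  ring

/-- The second derivative of the Jones polynomial at `1`. -/
lemma Planar.iteratedDeriv_two {w : GaussWord} (hp : w.Planar) (hw : w.WellFormed)
    (hN : ∀ p ∈ w, p.label ≤ N) :
    iteratedDeriv 2 w.jones 1 = -(3 / 4) * linkSum N w +
      3 / 16 * arrowSum (w.flatten N) (labels (w.flatten N)) := by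
  have hP := hw.pairedWord hN
  have hi := hp.isotropic hw hN
  rw [(hasMoments_jones hw hN).iteratedDeriv_two]
  simp only [Matrix.cons_val]
  rw [stateAvg_exponent w hP]
  have e : (fun T => exponent N w T ^ 2 +
      ((loopNumber (w.flatten N).get T - 1 : ℕ) : ℝ) / 4) = fun T => exponent N w T ^ 2 +
      (1 / 4) * ((loopNumber (w.flatten N).get T - 1 : ℕ) : ℝ) := by
    funext T; ring
  rw [e, stateAvg_loops_sub_one]
  simp only [sub_eq_add_neg, stateAvg_add, stateAvg_mul]
  rw [stateAvg_const w hP, stateAvg_exponent_sq w hP, stateAvg_loops w hP hi]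
  ring

variable (w) in
lemma stateAvg_exponent_loops (hP : PairedWord (w.flatten N)) (hi : Isotropic (w.flatten N))
    (hs : ∀ c ∈ labels (w.flatten N), signAt N w c = 1) :
    stateAvg N w (fun T => exponent N w T * loopNumber (w.flatten N).get T) =
      (labels (w.flatten N)).card + 3 / 8 * ∑ c ∈ labels (w.flatten N),
        ((arrowSum (w.flatten N) (labels (w.flatten N)) -
          ∑ d ∈ (labels (w.flatten N)).erase c, ∑ e ∈ (labels (w.flatten N)).erase c,
          twistTerm (w.flatten N) c d e : ℤ) : ℝ) := by
  have : ∀ T ⊆ labels (w.flatten N), exponent N w T * loopNumber (w.flatten N).get T =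
      ∑ c ∈ labels (w.flatten N), (1 * (loopNumber (w.flatten N).get T : ℝ) +
        (-1 / 2) * (smoothed c T * loopNumber (w.flatten N).get T)) := by
    intro T hT
    rw [exponent_eq w hT, Finset.sum_mul]
    refine Finset.sum_congr rfl fun c hc => ?_
    rw [hs c hc]
    unfold centered
    push_cast
    ring
  rw [stateAvg_congr this, stateAvg_sum]
  have h2 : ∀ c ∈ labels (w.flatten N), stateAvg N w (fun T =>
      1 * (loopNumber (w.flatten N).get T : ℝ) +
        (-1 / 2) * (smoothed c T * loopNumber (w.flatten N).get T)) = 1 + 3 / 8 *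
      ((arrowSum (w.flatten N) (labels (w.flatten N)) -
          ∑ d ∈ (labels (w.flatten N)).erase c, ∑ e ∈ (labels (w.flatten N)).erase c,
          twistTerm (w.flatten N) c d e : ℤ) : ℝ) := by
    intro c hc
    rw [stateAvg_add, stateAvg_mul, stateAvg_mul, stateAvg_loops w hP hi,
      stateAvg_smoothed_loops w hP hi hc, Int.cast_sub]
    ring
  rw [Finset.sum_congr rfl h2, Finset.sum_add_distrib, ← Finset.mul_sum]
  simp

variable (w) in
/-- The third moment of the exponent; all correlations of at most three crossings are known. -/
lemma stateAvg_exponent_cube (hP : PairedWord (w.flatten N))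
    (hs : ∀ c ∈ labels (w.flatten N), signAt N w c = 1) :
    stateAvg N w (fun T => exponent N w T ^ 3) =
      -(9 / 4) * (labels (w.flatten N)).card * linkSum N w +
      3 / 4 * (∑ c ∈ labels (w.flatten N), ∑ d ∈ labels (w.flatten N),
        ∑ e ∈ labels (w.flatten N), anyLink (w.flatten N) c d e) -
      9 / 8 * linkSum N w - 3 / 4 * (labels (w.flatten N)).card := by
  set L := labels (w.flatten N)
  have : ∀ T ⊆ L, exponent N w T ^ 3 = ∑ c ∈ L, ∑ d ∈ L, ∑ e ∈ L,
        (centered c T * centered d T * centered e T) := by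
    intro T hT
    have h0 : exponent N w T = ∑ c ∈ L, centered c T := by
      rw [exponent_eq w hT]
      exact Finset.sum_congr rfl fun c hc => by rw [hs c hc]; simp
    rw [h0, pow_succ, sq, Finset.sum_mul_sum, Finset.sum_mul]
    refine Finset.sum_congr rfl fun c _ => ?_
    rw [Finset.sum_mul]
    refine Finset.sum_congr rfl fun d _ => ?_
    rw [Finset.mul_sum]
  have hΛ : linkSum N w = ∑ c ∈ L, ∑ d ∈ L, link (w.flatten N) c d := by
    unfold linkSum
    refine Finset.sum_congr rfl fun c hc => Finset.sum_congr rfl fun d hd => ?_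
    rw [hs c hc, hs d hd]
    simp
  rw [stateAvg_congr this]
  simp only [stateAvg_sum]
  rw [Finset.sum_congr rfl fun c hc => Finset.sum_congr rfl fun d hd =>
    Finset.sum_congr rfl fun e he => stateAvg_centered_three w hP hc hd he]
  simp only [Finset.sum_add_distrib, Finset.sum_sub_distrib, ← Finset.mul_sum]
  have k1 : ∑ c ∈ L, ∑ d ∈ L, ∑ _e ∈ L, link (w.flatten N) c d = L.card * linkSum N w := by
    rw [hΛ]; simp only [Finset.sum_const, nsmul_eq_mul, Finset.mul_sum]
  have k2 : ∑ c ∈ L, ∑ _d ∈ L, ∑ e ∈ L, link (w.flatten N) c e = L.card * linkSum N w := by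
    rw [hΛ]; simp only [Finset.sum_const, nsmul_eq_mul, Finset.mul_sum]
  have k3 : ∑ _c ∈ L, ∑ d ∈ L, ∑ e ∈ L, link (w.flatten N) d e = L.card * linkSum N w := by
    rw [hΛ]; simp only [Finset.sum_const, nsmul_eq_mul]
  have k4 : ∑ c ∈ L, ∑ d ∈ L, same c d * ∑ e ∈ L, link (w.flatten N) c e = linkSum N w := by
    rw [hΛ]
    refine Finset.sum_congr rfl fun c hc => ?_
    simp [same, hc]
  have k5 : ∑ c ∈ L, ∑ d ∈ L, ∑ e ∈ L, same c e * link (w.flatten N) c d = linkSum N w := by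
    rw [hΛ]
    refine Finset.sum_congr rfl fun c hc => Finset.sum_congr rfl fun d hd => ?_
    simp [same, hc]
  have k6 : ∑ c ∈ L, ∑ d ∈ L, ∑ e ∈ L, same d e * link (w.flatten N) c d = linkSum N w := by
    rw [hΛ]
    refine Finset.sum_congr rfl fun c hc => Finset.sum_congr rfl fun d hd => ?_
    simp [same, hd]
  have k7 : ∑ c ∈ L, ∑ d ∈ L, same c d * ∑ e ∈ L, same c e = L.card := by
    rw [Finset.card_eq_sum_ones]
    push_cast
    refine Finset.sum_congr rfl fun c hc => ?_
    simp [same, hc]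
  rw [k1, k2, k3, k4, k5, k6, k7]
  ring

/-- The invariant of degree three for positive diagrams. -/
lemma Planar.third_order {w : GaussWord} (hp : w.Planar) (hw : w.WellFormed)
    (hN : ∀ p ∈ w, p.label ≤ N) (hs : ∀ c ∈ labels (w.flatten N), signAt N w c = 1) :
    4 * (-(1 / 144) * iteratedDeriv 3 w.jones 1 - (1 / 48) * iteratedDeriv 2 w.jones 1) =
      (1 / 16) * ((labels (w.flatten N)).card * linkSum N w) + (1 / 32) * linkSum N w -
      (1 / 48) * (∑ c ∈ labels (w.flatten N), ∑ d ∈ labels (w.flatten N),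
        ∑ e ∈ labels (w.flatten N), anyLink (w.flatten N) c d e) -
      (1 / 128) * ∑ c ∈ labels (w.flatten N),
        ((arrowSum (w.flatten N) (labels (w.flatten N)) -
          ∑ d ∈ (labels (w.flatten N)).erase c, ∑ e ∈ (labels (w.flatten N)).erase c,
          twistTerm (w.flatten N) c d e : ℤ) : ℝ) := by
  have hP := hw.pairedWord hN
  have hi := hp.isotropic hw hN
  rw [(hasMoments_jones hw hN).iteratedDeriv_two, (hasMoments_jones hw hN).iteratedDeriv_three]
  simp only [Matrix.cons_val]
  rw [stateAvg_exponent w hP]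
  have e : stateAvg N w (fun T => exponent N w T ^ 3 + 3 * exponent N w T *
      ((loopNumber (w.flatten N).get T - 1 : ℕ) : ℝ) / 4) = stateAvg N w fun T =>
      exponent N w T ^ 3 + (3 / 4 * (exponent N w T * loopNumber (w.flatten N).get T) +
        (-3 / 4) * exponent N w T) :=
    stateAvg_congr fun T _ => by
      rw [Nat.cast_sub (loopNumber_pos _ _)]
      push_cast
      ring
  rw [e]
  have e3 := stateAvg_exponent w hP
  rw [show exponent N w = fun T => exponent N w T from rfl] at e3
  rw [stateAvg_add, stateAvg_add, stateAvg_mul, stateAvg_mul, e3,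
    stateAvg_exponent_loops w hP hi hs, stateAvg_exponent_cube w hP hs]
  ring

end GaussWord

/-! ### An inequality between the numbers of configurations of chords -/

section ChordConfigurations

/-- The order of two positions, with the conventions of `orderSign`. -/
def posOrder (x y : ℕ) : ℤ := if y < x then 1 else if x < y then -1 else 0

section

variable {α : Type*} (o : α → α → ℤ)

/-- `chordFlow`, in terms of the order of the passages. -/
def flowOf (m n l : α) : ℤ := o l m - o l n

/-- `chordIndex`, in terms of the order of the passages. -/
def indexOf (c c' d d' : α) : ℤ := flowOf o c c' d - flowOf o c c' d'

/-- `orderSum`, in terms of the order of the passages. -/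
def orderSumOf (c c' d d' : α) : ℤ := o d c + o d c' + o d' c + o d' c'

/-- `twistOrder`, in terms of the order of the passages. -/
def twistOrderOf (c c' l m : α) : ℤ :=
  if flowOf o c c' l ≠ 0 ∧ flowOf o c c' m ≠ 0 then -o l m else o l m

/-- `sideSign`, in terms of the order of the passages. -/
def sideSignOf (c c' l : α) : ℤ := if flowOf o c c' l = 0 then 1 else -1

/-- `twistTerm`, in terms of the order of the passages. -/
def twistTermOf (c c' d d' e e' : α) : ℤ :=
  sideSignOf o c c' d * sideSignOf o c c' d' * (sideSignOf o c c' e * sideSignOf o c c' e') *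
  ((twistOrderOf o c c' e d - twistOrderOf o c c' e d' - twistOrderOf o c c' e' d +
      twistOrderOf o c c' e' d') *
    (twistOrderOf o c c' e d + twistOrderOf o c c' e d' + twistOrderOf o c c' e' d +
      twistOrderOf o c c' e' d'))

/-- The elements follow each other in the given order. -/
def Chain (a b c d : α) : Prop := o b a = 1 ∧ o c b = 1 ∧ o d c = 1

instance (a b c d : α) : Decidable (Chain o a b c d) := by unfold Chain; infer_instance

/-- The multiplicity with which the vanishing of the intersection number of two of the curves
`chordFlow` is used. Together with the multiplicity `18` of the relation in `tripleTerm`, these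
numbers solve the linear program which asks that the symmetrized contributions of three crossings
be nonnegative for all relative positions of their six passages. -/
def flowCoeff (c c' d d' : α) : ℤ :=
  (if Chain o d' d c' c ∨ Chain o c' d' c d then 42 else 0) +
  (if Chain o c c' d d' ∨ Chain o d c d' c' then 6 else 0) +
  (if Chain o c' d c d' ∨ Chain o c d' c' d then 18 else 0)

/-- The contribution of three crossings, given by their passages, to a multiple of the difference
of the two invariants. The last two summands do not contribute in total, because intersection
numbers vanish. -/
def tripleTerm (c c' d d' e e' : α) : ℤ :=
  24 * (if indexOf o d d' e e' ≠ 0 then 1 else 0) -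
  8 * (if indexOf o c c' d d' ≠ 0 ∨ indexOf o c c' e e' ≠ 0 ∨ indexOf o d d' e e' ≠ 0
    then 1 else 0) -
  3 * (indexOf o d d' e e' * orderSumOf o d d' e e') +
  3 * (if o c d = 0 ∨ o c e = 0 then 0 else twistTermOf o c c' d d' e e') +
  (if o c c' = 1 then 18 else 0) * (indexOf o c c' d d' * indexOf o c c' e e') +
  flowCoeff o c c' d d' * (flowOf o c c' e * flowOf o d d' e' -
    flowOf o c c' e' * flowOf o d d' e)

/-- The contribution of two crossings. -/
def pairTerm (c c' d d' : α) : ℤ :=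
  tripleTerm o c c' c c' d d' + tripleTerm o c c' d d' c c' + tripleTerm o c c' d d' d d' -
  36 * (if indexOf o c c' d d' ≠ 0 then 1 else 0) + 12 * (indexOf o c c' d d' *
    orderSumOf o c c' d d')

/-- The contribution of three crossings, in all orders. -/
def tripleSym (c c' d d' e e' : α) : ℤ :=
  tripleTerm o c c' d d' e e' + tripleTerm o c c' e e' d d' + tripleTerm o d d' c c' e e' +
  tripleTerm o d d' e e' c c' + tripleTerm o e e' c c' d d' + tripleTerm o e e' d d' c c'

end

/-- The check of the contributions of three crossings, with passages at the given positions. -/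
def tripleCheck : List ℕ → Bool
  | [c, c', d, d', e, e'] => decide (0 ≤ tripleSym posOrder c c' d d' e e')
  | _ => true

/-- The check of the contributions of two crossings. -/
def pairCheck : List ℕ → Bool
  | [c, c', d, d'] => decide (pairTerm posOrder c c' d d' + pairTerm posOrder d d' c c' = 0)
  | _ => true

/-- The comparison of `indexOf` and `orderSumOf` for two crossings. -/
def arrowCheck : List ℕ → Bool
  | [c, c', d, d'] => decide (indexOf posOrder c c' d d' * orderSumOf posOrder c c' d d' ≤
      4 * if indexOf posOrder c c' d d' ≠ 0 then 1 else 0)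
  | _ => true

/-- The check of the contributions of one crossing. -/
def singleCheck : List ℕ → Bool
  | [c, c'] => decide (tripleTerm posOrder c c' c c' c c' = 0)
  | _ => true

lemma tripleCheck_eq : ([0, 1, 2, 3, 4, 5].permutations').all tripleCheck = true := by
  decide +kernel

lemma pairCheck_eq : ([0, 1, 2, 3].permutations').all pairCheck = true := by
  decide +kernel

lemma arrowCheck_eq : ([0, 1, 2, 3].permutations').all arrowCheck = true := by
  decide +kernel

lemma singleCheck_eq : ([0, 1].permutations').all singleCheck = true := by
  decide +kernel

lemma exists_rank {n : ℕ} (x : Fin n → ℕ) (hx : Function.Injective x) :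
    ∃ y : Fin n → ℕ, List.ofFn y ∈ (List.range n).permutations' ∧
      ∀ i j, posOrder (x i) (x j) = posOrder (y i) (y j) := by
  let y : Fin n → ℕ := fun i => (Finset.univ.filter fun j => x j < x i).card
  have hlt : ∀ i j, x i < x j → y i < y j := by
    intro i j h
    refine Finset.card_lt_card ⟨fun k hk => ?_, fun hsub => ?_⟩
    · simp only [Finset.mem_filter, Finset.mem_univ, true_and] at hk ⊢
      omega
    · have : i ∈ Finset.univ.filter fun k => x k < x i := hsub (by simpa using h)
      simp at this
  have hbd : ∀ i, y i < n := by
    intro i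
    have : y i < (Finset.univ : Finset (Fin n)).card :=
      Finset.card_lt_card ⟨Finset.subset_univ _, fun hsub => by
        have : i ∈ Finset.univ.filter fun k => x k < x i := hsub (Finset.mem_univ i)
        simp at this⟩
    simpa using this
  have hinj : Function.Injective y := by
    intro i j h
    rcases lt_trichotomy (x i) (x j) with h' | h' | h'
    · have := hlt _ _ h'; omega
    · exact hx h'
    · have := hlt _ _ h'; omega
  refine ⟨y, ?_, fun i j => ?_⟩
  · rw [List.mem_permutations']
    have hnd : (List.ofFn y).Nodup := List.nodup_ofFn.2 hinj
    refine List.Subperm.perm_of_length_le (List.subperm_of_subset hnd fun a ha => ?_) (by simp)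
    obtain ⟨i, rfl⟩ := List.mem_ofFn.1 ha
    exact List.mem_range.2 (hbd i)
  · unfold posOrder
    rcases lt_trichotomy (x i) (x j) with h' | h' | h'
    · have := hlt _ _ h'
      split_ifs <;> omega
    · rw [hx h']; simp
    · have := hlt _ _ h'
      simp [h', this]

lemma tripleSym_nonneg (x : Fin 6 → ℕ) (hx : Function.Injective x) :
    0 ≤ tripleSym posOrder (x 0) (x 1) (x 2) (x 3) (x 4) (x 5) := by
  obtain ⟨y, hy, h⟩ := exists_rank x hx
  have h1 := List.all_eq_true.1 tripleCheck_eq _ hy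
  have h2 : 0 ≤ tripleSym posOrder (y 0) (y 1) (y 2) (y 3) (y 4) (y 5) := by
    simpa [List.ofFn_succ, tripleCheck] using h1
  have h3 : tripleSym (fun i j => posOrder (x i) (x j)) (0 : Fin 6) 1 2 3 4 5 =
      tripleSym (fun i j => posOrder (y i) (y j)) (0 : Fin 6) 1 2 3 4 5 := by
    congr 1
    funext i j
    exact h i j
  exact h2.trans_eq h3.symm

lemma pairTerm_add (x : Fin 4 → ℕ) (hx : Function.Injective x) :
    pairTerm posOrder (x 0) (x 1) (x 2) (x 3) + pairTerm posOrder (x 2) (x 3) (x 0) (x 1) = 0 := by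
  obtain ⟨y, hy, h⟩ := exists_rank x hx
  have h1 := List.all_eq_true.1 pairCheck_eq _ hy
  have h2 : pairTerm posOrder (y 0) (y 1) (y 2) (y 3) +
      pairTerm posOrder (y 2) (y 3) (y 0) (y 1) = 0 := by
    simpa [List.ofFn_succ, pairCheck] using h1
  have h3 : (fun i j => posOrder (x i) (x j)) = fun i j => posOrder (y i) (y j) := by
    funext i j
    exact h i j
  have h4 : pairTerm (fun i j => posOrder (x i) (x j)) (0 : Fin 4) 1 2 3 +
      pairTerm (fun i j => posOrder (x i) (x j)) (2 : Fin 4) 3 0 1 =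
      pairTerm (fun i j => posOrder (y i) (y j)) (0 : Fin 4) 1 2 3 +
      pairTerm (fun i j => posOrder (y i) (y j)) (2 : Fin 4) 3 0 1 := by rw [h3]
  exact h4.trans h2

lemma indexOf_mul_le (x : Fin 4 → ℕ) (hx : Function.Injective x) :
    indexOf posOrder (x 0) (x 1) (x 2) (x 3) * orderSumOf posOrder (x 0) (x 1) (x 2) (x 3) ≤
      4 * if indexOf posOrder (x 0) (x 1) (x 2) (x 3) ≠ 0 then 1 else 0 := by
  obtain ⟨y, hy, h⟩ := exists_rank x hx
  have h1 := List.all_eq_true.1 arrowCheck_eq _ hy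
  simp only [List.ofFn_succ, List.ofFn_zero, arrowCheck, decide_eq_true_eq] at h1
  have h3 : (fun i j => posOrder (x i) (x j)) = fun i j => posOrder (y i) (y j) := by
    funext i j
    exact h i j
  have h4 : indexOf (fun i j => posOrder (x i) (x j)) (0 : Fin 4) 1 2 3 =
      indexOf (fun i j => posOrder (y i) (y j)) (0 : Fin 4) 1 2 3 := by rw [h3]
  have h5 : orderSumOf (fun i j => posOrder (x i) (x j)) (0 : Fin 4) 1 2 3 =
      orderSumOf (fun i j => posOrder (y i) (y j)) (0 : Fin 4) 1 2 3 := by rw [h3]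
  have h6 : indexOf posOrder (x 0) (x 1) (x 2) (x 3) = indexOf posOrder (y 0) (y 1) (y 2) (y 3) :=
    h4
  have h7 : orderSumOf posOrder (x 0) (x 1) (x 2) (x 3) =
    orderSumOf posOrder (y 0) (y 1) (y 2) (y 3) := h5
  rw [h6, h7]
  exact h1

lemma tripleTerm_self (x : Fin 2 → ℕ) (hx : Function.Injective x) :
    tripleTerm posOrder (x 0) (x 1) (x 0) (x 1) (x 0) (x 1) = 0 := by
  obtain ⟨y, hy, h⟩ := exists_rank x hx
  have h1 := List.all_eq_true.1 singleCheck_eq _ hy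
  have h2 : tripleTerm posOrder (y 0) (y 1) (y 0) (y 1) (y 0) (y 1) = 0 := by
    simpa [List.ofFn_succ, singleCheck] using h1
  have h3 : (fun i j => posOrder (x i) (x j)) = fun i j => posOrder (y i) (y j) := by
    funext i j
    exact h i j
  have h4 : tripleTerm (fun i j => posOrder (x i) (x j)) (0 : Fin 2) 1 0 1 0 1 =
      tripleTerm (fun i j => posOrder (y i) (y j)) (0 : Fin 2) 1 0 1 0 1 := by rw [h3]
  exact h4.trans h2

variable {ι : Type*} [Fintype ι] [DecidableEq ι] {w : List (ι × Bool)}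

/-- `tripleTerm` for three crossings of a word. -/
def tripleWeight (w : List (ι × Bool)) (c d e : ι) : ℤ :=
  tripleTerm (orderSign w) (c, true) (c, false) (d, true) (d, false) (e, true) (e, false)

lemma tripleWeight_eq (w : List (ι × Bool)) (c d e : ι) : tripleWeight w c d e =
    24 * (if Linked w d e then 1 else 0) -
    8 * (if Linked w c d ∨ Linked w c e ∨ Linked w d e then 1 else 0) -
    3 * (chordIndex w d e * orderSum w d e) +
    3 * (if orderSign w (c, true) (d, true) = 0 ∨ orderSign w (c, true) (e, true) = 0 then 0
      else twistTerm w c d e) +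
    (if orderSign w (c, true) (c, false) = 1 then 18 else 0) *
      (chordIndex w c d * chordIndex w c e) +
    flowCoeff (orderSign w) (c, true) (c, false) (d, true) (d, false) *
      (chordFlow w (c, true) (e, true) * chordFlow w (d, true) (e, false) -
        chordFlow w (c, true) (e, false) * chordFlow w (d, true) (e, true)) := by
  simp only [orderSum]
  rfl

lemma injective_idxOf (hw : PairedWord w) {n : ℕ} {l : Fin n → ι × Bool}
    (hl : Function.Injective l) (hm : ∀ i, (l i).1 ∈ labels w) :
    Function.Injective fun i => w.idxOf (l i) := fun i _ h =>
  hl (idxOf_inj_of_mem ((hw.mem_labels (l i).2).1 (hm i)) h)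

lemma orderSign_eq_zero_iff (hw : PairedWord w) {c d : ι} (hc : c ∈ labels w) :
    orderSign w (c, true) (d, true) = 0 ↔ c = d := by
  constructor
  · intro h
    by_contra hcd
    have := orderSign_cases ((hw.mem_labels true).1 hc) (m := (d, true)) (by simp [hcd])
    omega
  · rintro rfl
    simp

lemma tripleTerm_comp {α β : Type*} (o : α → α → ℤ) (f : β → α) (c c' d d' e e' : β) :
    tripleTerm (fun l m => o (f l) (f m)) c c' d d' e e' =
      tripleTerm o (f c) (f c') (f d) (f d') (f e) (f e') := rfl

lemma tripleWeight_eq_posOrder (w : List (ι × Bool)) (c d e : ι) :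
    tripleWeight w c d e = tripleTerm posOrder (w.idxOf (c, true)) (w.idxOf (c, false))
      (w.idxOf (d, true)) (w.idxOf (d, false)) (w.idxOf (e, true)) (w.idxOf (e, false)) :=
  tripleTerm_comp posOrder (fun l => w.idxOf l) _ _ _ _ _ _

lemma tripleWeight_sym (hw : PairedWord w) {c d e : ι} (hc : c ∈ labels w) (hd : d ∈ labels w)
    (he : e ∈ labels w) (hcd : c ≠ d) (hce : c ≠ e) (hde : d ≠ e) :
    0 ≤ tripleWeight w c d e + tripleWeight w c e d + tripleWeight w d c e +
      tripleWeight w d e c + tripleWeight w e c d + tripleWeight w e d c := by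
  have hl : Function.Injective ![(c, true), (c, false), (d, true), (d, false), (e, true),
      (e, false)] := by
    intro i j
    fin_cases i <;> fin_cases j <;> simp [hcd, hce, hde, hcd.symm, hce.symm, hde.symm]
  have := tripleSym_nonneg _ (injective_idxOf hw hl (by
    intro i
    fin_cases i <;> simp [hc, hd, he]))
  simp only [Matrix.cons_val] at this
  simp only [tripleWeight_eq_posOrder]
  exact this

/-- `pairTerm` for two crossings of a word. -/
def pairWeight (w : List (ι × Bool)) (c d : ι) : ℤ :=
  tripleWeight w c c d + tripleWeight w c d c + tripleWeight w c d d -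
  36 * (if Linked w c d then 1 else 0) + 12 * (chordIndex w c d * orderSum w c d)

lemma pairWeight_eq_posOrder (w : List (ι × Bool)) (c d : ι) :
    pairWeight w c d = pairTerm posOrder (w.idxOf (c, true)) (w.idxOf (c, false))
      (w.idxOf (d, true)) (w.idxOf (d, false)) := by
  simp only [pairWeight, tripleWeight_eq_posOrder, pairTerm]
  rfl

lemma pairWeight_sym (hw : PairedWord w) {c d : ι} (hc : c ∈ labels w) (hd : d ∈ labels w)
    (hcd : c ≠ d) : pairWeight w c d + pairWeight w d c = 0 := by
  have hl : Function.Injective ![(c, true), (c, false), (d, true), (d, false)] := by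
    intro i j
    fin_cases i <;> fin_cases j <;> simp [hcd, hcd.symm]
  have := pairTerm_add _ (injective_idxOf hw hl (by
    intro i
    fin_cases i <;> simp [hc, hd]))
  simp only [Matrix.cons_val] at this
  rw [pairWeight_eq_posOrder, pairWeight_eq_posOrder]
  exact this

lemma chordIndex_mul_orderSum_le (hw : PairedWord w) {c d : ι} (hc : c ∈ labels w)
    (hd : d ∈ labels w) :
    chordIndex w c d * orderSum w c d ≤ 4 * if Linked w c d then 1 else 0 := by
  by_cases hcd : c = d
  · subst hcd
    simp [chordIndex_self, not_linked_self]
  have hl : Function.Injective ![(c, true), (c, false), (d, true), (d, false)] := by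
    intro i j
    fin_cases i <;> fin_cases j <;> simp [hcd, Ne.symm hcd]
  have := indexOf_mul_le _ (injective_idxOf hw hl (by
    intro i
    fin_cases i <;> simp [hc, hd]))
  simp only [Matrix.cons_val] at this
  exact this

lemma arrowSum_le (hw : PairedWord w) : arrowSum w (labels w) ≤
    4 * ∑ c ∈ labels w, ∑ d ∈ labels w, if Linked w c d then 1 else 0 := by
  simp only [arrowSum, Finset.mul_sum]
  exact Finset.sum_le_sum fun c hc => Finset.sum_le_sum fun d hd =>
    chordIndex_mul_orderSum_le hw hc hd

lemma tripleWeight_self (hw : PairedWord w) {c : ι} (hc : c ∈ labels w) :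
    tripleWeight w c c c = 0 := by
  have hl : Function.Injective ![(c, true), (c, false)] := by
    intro i j
    fin_cases i <;> fin_cases j <;> simp
  have := tripleTerm_self _ (injective_idxOf hw hl (by
    intro i
    fin_cases i <;> simp [hc]))
  simp only [Matrix.cons_val] at this
  rw [tripleWeight_eq_posOrder]
  exact this

lemma sum_symmetrized_nonneg (L : Finset ι) (f : ι → ι → ι → ℤ)
    (h : ∀ c ∈ L, ∀ d ∈ L, ∀ e ∈ L, 0 ≤ f c d e + f c e d + f d c e + f d e c + f e c d + f e d c) :
    0 ≤ ∑ c ∈ L, ∑ d ∈ L, ∑ e ∈ L, f c d e := by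
  have h1 := Finset.sum_nonneg fun c hc => Finset.sum_nonneg fun d hd =>
    Finset.sum_nonneg fun e he => h c hc d hd e he
  simp only [Finset.sum_add_distrib] at h1
  have s1 (g : ι → ι → ι → ℤ) :
      ∑ c ∈ L, ∑ d ∈ L, ∑ e ∈ L, g c e d = ∑ c ∈ L, ∑ d ∈ L, ∑ e ∈ L, g c d e :=
    Finset.sum_congr rfl fun c _ => Finset.sum_comm
  have s2 (g : ι → ι → ι → ℤ) :
      ∑ c ∈ L, ∑ d ∈ L, ∑ e ∈ L, g d c e = ∑ c ∈ L, ∑ d ∈ L, ∑ e ∈ L, g c d e :=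
    Finset.sum_comm
  have s3 : ∑ c ∈ L, ∑ d ∈ L, ∑ e ∈ L, f d e c = ∑ c ∈ L, ∑ d ∈ L, ∑ e ∈ L, f c d e :=
    (s2 fun c d e => f c e d).trans (s1 f)
  have s4 : ∑ c ∈ L, ∑ d ∈ L, ∑ e ∈ L, f e c d = ∑ c ∈ L, ∑ d ∈ L, ∑ e ∈ L, f c d e :=
    (s1 fun c d e => f d c e).trans (s2 f)
  have s5 : ∑ c ∈ L, ∑ d ∈ L, ∑ e ∈ L, f e d c = ∑ c ∈ L, ∑ d ∈ L, ∑ e ∈ L, f c d e :=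
    (s1 fun c d e => f d e c).trans s3
  rw [s1 f, s2 f, s3, s4, s5] at h1
  omega

lemma sum_chord_relations (hi : Isotropic w) (hw : PairedWord w) {c d : ι} (hc : c ∈ labels w)
    (hd : d ∈ labels w) : ∑ e ∈ labels w, (chordFlow w (c, true) (e, true) *
      chordFlow w (d, true) (e, false) - chordFlow w (c, true) (e, false) *
      chordFlow w (d, true) (e, true)) = 0 :=
  (hi _ ((hw.mem_labels true).1 hc)).2 _ ((hw.mem_labels true).1 hd)

lemma sum_split_coincidences (L : Finset ι) (f : ι → ι → ι → ℤ) (h0 : ∀ c ∈ L, f c c c = 0) :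
    ∑ c ∈ L, ∑ d ∈ L, ∑ e ∈ L, f c d e =
      (∑ c ∈ L, ∑ d ∈ L, ∑ e ∈ L, if c ≠ d ∧ c ≠ e ∧ d ≠ e then f c d e else 0) +
        ∑ c ∈ L, ∑ d ∈ L, (f c c d + f c d c + f c d d) := by
  have e1 : ∀ c ∈ L, ∀ d ∈ L, ∀ e ∈ L, f c d e = (if c ≠ d ∧ c ≠ e ∧ d ≠ e then f c d e else 0) +
      ((if c = d then f c c e else 0) + (if c = e then f c d c else 0) +
        if d = e then f c d d else 0) := by
    intro c hc d hd e he
    by_cases h1 : c = d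
    · subst h1
      by_cases h2 : c = e
      · subst h2; simp [h0 c hc]
      · simp [h2]
    · by_cases h2 : c = e
      · subst h2; simp [h1, Ne.symm h1]
      · by_cases h3 : d = e
        · subst h3; simp [h1]
        · simp [h1, h2, h3]
  rw [Finset.sum_congr rfl fun c hc => Finset.sum_congr rfl fun d hd =>
    Finset.sum_congr rfl fun e he => e1 c hc d hd e he]
  simp only [Finset.sum_add_distrib]
  congr 1
  congr 1
  · congr 1
    · refine Finset.sum_congr rfl fun c hc => ?_
      rw [Finset.sum_comm]
      exact Finset.sum_congr rfl fun e he => by simp [hc]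
    · exact Finset.sum_congr rfl fun c hc => Finset.sum_congr rfl fun d hd => by simp [hc]
  · exact Finset.sum_congr rfl fun c hc => Finset.sum_congr rfl fun d hd => by simp [hd]

/-- The difference of the two invariants of a diagram with positive crossings is not negative. -/
lemma Isotropic.chord_inequality (hi : Isotropic w) (hw : PairedWord w) :
    0 ≤ 24 * ((labels w).card * ∑ d ∈ labels w, ∑ e ∈ labels w, if Linked w d e then 1 else 0) -
      36 * (∑ d ∈ labels w, ∑ e ∈ labels w, if Linked w d e then 1 else 0) -
      8 * (∑ c ∈ labels w, ∑ d ∈ labels w, ∑ e ∈ labels w,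
        if Linked w c d ∨ Linked w c e ∨ Linked w d e then 1 else 0) -
      3 * (∑ c ∈ labels w, (arrowSum w (labels w) - ∑ d ∈ (labels w).erase c,
        ∑ e ∈ (labels w).erase c, twistTerm w c d e)) + 12 * arrowSum w (labels w) := by
  set L := labels w
  -- Three different crossings contribute a nonnegative number in every relative position.
  have h1 : 0 ≤ ∑ c ∈ L, ∑ d ∈ L, ∑ e ∈ L,
      if c ≠ d ∧ c ≠ e ∧ d ≠ e then tripleWeight w c d e else 0 := by
    refine sum_symmetrized_nonneg L _ fun c hc d hd e he => ?_
    by_cases h : c ≠ d ∧ c ≠ e ∧ d ≠ e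
    · obtain ⟨a1, a2, a3⟩ := h
      simpa [a1, a2, a3, a1.symm, a2.symm, a3.symm] using tripleWeight_sym hw hc hd he a1 a2 a3
    · have h' : c = d ∨ c = e ∨ d = e := by tauto
      rcases h' with rfl | rfl | rfl <;> simp
  -- The triples with coinciding crossings are accounted for by the pairs.
  have h2 : ∑ c ∈ L, ∑ d ∈ L, pairWeight w c d = 0 := by
    have e1 : ∑ c ∈ L, ∑ d ∈ L, (pairWeight w c d + pairWeight w d c) = 0 := by
      refine Finset.sum_eq_zero fun c hc => Finset.sum_eq_zero fun d hd => ?_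
      by_cases h : c = d
      · subst h
        simp [pairWeight, tripleWeight_self hw hc, not_linked_self, chordIndex_self]
      · exact pairWeight_sym hw hc hd h
    simp only [Finset.sum_add_distrib] at e1
    rw [Finset.sum_comm (f := fun c d => pairWeight w d c)] at e1
    omega
  have h3 := sum_split_coincidences L (tripleWeight w) fun c hc => tripleWeight_self hw hc
  have h4 : ∑ c ∈ L, ∑ d ∈ L, (tripleWeight w c c d + tripleWeight w c d c +
      tripleWeight w c d d) = 36 * (∑ d ∈ L, ∑ e ∈ L, if Linked w d e then 1 else 0) -
      12 * arrowSum w L := by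
    have e : ∀ c d, tripleWeight w c c d + tripleWeight w c d c + tripleWeight w c d d =
        pairWeight w c d + 36 * (if Linked w c d then 1 else 0) -
          12 * (chordIndex w c d * orderSum w c d) := fun c d => by
      unfold pairWeight; ring
    simp only [e, Finset.sum_sub_distrib, Finset.sum_add_distrib, h2, ← Finset.mul_sum]
    simp [arrowSum]
  -- The multiples of intersection numbers that were added to the contributions sum up to zero.
  have h5 : ∑ c ∈ L, ∑ d ∈ L, ∑ e ∈ L, tripleWeight w c d e =
      24 * (L.card * ∑ d ∈ L, ∑ e ∈ L, if Linked w d e then 1 else 0) -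
      8 * (∑ c ∈ L, ∑ d ∈ L, ∑ e ∈ L,
        if Linked w c d ∨ Linked w c e ∨ Linked w d e then 1 else 0) -
      3 * (∑ c ∈ L, (arrowSum w L - ∑ d ∈ L.erase c, ∑ e ∈ L.erase c, twistTerm w c d e)) := by
    have e1 : ∀ c ∈ L, ∑ d ∈ L, ∑ e ∈ L, (if orderSign w (c, true) (d, true) = 0 ∨
        orderSign w (c, true) (e, true) = 0 then 0 else twistTerm w c d e) =
        ∑ d ∈ L.erase c, ∑ e ∈ L.erase c, twistTerm w c d e := by
      intro c hc
      simp only [orderSign_eq_zero_iff hw hc]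
      rw [← Finset.sum_erase (a := c) L (by simp)]
      refine Finset.sum_congr rfl fun d hd => ?_
      rw [← Finset.sum_erase (a := c) L (by simp)]
      refine Finset.sum_congr rfl fun e he => ?_
      rw [if_neg]
      simp [(Finset.ne_of_mem_erase hd).symm, (Finset.ne_of_mem_erase he).symm]
    have e3 : ∀ c ∈ L, ∑ d ∈ L, ∑ e ∈ L, tripleWeight w c d e =
        24 * (∑ d ∈ L, ∑ e ∈ L, if Linked w d e then 1 else 0) -
        8 * (∑ d ∈ L, ∑ e ∈ L, if Linked w c d ∨ Linked w c e ∨ Linked w d e then 1 else 0) -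
        3 * (arrowSum w L - ∑ d ∈ L.erase c, ∑ e ∈ L.erase c, twistTerm w c d e) := by
      intro c hc
      simp only [tripleWeight_eq, Finset.sum_add_distrib, Finset.sum_sub_distrib,
        ← Finset.mul_sum]
      rw [e1 c hc, hi.sum_chordIndex hw hc]
      have e4 : ∑ d ∈ L, flowCoeff (orderSign w) (c, true) (c, false) (d, true) (d, false) *
          (∑ e ∈ L, chordFlow w (c, true) (e, true) * chordFlow w (d, true) (e, false) -
            ∑ e ∈ L, chordFlow w (c, true) (e, false) * chordFlow w (d, true) (e, true)) = 0 := by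
        refine Finset.sum_eq_zero fun d hd => ?_
        rw [← Finset.sum_sub_distrib, sum_chord_relations hi hw hc hd, mul_zero]
      rw [e4]
      simp [arrowSum]
      ring
    rw [Finset.sum_congr rfl e3]
    simp only [Finset.sum_sub_distrib, ← Finset.mul_sum, Finset.sum_const, nsmul_eq_mul]
  linarith

end ChordConfigurations

namespace GaussWord

variable {N : ℕ} {w : GaussWord}

lemma linkSum_eq (hs : ∀ c ∈ labels (w.flatten N), signAt N w c = 1) : linkSum N w =
    ((∑ c ∈ labels (w.flatten N), ∑ d ∈ labels (w.flatten N),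
      if Linked (w.flatten N) c d then 1 else 0 : ℤ) : ℝ) := by
  push_cast
  unfold linkSum link
  refine Finset.sum_congr rfl fun c hc => Finset.sum_congr rfl fun d hd => ?_
  rw [hs c hc, hs d hd]
  simp

/-- The inequality for a positive diagram, with the invariant of degree two expressed by the Jones
polynomial. -/
lemma Planar.inequality (hp : w.Planar) (hw : w.WellFormed) (hN : ∀ p ∈ w, p.label ≤ N)
    (hs : ∀ c ∈ labels (w.flatten N), signAt N w c = 1) :
    0 ≤ -(1 / 6) * iteratedDeriv 2 w.jones 1 ∧ -(1 / 6) * iteratedDeriv 2 w.jones 1 ≤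
      4 * (-(1 / 144) * iteratedDeriv 3 w.jones 1 - (1 / 48) * iteratedDeriv 2 w.jones 1) := by
  have hP := hw.pairedWord hN
  have hi := hp.isotropic hw hN
  rw [hp.third_order hw hN hs, hp.iteratedDeriv_two hw hN, linkSum_eq hs]
  have h1 : ((arrowSum (w.flatten N) (labels (w.flatten N)) : ℤ) : ℝ) ≤
      ((4 * ∑ c ∈ labels (w.flatten N), ∑ d ∈ labels (w.flatten N),
        if Linked (w.flatten N) c d then 1 else 0 : ℤ) : ℝ) := by
    exact_mod_cast arrowSum_le hP
  have h2 := hi.chord_inequality hP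
  have h3 : (∑ c ∈ labels (w.flatten N), ∑ d ∈ labels (w.flatten N),
      ∑ e ∈ labels (w.flatten N), anyLink (w.flatten N) c d e) =
      ((∑ c ∈ labels (w.flatten N), ∑ d ∈ labels (w.flatten N), ∑ e ∈ labels (w.flatten N),
        if Linked (w.flatten N) c d ∨ Linked (w.flatten N) c e ∨ Linked (w.flatten N) d e
          then 1 else 0 : ℤ) : ℝ) := by
    push_cast
    rfl
  rw [h3, ← Int.cast_sum]
  generalize (∑ c ∈ labels (w.flatten N), ∑ d ∈ labels (w.flatten N),
    if Linked (w.flatten N) c d then (1 : ℤ) else 0) = Λ at h1 h2 ⊢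
  generalize (∑ c ∈ labels (w.flatten N), ∑ d ∈ labels (w.flatten N), ∑ e ∈ labels (w.flatten N),
    if Linked (w.flatten N) c d ∨ Linked (w.flatten N) c e ∨ Linked (w.flatten N) d e
      then (1 : ℤ) else 0) = Y at h2 ⊢
  generalize (∑ c ∈ labels (w.flatten N), (arrowSum (w.flatten N) (labels (w.flatten N)) -
    ∑ d ∈ (labels (w.flatten N)).erase c, ∑ e ∈ (labels (w.flatten N)).erase c,
      twistTerm (w.flatten N) c d e)) = Z at h2 ⊢
  have h4 : (0 : ℝ) ≤ ((24 * ((labels (w.flatten N)).card * Λ) - 36 * Λ - 8 * Y - 3 * Z +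
    12 * arrowSum (w.flatten N) (labels (w.flatten N)) : ℤ) : ℝ) := by exact_mod_cast h2
  push_cast at h1 h4
  constructor <;> linarith

end GaussWord

/-! ### Local moves in state sums -/

section LocalMoves

open Matrix

variable {k : ℕ} {R : Type*} [CommRing R]

/-- The tensor of a crossing with the weights `a` and `b` of its two smoothings. -/
def crossTensor (a b : R) (x : Legs k) : R := a * orientedTensor R x + b * unorientedTensor R x

/-- The product of the matrix units at two consecutive passages. -/
def strand (R : Type*) [CommRing R] (p : Bool) (x y : Fin k × Fin k) : Matrix (Fin k) (Fin k) R :=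
  if p then single x.1 x.2 1 * single y.1 y.2 1 else single y.1 y.2 1 * single x.1 x.2 1

/-- The Kronecker symbol. -/
def delta (R : Type*) [CommRing R] (i j : Fin k) : R := if i = j then 1 else 0

lemma delta_comm (i j : Fin k) : delta R i j = delta R j i := by simp [delta, eq_comm]

lemma crossTensor_apply (a b : R) (i j l m : Fin k) : crossTensor a b ((i, j), (l, m)) =
    a * (delta R i m * delta R j l) + b * (delta R i l * delta R j m) := by
  unfold crossTensor orientedTensor unorientedTensor delta
  congr 2
  · simp only [@eq_comm _ l, @eq_comm _ m]
    split_ifs <;> simp_all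
  · simp only [@eq_comm _ l, @eq_comm _ m]
    split_ifs <;> simp_all

lemma strand_true (x y : Fin k × Fin k) (i j : Fin k) :
    strand R true x y i j = delta R i x.1 * (delta R x.2 y.1 * delta R j y.2) := by
  unfold strand delta
  by_cases h : x.2 = y.1
  · simp [h, single_apply]
    split_ifs <;> simp_all
  · simp [h]

/-- The local contribution of a triangle. -/
def triangle (p q r : Bool) (u v w : Legs k → R) (i₁ j₁ i₂ j₂ i₃ j₃ : Fin k) : R :=
  ∑ t : Legs k × Legs k × Legs k, u t.1 * v t.2.1 * w t.2.2 *
    (strand R p t.1.1 t.2.1.1 i₁ j₁ * strand R q t.1.2 t.2.2.1 i₂ j₂ *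
      strand R r t.2.1.2 t.2.2.2 i₃ j₃)

lemma strand_false (x y : Fin k × Fin k) : strand R false x y = strand R true y x := rfl

lemma triangle_true (u v w : Legs k → R) (i₁ j₁ i₂ j₂ i₃ j₃ : Fin k) :
    triangle true true true u v w i₁ j₁ i₂ j₂ i₃ j₃ = ∑ m₁, ∑ m₂, ∑ m₃,
      u ((i₁, m₁), (i₂, m₂)) * v ((m₁, j₁), (i₃, m₃)) * w ((m₂, j₂), (m₃, j₃)) := by
  unfold triangle
  simp only [Fintype.sum_prod_type, strand_true, delta, mul_ite, mul_one, mul_zero,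
    Finset.sum_ite_eq, Finset.mem_univ, if_true, Finset.sum_ite_irrel, Finset.sum_const_zero]

/-- A triangle with the orientations of all strands reversed is a triangle with the top and the
bottom strand exchanged. -/
lemma triangle_false (u v w : Legs k → R) (i₁ j₁ i₂ j₂ i₃ j₃ : Fin k) :
    triangle false false false u v w i₁ j₁ i₂ j₂ i₃ j₃ = triangle true true true
      (fun x => w x.swap) (fun x => v x.swap) (fun x => u x.swap) i₃ j₃ i₂ j₂ i₁ j₁ := by
  unfold triangle
  let e : Legs k × Legs k × Legs k → Legs k × Legs k × Legs k :=
    fun t => (t.2.2.swap, t.2.1.swap, t.1.swap)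
  have he : Function.Involutive e := fun t => rfl
  refine Fintype.sum_equiv he.toPerm _ _ fun t => ?_
  simp only [strand_false, Function.Involutive.coe_toPerm, e, Prod.swap_swap, Prod.fst_swap,
    Prod.snd_swap]
  ring

lemma ite_eq_delta (i j : Fin k) (x : R) : (if i = j then x else 0) = x * delta R i j := by
  simp [delta]

lemma sum_triangle_true {a b : R} (hab : a * b = 1) (hk : a ^ 2 + b ^ 2 = -k)
    (i₁ j₁ i₂ j₂ i₃ j₃ : Fin k) :
    ∑ m₁, ∑ m₂, ∑ m₃, crossTensor a b ((i₁, m₁), (i₂, m₂)) *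
      crossTensor a b ((m₁, j₁), (i₃, m₃)) * crossTensor a b ((m₂, j₂), (m₃, j₃)) =
    a ^ 3 * (delta R i₁ j₃ * delta R i₂ j₂ * delta R j₁ i₃) +
      a * (delta R i₁ i₂ * delta R j₁ i₃ * delta R j₂ j₃) +
      a * (delta R i₁ j₃ * delta R i₂ i₃ * delta R j₁ j₂) +
      b * (delta R i₁ j₁ * delta R i₂ i₃ * delta R j₂ j₃) +
      b * (delta R i₁ i₂ * delta R i₃ j₃ * delta R j₁ j₂) := by
  simp only [crossTensor_apply, add_mul, mul_add, Finset.sum_add_distrib]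
  simp only [delta, mul_ite, ite_mul, mul_one, mul_zero, zero_mul, Finset.sum_ite_eq,
    Finset.sum_ite_eq', Finset.mem_univ, if_true, Finset.sum_ite_irrel, Finset.sum_const_zero]
  simp only [ite_eq_delta, Finset.sum_const, Finset.card_univ, Fintype.card_fin, nsmul_eq_mul]
  rw [delta_comm j₂ i₂, delta_comm i₃ i₂, delta_comm i₃ j₁]
  linear_combination (delta R j₁ i₃ * delta R j₂ j₃ * delta R i₁ i₂ *
    (2 * a - a * (a * b + 1) - b ^ 3) + a * (delta R i₁ j₃ * delta R i₂ i₃ * delta R j₁ j₂) +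
    b * (delta R i₁ j₁ * delta R i₂ i₃ * delta R j₂ j₃) +
    b * (delta R i₁ i₂ * delta R i₃ j₃ * delta R j₁ j₂)) * hab +
    (delta R j₁ i₃ * delta R j₂ j₃ * delta R i₁ i₂ * a * b ^ 2) * hk

/-- Two crossings of opposite signs between two strands. -/
lemma sum_bigon {a b : R} (hab : a * b = 1) (hk : a ^ 2 + b ^ 2 = -k) (i₁ j₁ i₂ j₂ : Fin k) :
    ∑ m₁, ∑ m₂, crossTensor a b ((i₁, m₁), (i₂, m₂)) * crossTensor b a ((m₁, j₁), (m₂, j₂)) =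
      delta R i₁ j₁ * delta R i₂ j₂ := by
  simp only [crossTensor_apply, add_mul, mul_add, Finset.sum_add_distrib]
  simp only [delta, mul_ite, ite_mul, mul_one, mul_zero, zero_mul, Finset.sum_ite_eq,
    Finset.sum_ite_eq', Finset.mem_univ, if_true, Finset.sum_ite_irrel, Finset.sum_const_zero]
  simp only [ite_eq_delta, Finset.sum_const, Finset.card_univ, Fintype.card_fin, nsmul_eq_mul]
  rw [delta_comm j₂ i₂, delta_comm j₂ j₁]
  linear_combination (delta R i₁ j₁ * delta R i₂ j₂ + k * delta R i₁ i₂ * delta R j₁ j₂) * hab +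
    delta R i₁ i₂ * delta R j₁ j₂ * hk

/-- Reversal of one of the two legs. -/
def flipFst (x : Legs k) : Legs k := (x.1.swap, x.2)

/-- Reversal of one of the two legs. -/
def flipSnd (x : Legs k) : Legs k := (x.1, x.2.swap)

lemma crossTensor_flipFst (a b : R) (x : Legs k) :
    crossTensor a b (flipFst x) = crossTensor b a x := by
  unfold crossTensor orientedTensor unorientedTensor flipFst
  simp only [Prod.fst_swap, Prod.snd_swap]
  ring

lemma crossTensor_flipSnd (a b : R) (x : Legs k) :
    crossTensor a b (flipSnd x) = crossTensor b a x := by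
  unfold crossTensor orientedTensor unorientedTensor flipSnd
  simp only [Prod.fst_swap, Prod.snd_swap, and_comm]
  ring

lemma strand_flip (p : Bool) (x y : Fin k × Fin k) (i j : Fin k) :
    strand R (!p) x.swap y.swap i j = strand R p x y j i := by
  cases p
  · simp only [Bool.not_false, strand_false, strand_true, Prod.fst_swap, Prod.snd_swap]
    rw [delta_comm x.1]
    ring
  · simp only [Bool.not_true, strand_false, strand_true, Prod.fst_swap, Prod.snd_swap]
    rw [delta_comm y.1]
    ring

lemma flipFst_flipFst (x : Legs k) : flipFst (flipFst x) = x := rfl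

lemma flipSnd_flipSnd (x : Legs k) : flipSnd (flipSnd x) = x := rfl

lemma triangle_flip_top (p q r : Bool) (u v w : Legs k → R) (i₁ j₁ i₂ j₂ i₃ j₃ : Fin k) :
    triangle (!p) q r u v w i₁ j₁ i₂ j₂ i₃ j₃ =
      triangle p q r (fun x => u (flipFst x)) (fun x => v (flipFst x)) w j₁ i₁ i₂ j₂ i₃ j₃ := by
  unfold triangle
  refine Fintype.sum_equiv ((Function.Involutive.toPerm _ flipFst_flipFst).prodCongr
    ((Function.Involutive.toPerm _ flipFst_flipFst).prodCongr (Equiv.refl _))) _ _ fun t => ?_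
  have := strand_flip (R := R) (!p) t.1.1 t.2.1.1 j₁ i₁
  rw [Bool.not_not] at this
  simp only [Equiv.prodCongr_apply, Prod.map, Equiv.refl_apply]
  rw [← this]
  rfl

lemma triangle_flip_middle (p q r : Bool) (u v w : Legs k → R) (i₁ j₁ i₂ j₂ i₃ j₃ : Fin k) :
    triangle p (!q) r u v w i₁ j₁ i₂ j₂ i₃ j₃ =
      triangle p q r (fun x => u (flipSnd x)) v (fun x => w (flipFst x)) i₁ j₁ j₂ i₂ i₃ j₃ := by
  unfold triangle
  refine Fintype.sum_equiv ((Function.Involutive.toPerm _ flipSnd_flipSnd).prodCongr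
    ((Equiv.refl _).prodCongr (Function.Involutive.toPerm _ flipFst_flipFst))) _ _ fun t => ?_
  have := strand_flip (R := R) (!q) t.1.2 t.2.2.1 j₂ i₂
  rw [Bool.not_not] at this
  simp only [Equiv.prodCongr_apply, Prod.map, Equiv.refl_apply]
  rw [← this]
  rfl

lemma triangle_flip_bottom (p q r : Bool) (u v w : Legs k → R) (i₁ j₁ i₂ j₂ i₃ j₃ : Fin k) :
    triangle p q (!r) u v w i₁ j₁ i₂ j₂ i₃ j₃ =
      triangle p q r u (fun x => v (flipSnd x)) (fun x => w (flipSnd x)) i₁ j₁ i₂ j₂ j₃ i₃ := by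
  unfold triangle
  refine Fintype.sum_equiv ((Equiv.refl _).prodCongr
    ((Function.Involutive.toPerm _ flipSnd_flipSnd).prodCongr
      (Function.Involutive.toPerm _ flipSnd_flipSnd))) _ _ fun t => ?_
  have := strand_flip (R := R) (!r) t.2.1.2 t.2.2.2 j₃ i₃
  rw [Bool.not_not] at this
  simp only [Equiv.prodCongr_apply, Prod.map, Equiv.refl_apply]
  rw [← this]
  rfl

lemma crossTensor_swap (a b : R) (x : Legs k) : crossTensor a b x.swap = crossTensor a b x := by
  simp [crossTensor, orientedTensor_swap, unorientedTensor_swap]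

lemma triangle_move_aux {a b : R} (hab : a * b = 1) (hk : a ^ 2 + b ^ 2 = -k)
    (i₁ j₁ i₂ j₂ i₃ j₃ : Fin k) :
    triangle true true true (crossTensor a b) (crossTensor a b) (crossTensor a b)
        i₁ j₁ i₂ j₂ i₃ j₃ =
      triangle false false false (crossTensor a b) (crossTensor a b) (crossTensor a b)
        i₁ j₁ i₂ j₂ i₃ j₃ := by
  rw [triangle_false]
  simp only [crossTensor_swap]
  rw [triangle_true, triangle_true, sum_triangle_true hab hk, sum_triangle_true hab hk,
    delta_comm i₃ j₁, delta_comm j₃ i₁, delta_comm i₃ i₂, delta_comm j₂ j₁, delta_comm i₂ i₁,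
    delta_comm j₃ j₂]
  ring

/-- The tensor of a crossing of which one strand may be reversed. -/
def signedTensor (a b : R) (p : Bool) : Legs k → R :=
  if p then crossTensor a b else crossTensor b a

lemma signedTensor_flipFst (a b : R) (p : Bool) :
    (fun x : Legs k => signedTensor a b p (flipFst x)) = signedTensor a b (!p) := by
  funext x
  cases p <;> simp [signedTensor, crossTensor_flipFst]

lemma signedTensor_flipSnd (a b : R) (p : Bool) :
    (fun x : Legs k => signedTensor a b p (flipSnd x)) = signedTensor a b (!p) := by
  funext x
  cases p <;> simp [signedTensor, crossTensor_flipSnd]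

lemma signedTensor_swap (a b : R) (p : Bool) (x : Legs k) :
    signedTensor a b p x.swap = signedTensor a b p x := by
  cases p <;> simp [signedTensor, crossTensor_swap]

/-- The Yang–Baxter equation, for all orientations of the three strands. -/
lemma triangle_move {a b : R} (hab : a * b = 1) (hk : a ^ 2 + b ^ 2 = -k) (p q r : Bool)
    (i₁ j₁ i₂ j₂ i₃ j₃ : Fin k) :
    triangle p q r (signedTensor a b (p == q)) (signedTensor a b (p == r))
        (signedTensor a b (q == r)) i₁ j₁ i₂ j₂ i₃ j₃ =
      triangle (!p) (!q) (!r) (signedTensor a b (p == q)) (signedTensor a b (p == r))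
        (signedTensor a b (q == r)) i₁ j₁ i₂ j₂ i₃ j₃ := by
  have ht : ∀ i₁ j₁ i₂ j₂ i₃ j₃ : Fin k,
      triangle true true true (signedTensor a b true) (signedTensor a b true)
        (signedTensor a b true) i₁ j₁ i₂ j₂ i₃ j₃ = triangle false false false
        (signedTensor a b true) (signedTensor a b true) (signedTensor a b true)
          i₁ j₁ i₂ j₂ i₃ j₃ := triangle_move_aux hab hk
  -- Reversing one strand turns the crossings on it into crossings of the opposite sign, so that all
  -- cases reduce to the one with parallel strands.
  have h1 : ∀ (p q r : Bool) (u v w i₁ j₁ i₂ j₂ i₃ j₃), triangle (R := R) (k := k) p q r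
      (signedTensor a b u) (signedTensor a b v) (signedTensor a b w) i₁ j₁ i₂ j₂ i₃ j₃ =
      triangle (!p) q r (signedTensor a b (!u)) (signedTensor a b (!v))
        (signedTensor a b w) j₁ i₁ i₂ j₂ i₃ j₃ := by
    intro p q r u v w i₁ j₁ i₂ j₂ i₃ j₃
    have := triangle_flip_top (!p) q r (signedTensor a b u) (signedTensor a b v)
      (signedTensor a b w) i₁ j₁ i₂ j₂ i₃ j₃
    rwa [Bool.not_not, signedTensor_flipFst, signedTensor_flipFst] at this
  have h2 : ∀ (p q r : Bool) (u v w i₁ j₁ i₂ j₂ i₃ j₃), triangle (R := R) (k := k) p q r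
      (signedTensor a b u) (signedTensor a b v) (signedTensor a b w) i₁ j₁ i₂ j₂ i₃ j₃ =
      triangle p (!q) r (signedTensor a b (!u)) (signedTensor a b v)
        (signedTensor a b (!w)) i₁ j₁ j₂ i₂ i₃ j₃ := by
    intro p q r u v w i₁ j₁ i₂ j₂ i₃ j₃
    have := triangle_flip_middle p (!q) r (signedTensor a b u) (signedTensor a b v)
      (signedTensor a b w) i₁ j₁ i₂ j₂ i₃ j₃
    rwa [Bool.not_not, signedTensor_flipSnd, signedTensor_flipFst] at this
  have h3 : ∀ (p q r : Bool) (u v w i₁ j₁ i₂ j₂ i₃ j₃), triangle (R := R) (k := k) p q r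
      (signedTensor a b u) (signedTensor a b v) (signedTensor a b w) i₁ j₁ i₂ j₂ i₃ j₃ =
      triangle p q (!r) (signedTensor a b u) (signedTensor a b (!v))
        (signedTensor a b (!w)) i₁ j₁ i₂ j₂ j₃ i₃ := by
    intro p q r u v w i₁ j₁ i₂ j₂ i₃ j₃
    have := triangle_flip_bottom p q (!r) (signedTensor a b u) (signedTensor a b v)
      (signedTensor a b w) i₁ j₁ i₂ j₂ i₃ j₃
    rwa [Bool.not_not, signedTensor_flipSnd, signedTensor_flipSnd] at this
  have hp : ∀ q r : Bool, ∀ i₁ j₁ i₂ j₂ i₃ j₃ : Fin k,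
      triangle true q r (signedTensor a b (true == q)) (signedTensor a b (true == r))
        (signedTensor a b (q == r)) i₁ j₁ i₂ j₂ i₃ j₃ =
      triangle false (!q) (!r) (signedTensor a b (true == q)) (signedTensor a b (true == r))
        (signedTensor a b (q == r)) i₁ j₁ i₂ j₂ i₃ j₃ := by
    intro q r i₁ j₁ i₂ j₂ i₃ j₃
    cases q <;> cases r
    · rw [h1, h1 false]
      exact (ht _ _ _ _ _ _).symm
    · rw [h2, h2 false]
      exact ht _ _ _ _ _ _
    · rw [h3, h3 false]
      exact ht _ _ _ _ _ _
    · exact ht _ _ _ _ _ _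
  cases p
  · cases q <;> cases r
    · exact (hp true true _ _ _ _ _ _).symm
    · exact (hp true false _ _ _ _ _ _).symm
    · exact (hp false true _ _ _ _ _ _).symm
    · exact (hp false false _ _ _ _ _ _).symm
  · exact hp q r _ _ _ _ _ _

/-- The local contribution of a bigon. -/
lemma bigon_true (u v : Legs k → R) (i₁ j₁ i₂ j₂ : Fin k) :
    ∑ t : Legs k × Legs k, u t.1 * v t.2 *
      (strand R true t.1.1 t.2.1 i₁ j₁ * strand R true t.1.2 t.2.2 i₂ j₂) =
      ∑ m₁, ∑ m₂, u ((i₁, m₁), (i₂, m₂)) * v ((m₁, j₁), (m₂, j₂)) := by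
  simp only [Fintype.sum_prod_type, strand_true, delta, mul_ite, mul_one, mul_zero,
    Finset.sum_ite_eq, Finset.mem_univ, if_true, Finset.sum_ite_irrel, Finset.sum_const_zero]

lemma bigon_move {a b : R} (hab : a * b = 1) (hk : a ^ 2 + b ^ 2 = -k) (p : Bool)
    (i₁ j₁ i₂ j₂ : Fin k) :
    ∑ t : Legs k × Legs k, crossTensor a b t.1 * crossTensor b a t.2 *
      (strand R true t.1.1 t.2.1 i₁ j₁ * strand R p t.1.2 t.2.2 i₂ j₂) =
      delta R i₁ j₁ * delta R i₂ j₂ := by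
  cases p
  · have e : ∀ t : Legs k × Legs k, crossTensor a b t.1 * crossTensor b a t.2 *
        (strand R true t.1.1 t.2.1 i₁ j₁ * strand R false t.1.2 t.2.2 i₂ j₂) =
        crossTensor b a (flipSnd t.1) * crossTensor a b (flipSnd t.2) *
        (strand R true (flipSnd t.1).1 (flipSnd t.2).1 i₁ j₁ *
          strand R true (flipSnd t.1).2 (flipSnd t.2).2 j₂ i₂) := by
      intro t
      rw [crossTensor_flipSnd, crossTensor_flipSnd]
      have := strand_flip (R := R) true t.1.2.swap t.2.2.swap i₂ j₂
      simp only [Prod.swap_swap, Bool.not_true] at this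
      rw [this]
      rfl
    have e2 := Equiv.sum_comp ((Function.Involutive.toPerm _ flipSnd_flipSnd).prodCongr
      (Function.Involutive.toPerm _ flipSnd_flipSnd)) fun t : Legs k × Legs k =>
        crossTensor b a t.1 * crossTensor a b t.2 *
        (strand R true t.1.1 t.2.1 i₁ j₁ * strand R true t.1.2 t.2.2 j₂ i₂)
    refine (Finset.sum_congr rfl fun t _ => e t).trans (e2.trans ?_)
    rw [bigon_true, sum_bigon (by rw [mul_comm, hab]) (by rw [add_comm, hk]), delta_comm i₂]
  · rw [bigon_true, sum_bigon hab hk]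

end LocalMoves

/-! ### Reidemeister moves in state sums -/

section StateMoves

open Matrix

variable {ι : Type*} [Fintype ι] [DecidableEq ι] {R : Type*} [CommRing R] {k : ℕ}

lemma trace_mul_entries (U P V Q X S Y : Matrix (Fin k) (Fin k) R) :
    (U * P * V * Q * X * S * Y).trace = ∑ i₁, ∑ j₁, ∑ i₂, ∑ j₂, ∑ i₃, ∑ j₃,
      P i₁ j₁ * Q i₂ j₂ * S i₃ j₃ * (V j₁ i₂ * X j₂ i₃ * (Y * U) j₃ i₁) := by
  have h : (U * P * V * Q * X * S * Y).trace = (P * (V * (Q * (X * (S * (Y * U)))))).trace := by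
    rw [show U * P * V * Q * X * S * Y = U * (P * (V * (Q * (X * (S * Y))))) by
      simp only [Matrix.mul_assoc], Matrix.trace_mul_comm]
    simp only [Matrix.mul_assoc]
  rw [h]
  generalize Y * U = Z
  simp only [Matrix.trace, Matrix.diag, Matrix.mul_apply, Finset.mul_sum]
  refine Finset.sum_congr rfl fun _ _ => Finset.sum_congr rfl fun _ _ =>
    Finset.sum_congr rfl fun _ _ => Finset.sum_congr rfl fun _ _ =>
    Finset.sum_congr rfl fun _ _ => Finset.sum_congr rfl fun _ _ => by ring

lemma sum_trace_entries {α : Type*} [Fintype α] (u : α → R) (P Q S : α → Matrix (Fin k) (Fin k) R)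
    (U V X Y : Matrix (Fin k) (Fin k) R) :
    ∑ t, u t * (U * P t * V * Q t * X * S t * Y).trace =
      ∑ i₁, ∑ j₁, ∑ i₂, ∑ j₂, ∑ i₃, ∑ j₃, (∑ t, u t * (P t i₁ j₁ * Q t i₂ j₂ * S t i₃ j₃)) *
        (V j₁ i₂ * X j₂ i₃ * (Y * U) j₃ i₁) := by
  simp only [trace_mul_entries, Finset.mul_sum, Finset.sum_mul]
  rw [Finset.sum_comm]
  refine Finset.sum_congr rfl fun _ _ => ?_
  rw [Finset.sum_comm]
  refine Finset.sum_congr rfl fun _ _ => ?_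
  rw [Finset.sum_comm]
  refine Finset.sum_congr rfl fun _ _ => ?_
  rw [Finset.sum_comm]
  refine Finset.sum_congr rfl fun _ _ => ?_
  rw [Finset.sum_comm]
  refine Finset.sum_congr rfl fun _ _ => ?_
  rw [Finset.sum_comm]
  exact Finset.sum_congr rfl fun _ _ => Finset.sum_congr rfl fun _ _ => by ring

/-- Sums of products of matrices with three varying factors agree if the tensors of the entries of
these factors agree. -/
lemma sum_trace_congr {α β : Type*} [Fintype α] [Fintype β] {u : α → R} {u' : β → R}
    {P Q S : α → Matrix (Fin k) (Fin k) R} {P' Q' S' : β → Matrix (Fin k) (Fin k) R}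
    (h : ∀ i₁ j₁ i₂ j₂ i₃ j₃, ∑ t, u t * (P t i₁ j₁ * Q t i₂ j₂ * S t i₃ j₃) =
      ∑ t, u' t * (P' t i₁ j₁ * Q' t i₂ j₂ * S' t i₃ j₃)) (U V X Y : Matrix (Fin k) (Fin k) R) :
    ∑ t, u t * (U * P t * V * Q t * X * S t * Y).trace =
      ∑ t, u' t * (U * P' t * V * Q' t * X * S' t * Y).trace := by
  rw [sum_trace_entries, sum_trace_entries]
  simp only [h]

/-- The matrix unit at one of the passages of a crossing. -/
def leg (b : Bool) (x : Legs k) : Fin k × Fin k := if b then x.1 else x.2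

lemma letterMatrix_leg (χ : ι → Legs k) (l : ι × Bool) :
    letterMatrix R χ l = single (leg l.2 (χ l.1)).1 (leg l.2 (χ l.1)).2 1 := by
  unfold letterMatrix leg
  split_ifs <;> rfl

/-- Two consecutive passages, in one of the two orders. -/
def orderedPair (p : Bool) (l m : ι × Bool) : List (ι × Bool) := if p then [l, m] else [m, l]

lemma wordMatrix_orderedPair (χ : ι → Legs k) (p : Bool) (l m : ι × Bool) :
    wordMatrix R χ (orderedPair p l m) = strand R p (leg l.2 (χ l.1)) (leg m.2 (χ m.1)) := by
  cases p <;> simp [orderedPair, strand, wordMatrix, letterMatrix_leg]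

/-- The passage marked `true` is made the first one. -/
def orient (b : Bool) : Legs k ≃ Legs k := if b then Equiv.refl _ else Equiv.prodComm _ _

lemma orient_fst (b : Bool) (x : Legs k) : (orient b x).1 = leg b x := by
  cases b <;> simp [orient, leg]

lemma orient_snd (b : Bool) (x : Legs k) : (orient b x).2 = leg (!b) x := by
  cases b <;> simp [orient, leg]

lemma signedTensor_orient (a a' : R) (p b : Bool) (x : Legs k) :
    signedTensor a a' p (orient b x) = signedTensor a a' p x := by
  cases b
  · exact signedTensor_swap a a' p x
  · rfl

lemma triangle_orient (a a' : R) (u v w p q r b b' b'' : Bool) (i₁ j₁ i₂ j₂ i₃ j₃ : Fin k) :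
    ∑ t : Legs k × Legs k × Legs k, signedTensor a a' u t.1 * signedTensor a a' v t.2.1 *
      signedTensor a a' w t.2.2 * (strand R p (leg b t.1) (leg b' t.2.1) i₁ j₁ *
        strand R q (leg (!b) t.1) (leg b'' t.2.2) i₂ j₂ *
        strand R r (leg (!b') t.2.1) (leg (!b'') t.2.2) i₃ j₃) =
    triangle p q r (signedTensor a a' u) (signedTensor a a' v) (signedTensor a a' w)
      i₁ j₁ i₂ j₂ i₃ j₃ := by
  unfold triangle
  refine Fintype.sum_equiv ((orient b).prodCongr ((orient b').prodCongr (orient b''))) _ _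
    fun t => ?_
  simp only [Equiv.prodCongr_apply, Prod.map, orient_fst, orient_snd, signedTensor_orient]

lemma bigon_orient {a a' : R} (hab : a * a' = 1) (hk : a ^ 2 + a' ^ 2 = -k) (p b b' : Bool)
    (i₁ j₁ i₂ j₂ : Fin k) :
    ∑ t : Legs k × Legs k, crossTensor a a' t.1 * crossTensor a' a t.2 *
      (strand R true (leg b t.1) (leg b' t.2) i₁ j₁ *
        strand R p (leg (!b) t.1) (leg (!b') t.2) i₂ j₂) = delta R i₁ j₁ * delta R i₂ j₂ := by
  rw [← bigon_move hab hk p]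
  refine Fintype.sum_equiv ((orient b).prodCongr (orient b')) _ _ fun t => ?_
  have h1 := signedTensor_orient a a' true b t.1
  have h2 := signedTensor_orient a a' false b' t.2
  simp only [signedTensor, if_true, Bool.false_eq_true, if_false] at h1 h2
  simp only [Equiv.prodCongr_apply, Prod.map, orient_fst, orient_snd, h1, h2]

lemma tensorAvg_two [NeZero k] (wt : ι → Legs k → R) (F : (ι → Legs k) → R) {c d : ι}
    (hcd : c ≠ d) : tensorAvg wt F =
      tensorAvg (Function.update (Function.update wt c (idleTensor R)) d (idleTensor R)) fun χ =>
        ∑ t : Legs k × Legs k, wt c t.1 * wt d t.2 *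
          F (Function.update (Function.update χ d t.2) c t.1) := by
  rw [tensorAvg_update wt F c (idleTensor R) sum_idleTensor,
    tensorAvg_update _ _ d (idleTensor R) sum_idleTensor]
  refine tensorAvg_congr _ fun χ => ?_
  refine Eq.trans ?_ (Fintype.sum_prod_type_right _).symm
  refine Finset.sum_congr rfl fun y _ => ?_
  rw [Function.update_of_ne hcd.symm, Finset.mul_sum]
  exact Finset.sum_congr rfl fun x _ => by ring

lemma tensorAvg_three [NeZero k] (wt : ι → Legs k → R) (F : (ι → Legs k) → R) {c d e : ι}
    (hcd : c ≠ d) (hce : c ≠ e) (hde : d ≠ e) : tensorAvg wt F =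
      tensorAvg (Function.update (Function.update (Function.update wt c (idleTensor R)) d
        (idleTensor R)) e (idleTensor R)) fun χ =>
        ∑ t : Legs k × Legs k × Legs k, wt c t.1 * wt d t.2.1 * wt e t.2.2 *
          F (Function.update (Function.update (Function.update χ e t.2.2) d t.2.1) c t.1) := by
  rw [tensorAvg_two wt F hcd, tensorAvg_update _ _ e (idleTensor R) sum_idleTensor]
  refine tensorAvg_congr _ fun χ => ?_
  have e1 : ∀ G : Legs k × Legs k × Legs k → R,
      ∑ t, G t = ∑ z, ∑ t : Legs k × Legs k, G (t.1, t.2, z) := by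
    intro G
    rw [Fintype.sum_prod_type]
    calc ∑ x, ∑ t : Legs k × Legs k, G (x, t) = ∑ x, ∑ z, ∑ y, G (x, y, z) :=
          Finset.sum_congr rfl fun x _ => Fintype.sum_prod_type_right fun t => G (x, t)
      _ = ∑ z, ∑ x, ∑ y, G (x, y, z) := Finset.sum_comm
      _ = _ := Finset.sum_congr rfl fun z _ =>
          (Fintype.sum_prod_type fun t : Legs k × Legs k => G (t.1, t.2, z)).symm
  rw [e1]
  refine Finset.sum_congr rfl fun z _ => ?_
  rw [Function.update_of_ne hde.symm, Function.update_of_ne hce.symm, Finset.mul_sum]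
  exact Finset.sum_congr rfl fun t _ => by ring

/-- The colours of three crossings are changed. -/
def recolor (χ : ι → Legs k) (c d e : ι) (t : Legs k × Legs k × Legs k) : ι → Legs k :=
  Function.update (Function.update (Function.update χ e t.2.2) d t.2.1) c t.1

lemma recolor_apply (χ : ι → Legs k) {c d e : ι} (hcd : c ≠ d) (hce : c ≠ e) (hde : d ≠ e)
    (t : Legs k × Legs k × Legs k) : recolor χ c d e t c = t.1 ∧ recolor χ c d e t d = t.2.1 ∧
      recolor χ c d e t e = t.2.2 := by
  simp [recolor, hcd.symm, hce.symm, hde.symm]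

lemma wordMatrix_recolor (χ : ι → Legs k) {c d e : ι} (t : Legs k × Legs k × Legs k)
    {w : List (ι × Bool)} (hw : ∀ l ∈ w, l.1 ≠ c ∧ l.1 ≠ d ∧ l.1 ≠ e) :
    wordMatrix R (recolor χ c d e t) w = wordMatrix R χ w := by
  unfold recolor
  rw [wordMatrix_update _ _ fun l hl => (hw l hl).1, wordMatrix_update _ _ fun l hl => (hw l hl).2.1,
    wordMatrix_update _ _ fun l hl => (hw l hl).2.2]

/-- Invariance of the state sum under the triangle move. -/
lemma stateTrace_triangle [NeZero k] {a a' : R} (hab : a * a' = 1) (hk : a ^ 2 + a' ^ 2 = -k)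
    {wt : ι → Legs k → R} {c d e : ι} (hcd : c ≠ d) (hce : c ≠ e) (hde : d ≠ e) {p q r : Bool}
    (hc : wt c = signedTensor a a' (p == q)) (hd : wt d = signedTensor a a' (p == r))
    (he : wt e = signedTensor a a' (q == r)) (b b' b'' : Bool) {u v x y : List (ι × Bool)}
    (hu : ∀ l ∈ u, l.1 ≠ c ∧ l.1 ≠ d ∧ l.1 ≠ e) (hv : ∀ l ∈ v, l.1 ≠ c ∧ l.1 ≠ d ∧ l.1 ≠ e)
    (hx : ∀ l ∈ x, l.1 ≠ c ∧ l.1 ≠ d ∧ l.1 ≠ e) (hy : ∀ l ∈ y, l.1 ≠ c ∧ l.1 ≠ d ∧ l.1 ≠ e) :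
    stateTrace wt (u ++ orderedPair p (c, b) (d, b') ++ v ++ orderedPair q (c, !b) (e, b'') ++
        x ++ orderedPair r (d, !b') (e, !b'') ++ y) =
      stateTrace wt (u ++ orderedPair (!p) (c, b) (d, b') ++ v ++
        orderedPair (!q) (c, !b) (e, b'') ++ x ++ orderedPair (!r) (d, !b') (e, !b'') ++ y) := by
  unfold stateTrace
  rw [tensorAvg_three wt _ hcd hce hde, tensorAvg_three wt _ hcd hce hde]
  refine tensorAvg_congr _ fun χ => ?_
  change ∑ t, wt c t.1 * wt d t.2.1 * wt e t.2.2 * (wordMatrix R (recolor χ c d e t) _).trace =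
    ∑ t, wt c t.1 * wt d t.2.1 * wt e t.2.2 * (wordMatrix R (recolor χ c d e t) _).trace
  simp only [wordMatrix_append, wordMatrix_recolor χ _ hu, wordMatrix_recolor χ _ hv,
    wordMatrix_recolor χ _ hx, wordMatrix_recolor χ _ hy, wordMatrix_orderedPair,
    (recolor_apply χ hcd hce hde _).1, (recolor_apply χ hcd hce hde _).2.1,
    (recolor_apply χ hcd hce hde _).2.2]
  refine sum_trace_congr (fun i₁ j₁ i₂ j₂ i₃ j₃ => ?_) _ _ _ _
  simp only [hc, hd, he]
  rw [triangle_orient, triangle_orient, triangle_move hab hk]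

/-- Invariance of the state sum under the triangle move, with the other cyclic order of the
strands. -/
lemma stateTrace_triangle' [NeZero k] {a a' : R} (hab : a * a' = 1) (hk : a ^ 2 + a' ^ 2 = -k)
    {wt : ι → Legs k → R} {c d e : ι} (hcd : c ≠ d) (hce : c ≠ e) (hde : d ≠ e) {p q r : Bool}
    (hc : wt c = signedTensor a a' (p == q)) (hd : wt d = signedTensor a a' (p == r))
    (he : wt e = signedTensor a a' (q == r)) (b b' b'' : Bool) {u v x y : List (ι × Bool)}
    (hu : ∀ l ∈ u, l.1 ≠ c ∧ l.1 ≠ d ∧ l.1 ≠ e) (hv : ∀ l ∈ v, l.1 ≠ c ∧ l.1 ≠ d ∧ l.1 ≠ e)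
    (hx : ∀ l ∈ x, l.1 ≠ c ∧ l.1 ≠ d ∧ l.1 ≠ e) (hy : ∀ l ∈ y, l.1 ≠ c ∧ l.1 ≠ d ∧ l.1 ≠ e) :
    stateTrace wt (u ++ orderedPair p (c, b) (d, b') ++ v ++ orderedPair r (d, !b') (e, !b'') ++
        x ++ orderedPair q (c, !b) (e, b'') ++ y) =
      stateTrace wt (u ++ orderedPair (!p) (c, b) (d, b') ++ v ++
        orderedPair (!r) (d, !b') (e, !b'') ++ x ++ orderedPair (!q) (c, !b) (e, b'') ++ y) := by
  unfold stateTrace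
  rw [tensorAvg_three wt _ hcd hce hde, tensorAvg_three wt _ hcd hce hde]
  refine tensorAvg_congr _ fun χ => ?_
  change ∑ t, wt c t.1 * wt d t.2.1 * wt e t.2.2 * (wordMatrix R (recolor χ c d e t) _).trace =
    ∑ t, wt c t.1 * wt d t.2.1 * wt e t.2.2 * (wordMatrix R (recolor χ c d e t) _).trace
  simp only [wordMatrix_append, wordMatrix_recolor χ _ hu, wordMatrix_recolor χ _ hv,
    wordMatrix_recolor χ _ hx, wordMatrix_recolor χ _ hy, wordMatrix_orderedPair,
    (recolor_apply χ hcd hce hde _).1, (recolor_apply χ hcd hce hde _).2.1,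
    (recolor_apply χ hcd hce hde _).2.2]
  refine sum_trace_congr (fun i₁ j₁ i₃ j₃ i₂ j₂ => ?_) _ _ _ _
  simp only [hc, hd, he, mul_right_comm (strand R _ _ _ i₁ j₁) (strand R _ _ _ i₃ j₃)]
  rw [triangle_orient, triangle_orient, triangle_move hab hk]

/-- Invariance of the state sum under removal of a bigon. -/
lemma stateTrace_bigon [NeZero k] {a a' : R} (hab : a * a' = 1) (hk : a ^ 2 + a' ^ 2 = -k)
    {wt : ι → Legs k → R} {c d : ι} (hcd : c ≠ d) (hc : wt c = crossTensor a a')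
    (hd : wt d = crossTensor a' a) (p b b' : Bool) {u v x : List (ι × Bool)}
    (hu : ∀ l ∈ u, l.1 ≠ c ∧ l.1 ≠ d) (hv : ∀ l ∈ v, l.1 ≠ c ∧ l.1 ≠ d)
    (hx : ∀ l ∈ x, l.1 ≠ c ∧ l.1 ≠ d) :
    stateTrace wt (u ++ orderedPair true (c, b) (d, b') ++ v ++
        orderedPair p (c, !b) (d, !b') ++ x) =
      stateTrace (Function.update (Function.update wt c (idleTensor R)) d (idleTensor R))
        (u ++ v ++ x) := by
  unfold stateTrace
  rw [tensorAvg_two wt _ hcd]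
  refine tensorAvg_congr _ fun χ => ?_
  have e : ∀ (t : Legs k × Legs k) (w : List (ι × Bool)), (∀ l ∈ w, l.1 ≠ c ∧ l.1 ≠ d) →
      wordMatrix R (Function.update (Function.update χ d t.2) c t.1) w = wordMatrix R χ w := by
    intro t w hw
    rw [wordMatrix_update _ _ fun l hl => (hw l hl).1,
      wordMatrix_update _ _ fun l hl => (hw l hl).2]
  simp only [wordMatrix_append, e _ u hu, e _ v hv, e _ x hx, wordMatrix_orderedPair,
    Function.update_self, Function.update_of_ne hcd.symm, hc, hd]
  have h := sum_trace_congr (u := fun t : Legs k × Legs k =>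
    crossTensor a a' t.1 * crossTensor a' a t.2)
    (P := fun t => strand R true (leg b t.1) (leg b' t.2))
    (Q := fun t => strand R p (leg (!b) t.1) (leg (!b') t.2)) (S := fun _ => 1)
    (β := Unit) (u' := 1) (P' := 1) (Q' := 1) (S' := 1) (fun i₁ j₁ i₂ j₂ i₃ j₃ => by
      have := bigon_orient hab hk p b b' i₁ j₁ i₂ j₂
      simp only [← mul_assoc] at this ⊢
      rw [← Finset.sum_mul, this]
      simp [delta, Matrix.one_apply])
    (wordMatrix R χ u) (wordMatrix R χ v) 1 (wordMatrix R χ x)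
  simpa using h

/-- The effect of the removal of a kink on the state sum. -/
lemma stateTrace_kink [NeZero k] {a a' : R} {wt : ι → Legs k → R} {c : ι}
    (hc : wt c = crossTensor a a') (b : Bool) {u v : List (ι × Bool)}
    (hu : ∀ l ∈ u, l.1 ≠ c) (hv : ∀ l ∈ v, l.1 ≠ c) :
    stateTrace wt (u ++ [(c, b), (c, !b)] ++ v) =
      (a * k + a') * stateTrace (Function.update wt c (idleTensor R)) (u ++ v) := by
  unfold stateTrace
  rw [tensorAvg_update wt _ c (idleTensor R) sum_idleTensor, ← tensorAvg_smul]
  refine tensorAvg_congr _ fun χ => ?_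
  have h := sum_chord a a' b χ c (1 : Matrix (Fin k) (Fin k) R)
  simp only [wordMatrix_append, wordMatrix_update _ _ hu, wordMatrix_update _ _ hv, hc]
  have e : ∀ x, wordMatrix R (Function.update χ c x) [(c, b), (c, !b)] =
      letterMatrix R (Function.update χ c x) (c, b) * 1 *
        letterMatrix R (Function.update χ c x) (c, !b) := by
    intro x
    simp [wordMatrix]
  simp only [e]
  have e2 : ∀ x, crossTensor a a' x * (wordMatrix R χ u *
      (letterMatrix R (Function.update χ c x) (c, b) * 1 *
        letterMatrix R (Function.update χ c x) (c, !b)) * wordMatrix R χ v).trace =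
      (wordMatrix R χ u * ((a * orientedTensor R x + a' * unorientedTensor R x) •
      (letterMatrix R (Function.update χ c x) (c, b) * 1 *
        letterMatrix R (Function.update χ c x) (c, !b))) * wordMatrix R χ v).trace := by
    intro x
    rw [Matrix.mul_smul, Matrix.smul_mul, Matrix.trace_smul, smul_eq_mul]
    rfl
  simp only [e2]
  rw [← Matrix.trace_sum, ← Finset.sum_mul, ← Finset.mul_sum, h]
  simp only [Matrix.trace_one, Fintype.card_fin, Matrix.transpose_one, ← add_smul]
  rw [Matrix.mul_smul, Matrix.smul_mul, Matrix.trace_smul, Matrix.mul_one, smul_eq_mul]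

lemma stateTrace_relabel {κ : Type*} [Fintype κ] [DecidableEq κ] (σ : ι ≃ κ)
    (wt : κ → Legs k → R) (w : List (ι × Bool)) :
    stateTrace wt (w.map fun l => (σ l.1, l.2)) = stateTrace (fun c => wt (σ c)) w := by
  unfold stateTrace tensorAvg
  refine (Fintype.sum_equiv (σ.arrowCongr (Equiv.refl (Legs k))) _ _ fun χ => ?_).symm
  congr 1
  · refine Fintype.prod_equiv σ _ _ fun c => ?_
    simp
  · simp only [wordMatrix, List.map_map]
    congr 2
    refine List.map_congr_left fun l _ => ?_
    simp [letterMatrix]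

end StateMoves

/-! ### Invariance of the Jones polynomial -/

section FlatMoves

variable {ι : Type*} [Fintype ι] [DecidableEq ι] {K : Type*} [Field K] {k : ℕ} [NeZero k]

/-- The normalized state sum of a word with the crossing signs `s`, at a value of the variable `A`
with `-A ^ 2 - A ^ (-2) = k`. -/
def flatTrace (k : ℕ) [NeZero k] (A : K) (s : ι → ℤ) (w : List (ι × Bool)) : K :=
  (-A ^ 3) ^ (-∑ c ∈ labels w, s c) *
    stateTrace (k := k) (chordWeight (fun c => A ^ s c) (fun c => A ^ (-s c)) (labels w)) w

lemma flatTrace_congr (A : K) {s s' : ι → ℤ} {w : List (ι × Bool)}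
    (h : ∀ c ∈ labels w, s c = s' c) : flatTrace k A s w = flatTrace k A s' w := by
  unfold flatTrace
  rw [Finset.sum_congr rfl h]
  congr 2
  funext c x
  unfold chordWeight
  split_ifs with hc
  · simp only [h c hc]
  · rfl

lemma flatTrace_rotate (A : K) (s : ι → ℤ) (u v : List (ι × Bool)) :
    flatTrace k A s (u ++ v) = flatTrace k A s (v ++ u) := by
  unfold flatTrace
  rw [stateTrace_rotate, labels_perm List.perm_append_comm]

lemma flatTrace_relabel {κ : Type*} [Fintype κ] [DecidableEq κ] (σ : ι ≃ κ) (A : K) (s : κ → ℤ)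
    (w : List (ι × Bool)) :
    flatTrace k A s (w.map fun l => (σ l.1, l.2)) = flatTrace k A (fun c => s (σ c)) w := by
  have hl : labels (w.map fun l => (σ l.1, l.2)) = (labels w).image σ := by
    ext c
    simp [labels]
  unfold flatTrace
  rw [stateTrace_relabel, hl, Finset.sum_image σ.injective.injOn]
  congr 2
  funext c x
  simp [chordWeight]

lemma sq_zpow_add {A : K} (hk : -A ^ 2 - A⁻¹ ^ 2 = k) {s : ℤ} (hs : s = 1 ∨ s = -1) :
    (A ^ s) ^ 2 + (A ^ (-s)) ^ 2 = -k := by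
  rw [← hk]
  rcases hs with rfl | rfl
  · rw [zpow_neg, zpow_one]; ring
  · rw [neg_neg, zpow_neg, zpow_one]; ring

lemma zpow_mul_zpow_neg {A : K} (hA : A ≠ 0) (s : ℤ) : A ^ s * A ^ (-s) = 1 := by
  rw [← zpow_add₀ hA, add_neg_cancel, zpow_zero]

/-- A kink. -/
lemma flatTrace_kink {A : K} (hA : A ≠ 0) (hk : -A ^ 2 - A⁻¹ ^ 2 = k) {s : ι → ℤ} {c : ι} {b : Bool}
    {u v : List (ι × Bool)} (hs : s c = 1 ∨ s c = -1)
    (h : PairedWord (u ++ [(c, b), (c, !b)] ++ v)) :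
    flatTrace k A s (u ++ [(c, b), (c, !b)] ++ v) = flatTrace k A s (u ++ v) := by
  have hp : (u ++ [(c, b), (c, !b)] ++ v).Perm ((c, b) :: [] ++ (c, !b) :: (u ++ v)) := by
    rw [← Multiset.coe_eq_coe]
    simp only [← Multiset.coe_add, ← Multiset.cons_coe, Multiset.coe_nil, ← Multiset.singleton_add]
    abel
  obtain ⟨-, h2⟩ := (h.of_perm hp).remove
  rw [List.nil_append] at h2
  have hc := notMem_labels h2
  have hl : labels (u ++ [(c, b), (c, !b)] ++ v) = insert c (labels (u ++ v)) := by
    rw [labels_perm hp, labels_remove, List.nil_append]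
  unfold flatTrace
  rw [hl, stateTrace_kink (c := c) (a := A ^ s c) (a' := A ^ (-s c)) (by
      funext x
      rw [chordWeight_insert_self]
      rfl) b (fun l hl => h2 l (by simp [hl])) (fun l hl => h2 l (by simp [hl])),
    chordWeight_update _ _ _ hc, Finset.sum_insert hc, ← mul_assoc]
  congr 1
  have h3 : A ^ s c * k + A ^ (-s c) = (-A ^ 3) ^ s c := by
    rw [← hk]
    rcases hs with hs | hs <;> rw [hs]
    · rw [zpow_one, zpow_one, zpow_neg, zpow_one]
      field_simp
      ring
    · simp only [zpow_neg, zpow_one, neg_neg]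
      field_simp
      ring
  have hA3 : -A ^ 3 ≠ 0 := neg_ne_zero.2 (pow_ne_zero 3 hA)
  rw [h3, neg_add, zpow_add₀ hA3, mul_assoc, mul_comm _ ((-A ^ 3) ^ s c), ← mul_assoc,
    ← zpow_add₀ hA3, neg_add_cancel, zpow_zero, one_mul]

lemma coe_orderedPair (p : Bool) (l m : ι × Bool) :
    (orderedPair p l m : Multiset (ι × Bool)) = {l} + {m} := by
  cases p
  · exact Multiset.coe_eq_coe.2 (List.Perm.swap l m [])
  · rfl

/-- A bigon. -/
lemma flatTrace_bigon {A : K} (hA : A ≠ 0) (hk : -A ^ 2 - A⁻¹ ^ 2 = k) {s : ι → ℤ} {c d : ι}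
    (p b b' : Bool) {u v x : List (ι × Bool)} (hs : s c = 1 ∨ s c = -1) (hd : s d = -s c)
    (h : PairedWord (u ++ orderedPair true (c, b) (d, b') ++ v ++
        orderedPair p (c, !b) (d, !b') ++ x)) :
    flatTrace k A s (u ++ orderedPair true (c, b) (d, b') ++ v ++
        orderedPair p (c, !b) (d, !b') ++ x) = flatTrace k A s (u ++ v ++ x) := by
  have hp : (u ++ orderedPair true (c, b) (d, b') ++ v ++ orderedPair p (c, !b) (d, !b') ++ x).Perm
      ((c, b) :: [] ++ (c, !b) :: ((d, b') :: [] ++ (d, !b') :: (u ++ v ++ x))) := by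
    rw [← Multiset.coe_eq_coe]
    simp only [← Multiset.coe_add, ← Multiset.cons_coe, Multiset.coe_nil, coe_orderedPair,
      ← Multiset.singleton_add]
    abel
  obtain ⟨h1, h2⟩ := (h.of_perm hp).remove
  rw [List.nil_append] at h1 h2
  obtain ⟨-, h3⟩ := h1.remove
  rw [List.nil_append] at h3
  have hcd : c ≠ d := fun e => h2 (d, b') (by simp) e.symm
  have hl : labels (u ++ orderedPair true (c, b) (d, b') ++ v ++
      orderedPair p (c, !b) (d, !b') ++ x) = insert c (insert d (labels (u ++ v ++ x))) := by
    rw [labels_perm hp, labels_remove, List.nil_append, labels_remove, List.nil_append]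
  have hdl := notMem_labels h3
  have hcl : c ∉ insert d (labels (u ++ v ++ x)) := by
    have := notMem_labels h2
    rwa [labels_remove, List.nil_append] at this
  have h4 : ∀ l ∈ u ++ v ++ x, l.1 ≠ c ∧ l.1 ≠ d := fun l hl =>
    ⟨h2 l (by simp at hl ⊢; tauto), h3 l hl⟩
  unfold flatTrace
  rw [hl, stateTrace_bigon (a := A ^ s c) (a' := A ^ (-s c)) (zpow_mul_zpow_neg hA _)
    (sq_zpow_add hk hs) hcd
    (by funext x; rw [chordWeight_insert_self]; rfl)
    (by
      funext x
      rw [Finset.insert_comm, chordWeight_insert_self, hd, neg_neg]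
      rfl) p b b' (fun l hl => h4 l (by simp [hl])) (fun l hl => h4 l (by simp [hl]))
      (fun l hl => h4 l (by simp [hl])),
    chordWeight_update _ _ _ hcl, chordWeight_update _ _ _ hdl, Finset.sum_insert hcl,
    Finset.sum_insert hdl, hd, add_neg_cancel_left]

lemma crossTensor_signed {A : K} (σ : ℤ) (p : Bool) {τ : ℤ} (h : τ = if p then σ else -σ) :
    (fun x : Legs k => A ^ τ * orientedTensor K x + A ^ (-τ) * unorientedTensor K x) =
      signedTensor (A ^ σ) (A ^ (-σ)) p := by
  subst h
  cases p <;> simp [signedTensor, crossTensor, funext_iff]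

lemma triangle_facts {c d e : ι} {p q r b b' b'' : Bool} {W u v x y : List (ι × Bool)}
    (hW : (W : Multiset (ι × Bool)) = ↑(u ++ orderedPair p (c, b) (d, b') ++ v ++
      orderedPair q (c, !b) (e, b'') ++ x ++ orderedPair r (d, !b') (e, !b'') ++ y))
    (h : PairedWord W) : c ≠ d ∧ c ≠ e ∧ d ≠ e ∧
      (∀ l ∈ u ++ v ++ x ++ y, l.1 ≠ c ∧ l.1 ≠ d ∧ l.1 ≠ e) ∧
      labels W = insert c (insert d (insert e (labels (u ++ v ++ x ++ y)))) := by
  have hp : W.Perm ((c, b) :: [] ++ (c, !b) :: ((d, b') :: [] ++ (d, !b') ::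
      ((e, b'') :: [] ++ (e, !b'') :: (u ++ v ++ x ++ y)))) := by
    rw [← Multiset.coe_eq_coe, hW]
    simp only [← Multiset.coe_add, ← Multiset.cons_coe, Multiset.coe_nil, coe_orderedPair,
      ← Multiset.singleton_add]
    abel
  obtain ⟨h1, h2⟩ := (h.of_perm hp).remove
  rw [List.nil_append] at h1 h2
  obtain ⟨h3, h4⟩ := h1.remove
  rw [List.nil_append] at h3 h4
  obtain ⟨-, h6⟩ := h3.remove
  rw [List.nil_append] at h6
  refine ⟨fun e => h2 (d, b') (by simp) e.symm, fun e' => h2 (e, b'') (by simp) e'.symm,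
    fun e' => h4 (e, b'') (by simp) e'.symm, fun l hl => ⟨h2 l ?_, h4 l ?_, h6 l hl⟩, ?_⟩
  · simp at hl ⊢; tauto
  · simp at hl ⊢; tauto
  · simp only [labels_perm hp, labels_remove, List.nil_append]

/-- The triangle move. -/
lemma flatTrace_triangle {A : K} (hA : A ≠ 0) (hk : -A ^ 2 - A⁻¹ ^ 2 = k) {s : ι → ℤ} {c d e : ι}
    (p q r b b' b'' : Bool) {u v x y : List (ι × Bool)} {σ : ℤ} (hσ : σ = 1 ∨ σ = -1)
    (hc : s c = if p == q then σ else -σ) (hd : s d = if p == r then σ else -σ)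
    (he : s e = if q == r then σ else -σ)
    (h : PairedWord (u ++ orderedPair p (c, b) (d, b') ++ v ++ orderedPair q (c, !b) (e, b'') ++
        x ++ orderedPair r (d, !b') (e, !b'') ++ y)) :
    flatTrace k A s (u ++ orderedPair p (c, b) (d, b') ++ v ++ orderedPair q (c, !b) (e, b'') ++
        x ++ orderedPair r (d, !b') (e, !b'') ++ y) =
      flatTrace k A s (u ++ orderedPair (!p) (c, b) (d, b') ++ v ++
        orderedPair (!q) (c, !b) (e, b'') ++ x ++ orderedPair (!r) (d, !b') (e, !b'') ++ y) := by
  obtain ⟨hcd, hce, hde, h4, hl⟩ := triangle_facts rfl h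
  have hl' : labels (u ++ orderedPair (!p) (c, b) (d, b') ++ v ++
        orderedPair (!q) (c, !b) (e, b'') ++ x ++ orderedPair (!r) (d, !b') (e, !b'') ++ y) =
      labels (u ++ orderedPair p (c, b) (d, b') ++ v ++
        orderedPair q (c, !b) (e, b'') ++ x ++ orderedPair r (d, !b') (e, !b'') ++ y) := by
    refine labels_perm (Multiset.coe_eq_coe.1 ?_)
    simp only [← Multiset.coe_add, coe_orderedPair]
  unfold flatTrace
  rw [hl', stateTrace_triangle (a := A ^ σ) (a' := A ^ (-σ)) (zpow_mul_zpow_neg hA _)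
    (sq_zpow_add hk hσ) hcd hce hde (p := p) (q := q) (r := r) _ _ _ b b' b''
      (fun l hl => h4 l (by simp [hl])) (fun l hl => h4 l (by simp [hl]))
      (fun l hl => h4 l (by simp [hl])) (fun l hl => h4 l (by simp [hl]))]
  all_goals
    rw [← crossTensor_signed σ _ (by assumption)]
    funext x
    simp only [chordWeight]
    rw [if_pos (by rw [hl]; simp)]

/-- The triangle move, with the other cyclic order of the strands. -/
lemma flatTrace_triangle' {A : K} (hA : A ≠ 0) (hk : -A ^ 2 - A⁻¹ ^ 2 = k) {s : ι → ℤ}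
    {c d e : ι} (p q r b b' b'' : Bool) {u v x y : List (ι × Bool)} {σ : ℤ} (hσ : σ = 1 ∨ σ = -1)
    (hc : s c = if p == q then σ else -σ) (hd : s d = if p == r then σ else -σ)
    (he : s e = if q == r then σ else -σ)
    (h : PairedWord (u ++ orderedPair p (c, b) (d, b') ++ v ++ orderedPair r (d, !b') (e, !b'') ++
        x ++ orderedPair q (c, !b) (e, b'') ++ y)) :
    flatTrace k A s (u ++ orderedPair p (c, b) (d, b') ++ v ++ orderedPair r (d, !b') (e, !b'') ++
        x ++ orderedPair q (c, !b) (e, b'') ++ y) =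
      flatTrace k A s (u ++ orderedPair (!p) (c, b) (d, b') ++ v ++
        orderedPair (!r) (d, !b') (e, !b'') ++ x ++ orderedPair (!q) (c, !b) (e, b'') ++ y) := by
  obtain ⟨hcd, hce, hde, h4, hl⟩ := triangle_facts (q := q) (r := r) (b := b) (b' := b')
    (b'' := b'') (p := p) (c := c) (d := d) (e := e) (u := u) (v := v) (x := x) (y := y) (by
      simp only [← Multiset.coe_add]
      abel) h
  have hl' : labels (u ++ orderedPair (!p) (c, b) (d, b') ++ v ++
        orderedPair (!r) (d, !b') (e, !b'') ++ x ++ orderedPair (!q) (c, !b) (e, b'') ++ y) =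
      labels (u ++ orderedPair p (c, b) (d, b') ++ v ++
        orderedPair r (d, !b') (e, !b'') ++ x ++ orderedPair q (c, !b) (e, b'') ++ y) := by
    refine labels_perm (Multiset.coe_eq_coe.1 ?_)
    simp only [← Multiset.coe_add, coe_orderedPair]
  unfold flatTrace
  rw [hl', stateTrace_triangle' (a := A ^ σ) (a' := A ^ (-σ)) (zpow_mul_zpow_neg hA _)
    (sq_zpow_add hk hσ) hcd hce hde (p := p) (q := q) (r := r) _ _ _ b b' b''
      (fun l hl => h4 l (by simp [hl])) (fun l hl => h4 l (by simp [hl]))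
      (fun l hl => h4 l (by simp [hl])) (fun l hl => h4 l (by simp [hl]))]
  all_goals
    rw [← crossTensor_signed σ _ (by assumption)]
    funext x
    simp only [chordWeight]
    rw [if_pos (by rw [hl]; simp)]

end FlatMoves

namespace GaussWord

variable {N k : ℕ} [NeZero k] {K : Type*} [Field K]

lemma natCast_mul_jonesSum {w : GaussWord} {A : K} (hA : A ≠ 0) (hk : -A ^ 2 - A⁻¹ ^ 2 = k)
    (hP : PairedWord (w.flatten N)) :
    k * jonesSum N w A = flatTrace k A (signAt N w) (w.flatten N) := by
  unfold flatTrace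
  rw [jonesSum_eq hA, ← eval_loopPoly _ _ hP, loopPoly, Polynomial.eval_finsetSum, mul_left_comm,
    Finset.mul_sum]
  congr 1
  refine Finset.sum_congr rfl fun T _ => ?_
  obtain ⟨l, hl⟩ := Nat.exists_eq_succ_of_ne_zero (loopNumber_pos (w.flatten N).get T).ne'
  rw [hl, hk]
  simp only [Polynomial.eval_mul, Polynomial.eval_C, Polynomial.eval_pow, Polynomial.eval_X]
  rw [Nat.succ_sub_one, Nat.succ_eq_add_one, pow_succ]
  ring

lemma flatten_append (u v : GaussWord) :
    flatten N (u ++ v) = flatten N u ++ flatten N v := List.map_append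

lemma flatten_ordered (p : ℤˣ) (P Q : Passage) : flatten N (ordered p P Q) =
    orderedPair (decide (p = 1)) (flatLetter N P) (flatLetter N Q) := by
  unfold ordered orderedPair flatten
  by_cases h : p = 1 <;> simp [h]

lemma flatLetter_not (c : ℕ) (o : Bool) (s : ℤˣ) : flatLetter N ⟨c, !o, s⟩ =
    (Fin.ofNat (N + 1) c, !(flatLetter N ⟨c, o, s⟩).2) := by
  unfold flatLetter
  cases o <;> by_cases h : s = 1 <;> simp [h]

lemma unit_mul_eq (p q s : ℤˣ) : ((p * q * s : ℤˣ) : ℤ) =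
    if decide (p = 1) == decide (q = 1) then (s : ℤ) else -(s : ℤ) := by
  rcases Int.units_eq_one_or p with rfl | rfl <;> rcases Int.units_eq_one_or q with rfl | rfl <;>
    simp

lemma decide_neg_unit (p : ℤˣ) : decide (-p = 1) = !decide (p = 1) := by
  rcases Int.units_eq_one_or p with rfl | rfl <;> simp

lemma unit_cases (s : ℤˣ) : (s : ℤ) = 1 ∨ (s : ℤ) = -1 := by
  rcases Int.units_eq_one_or s with rfl | rfl <;> simp

lemma flatTrace_signAt_congr {w w' : GaussWord} (hw : w.WellFormed) (hw' : w'.WellFormed)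
    (hN : ∀ p ∈ w, p.label ≤ N) (hN' : ∀ p ∈ w', p.label ≤ N) (A : K)
    (h : ∀ p ∈ w', p ∈ w) : flatTrace k A (signAt N w) (w'.flatten N) =
      flatTrace k A (signAt N w') (w'.flatten N) := by
  refine flatTrace_congr A fun c hc => ?_
  rw [labels_flatten, Finset.mem_image] at hc
  obtain ⟨x, hx, rfl⟩ := hc
  obtain ⟨p, hp, rfl⟩ := mem_crossings.1 hx
  rw [signAt_eq hw hN (h p hp), signAt_eq hw' hN' hp]

lemma exists_perm_ofNat {w : GaussWord} {f : ℕ → ℕ} (hf : Function.Injective f)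
    (hN : ∀ p ∈ w, p.label ≤ N) (hN' : ∀ p ∈ w, f p.label ≤ N) :
    ∃ σ : Fin (N + 1) ≃ Fin (N + 1), ∀ p ∈ w,
      σ (Fin.ofNat (N + 1) p.label) = Fin.ofNat (N + 1) (f p.label) := by
  obtain ⟨g, hg⟩ := Finset.exists_equiv_extend_of_card_eq (α := Fin (N + 1)) (β := Fin (N + 1))
    (t := Finset.univ) (by simp) (s := w.crossings.image (Fin.ofNat (N + 1)))
    (f := fun c => Fin.ofNat (N + 1) (f c)) (Finset.subset_univ _) (by
      intro a ha b hb hab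
      simp only [Finset.coe_image, Set.mem_image, Finset.mem_coe] at ha hb
      obtain ⟨x, hx, rfl⟩ := ha
      obtain ⟨y, hy, rfl⟩ := hb
      obtain ⟨p, hp, rfl⟩ := mem_crossings.1 hx
      obtain ⟨q, hq, rfl⟩ := mem_crossings.1 hy
      simp only [Fin.val_ofNat, Nat.mod_eq_of_lt (Nat.lt_succ_of_le (hN p hp)),
        Nat.mod_eq_of_lt (Nat.lt_succ_of_le (hN q hq))] at hab
      rw [hf ((fin_ofNat_inj (hN' p hp) (hN' q hq)).1 hab)])
  refine ⟨g.trans (Equiv.subtypeUnivEquiv (fun x => Finset.mem_univ x)), fun p hp => ?_⟩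
  have := hg (Fin.ofNat (N + 1) p.label) (Finset.mem_image_of_mem _ (mem_crossings.2 ⟨p, hp, rfl⟩))
  simp only [Equiv.trans_apply, Equiv.subtypeUnivEquiv_apply]
  rw [this, Fin.val_ofNat, Nat.mod_eq_of_lt (Nat.lt_succ_of_le (hN p hp))]

/-- The normalized state sum is invariant under Reidemeister moves. -/
theorem Move.flatTrace_eq {w w' : GaussWord} (h : Move w w') (hw : w.WellFormed)
    (hw' : w'.WellFormed) (hN : ∀ p ∈ w, p.label ≤ N) (hN' : ∀ p ∈ w', p.label ≤ N) {A : K}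
    (hA : A ≠ 0) (hk : -A ^ 2 - A⁻¹ ^ 2 = k) : flatTrace k A (signAt N w) (w.flatten N) =
      flatTrace k A (signAt N w') (w'.flatten N) := by
  have hP := hw.pairedWord hN
  cases h with
  | rotate u v =>
    rw [← flatTrace_signAt_congr hw hw' hN hN' A (by simp [or_comm]), flatten_append,
      flatten_append, flatTrace_rotate]
  | relabel f u =>
    obtain ⟨σ, hσ⟩ := exists_perm_ofNat (w := w) f.injective hN fun p hp =>
      hN' _ (List.mem_map_of_mem hp)
    have e : flatten N (w.map fun p => ⟨f p.label, p.isOver, p.sign⟩) =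
        (w.flatten N).map fun l => (σ l.1, l.2) := by
      simp only [flatten, List.map_map]
      refine List.map_congr_left fun p hp => ?_
      exact Prod.ext (hσ p hp).symm rfl
    rw [e, flatTrace_relabel]
    refine flatTrace_congr A fun c hc => ?_
    rw [labels_flatten, Finset.mem_image] at hc
    obtain ⟨x, hx, rfl⟩ := hc
    obtain ⟨p, hp, rfl⟩ := mem_crossings.1 hx
    rw [hσ p hp, signAt_eq hw hN hp]
    exact (signAt_eq hw' hN' (List.mem_map_of_mem (f := fun p : Passage =>
      (⟨f p.label, p.isOver, p.sign⟩ : Passage)) hp)).symm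
  | r1 u v c o s =>
    rw [← flatTrace_signAt_congr hw hw' hN hN' A (by simp; tauto)]
    have hs := signAt_eq hw hN (p := ⟨c, o, s⟩) (by simp)
    simp only [flatten_append] at hP ⊢
    have e : flatten N [⟨c, o, s⟩, ⟨c, !o, s⟩] = [(Fin.ofNat (N + 1) c, (flatLetter N ⟨c, o, s⟩).2),
        (Fin.ofNat (N + 1) c, !(flatLetter N ⟨c, o, s⟩).2)] := by
      rw [← flatLetter_not]
      rfl
    rw [e] at hP ⊢
    exact flatTrace_kink hA hk (by rw [hs]; exact unit_cases s) hP
  | r2_parallel u v x c d o s =>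
    rw [← flatTrace_signAt_congr hw hw' hN hN' A (by simp; tauto)]
    have hs := signAt_eq hw hN (p := ⟨c, o, s⟩) (by simp)
    have hs' := signAt_eq hw hN (p := ⟨d, o, -s⟩) (by simp)
    simp only [flatten_append] at hP ⊢
    have e : flatten N [⟨c, o, s⟩, ⟨d, o, -s⟩] = orderedPair true
      (Fin.ofNat (N + 1) c, (flatLetter N ⟨c, o, s⟩).2)
      (Fin.ofNat (N + 1) d, (flatLetter N ⟨d, o, -s⟩).2) := rfl
    have e' : flatten N [⟨c, !o, s⟩, ⟨d, !o, -s⟩] = orderedPair true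
        (Fin.ofNat (N + 1) c, !(flatLetter N ⟨c, o, s⟩).2)
        (Fin.ofNat (N + 1) d, !(flatLetter N ⟨d, o, -s⟩).2) := by
      rw [← flatLetter_not, ← flatLetter_not]
      rfl
    rw [e, e'] at hP ⊢
    exact flatTrace_bigon hA hk true _ _ (by rw [hs]; exact unit_cases s)
      (by rw [hs, hs']; simp) hP
  | r2_opposite u v x c d o s =>
    rw [← flatTrace_signAt_congr hw hw' hN hN' A (by simp; tauto)]
    have hs := signAt_eq hw hN (p := ⟨c, o, s⟩) (by simp)
    have hs' := signAt_eq hw hN (p := ⟨d, o, -s⟩) (by simp)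
    simp only [flatten_append] at hP ⊢
    have e : flatten N [⟨c, o, s⟩, ⟨d, o, -s⟩] = orderedPair true
      (Fin.ofNat (N + 1) c, (flatLetter N ⟨c, o, s⟩).2)
      (Fin.ofNat (N + 1) d, (flatLetter N ⟨d, o, -s⟩).2) := rfl
    have e' : flatten N [⟨d, !o, -s⟩, ⟨c, !o, s⟩] = orderedPair false
        (Fin.ofNat (N + 1) c, !(flatLetter N ⟨c, o, s⟩).2)
        (Fin.ofNat (N + 1) d, !(flatLetter N ⟨d, o, -s⟩).2) := by
      rw [← flatLetter_not, ← flatLetter_not]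
      rfl
    rw [e, e'] at hP ⊢
    exact flatTrace_bigon hA hk false _ _ (by rw [hs]; exact unit_cases s)
      (by rw [hs, hs']; simp) hP
  | r3 u v x y c d e p q r s =>
    have hmem : ∀ (ε : ℤˣ) (P Q R : Passage), R ∈ ordered ε P Q ↔ R = P ∨ R = Q := by
      intro ε P Q R
      unfold ordered
      split_ifs <;> simp [or_comm]
    rw [← flatTrace_signAt_congr hw hw' hN hN' A (by simp [hmem])]
    have hc := signAt_eq hw hN (p := ⟨c, true, p * q * s⟩) (by simp [hmem])
    have hd := signAt_eq hw hN (p := ⟨d, true, p * r * s⟩) (by simp [hmem])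
    have he := signAt_eq hw hN (p := ⟨e, true, q * r * s⟩) (by simp [hmem])
    rw [unit_mul_eq] at hc hd he
    simp only [flatten_append, flatten_ordered] at hP ⊢
    have e1 := flatLetter_not (N := N) c true (p * q * s)
    have e2 := flatLetter_not (N := N) d true (p * r * s)
    have e3 := flatLetter_not (N := N) e true (q * r * s)
    simp only [Bool.not_true] at e1 e2 e3
    simp only [e1, e2, e3, decide_neg_unit] at hP ⊢
    exact flatTrace_triangle hA hk _ _ _ _ _ _ (unit_cases s) hc hd he hP
  | r3' u v x y c d e p q r s =>
    have hmem : ∀ (ε : ℤˣ) (P Q R : Passage), R ∈ ordered ε P Q ↔ R = P ∨ R = Q := by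
      intro ε P Q R
      unfold ordered
      split_ifs <;> simp [or_comm]
    rw [← flatTrace_signAt_congr hw hw' hN hN' A (by simp [hmem])]
    have hc := signAt_eq hw hN (p := ⟨c, true, p * q * s⟩) (by simp [hmem])
    have hd := signAt_eq hw hN (p := ⟨d, true, p * r * s⟩) (by simp [hmem])
    have he := signAt_eq hw hN (p := ⟨e, true, q * r * s⟩) (by simp [hmem])
    rw [unit_mul_eq] at hc hd he
    simp only [flatten_append, flatten_ordered] at hP ⊢
    have e1 := flatLetter_not (N := N) c true (p * q * s)
    have e2 := flatLetter_not (N := N) d true (p * r * s)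
    have e3 := flatLetter_not (N := N) e true (q * r * s)
    simp only [Bool.not_true] at e1 e2 e3
    simp only [e1, e2, e3, decide_neg_unit] at hP ⊢
    exact flatTrace_triangle' hA hk _ _ _ _ _ _ (unit_cases s) hc hd he hP

end GaussWord

/-- The function `f` is a Laurent polynomial on the nonzero elements of the field. -/
def IsLaurent {F : Type*} [Field F] (f : F → F) : Prop :=
  ∃ (m : ℕ) (p : Polynomial F), ∀ x, x ≠ 0 → x ^ m * f x = p.eval x

namespace IsLaurent

variable {F : Type*} [Field F]

lemma const (c : F) : IsLaurent fun _ : F => c := ⟨0, Polynomial.C c, by simp⟩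

lemma add {f g : F → F} (hf : IsLaurent f) (hg : IsLaurent g) : IsLaurent fun x => f x + g x := by
  obtain ⟨m, p, hp⟩ := hf
  obtain ⟨n, q, hq⟩ := hg
  refine ⟨m + n, .X ^ n * p + .X ^ m * q, fun x hx => ?_⟩
  simp only [Polynomial.eval_add, Polynomial.eval_mul, Polynomial.eval_pow, Polynomial.eval_X,
    ← hp x hx, ← hq x hx]
  ring

lemma mul {f g : F → F} (hf : IsLaurent f) (hg : IsLaurent g) : IsLaurent fun x => f x * g x := by
  obtain ⟨m, p, hp⟩ := hf
  obtain ⟨n, q, hq⟩ := hg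
  refine ⟨m + n, p * q, fun x hx => ?_⟩
  rw [Polynomial.eval_mul, ← hp x hx, ← hq x hx]
  ring

lemma sub {f g : F → F} (hf : IsLaurent f) (hg : IsLaurent g) : IsLaurent fun x => f x - g x := by
  have : (fun x => f x - g x) = fun x => f x + -1 * g x := by funext x; ring
  rw [this]
  exact hf.add ((const _).mul hg)

lemma zpow (e : ℤ) : IsLaurent fun x : F => x ^ e := by
  refine ⟨e.natAbs, .X ^ (e + e.natAbs).toNat, fun x hx => ?_⟩
  rw [Polynomial.eval_pow, Polynomial.eval_X, ← zpow_natCast, ← zpow_natCast, ← zpow_add₀ hx]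
  congr 1
  omega

lemma sum {ι : Type*} (s : Finset ι) {f : ι → F → F} (h : ∀ i ∈ s, IsLaurent (f i)) :
    IsLaurent fun x => ∑ i ∈ s, f i x := by
  classical
  induction s using Finset.induction_on with
  | empty => simpa using const (0 : F)
  | insert a s ha ih =>
    simp only [Finset.sum_insert ha]
    exact (h a (by simp)).add (ih fun i hi => h i (by simp [hi]))

lemma prod {ι : Type*} (s : Finset ι) {f : ι → F → F} (h : ∀ i ∈ s, IsLaurent (f i)) :
    IsLaurent fun x => ∏ i ∈ s, f i x := by
  classical
  induction s using Finset.induction_on with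
  | empty => simpa using const (1 : F)
  | insert a s ha ih =>
    simp only [Finset.prod_insert ha]
    exact (h a (by simp)).mul (ih fun i hi => h i (by simp [hi]))

lemma pow {f : F → F} (hf : IsLaurent f) (n : ℕ) : IsLaurent fun x => f x ^ n := by
  simpa using prod (Finset.range n) fun _ _ => hf

lemma det {n : Type*} [Fintype n] [DecidableEq n] {M : F → Matrix n n F}
    (h : ∀ i j, IsLaurent fun x => M x i j) : IsLaurent fun x => (M x).det := by
  simp only [Matrix.det_apply']
  exact sum _ fun σ _ => (const _).mul (prod _ fun i _ => h _ _)

lemma eq_of_infinite {f g : F → F} (hf : IsLaurent f) (hg : IsLaurent g) {s : Set F}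
    (hs : s.Infinite) (h0 : ∀ x ∈ s, x ≠ 0) (h : ∀ x ∈ s, f x = g x) {x : F} (hx : x ≠ 0) :
    f x = g x := by
  obtain ⟨m, p, hp⟩ := hf.sub hg
  have h0 : p = 0 := Polynomial.eq_zero_of_infinite_isRoot p (hs.mono fun y hy => by
    change p.eval y = 0
    rw [← hp _ (h0 y hy)]
    beta_reduce
    rw [h y hy, sub_self, mul_zero])
  have := hp x hx
  rw [h0, Polynomial.eval_zero, mul_eq_zero] at this
  exact sub_eq_zero.1 (this.resolve_left (pow_ne_zero _ hx))

/-- The numbers `x` with `-x ^ 2 - x ^ (-2) = k` for some `k ≥ 1` are infinitely many. -/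
lemma eq_of_loop_values {f g : ℂ → ℂ} (hf : IsLaurent f) (hg : IsLaurent g)
    (h : ∀ (k : ℕ) (x : ℂ), k ≠ 0 → x ≠ 0 → -x ^ 2 - x⁻¹ ^ 2 = k → f x = g x) {x : ℂ}
    (hx : x ≠ 0) : f x = g x := by
  have hex : ∀ k : ℕ, ∃ B : ℂ, B ≠ 0 ∧ -B ^ 2 - B⁻¹ ^ 2 = (k + 1 : ℕ) := by
    intro k
    obtain ⟨y, hy⟩ := IsAlgClosed.exists_eq_mul_self (((k + 1 : ℕ) : ℂ) ^ 2 - 4)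
    obtain ⟨B, hB⟩ := IsAlgClosed.exists_eq_mul_self ((-((k + 1 : ℕ) : ℂ) + y) / 2)
    have hB4 : B ^ 4 + (k + 1 : ℕ) * B ^ 2 + 1 = 0 := by
      linear_combination -(B ^ 2 + (-((k + 1 : ℕ) : ℂ) + y) / 2 + (k + 1 : ℕ)) * hB - hy / 4
    have hB0 : B ≠ 0 := by rintro rfl; simp at hB4
    refine ⟨B, hB0, ?_⟩
    field_simp
    linear_combination -hB4
  choose B hB0 hB using hex
  have hinj : Function.Injective B := by
    intro i j hij
    have := hB i
    rw [hij, hB j] at this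
    have := Nat.cast_injective this
    omega
  refine hf.eq_of_infinite hg (Set.infinite_range_of_injective hinj) ?_ ?_ hx
  · rintro _ ⟨k, rfl⟩
    exact hB0 k
  · rintro _ ⟨k, rfl⟩
    exact h (k + 1) (B k) k.succ_ne_zero (hB0 k) (hB k)

end IsLaurent

namespace GaussWord

lemma isLaurent_jonesSum (N : ℕ) (w : GaussWord) : IsLaurent (jonesSum (K := ℂ) N w) := by
  unfold jonesSum
  refine IsLaurent.sum (F := ℂ) _ fun T _ => ((IsLaurent.const _).mul (IsLaurent.zpow _)).mul
    (IsLaurent.pow ?_ _)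
  have hl : (fun A : ℂ => -A ^ 2 - A⁻¹ ^ 2) = fun A => -1 * A ^ (2 : ℤ) - A ^ (-2 : ℤ) := by
    funext A
    rw [zpow_neg, ← inv_zpow]
    simp only [zpow_ofNat]
    ring
  rw [hl]
  exact ((IsLaurent.const _).mul (IsLaurent.zpow _)).sub (IsLaurent.zpow _)

lemma Move.jones_eq {w w' : GaussWord} (h : Move w w') (hw : w.WellFormed) (hw' : w'.WellFormed)
    {t : ℝ} (ht : 0 < t) : w.jones t = w'.jones t := by
  obtain ⟨N, hN⟩ : ∃ N, ∀ p ∈ w ++ w', p.label ≤ N :=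
    ⟨((w ++ w').map Passage.label).sum, fun p hp =>
      List.single_le_sum (by simp) _ (List.mem_map_of_mem hp)⟩
  have hN1 : ∀ p ∈ w, p.label ≤ N := fun p hp => hN p (by simp [hp])
  have hN2 : ∀ p ∈ w', p.label ≤ N := fun p hp => hN p (by simp [hp])
  rw [GaussWord.jones_eq hw hN1 ht, GaussWord.jones_eq hw' hN2 ht]
  have hA := (Real.rpow_pos_of_pos ht (-(1 / 4))).ne'
  set A : ℝ := t ^ (-(1 / 4) : ℝ)
  have hc : ∀ u : GaussWord, ((jonesSum N u A : ℝ) : ℂ) = jonesSum N u (A : ℂ) := by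
    intro u
    simp only [jonesSum]
    push_cast
    rfl
  have := IsLaurent.eq_of_loop_values (isLaurent_jonesSum N w) (isLaurent_jonesSum N w')
    (fun k B hk hB hkB => by
      have : NeZero k := ⟨hk⟩
      have hk' : (k : ℂ) ≠ 0 := Nat.cast_ne_zero.2 hk
      refine mul_left_cancel₀ hk' ?_
      rw [natCast_mul_jonesSum hB hkB (hw.pairedWord hN1),
        natCast_mul_jonesSum hB hkB (hw'.pairedWord hN2), h.flatTrace_eq hw hw' hN1 hN2 hB hkB])
    (x := A) (by exact_mod_cast hA)
  rw [← hc, ← hc] at this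
  exact_mod_cast this

end GaussWord

/-- The Jones polynomial is an invariant of the knot. -/
theorem KnotDiagram.jones_eq {D D' : KnotDiagram} (h : D.knot = D'.knot) {t : ℝ} (ht : 0 < t) :
    D.word.jones t = D'.word.jones t := by
  replace h := Quot.eqvGen_exact h
  induction h with
  | rel D D' h => exact h.jones_eq D.wellFormed D'.wellFormed ht
  | refl => rfl
  | symm _ _ _ ih => exact ih.symm
  | trans _ _ _ _ _ ih1 ih2 => exact ih1.trans ih2

lemma KnotDiagram.iteratedDeriv_jones_eq {D D' : KnotDiagram} (h : D.knot = D'.knot) (n : ℕ) :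
    iteratedDeriv n D.word.jones 1 = iteratedDeriv n D'.word.jones 1 := by
  refine Filter.EventuallyEq.iteratedDeriv_eq n ?_
  filter_upwards [lt_mem_nhds one_pos] with t ht
  exact KnotDiagram.jones_eq h ht

/-! ### The Alexander matrix -/

/-- The expansion of a determinant to first order, with a continuous remainder. -/
lemma Matrix.exists_det_one_add_smul {n X : Type*} [Fintype n] [DecidableEq n] [TopologicalSpace X]
    {z : X → ℝ} (hz : Continuous z) {M : X → Matrix n n ℝ} (hM : Continuous M) :
    ∃ r : X → ℝ, Continuous r ∧
      ∀ x, (1 + z x • M x).det = 1 + (M x).trace * z x + r x * z x ^ 2 := by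
  -- The expansion holds over the ring of continuous functions on `X`.
  obtain ⟨r, hr⟩ : ∃ r : C(X, ℝ), _ = 1 + _ * _ + r * _ :=
    ⟨_, Matrix.det_one_add_smul (⟨z, hz⟩ : C(X, ℝ))
      (Matrix.of fun i j => (⟨fun x => M x i j, hM.matrix_elem i j⟩ : C(X, ℝ)))⟩
  refine ⟨r, r.continuous, fun x => ?_⟩
  have h := congrArg (ContinuousMap.evalAlgHom ℝ ℝ x) hr
  rw [AlgHom.map_det] at h
  convert h using 1
  · congr 1
    ext i j
    by_cases hij : i = j <;> simp [hij]
  · simp only [map_add, map_one, map_mul, map_pow, Matrix.trace, map_sum]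
    rfl

namespace GaussWord

open Matrix

variable (w : GaussWord)

/-- The entry in the row of an under-passage `i` and the column of a passage `k` is the indicator of
`k` coming before `i`, minus that of `k` coming before the over-passage of the same crossing. -/
def orderMatrix : Matrix (Fin w.length) (Fin w.length) ℝ := fun i k =>
  (if k < i then 1 else 0) - ∑ j : Fin w.length,
    if (w.get j).isOver ∧ (w.get j).label = (w.get i).label then if k < j then 1 else 0 else 0

/-- The coefficient of a row of the Alexander matrix. -/
noncomputable def rowWeight (t : ℝ) (i : Fin w.length) : ℝ :=
  if (w.get i).isOver then 0 else 1 - t ^ ((w.get i).sign : ℤ)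

/-- The lower triangular matrix that is inverse to the Alexander matrix at `1`. -/
def lowerMatrix (m : ℕ) : Matrix (Fin m) (Fin m) ℝ := fun j k => if k ≤ j then 1 else 0

lemma det_lowerMatrix (m : ℕ) : (lowerMatrix m).det = 1 := by
  rw [det_of_isLowerTriangular]
  · simp [lowerMatrix]
  · intro i j h
    have : i < j := h
    simp [lowerMatrix, not_le.2 this]

lemma sum_edgeRow (e : Fin (w.length + 1)) (k : Fin w.length) :
    ∑ j, w.edgeRow e j * lowerMatrix w.length j k = if k.castSucc < e then 1 else 0 := by
  unfold edgeRow lowerMatrix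
  rcases Fin.eq_zero_or_eq_succ e with rfl | ⟨j, rfl⟩
  · simp [(Fin.succ_ne_zero _).symm]
  · simp only [Fin.succ_inj, ite_mul, one_mul, zero_mul, Finset.sum_ite_eq, Finset.mem_univ,
      if_true, Fin.castSucc_lt_succ_iff]

lemma alexander_eq (t : ℝ) :
    w.alexander t = (1 + diagonal (w.rowWeight t) * w.orderMatrix).det := by
  have : w.alexanderMatrix t * lowerMatrix w.length =
      1 + diagonal (w.rowWeight t) * w.orderMatrix := by
    ext i k
    have h1 := w.sum_edgeRow i.succ k
    have h2 := w.sum_edgeRow i.castSucc k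
    have h3 : ∑ j, (∑ l : Fin w.length, if (w.get l).isOver ∧ (w.get l).label = (w.get i).label then
        w.edgeRow l.castSucc j else 0) * lowerMatrix w.length j k =
        ∑ l : Fin w.length, if (w.get l).isOver ∧ (w.get l).label = (w.get i).label then
          if k < l then 1 else 0 else 0 := by
      simp only [Finset.sum_mul]
      rw [Finset.sum_comm]
      refine Finset.sum_congr rfl fun l _ => ?_
      split_ifs with hl hk
      · rw [sum_edgeRow, if_pos (by simpa using hk)]
      · rw [sum_edgeRow, if_neg (by simpa using hk)]
      · simp
    have h4 : (if k.castSucc < i.succ then (1 : ℝ) else 0) =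
        (if i = k then 1 else 0) + if k.castSucc < i.castSucc then 1 else 0 := by
      rcases lt_trichotomy k i with h | h | h
      · simp [h, h.ne', Fin.castSucc_lt_succ_iff, h.le]
      · simp [h, Fin.castSucc_lt_succ_iff]
      · simp [h.ne, Fin.castSucc_lt_succ_iff, not_le.2 h, not_lt.2 h.le]
    rw [h4] at h1
    rw [mul_apply, Matrix.add_apply, diagonal_mul, one_apply]
    unfold alexanderMatrix rowWeight orderMatrix
    by_cases ho : (w.get i).isOver
    · simp only [if_pos ho, sub_mul, Finset.sum_sub_distrib, h1, h2]
      ring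
    · simp only [if_neg ho, sub_mul, Finset.sum_sub_distrib, h1, mul_assoc, ← Finset.mul_sum, h2,
        h3, Fin.castSucc_lt_castSucc_iff]
      ring
  rw [← this, det_mul, det_lowerMatrix, mul_one, alexander]

lemma alexander_one : w.alexander 1 = 1 := by
  have : w.rowWeight 1 = 0 := by funext i; simp [rowWeight]
  rw [alexander_eq, this]
  simp

lemma isLaurent_alexander : IsLaurent fun x : ℝ => w.alexander (x ^ 2) := by
  simp only [alexander_eq]
  refine IsLaurent.det fun i j => ?_
  simp only [Matrix.add_apply, diagonal_mul]
  refine (IsLaurent.const _).add (IsLaurent.mul ?_ (IsLaurent.const _))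
  unfold rowWeight
  split_ifs
  · exact IsLaurent.const _
  · refine (IsLaurent.const 1).sub ?_
    have : (fun x : ℝ => (x ^ 2) ^ ((w.get i).sign : ℤ)) =
        fun x => x ^ (2 * ((w.get i).sign : ℤ)) := by
      funext x
      rw [_root_.zpow_mul, zpow_ofNat]
    rw [this]
    exact IsLaurent.zpow _

variable {w}

/-- The Conway polynomial is an even polynomial with constant coefficient `1`. -/
lemma IsConway.even {p : Polynomial ℤ} (h : w.IsConway p) :
    p.coeff 0 = 1 ∧ p.coeff 1 = 0 ∧ ∀ x : ℝ, 0 < x →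
      Polynomial.aeval (x - x⁻¹) p ^ 2 = w.alexander (x ^ 2) * w.alexander ((x ^ 2)⁻¹) := by
  obtain ⟨k, hk⟩ := h
  have h1 : ∀ x : ℝ, 0 < x → Polynomial.aeval (x - x⁻¹) p = x ^ k * w.alexander (x ^ 2) := by
    intro x hx
    have := hk (x ^ 2) (by positivity)
    rwa [Real.sqrt_sq hx.le] at this
  -- Both sides are Laurent polynomials in `x = √t`, hence agree also for negative `x`; the sign
  -- change of `x` shows the parity of `p`.
  have h2 : ∀ x : ℝ, x ≠ 0 → Polynomial.aeval (x - x⁻¹) p = x ^ k * w.alexander (x ^ 2) := by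
    intro x hx
    refine IsLaurent.eq_of_infinite (f := fun x : ℝ => Polynomial.aeval (x - x⁻¹) p) ?_
      ((IsLaurent.zpow k).mul w.isLaurent_alexander) (s := Set.Ioi 0) (Set.Ioi_infinite 0)
      (fun x hx => (Set.mem_Ioi.1 hx).ne') (fun x hx => h1 x hx) hx
    simp only [Polynomial.aeval_eq_sum_range, zsmul_eq_mul]
    refine IsLaurent.sum _ fun i _ => (IsLaurent.const _).mul (IsLaurent.pow ?_ i)
    exact (by simpa using (IsLaurent.zpow (F := ℝ) 1).sub (IsLaurent.zpow (-1)))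
  have h3 : ∀ x : ℝ, x ≠ 0 → Polynomial.aeval (-(x - x⁻¹)) p =
      (-1) ^ k * Polynomial.aeval (x - x⁻¹) p := by
    intro x hx
    have := h2 (-x) (neg_ne_zero.2 hx)
    rw [neg_sq, neg_eq_neg_one_mul x, mul_zpow, mul_assoc, ← h2 x hx] at this
    rw [← this]
    congr 2
    rw [mul_inv]
    norm_num
    ring
  have h4 : (Polynomial.aeval (0 : ℝ) p) = 1 := by
    have := h1 1 one_pos
    simpa [alexander_one] using this
  have h5 : ((-1 : ℝ) ^ k) = 1 := by
    have := h3 1 one_ne_zero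
    simpa [h4] using this.symm
  rw [h5] at h3
  simp only [one_mul] at h3
  have h6 : (p.map (Int.castRingHom ℝ)).comp (-Polynomial.X) = p.map (Int.castRingHom ℝ) := by
    refine Polynomial.funext fun z => ?_
    -- Every real number `z` is of the form `x - x⁻¹` with `x > 0`.
    have hs := Real.sq_sqrt (show 0 ≤ z ^ 2 + 4 by positivity)
    have hx : z + √(z ^ 2 + 4) ≠ 0 := by
      intro h0
      have : √(z ^ 2 + 4) = -z := by linarith
      rw [this] at hs
      nlinarith
    have hz := h3 ((z + √(z ^ 2 + 4)) / 2) (by positivity)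
    have : (z + √(z ^ 2 + 4)) / 2 - ((z + √(z ^ 2 + 4)) / 2)⁻¹ = z := by
      field_simp
      nlinarith
    rw [this] at hz
    simpa [Polynomial.aeval_def, Polynomial.eval_comp, Polynomial.eval_map] using hz
  refine ⟨?_, ?_, fun x hx => ?_⟩
  · rw [← Polynomial.coeff_zero_eq_aeval_zero'] at h4
    rw [eq_intCast] at h4
    exact_mod_cast h4
  · have := congrArg (fun q => (Polynomial.derivative q).eval 0) h6
    simp only [Polynomial.derivative_comp, Polynomial.derivative_neg, Polynomial.derivative_X,
      Polynomial.eval_mul, Polynomial.eval_comp, Polynomial.eval_neg, Polynomial.eval_X,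
      Polynomial.eval_one, neg_zero, ← Polynomial.coeff_zero_eq_eval_zero,
      Polynomial.coeff_derivative, Polynomial.coeff_map] at this
    have h7 : (p.coeff 1 : ℝ) = 0 := by
      simp at this
      linarith
    exact_mod_cast h7
  · have hx' : 0 < x⁻¹ := inv_pos.2 hx
    have := h1 x⁻¹ hx'
    rw [inv_inv, ← neg_sub, h3 x hx.ne', inv_pow, _root_.inv_zpow] at this
    rw [sq]
    nth_rewrite 2 [this]
    rw [h1 x hx]
    have := zpow_ne_zero k hx.ne'
    field_simp

/-- The second coefficient of the Conway polynomial, as the second-order term of the product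
`Δ(t) Δ(1 / t)`. -/
lemma IsConway.two_mul_coeff_two {p : Polynomial ℤ} (h : w.IsConway p) :
    2 * (p.coeff 2 : ℝ) = ∑ i, (if (w.get i).isOver then 0 else -w.orderMatrix i i) -
      ∑ i, ∑ k, (if (w.get i).isOver then 0 else ((w.get i).sign : ℝ)) *
        (if (w.get k).isOver then 0 else ((w.get k).sign : ℝ)) *
        (w.orderMatrix i k * w.orderMatrix k i) := by
  obtain ⟨h0, h1, h2⟩ := h.even
  set Y := w.orderMatrix
  -- With `x = exp v` and `z = x - x⁻¹` the product `Δ(x ^ 2) Δ(x ^ (-2))` is the determinant of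
  -- `1 + z ^ 2 W` for a continuous matrix function `W`; comparing the terms of order `z ^ 2` gives
  -- the trace of `W` at `v = 0`.
  let u : Fin w.length → ℝ := fun i => if (w.get i).isOver then 0 else 1
  let a : ℝ → Fin w.length → ℝ := fun v i =>
    if (w.get i).isOver then 0 else (w.get i).sign * Real.exp ((w.get i).sign * v)
  let z : ℝ → ℝ := fun v => Real.exp v - Real.exp (-v)
  have hz : Continuous z := by fun_prop
  have ha : Continuous a := continuous_pi fun i => by
    by_cases ho : (w.get i).isOver
    · simp only [a, if_pos ho]
      fun_prop
    · simp only [a, if_neg ho]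
      fun_prop
  let W : ℝ → Matrix (Fin w.length) (Fin w.length) ℝ := fun v =>
    -(diagonal u * Y) - diagonal (a v) * Y * (diagonal (a (-v)) * Y)
  have hW : Continuous W := by
    have h1 : Continuous fun v => diagonal (a v) := ha.matrix_diagonal
    have h2 : Continuous fun v => diagonal (a (-v)) := (ha.comp continuous_neg).matrix_diagonal
    exact continuous_const.sub ((h1.matrix_mul continuous_const).matrix_mul
      (h2.matrix_mul continuous_const))
  obtain ⟨r, hr, hr'⟩ := exists_det_one_add_smul (hz.pow 2) hW
  have hd : ∀ v, w.rowWeight (Real.exp v ^ 2) = -z v • a v := by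
    intro v
    funext i
    have h3 := Real.exp_add v (-v)
    rw [add_neg_cancel, Real.exp_zero] at h3
    by_cases ho : (w.get i).isOver
    · simp only [rowWeight, a, if_pos ho, Pi.smul_apply, smul_zero]
    · rcases Int.units_eq_one_or (w.get i).sign with hs | hs
      · simp only [rowWeight, a, z, if_neg ho, hs, Pi.smul_apply, smul_eq_mul, Units.val_one,
          zpow_one, Int.cast_one, one_mul]
        linear_combination h3
      · simp only [rowWeight, a, z, if_neg ho, hs, Pi.smul_apply, smul_eq_mul, Units.val_neg,
          Units.val_one, _root_.zpow_neg_one, Int.cast_neg, Int.cast_one, neg_mul, one_mul,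
          ← inv_pow, ← Real.exp_neg]
        linear_combination h3
  have hd' : ∀ v, w.rowWeight ((Real.exp v ^ 2)⁻¹) = z v • a (-v) := by
    intro v
    have h3 := hd (-v)
    rw [Real.exp_neg, inv_pow] at h3
    rw [h3]
    congr 1
    simp only [z, neg_neg, neg_sub]
  have hdet : ∀ v, w.alexander (Real.exp v ^ 2) * w.alexander ((Real.exp v ^ 2)⁻¹) =
      (1 + z v ^ 2 • W v).det := by
    intro v
    rw [alexander_eq, alexander_eq, ← det_mul, hd, hd']
    congr 1
    have h3 : diagonal (-z v • a v) = -z v • diagonal (a v) := by rw [diagonal_smul]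
    have h4 : diagonal (z v • a (-v)) = z v • diagonal (a (-v)) := by rw [diagonal_smul]
    have h5 : diagonal (a (-v)) * Y = diagonal (a v) * Y - z v • (diagonal u * Y) := by
      rw [← Matrix.smul_mul, ← Matrix.sub_mul, ← diagonal_smul, diagonal_sub]
      congr 2
      funext i
      by_cases ho : (w.get i).isOver
      · simp only [a, u, if_pos ho, Pi.smul_apply, smul_zero, sub_zero]
      · rcases Int.units_eq_one_or (w.get i).sign with hs | hs <;>
          simp only [a, u, if_neg ho, hs, Pi.smul_apply, smul_eq_mul, z, Units.val_neg,
            Units.val_one, Int.cast_neg, Int.cast_one] <;> ring_nf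
    rw [h3, h4, Matrix.smul_mul, Matrix.smul_mul]
    simp only [W, add_mul, mul_add, one_mul, mul_one, Matrix.smul_mul, Matrix.mul_smul]
    rw [h5]
    simp only [Matrix.mul_sub, Matrix.mul_smul, smul_sub]
    module
  let q := p.divX.divX.divX
  have hp : ∀ y : ℝ, Polynomial.aeval y p =
      1 + p.coeff 2 * y ^ 2 + y ^ 3 * Polynomial.aeval y q := by
    intro y
    have h3 : Polynomial.X * (Polynomial.X * (Polynomial.X * q + .C (p.coeff 2)) + .C (p.coeff 1)) +
        .C (p.coeff 0) = p := by
      have e2 := Polynomial.X_mul_divX_add p.divX.divX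
      have e1 := Polynomial.X_mul_divX_add p.divX
      have e0 := Polynomial.X_mul_divX_add p
      simp only [Polynomial.coeff_divX] at e2 e1 e0
      rw [e2, e1, e0]
    conv_lhs => rw [← h3, h0, h1]
    simp
    ring
  have hq : Continuous fun v => Polynomial.aeval (z v) q :=
    q.continuous_aeval.comp hz
  have key : (fun v => 2 * (p.coeff 2 : ℝ) + z v * (2 * Polynomial.aeval (z v) q +
      (p.coeff 2 : ℝ) ^ 2 * z v + 2 * p.coeff 2 * z v ^ 2 * Polynomial.aeval (z v) q +
      z v ^ 3 * Polynomial.aeval (z v) q ^ 2)) = fun v => (W v).trace + r v * z v ^ 2 := by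
    refine Continuous.ext_on (dense_compl_singleton (0 : ℝ)) (by fun_prop)
      (by fun_prop) fun v hv => ?_
    have hz0 : z v ≠ 0 := by
      intro h3
      have := Real.exp_injective (sub_eq_zero.1 h3)
      exact hv (by simp; linarith)
    have h3 := h2 (Real.exp v) (Real.exp_pos v)
    rw [hdet, ← Real.exp_neg, hp] at h3
    have h4 := hr' v
    simp only [Pi.pow_apply] at h4
    rw [h4] at h3
    refine mul_left_cancel₀ (pow_ne_zero 2 hz0) ?_
    linear_combination h3
  have h3 := congrFun key 0
  have hz0 : z 0 = 0 := by simp [z]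
  simp only [hz0, zero_mul, add_zero, ne_eq, OfNat.ofNat_ne_zero, not_false_eq_true, zero_pow,
    mul_zero] at h3
  rw [h3]
  have hu : ∀ i, u i = if (w.get i).isOver then 0 else 1 := fun i => rfl
  have ha0 : ∀ i, a 0 i = if (w.get i).isOver then 0 else ((w.get i).sign : ℝ) := fun i => by
    simp only [a, mul_zero, Real.exp_zero, mul_one]
  simp only [W, neg_zero, ← ha0, Matrix.trace, Matrix.diag_apply, Matrix.sub_apply,
    Matrix.neg_apply, Finset.sum_sub_distrib, diagonal_mul, mul_apply (M := diagonal (a 0) * Y)]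
  congr 1
  · refine Finset.sum_congr rfl fun i _ => ?_
    rw [hu]
    split_ifs <;> simp
  · refine Finset.sum_congr rfl fun i _ => Finset.sum_congr rfl fun k _ => ?_
    ring

end GaussWord

/-! ### The second coefficient of the Conway polynomial -/

namespace GaussWord

variable {N : ℕ} {w : GaussWord}

/-- The letter of the over-passage (`b = true`) or of the under-passage (`b = false`). -/
noncomputable def letterAt (N : ℕ) (w : GaussWord) (b : Bool) (c : Fin (N + 1)) :
    Fin (N + 1) × Bool :=
  (c, decide (b = true ↔ signAt N w c = 1))

lemma flatLetter_eq_letterAt (hw : w.WellFormed) (hN : ∀ p ∈ w, p.label ≤ N) {p : Passage}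
    (hp : p ∈ w) : flatLetter N p = letterAt N w p.isOver (Fin.ofNat (N + 1) p.label) := by
  unfold letterAt flatLetter
  rw [signAt_eq hw hN hp]
  simp

/-- The indicator of the event that the under-passage of `d` comes before the under-passage of `c`,
minus that of the event that it comes before the over-passage of `c`. -/
noncomputable def underOrder (N : ℕ) (w : GaussWord) (c d : Fin (N + 1)) : ℝ :=
  (if (w.flatten N).idxOf (letterAt N w false d) < (w.flatten N).idxOf (letterAt N w false c) then 1
    else 0) -
  if (w.flatten N).idxOf (letterAt N w false d) < (w.flatten N).idxOf (letterAt N w true c) then 1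
    else 0

lemma sum_under (hw : w.WellFormed) (hN : ∀ p ∈ w, p.label ≤ N) (f : Fin (N + 1) → ℝ) :
    ∑ i : Fin w.length, (if (w.get i).isOver then 0 else f (Fin.ofNat (N + 1) (w.get i).label)) =
      ∑ c ∈ labels (w.flatten N), f c := by
  have h := sum_flatten (N := N) (w := w) fun l => if l = letterAt N w false l.1 then f l.1 else 0
  rw [(hw.pairedWord hN).sum_map] at h
  rw [Finset.sum_congr rfl fun i _ => ?_, ← h]
  · refine Finset.sum_congr rfl fun c _ => ?_
    by_cases hs : signAt N w c = 1 <;> simp [letterAt, hs]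
  · rw [flatLetter_eq_letterAt hw hN (List.get_mem w i)]
    by_cases hs : signAt N w (Fin.ofNat (N + 1) (w.get i).label) = 1 <;>
      cases (w.get i).isOver <;> simp only [letterAt, hs] <;> simp

lemma orderMatrix_eq (hw : w.WellFormed) (hN : ∀ p ∈ w, p.label ≤ N) {i k : Fin w.length}
    (hi : ¬(w.get i).isOver) (hk : ¬(w.get k).isOver) : w.orderMatrix i k =
      underOrder N w (Fin.ofNat (N + 1) (w.get i).label) (Fin.ofNat (N + 1) (w.get k).label) := by
  have hmem := hw.2 _ (List.get_mem w i)
  rw [Bool.not_eq_true] at hi hk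
  rw [hi, Bool.not_false] at hmem
  obtain ⟨j, hj⟩ := List.get_of_mem hmem
  have e1 := idxOf_flatten hw hN i
  have e2 := idxOf_flatten hw hN j
  have e3 := idxOf_flatten hw hN k
  rw [flatLetter_eq_letterAt hw hN (List.get_mem w _)] at e1 e2 e3
  rw [hj] at e2
  rw [hi] at e1
  rw [hk] at e3
  unfold orderMatrix underOrder
  rw [e1, e2, e3, Finset.sum_eq_single j]
  · rw [hj]
    simp
  · intro l _ hl
    rw [if_neg]
    rintro ⟨h1, h2⟩
    refine hl (Fin.ext ?_)
    have e4 := idxOf_flatten hw hN l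
    rw [flatLetter_eq_letterAt hw hN (List.get_mem w _), h1, h2, e2] at e4
    exact e4.symm
  · simp

lemma IsConway.two_mul_coeff_two_eq_sum {p : Polynomial ℤ} (h : w.IsConway p) (hw : w.WellFormed)
    (hN : ∀ p ∈ w, p.label ≤ N) : 2 * (p.coeff 2 : ℝ) =
      ∑ c ∈ labels (w.flatten N), -underOrder N w c c -
        ∑ c ∈ labels (w.flatten N), ∑ d ∈ labels (w.flatten N), signAt N w c * signAt N w d *
          (underOrder N w c d * underOrder N w d c) := by
  rw [h.two_mul_coeff_two, ← sum_under hw hN, ← sum_under hw hN]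
  simp only [← sum_under hw hN]
  congr 1
  · refine Finset.sum_congr rfl fun i _ => ?_
    split_ifs with hi
    · rfl
    · rw [orderMatrix_eq hw hN hi hi]
  · refine Finset.sum_congr rfl fun i _ => ?_
    split_ifs with hi
    · simp
    · refine Finset.sum_congr rfl fun k _ => ?_
      split_ifs with hk
      · simp
      · rw [orderMatrix_eq hw hN hi hk, orderMatrix_eq hw hN hk hi,
          signAt_eq hw hN (List.get_mem w i), signAt_eq hw hN (List.get_mem w k)]

/-- The order of the two passages through a crossing. -/
noncomputable def passageOrder (N : ℕ) (w : GaussWord) (c : Fin (N + 1)) : ℤ :=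
  orderSign (w.flatten N) (letterAt N w true c) (letterAt N w false c)

/-- The contribution of two different crossings. The last term on the right-hand side has vanishing
sum for a planar diagram. -/
lemma underOrder_mul (hP : PairedWord (w.flatten N)) {c d : Fin (N + 1)}
    (hc : c ∈ labels (w.flatten N)) (hd : d ∈ labels (w.flatten N)) (hcd : c ≠ d) :
    -(signAt N w c * signAt N w d * (underOrder N w c d * underOrder N w d c)) =
      (1 / 4) * (signAt N w c * signAt N w d * link (w.flatten N) c d) -
        (1 / 16) * (chordIndex (w.flatten N) c d * orderSum (w.flatten N) c d) +
        (1 / 8) * (chordIndex (w.flatten N) c d * (passageOrder N w c - passageOrder N w d)) := by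
  have hne : ∀ l m : Fin (N + 1) × Bool, l.1 ∈ labels (w.flatten N) → l ≠ m →
      (w.flatten N).idxOf l < (w.flatten N).idxOf m ∨
        (w.flatten N).idxOf m < (w.flatten N).idxOf l := fun l m hl h =>
    lt_or_gt_of_ne (mt (idxOf_inj_of_mem ((hP.mem_labels l.2).1 hl)) h)
  have h1 := hne (c, true) (c, false) hc (by simp)
  have h2 := hne (d, true) (d, false) hd (by simp)
  have h3 := hne (c, true) (d, true) hc (by simp [hcd])
  have h4 := hne (c, true) (d, false) hc (by simp [hcd])
  have h5 := hne (c, false) (d, true) hc (by simp [hcd])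
  have h6 := hne (c, false) (d, false) hc (by simp [hcd])
  -- A finite check over the signs and the orders of the four passages.
  rcases signAt_cases w c with hsc | hsc <;> rcases signAt_cases w d with hsd | hsd <;>
    simp only [underOrder, passageOrder, link, Linked, chordIndex_eq, orderSum, orderSign, letterAt,
      hsc, hsd, reduceCtorEq, false_iff, true_iff, not_true, decide_true, decide_false,
      show ¬(-1 : ℤ) = 1 by decide] <;>
    generalize (w.flatten N).idxOf (c, true) = i1 at * <;>
    generalize (w.flatten N).idxOf (c, false) = i2 at * <;>
    generalize (w.flatten N).idxOf (d, true) = i3 at * <;>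
    generalize (w.flatten N).idxOf (d, false) = i4 at * <;>
    clear hne hsc hsd <;>
    rcases h1 with h1 | h1 <;> rcases h2 with h2 | h2 <;> rcases h3 with h3 | h3 <;>
    rcases h4 with h4 | h4 <;> rcases h5 with h5 | h5 <;> rcases h6 with h6 | h6 <;>
    first
    | omega
    | (simp only [h1, h2, h3, h4, h5, h6, h1.not_gt, h2.not_gt, h3.not_gt, h4.not_gt, h5.not_gt,
        h6.not_gt, if_true, if_false]
       norm_num)

/-- The second coefficient of the Conway polynomial of a planar diagram. -/
theorem IsConway.coeff_two {p : Polynomial ℤ} (h : w.IsConway p) (hp : w.Planar)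
    (hw : w.WellFormed) (hN : ∀ p ∈ w, p.label ≤ N) :
    (p.coeff 2 : ℝ) = -(1 / 6) * iteratedDeriv 2 w.jones 1 := by
  have hP := hw.pairedWord hN
  have hi := hp.isotropic hw hN
  have h0 : ∀ c ∈ labels (w.flatten N),
      ∑ d ∈ labels (w.flatten N), (chordIndex (w.flatten N) c d : ℝ) = 0 := fun c hc => by
    exact_mod_cast hi.sum_chordIndex hP hc
  have h1 : ∑ c ∈ labels (w.flatten N), ∑ d ∈ labels (w.flatten N),
      (chordIndex (w.flatten N) c d * (passageOrder N w c - passageOrder N w d) : ℝ) = 0 := by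
    simp only [mul_sub, Finset.sum_sub_distrib]
    rw [Finset.sum_eq_zero fun c hc => by rw [← Finset.sum_mul, h0 c hc, zero_mul],
      Finset.sum_comm, Finset.sum_eq_zero fun d hd => ?_, sub_self]
    rw [← Finset.sum_mul, Finset.sum_congr rfl fun c _ => by rw [chordIndex_comm, Int.cast_neg],
      Finset.sum_neg_distrib, h0 d hd, neg_zero, zero_mul]
  have h2 : 2 * (p.coeff 2 : ℝ) = (1 / 4) * linkSum N w -
      (1 / 16) * arrowSum (w.flatten N) (labels (w.flatten N)) := by
    rw [h.two_mul_coeff_two_eq_sum hw hN, ← Finset.sum_sub_distrib]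
    calc _ = ∑ c ∈ labels (w.flatten N), ∑ d ∈ labels (w.flatten N),
          ((1 / 4) * (signAt N w c * signAt N w d * link (w.flatten N) c d) -
          (1 / 16) * (chordIndex (w.flatten N) c d * orderSum (w.flatten N) c d) +
          (1 / 8) * (chordIndex (w.flatten N) c d * (passageOrder N w c - passageOrder N w d))) := by
          refine Finset.sum_congr rfl fun c hc => ?_
          rw [← Finset.add_sum_erase _ _ hc, ← Finset.add_sum_erase _ _ hc,
            Finset.sum_congr rfl fun d hd => (underOrder_mul hP hc (Finset.mem_of_mem_erase hd)
              (Finset.ne_of_mem_erase hd).symm).symm, Finset.sum_neg_distrib, chordIndex_self]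
          have hu : underOrder N w c c ^ 2 = -underOrder N w c c := by
            unfold underOrder
            rw [if_neg (lt_irrefl _)]
            split_ifs <;> norm_num
          have hs : (signAt N w c : ℝ) * signAt N w c = 1 := by
            rcases signAt_cases w c with h | h <;> simp [h]
          rw [link_self]
          push_cast
          linear_combination -hu - underOrder N w c c ^ 2 * hs
      _ = _ := by
          simp only [Finset.sum_add_distrib, Finset.sum_sub_distrib, ← Finset.mul_sum, h1, linkSum,
            arrowSum]
          push_cast
          ring
  rw [hp.iteratedDeriv_two hw hN]
  linarith

end GaussWord

/-! ### The inequality -/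

lemma KnotDiagram.exists_label_le (D : KnotDiagram) : ∃ N, ∀ p ∈ D.word, p.label ≤ N :=
  ⟨(D.word.map Passage.label).sum, fun _ hp =>
    List.single_le_sum (by simp) _ (List.mem_map_of_mem hp)⟩

theorem lemma3p7 (K : Knot) (hK : ∃ D : KnotDiagram, D.IsPositive ∧ D.knot = K) :
    (K.a 2 : ℝ) ≤ 4 * K.v₃ := by
  obtain ⟨D, hD, hDK⟩ := hK
  obtain ⟨N, hN⟩ := D.exists_label_le
  obtain ⟨M, hM⟩ := K.diagram.exists_label_le
  have hK : D.knot = K.diagram.knot := hDK.trans (Quot.out_eq K).symm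
  have hpos : ∀ c ∈ labels (D.word.flatten N), GaussWord.signAt N D.word c = 1 := by
    intro c hc
    obtain ⟨l, hl, rfl⟩ := mem_labels_iff.1 hc
    obtain ⟨p, hp, rfl⟩ := List.mem_map.1 hl
    rw [GaussWord.flatLetter, GaussWord.signAt_eq D.wellFormed hN hp, hD p hp, Units.val_one]
  obtain ⟨h0, h1⟩ := D.planar.inequality D.wellFormed hN hpos
  rw [KnotDiagram.iteratedDeriv_jones_eq hK] at h0 h1
  rw [KnotDiagram.iteratedDeriv_jones_eq hK] at h1
  refine le_trans ?_ h1
  unfold Knot.a Knot.conway GaussWord.conway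
  split_ifs with h
  · exact (h.choose_spec.coeff_two K.diagram.planar K.diagram.wellFormed hM).le
  -- If no polynomial has the defining property, then `conway` is `0`; the bound holds all the same.
  · simpa using h0
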